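/- **Conventions.** All graphs are finite, simple and undirected, with vertex set $V=\{0,\dots,n-1\}$, $n\ge 1$. For $S\subseteq V$ the cut-set $\partial(S)$ is the set of edges with exactly one endpoint in $S$. A *disconnecting set* of a connected graph $G$ is a set of edges whose removal disconnects $G$; a *bond* is an inclusion-wise minimal disconnecting set. (Connected induced subgraphs are understood to be nonempty.) A *nice tree decomposition* of $G$ is a rooted tree decomposition with empty root bag in which every node is of one of five types: a *leaf* (empty bag); *introduce vertex* $v$ (one child; $v$ is not in the child's bag and is added to it); *introduce edge* $uv$ (one child, with the same bag, which contains $u$ and $v$); *forget vertex* $v$ (one child; $v$ is removed from the child's bag); *join* (two children, all three bags equal); and in which every edge of $G$ is introduced exactly once. Its width $tw$ is the maximum bag size minus one. As usual, the decomposition is assumed to have $O(tw\cdot n)$ nodes, i.e. at most $K(tw+1)n$ nodes for a constant $K$. Running times are numbers of steps of a random access machine with unit-cost arithmetic ($+,-,\cdot$, integer division, remainder, comparison) and indirect addressing, all of whose computed words are also bounded by the stated time bound. The notation $2^{O(tw\log tw)}$ means at most $2^{c(tw\log_2 tw+1)}$ (with $0\log 0=0$) for a constant $c$ depending only on $K$;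 the programs do not depend on $K$. **Theorem.** 1. There is an algorithm that, given a nice tree decomposition of width $tw$ of a connected graph $G$ with $n$ vertices, finds a bond of $G$ of maximum size (a set $S$ such that $\partial(S)$ is such a bond, and the size of the bond), or reports that $G$ has no bond, in time $2^{O(tw\log tw)}\cdot n$. 2. Each of the following problems can be solved in time $2^{O(tw\log tw)}\cdot n$, given a nice tree decomposition of width $tw$ of a graph $G$ with $n$ vertices, an integer $k$ and, where they occur, vertices $s,t$ of $G$. That is, within this time an algorithm finds a feasible set $S$ with $|\partial(S)|$ maximum together with the value $|\partial(S)|$, or reports that there is no feasible set, and it decides whether there is a feasible set $S$ with $|\partial(S)|\ge k$. * **Largest $st$-Bond**: $S\subsetneq V$ is feasible if $s\in S$, $t\notin S$, and $G[S]$ and $G[V\setminus S]$ are both connected. * **Maximum Connected Cut**: $S\subsetneq V$ is feasible if $G[S]$ is connected. * **Maximum Connected $st$-Cut**: $S\subsetneq V$ is feasible if $s\in S$, $t\notin S$, and $G[S]$ is connected. -/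

import Mathlib

/-! ## Cuts and bonds -/

namespace BondCut

/-- The cut-set `∂(S)`: the edges of `G` with one endpoint in `S` and the other outside `S`. -/
noncomputable def cutSet {n : ℕ} (G : SimpleGraph (Fin n)) (S : Finset (Fin n)) :
    Finset (Sym2 (Fin n)) :=
  open Classical in
  Finset.univ.filter fun e => ∃ u v, e = s(u, v) ∧ G.Adj u v ∧ u ∈ S ∧ v ∉ S

/-- A set of edges of `G` whose removal disconnects `G`. -/
def IsDisconnectingSet {n : ℕ} (G : SimpleGraph (Fin n)) (F : Finset (Sym2 (Fin n))) : Prop :=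
  (∀ e ∈ F, e ∈ G.edgeSet) ∧ ¬ (G.deleteEdges (F : Set (Sym2 (Fin n)))).Connected

/-- A bond: an inclusion-wise minimal disconnecting set. -/
def IsBond {n : ℕ} (G : SimpleGraph (Fin n)) (F : Finset (Sym2 (Fin n))) : Prop :=
  Minimal (IsDisconnectingSet G) F

/-- `S` is a proper subset of the vertices such that `G[S]` is connected
(in particular, `S` is nonempty). -/
def IsConnectedCut {n : ℕ} (G : SimpleGraph (Fin n)) (S : Finset (Fin n)) : Prop :=
  S ⊂ Finset.univ ∧ (G.induce {v | v ∈ S}).Connected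

/-- Feasible solutions of Maximum Connected `st`-Cut. -/
def IsConnectedStCut {n : ℕ} (G : SimpleGraph (Fin n)) (s t : Fin n) (S : Finset (Fin n)) :
    Prop :=
  IsConnectedCut G S ∧ s ∈ S ∧ t ∉ S

/-- Feasible solutions of Largest `st`-Bond. -/
def IsStBondCut {n : ℕ} (G : SimpleGraph (Fin n)) (s t : Fin n) (S : Finset (Fin n)) : Prop :=
  IsConnectedStCut G s t S ∧ (G.induce {v | v ∉ S}).Connected

/-! ## Nice tree decompositions with introduce-edge nodes -/

/-- Rooted trees whose nodes carry one of the five types of a nice tree decomposition. -/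
inductive NiceTree (n : ℕ) : Type
  | leaf : NiceTree n
  | introVertex (v : Fin n) (child : NiceTree n) : NiceTree n
  | introEdge (u v : Fin n) (child : NiceTree n) : NiceTree n
  | forget (v : Fin n) (child : NiceTree n) : NiceTree n
  | join (left right : NiceTree n) : NiceTree n

namespace NiceTree

variable {n : ℕ}

/-- The bag of the root of the tree. -/
def bag : NiceTree n → Finset (Fin n)
  | leaf => ∅
  | introVertex v t => insert v t.bag
  | introEdge _ _ t => t.bag
  | forget v t => t.bag.erase v
  | join a _ => a.bag

/-- The local conditions at the nodes. -/
def LocallyNice : NiceTree n → Prop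
  | leaf => True
  | introVertex v t => v ∉ t.bag ∧ t.LocallyNice
  | introEdge u v t => u ∈ t.bag ∧ v ∈ t.bag ∧ t.LocallyNice
  | forget v t => v ∈ t.bag ∧ t.LocallyNice
  | join a b => a.bag = b.bag ∧ a.LocallyNice ∧ b.LocallyNice

/-- The edges introduced in the tree, with multiplicity. -/
def introducedEdges : NiceTree n → List (Sym2 (Fin n))
  | leaf => []
  | introVertex _ t => t.introducedEdges
  | introEdge u v t => s(u, v) :: t.introducedEdges
  | forget _ t => t.introducedEdges
  | join a b => a.introducedEdges ++ b.introducedEdges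

/-- The subtree at an address. An address lists the branches taken on the way down from the root;
the only child of a node is reached by `false`, the two children of a join node by `false` and
`true`. -/
def subtree : NiceTree n → List Bool → Option (NiceTree n)
  | t, [] => some t
  | leaf, _ :: _ => none
  | introVertex _ t, false :: p => t.subtree p
  | introVertex _ _, true :: _ => none
  | introEdge _ _ t, false :: p => t.subtree p
  | introEdge _ _ _, true :: _ => none
  | forget _ t, false :: p => t.subtree p
  | forget _ _, true :: _ => none
  | join a _, false :: p => a.subtree p
  | join _ b, true :: p => b.subtree p

/-- The nodes of the tree, given by their addresses. -/
def Node (t : NiceTree n) : Type := {p : List Bool // (t.subtree p).isSome}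

/-- The bag of a node. -/
def bagAt (t : NiceTree n) (x : t.Node) : Finset (Fin n) := ((t.subtree x.1).get x.2).bag

/-- The underlying undirected tree: every node is adjacent to its children. -/
def treeGraph (t : NiceTree n) : SimpleGraph t.Node where
  Adj x y := (∃ b, y.1 = x.1 ++ [b]) ∨ (∃ b, x.1 = y.1 ++ [b])
  symm := ⟨fun _ _ h => h.symm⟩
  loopless := ⟨by
    rintro x (⟨b, h⟩ | ⟨b, h⟩) <;> simpa using congrArg List.length h⟩

/-- The number of nodes. -/
def numNodes : NiceTree n → ℕ
  | leaf => 1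
  | introVertex _ t => t.numNodes + 1
  | introEdge _ _ t => t.numNodes + 1
  | forget _ t => t.numNodes + 1
  | join a b => a.numNodes + b.numNodes + 1

/-- The largest size of a bag. -/
def maxBagCard : NiceTree n → ℕ
  | leaf => 0
  | introVertex v t => max (introVertex v t).bag.card t.maxBagCard
  | introEdge u v t => max (introEdge u v t).bag.card t.maxBagCard
  | forget v t => max (forget v t).bag.card t.maxBagCard
  | join a b => max (join a b).bag.card (max a.maxBagCard b.maxBagCard)

/-- The width: the largest size of a bag minus one. -/
def width (t : NiceTree n) : ℕ := t.maxBagCard - 1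

/-- `t` is a nice tree decomposition of `G`, with introduce-edge nodes: the root bag is empty, the
nodes satisfy the conditions of their types, every edge of `G` is introduced exactly once (at a node
whose bag contains both ends), and the nodes whose bags contain a given vertex
form a nonempty connected subtree. -/
structure IsNiceDecomposition (t : NiceTree n) (G : SimpleGraph (Fin n)) : Prop where
  root_bag : t.bag = ∅
  locallyNice : t.LocallyNice
  edges_nodup : t.introducedEdges.Nodup
  mem_edges : ∀ e, e ∈ t.introducedEdges ↔ e ∈ G.edgeSet
  connected : ∀ v, (t.treeGraph.induce {x | v ∈ t.bagAt x}).Connected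

/-- The nodes in post-order (children before their parent), each coded by a type code and up to two
vertices. -/
def postorder : NiceTree n → List (ℕ × ℕ × ℕ)
  | leaf => [(0, 0, 0)]
  | introVertex v t => t.postorder ++ [(1, v.val, 0)]
  | introEdge u v t => t.postorder ++ [(2, u.val, v.val)]
  | forget v t => t.postorder ++ [(3, v.val, 0)]
  | join a b => a.postorder ++ b.postorder ++ [(4, 0, 0)]

end NiceTree

/-! ## Random access machine with bounded words

Programs work on registers and on arrays (both named by constants of the program, so that
a program uses finitely many of them); array cells are addressed by register contents.
Every instruction and every test costs one step. The word capacity `W` is the largest number that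
an instruction may produce: a computation that exceeds it is stuck and has no result. -/

/-- Arithmetic and comparison instructions. -/
inductive Op : Type
  | add | sub | mul | div | mod | lt | eq

/-- Natural number arithmetic, with truncated subtraction; comparisons give `1` or `0`. -/
def Op.eval : Op → ℕ → ℕ → ℕ
  | .add, x, y => x + y
  | .sub, x, y => x - y
  | .mul, x, y => x * y
  | .div, x, y => x / y
  | .mod, x, y => x % y
  | .lt, x, y => if x < y then 1 else 0
  | .eq, x, y => if x = y then 1 else 0

inductive Prog : Type
  /-- do nothing -/
  | skip : Prog
  /-- `r := a` -/
  | const (r a : ℕ) : Prog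
  /-- `r := x o y`, for registers `x` and `y` -/
  | arith (o : Op) (r x y : ℕ) : Prog
  /-- `r := A[i]`, for an array `A` and a register `i` -/
  | load (r A i : ℕ) : Prog
  /-- `A[i] := x`, for an array `A` and registers `i` and `x` -/
  | store (A i x : ℕ) : Prog
  | seq (p q : Prog) : Prog
  /-- if register `r` is nonzero then `p` else `q` -/
  | cond (r : ℕ) (p q : Prog) : Prog
  /-- while register `r` is nonzero do `p` -/
  | loop (r : ℕ) (p : Prog) : Prog

structure State : Type where
  reg : ℕ → ℕ
  arr : ℕ → ℕ → ℕ

def State.setReg (σ : State) (r a : ℕ) : State :=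
  { σ with reg := Function.update σ.reg r a }

def State.setArr (σ : State) (A i a : ℕ) : State :=
  { σ with arr := Function.update σ.arr A (Function.update (σ.arr A) i a) }

/-- `Exec W p σ T σ'`: with word capacity `W`, the program `p` started in state `σ` halts after
exactly `T` steps in state `σ'`. -/
inductive Exec (W : ℕ) : Prog → State → ℕ → State → Prop
  | skip (σ : State) : Exec W .skip σ 1 σ
  | const (σ : State) (r a : ℕ) (h : a ≤ W) : Exec W (.const r a) σ 1 (σ.setReg r a)
  | arith (σ : State) (o : Op) (r x y : ℕ) (h : o.eval (σ.reg x) (σ.reg y) ≤ W) :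
      Exec W (.arith o r x y) σ 1 (σ.setReg r (o.eval (σ.reg x) (σ.reg y)))
  | load (σ : State) (r A i : ℕ) :
      Exec W (.load r A i) σ 1 (σ.setReg r (σ.arr A (σ.reg i)))
  | store (σ : State) (A i x : ℕ) :
      Exec W (.store A i x) σ 1 (σ.setArr A (σ.reg i) (σ.reg x))
  | seq {p q : Prog} {σ₁ σ₂ σ₃ : State} {T₁ T₂ : ℕ} (h₁ : Exec W p σ₁ T₁ σ₂)
      (h₂ : Exec W q σ₂ T₂ σ₃) : Exec W (.seq p q) σ₁ (T₁ + T₂) σ₃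
  | condTrue {r : ℕ} {p q : Prog} {σ σ' : State} {T : ℕ} (hr : σ.reg r ≠ 0)
      (h : Exec W p σ T σ') : Exec W (.cond r p q) σ (T + 1) σ'
  | condFalse {r : ℕ} {p q : Prog} {σ σ' : State} {T : ℕ} (hr : σ.reg r = 0)
      (h : Exec W q σ T σ') : Exec W (.cond r p q) σ (T + 1) σ'
  | loopTrue {r : ℕ} {p : Prog} {σ₁ σ₂ σ₃ : State} {T₁ T₂ : ℕ} (hr : σ₁.reg r ≠ 0)
      (h₁ : Exec W p σ₁ T₁ σ₂) (h₂ : Exec W (.loop r p) σ₂ T₂ σ₃) :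
      Exec W (.loop r p) σ₁ (T₁ + T₂ + 1) σ₃
  | loopFalse {r : ℕ} {p : Prog} {σ : State} (hr : σ.reg r = 0) : Exec W (.loop r p) σ 1 σ

/-! ## Input, output and running time -/

/-- The input: the registers hold the number of vertices, the number of nodes and then the further
parameters; arrays `0`, `1`, `2` hold the nodes in post-order. Everything else is `0`. -/
def NiceTree.input {n : ℕ} (t : NiceTree n) (params : List ℕ) : State where
  reg r := (n :: t.numNodes :: params).getD r 0
  arr A i :=
    match A with
    | 0 => (t.postorder.getD i (0, 0, 0)).1
    | 1 => (t.postorder.getD i (0, 0, 0)).2.1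
    | 2 => (t.postorder.getD i (0, 0, 0)).2.2
    | _ => 0

/-- `P`, run on the decomposition `t` of width `tw` and on `params`, halts in a state that satisfies
`post`, within `2 ^ (c * (tw * log tw + 1)) * n` steps and with no word exceeding this bound. The
summand `1` only matters for `tw ≤ 1`, where `tw * log tw` vanishes. -/
def NiceTree.RunsInTime {n : ℕ} (t : NiceTree n) (P : Prog) (c : ℝ) (params : List ℕ)
    (post : State → Prop) : Prop :=
  ∃ (T W : ℕ) (σ : State), Exec W P (t.input params) T σ ∧ post σ ∧
    (T : ℝ) ≤ (2 : ℝ) ^ (c * (t.width * Real.logb 2 t.width + 1)) * n ∧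
    (W : ℝ) ≤ (2 : ℝ) ^ (c * (t.width * Real.logb 2 t.width + 1)) * n

/-- The final state contains the vertex set `S` and the size of its cut-set: register `0` is `1`,
register `1` is `|∂(S)|`, and array `3` is the indicator function of `S`. -/
def State.Outputs {n : ℕ} (σ : State) (G : SimpleGraph (Fin n)) (S : Finset (Fin n)) : Prop :=
  σ.reg 0 = 1 ∧ σ.reg 1 = (cutSet G S).card ∧
    ∀ v : Fin n, σ.arr 3 v = if v ∈ S then 1 else 0

/-- The final state contains a bond of maximum size (given by one of its sides), or `0` in
register `0` if there is no bond. -/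
def FoundMaximumBond {n : ℕ} (G : SimpleGraph (Fin n)) (σ : State) : Prop :=
  (∃ S, σ.Outputs G S ∧ IsBond G (cutSet G S) ∧
    ∀ F, IsBond G F → F.card ≤ (cutSet G S).card) ∨
  (σ.reg 0 = 0 ∧ ¬ ∃ F, IsBond G F)

/-- The final state contains a feasible `S` with `|∂(S)|` maximum, or `0` in register `0` if nothing
is feasible; and register `2` answers (by `1` or `0`) whether there is a feasible `S` with
`|∂(S)| ≥ k`. -/
def SolvedCutProblem {n : ℕ} (G : SimpleGraph (Fin n)) (feasible : Finset (Fin n) → Prop) (k : ℕ)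
    (σ : State) : Prop :=
  ((∃ S, σ.Outputs G S ∧ feasible S ∧
      ∀ S', feasible S' → (cutSet G S').card ≤ (cutSet G S).card) ∨
    (σ.reg 0 = 0 ∧ ¬ ∃ S, feasible S)) ∧
  ((σ.reg 2 = 1 ∧ ∃ S, feasible S ∧ k ≤ (cutSet G S).card) ∨
    (σ.reg 2 = 0 ∧ ¬ ∃ S, feasible S ∧ k ≤ (cutSet G S).card))

end BondCut

set_option linter.constructorNameAsVariable false
set_option linter.unusedSimpArgs false

/-! The proof is a dynamic programming over the tree decomposition. Take a set `S` restricted to the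
vertices seen below a node. Only three things about it matter for the rest of the graph: which bag
vertices lie in `S`; how the bag is partitioned by connectivity along the edges seen so far that do
not cross the cut; and how many components no longer meet the bag, counted separately inside and
outside `S`. The bag separates what has been seen from what is to come, so a component that has left
the bag never grows again. At the empty root bag every component is complete. Hence `S` is connected
exactly when one component was completed inside, and the complement when one was completed outside.

With `b` slots for a bag, `b` being the largest bag size, such a state is a string of `b + 2` digits
in base `2 * b + 1`: one label per slot, whose parity tells the side, and two counters. There are
`(2 * b + 1) ^ (b + 2)` strings, which is `2 ^ O(tw * log tw)`. At each node all pairs of states are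
combined, in time polynomial in this number.

In a connected graph the bonds are the cut-sets with two connected sides (`isBond_iff`), so all four
problems are solved by one program with two switches: whether the complement must be connected, and
whether `s` and `t` are prescribed. The relation `Ctx.Deriv` says that a state is reached by a set.
`Deriv.describes` shows that a derived state tells the truth about its set, and `exists_deriv` that
every admissible set has a state. Both rest on the two separator lemmas `label_eq_of_eqvGen_union`
and `eqvGen_of_eqvGen_union`. At the root they become `Deriv.feasible` and `Feasible.deriv`. The
table bounds the value of every derivation from above (`TableOK.complete`), and following its back
pointers yields a set that attains the entry (`rounds_backStmt`).

The machine is reached through a small language with bounded loops and weakest preconditions, which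
`Stmt.exec_compile` translates with a step bound. The decomposition is a list in post-order; since
`rounds_add` splits a scan of the list into scans of subtrees, each pass is verified by induction on
the tree. `time_phases_le` and `exists_exponent` turn the step bound into the stated one. -/

namespace BondCut

/-! ## A structured language with bounded loops -/

/-- Variables of the structured language. -/
inductive Var : Type
  | n | N | s | t | st | conn | b | L | B | M | i | j | j1 | j2 | c1 | c2 | c | pw | r | ok | g
  | ty | u | w | p | q | aa | ee | v1 | v2 | cur | x | l | f | d | nv | idx
  deriving DecidableEq

/-- Arrays of the structured language. -/
inductive Arr : Type
  | ty | u | w | out | sz | left | occ | slot | val | bp1 | bp2 | nd | X | Y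
  deriving DecidableEq

/-- The register that holds a variable. -/
def Var.code : Var → ℕ
  | n => 0 | N => 1 | s => 3 | t => 4 | st => 6 | conn => 7 | b => 8 | L => 9 | B => 10 | M => 11
  | i => 12 | j => 13 | j1 => 14 | j2 => 15 | c1 => 16 | c2 => 17 | c => 18 | pw => 19 | r => 20
  | ok => 21 | g => 22 | ty => 23 | u => 24 | w => 25 | p => 26 | q => 27 | aa => 28 | ee => 29
  | v1 => 30 | v2 => 31 | cur => 32 | x => 33 | l => 34 | f => 35 | d => 36 | nv => 37 | idx => 38

/-- The machine array that holds an array. -/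
def Arr.code : Arr → ℕ
  | ty => 0 | u => 1 | w => 2 | out => 3 | sz => 4 | left => 5 | occ => 6 | slot => 7 | val => 8
  | bp1 => 9 | bp2 => 10 | nd => 11 | X => 12 | Y => 13

theorem Var.code_injective : Function.Injective Var.code := by
  intro x y h
  cases x <;> cases y <;> first | rfl | (simp [Var.code] at h)

theorem Arr.code_injective : Function.Injective Arr.code := by
  intro x y h
  cases x <;> cases y <;> first | rfl | (simp [Arr.code] at h)

/-- No variable lives in register 2, in register 5 or from 98 on. Register 2 keeps the input `k`,
register 5 stays zero, register 98 is the loop flag, and the registers from 100 on are scratch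
space. -/
theorem Var.code_lt (x : Var) : x.code < 98 := by cases x <;> decide
theorem Var.code_ne_two (x : Var) : x.code ≠ 2 := by cases x <;> decide
theorem Var.code_ne_five (x : Var) : x.code ≠ 5 := by cases x <;> decide

/-- States of the structured language. -/
structure HState : Type where
  v : Var → ℕ
  a : Arr → ℕ → ℕ

def HState.set (σ : HState) (x : Var) (k : ℕ) : HState :=
  { σ with v := Function.update σ.v x k }

def HState.put (σ : HState) (A : Arr) (i k : ℕ) : HState :=
  { σ with a := Function.update σ.a A (Function.update (σ.a A) i k) }

@[simp] theorem HState.set_v (σ : HState) (x y : Var) (k : ℕ) :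
    (σ.set x k).v y = if y = x then k else σ.v y := by
  simp [HState.set, Function.update_apply]

@[simp] theorem HState.set_a (σ : HState) (x : Var) (k : ℕ) : (σ.set x k).a = σ.a := rfl

@[simp] theorem HState.put_v (σ : HState) (A : Arr) (i k : ℕ) : (σ.put A i k).v = σ.v := rfl

@[simp] theorem HState.put_a (σ : HState) (A A' : Arr) (i k : ℕ) :
    (σ.put A i k).a A' = if A' = A then Function.update (σ.a A) i k else σ.a A' := by
  simp [HState.put, Function.update_apply]

inductive Exp : Type
  | var (x : Var)
  | lit (k : ℕ)
  | bin (o : Op) (e e' : Exp)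
  | get (A : Arr) (e : Exp)

namespace Exp

instance : Add Exp := ⟨bin .add⟩
instance : Sub Exp := ⟨bin .sub⟩
instance : Mul Exp := ⟨bin .mul⟩
instance : Div Exp := ⟨bin .div⟩
instance : Mod Exp := ⟨bin .mod⟩

/-- The test whether the first value is less than the second one. -/
def less (e₁ e₂ : Exp) : Exp := bin .lt e₁ e₂

/-- The test whether the two values are equal. -/
def same (e₁ e₂ : Exp) : Exp := bin .eq e₁ e₂

def eval (σ : HState) : Exp → ℕ
  | var x => σ.v x
  | lit k => k
  | bin o e e' => o.eval (e.eval σ) (e'.eval σ)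
  | get A e => σ.a A (e.eval σ)

/-- No literal, sum or product that occurs in the evaluation exceeds `W`. -/
def ok (W : ℕ) (σ : HState) : Exp → Prop
  | var _ => True
  | lit k => k ≤ W
  | bin o e e' => e.ok W σ ∧ e'.ok W σ ∧
      match o with
      | .add => e.eval σ + e'.eval σ ≤ W
      | .mul => e.eval σ * e'.eval σ ≤ W
      | _ => True
  | get _ e => e.ok W σ

variable (W : ℕ) (σ : HState) (e e' : Exp)

@[simp] theorem eval_var (x : Var) : (var x).eval σ = σ.v x := rfl
@[simp] theorem eval_lit (k : ℕ) : (lit k).eval σ = k := rfl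
@[simp] theorem eval_get (A : Arr) : (get A e).eval σ = σ.a A (e.eval σ) := rfl
@[simp] theorem eval_add : (e + e').eval σ = e.eval σ + e'.eval σ := rfl
@[simp] theorem eval_sub : (e - e').eval σ = e.eval σ - e'.eval σ := rfl
@[simp] theorem eval_mul : (e * e').eval σ = e.eval σ * e'.eval σ := rfl
@[simp] theorem eval_div : (e / e').eval σ = e.eval σ / e'.eval σ := rfl
@[simp] theorem eval_mod : (e % e').eval σ = e.eval σ % e'.eval σ := rfl
@[simp] theorem eval_less : (less e e').eval σ = if e.eval σ < e'.eval σ then 1 else 0 := rfl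
@[simp] theorem eval_same : (same e e').eval σ = if e.eval σ = e'.eval σ then 1 else 0 := rfl

@[simp] theorem ok_var (x : Var) : (var x).ok W σ := trivial
@[simp] theorem ok_lit (k : ℕ) : (lit k).ok W σ ↔ k ≤ W := Iff.rfl
@[simp] theorem ok_get (A : Arr) : (get A e).ok W σ ↔ e.ok W σ := Iff.rfl
@[simp] theorem ok_add :
    (e + e').ok W σ ↔ e.ok W σ ∧ e'.ok W σ ∧ e.eval σ + e'.eval σ ≤ W := Iff.rfl
@[simp] theorem ok_mul :
    (e * e').ok W σ ↔ e.ok W σ ∧ e'.ok W σ ∧ e.eval σ * e'.eval σ ≤ W := Iff.rfl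
@[simp] theorem ok_sub : (e - e').ok W σ ↔ e.ok W σ ∧ e'.ok W σ := by
  change e.ok W σ ∧ e'.ok W σ ∧ True ↔ _; simp
@[simp] theorem ok_div : (e / e').ok W σ ↔ e.ok W σ ∧ e'.ok W σ := by
  change e.ok W σ ∧ e'.ok W σ ∧ True ↔ _; simp
@[simp] theorem ok_mod : (e % e').ok W σ ↔ e.ok W σ ∧ e'.ok W σ := by
  change e.ok W σ ∧ e'.ok W σ ∧ True ↔ _; simp
@[simp] theorem ok_less : (less e e').ok W σ ↔ e.ok W σ ∧ e'.ok W σ := by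
  change e.ok W σ ∧ e'.ok W σ ∧ True ↔ _; simp
@[simp] theorem ok_same : (same e e').ok W σ ↔ e.ok W σ ∧ e'.ok W σ := by
  change e.ok W σ ∧ e'.ok W σ ∧ True ↔ _; simp

end Exp

inductive Stmt : Type
  | skip : Stmt
  | assign (x : Var) (e : Exp) : Stmt
  | store (A : Arr) (i e : Exp) : Stmt
  | seq (p q : Stmt) : Stmt
  | ite (e : Exp) (p q : Stmt) : Stmt
  /-- for `x` from `0` below `r` do `p` -/
  | loop (x r : Var) (p : Stmt) : Stmt

/-- Run a list of statements. -/
def block : List Stmt → Stmt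
  | [] => .skip
  | p :: ps => .seq p (block ps)

/-- `k` rounds of a loop with counter `x` whose body has the predicate transformer `F`. -/
def rounds (F : (HState → Prop) → HState → Prop) (x : Var) :
    ℕ → (HState → Prop) → HState → Prop
  | 0, Q => Q
  | k + 1, Q => F fun τ => rounds F x k Q (τ.set x (τ.v x + 1))

/-- Weakest preconditions, with word capacity `W`. -/
def wp (W : ℕ) : Stmt → (HState → Prop) → HState → Prop
  | .skip => fun Q σ => Q σ
  | .assign x e => fun Q σ => e.ok W σ ∧ Q (σ.set x (e.eval σ))
  | .store A i e => fun Q σ => i.ok W σ ∧ e.ok W σ ∧ Q (σ.put A (i.eval σ) (e.eval σ))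
  | .seq p q => fun Q σ => wp W p (wp W q Q) σ
  | .ite e p q => fun Q σ => e.ok W σ ∧ (e.eval σ ≠ 0 → wp W p Q σ) ∧ (e.eval σ = 0 → wp W q Q σ)
  | .loop x r p => fun Q σ => rounds (wp W p) x (σ.v r) Q (σ.set x 0)

/-- The variables that a statement may change. -/
def Stmt.writes : Stmt → List Var
  | .skip => []
  | .assign x _ => [x]
  | .store _ _ _ => []
  | .seq p q => p.writes ++ q.writes
  | .ite _ p q => p.writes ++ q.writes
  | .loop x _ p => x :: p.writes

/-- The arrays that a statement may change. -/
def Stmt.stores : Stmt → List Arr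
  | .skip => []
  | .assign _ _ => []
  | .store A _ _ => [A]
  | .seq p q => p.stores ++ q.stores
  | .ite _ p q => p.stores ++ q.stores
  | .loop _ _ p => p.stores

/-- Loop counters and loop bounds are not changed in the body, and the loop bounds are in `R`. -/
def Stmt.wf (R : List Var) : Stmt → Bool
  | .skip => true
  | .assign _ _ => true
  | .store _ _ _ => true
  | .seq p q => p.wf R && q.wf R
  | .ite _ p q => p.wf R && q.wf R
  | .loop x r p => p.wf R && (decide (r ∈ R) && decide (x ∉ p.writes))

/-! ### Frame conditions and the loop rule -/

/-- `τ` agrees with `σ` outside the variables `xs` and the arrays `As`. -/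
structure Frame (xs : List Var) (As : List Arr) (σ τ : HState) : Prop where
  v : ∀ y, y ∉ xs → τ.v y = σ.v y
  a : ∀ A, A ∉ As → τ.a A = σ.a A

theorem Frame.refl (xs : List Var) (As : List Arr) (σ : HState) : Frame xs As σ σ :=
  ⟨fun _ _ => rfl, fun _ _ => rfl⟩

theorem Frame.trans {xs : List Var} {As : List Arr} {σ τ υ : HState} (h : Frame xs As σ τ)
    (h' : Frame xs As τ υ) : Frame xs As σ υ :=
  ⟨fun y hy => (h'.v y hy).trans (h.v y hy), fun A hA => (h'.a A hA).trans (h.a A hA)⟩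

theorem Frame.mono {xs ys : List Var} {As Bs : List Arr} {σ τ : HState} (h : Frame xs As σ τ)
    (hx : xs ⊆ ys) (hA : As ⊆ Bs) : Frame ys Bs σ τ :=
  ⟨fun y hy => h.v y fun h' => hy (hx h'), fun A hA' => h.a A fun h' => hA' (hA h')⟩

theorem Frame.set {xs : List Var} {As : List Arr} {σ τ : HState} (h : Frame xs As σ τ)
    {x : Var} (hx : x ∈ xs) (k : ℕ) : Frame xs As σ (τ.set x k) :=
  ⟨fun y hy => by
    have : y ≠ x := fun h' => hy (h' ▸ hx)
    simp [this, h.v y hy], h.a⟩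

theorem rounds_mono {F : (HState → Prop) → HState → Prop}
    (hF : ∀ Q Q' : HState → Prop, (∀ τ, Q τ → Q' τ) → ∀ σ, F Q σ → F Q' σ) (x : Var)
    {Q Q' : HState → Prop} (h : ∀ τ, Q τ → Q' τ) (k : ℕ) :
    ∀ σ, rounds F x k Q σ → rounds F x k Q' σ := by
  induction k with
  | zero => exact h
  | succ k ih => exact fun σ => hF _ _ (fun τ => ih _) σ

theorem wp_mono (W : ℕ) (p : Stmt) : ∀ {Q Q' : HState → Prop}, (∀ τ, Q τ → Q' τ) →
    ∀ {σ}, wp W p Q σ → wp W p Q' σ := by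
  induction p with
  | skip => exact fun h σ => h σ
  | assign x e => exact fun h σ H => ⟨H.1, h _ H.2⟩
  | store A i e => exact fun h σ H => ⟨H.1, H.2.1, h _ H.2.2⟩
  | seq p q hp hq => exact fun h σ => hp fun τ => hq h
  | ite e p q hp hq => exact fun h σ H => ⟨H.1, fun H' => hp h (H.2.1 H'), fun H' => hq h (H.2.2 H')⟩
  | loop x r p hp => exact fun h σ => rounds_mono (F := wp W p) (fun _ _ h' _ => hp h') x h _ _

/-- The nodes of a subtree are consecutive in post-order. A loop over all nodes thus splits into the
rounds for the children and the round for the root, which turns loop verification into tree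
induction. -/
theorem rounds_add (F : (HState → Prop) → HState → Prop) (x : Var) (Q : HState → Prop)
    (k l : ℕ) : rounds F x (k + l) Q = rounds F x k (rounds F x l Q) := by
  induction k with
  | zero => simp [rounds]
  | succ k ih => rw [Nat.succ_add]; simp only [rounds, ih]

/-- A postcondition may always be strengthened by the statement that everything outside `writes` and
`stores` is unchanged. Loop invariants therefore need to mention only what the body changes. -/
theorem wp_frame (W : ℕ) (p : Stmt) : ∀ {Q : HState → Prop} {σ : HState}, wp W p Q σ →
    wp W p (fun τ => Q τ ∧ Frame p.writes p.stores σ τ) σ := by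
  induction p with
  | skip => exact fun h => ⟨h, .refl _ _ _⟩
  | assign x e =>
      refine fun h => ⟨h.1, h.2, ⟨fun y hy => ?_, fun _ _ => rfl⟩⟩
      simp only [Stmt.writes, List.mem_singleton] at hy
      simp [hy]
  | store A i e =>
      refine fun h => ⟨h.1, h.2.1, h.2.2, ⟨fun _ _ => rfl, fun y hy => ?_⟩⟩
      simp only [Stmt.stores, List.mem_singleton] at hy
      simp [hy]
  | seq p q hp hq =>
      refine fun h => wp_mono W p (fun τ hτ => ?_) (hp h)
      refine wp_mono W q (fun υ hυ => ⟨hυ.1, ?_⟩) (hq hτ.1)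
      exact (hτ.2.mono (by simp [Stmt.writes]) (by simp [Stmt.stores])).trans
        (hυ.2.mono (by simp [Stmt.writes]) (by simp [Stmt.stores]))
  | ite e p q hp hq =>
      refine fun h => ⟨h.1, fun H => ?_, fun H => ?_⟩
      · exact wp_mono W p (fun τ hτ => ⟨hτ.1, hτ.2.mono (by simp [Stmt.writes])
          (by simp [Stmt.stores])⟩) (hp (h.2.1 H))
      · exact wp_mono W q (fun τ hτ => ⟨hτ.1, hτ.2.mono (by simp [Stmt.writes])
          (by simp [Stmt.stores])⟩) (hq (h.2.2 H))
  | loop x r p hp =>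
      intro Q σ h
      have key : ∀ (k : ℕ) (τ : HState), Frame (x :: p.writes) p.stores σ τ →
          rounds (wp W p) x k Q τ →
          rounds (wp W p) x k (fun υ => Q υ ∧ Frame (x :: p.writes) p.stores σ υ) τ := by
        intro k
        induction k with
        | zero => exact fun τ hτ H => ⟨H, hτ⟩
        | succ k ih =>
            intro τ hτ H
            refine wp_mono W p (fun υ hυ => ?_) (hp H)
            refine ih _ ?_ hυ.1
            exact (hτ.trans (hυ.2.mono (by simp) (by simp))).set (by simp) _
      exact key _ _ ((Frame.refl _ _ _).set (by simp) _) h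

theorem rounds_frame (W : ℕ) (p : Stmt) (x : Var) {Q : HState → Prop} (k : ℕ) :
    ∀ {σ : HState}, rounds (wp W p) x k Q σ →
      rounds (wp W p) x k (fun τ => Q τ ∧ Frame (x :: p.writes) p.stores σ τ) σ := by
  induction k with
  | zero => exact fun h => ⟨h, .refl _ _ _⟩
  | succ k ih =>
      intro σ h
      refine wp_mono W p (fun υ hυ => ?_) (wp_frame W p h)
      refine rounds_mono (F := wp W p) (fun _ _ h' _ => wp_mono W p h') x (fun τ hτ => ⟨hτ.1, ?_⟩) _ _ (ih hυ.1)
      exact ((hυ.2.mono (by simp) (by simp)).set (x := x) (by simp) _).trans hτ.2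

/-- The loop rule. -/
theorem wp_loop {W : ℕ} {x r : Var} {p : Stmt} {Q : HState → Prop} {σ : HState}
    (I : ℕ → HState → Prop) (hx : x ∉ p.writes) (h0 : I 0 (σ.set x 0))
    (hstep : ∀ k < σ.v r, ∀ τ, Frame (x :: p.writes) p.stores σ τ → τ.v x = k → I k τ →
      wp W p (fun υ => I (k + 1) (υ.set x (k + 1))) τ)
    (hQ : ∀ τ, Frame (x :: p.writes) p.stores σ τ → I (σ.v r) τ → Q τ) :
    wp W (.loop x r p) Q σ := by
  change rounds (wp W p) x (σ.v r) Q (σ.set x 0)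
  -- Here `k` rounds are done and `m` remain; the frame refers to the state before the loop
  -- throughout.
  have key : ∀ (m k : ℕ) (τ : HState), k + m = σ.v r → Frame (x :: p.writes) p.stores σ τ →
      τ.v x = k → I k τ → rounds (wp W p) x m Q τ := by
    intro m
    induction m with
    | zero =>
        intro k τ hk hτ _ hI
        simp only [Nat.add_zero] at hk
        exact hQ τ hτ (hk ▸ hI)
    | succ m ih =>
        intro k τ hk hτ hxk hI
        refine wp_mono W p (fun υ hυ => ?_) (wp_frame W p (hstep k (by omega) τ hτ hxk hI))
        have hυx : υ.v x = k := (hυ.2.v x hx).trans hxk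
        refine ih (k + 1) _ (by omega) ?_ (by simp [hυx]) (by rw [hυx]; exact hυ.1)
        exact (hτ.trans (hυ.2.mono (by simp) (by simp))).set (by simp) _
  exact key _ 0 _ (by simp) ((Frame.refl _ _ _).set (by simp) _) (by simp) h0

@[simp] theorem wp_skip (W : ℕ) (Q : HState → Prop) (σ : HState) : wp W .skip Q σ ↔ Q σ := Iff.rfl

@[simp] theorem wp_assign (W : ℕ) (x : Var) (e : Exp) (Q : HState → Prop) (σ : HState) :
    wp W (.assign x e) Q σ ↔ e.ok W σ ∧ Q (σ.set x (e.eval σ)) := Iff.rfl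

@[simp] theorem wp_store (W : ℕ) (A : Arr) (i e : Exp) (Q : HState → Prop) (σ : HState) :
    wp W (.store A i e) Q σ ↔
      i.ok W σ ∧ e.ok W σ ∧ Q (σ.put A (i.eval σ) (e.eval σ)) := Iff.rfl

@[simp] theorem wp_seq (W : ℕ) (p q : Stmt) (Q : HState → Prop) (σ : HState) :
    wp W (.seq p q) Q σ ↔ wp W p (wp W q Q) σ := Iff.rfl

@[simp] theorem wp_block_nil (W : ℕ) (Q : HState → Prop) (σ : HState) :
    wp W (block []) Q σ ↔ Q σ := Iff.rfl

@[simp] theorem wp_block_cons (W : ℕ) (p : Stmt) (ps : List Stmt) (Q : HState → Prop)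
    (σ : HState) : wp W (block (p :: ps)) Q σ ↔ wp W p (wp W (block ps) Q) σ := Iff.rfl

@[simp] theorem wp_ite (W : ℕ) (e : Exp) (p q : Stmt) (Q : HState → Prop) (σ : HState) :
    wp W (.ite e p q) Q σ ↔
      e.ok W σ ∧ (e.eval σ ≠ 0 → wp W p Q σ) ∧ (e.eval σ = 0 → wp W q Q σ) := Iff.rfl

/-! ## Compilation -/

/-- Code that evaluates an expression using the registers from `d` on, and the register in which
the result is found. -/
def Exp.compile : Exp → ℕ → Prog × ℕ
  | .var x, _ => (.skip, x.code)
  | .lit k, d => (.const d k, d)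
  | .bin o e e', d =>
      (.seq (e.compile d).1 (.seq (e'.compile (d + 1)).1
        (.arith o d (e.compile d).2 (e'.compile (d + 1)).2)), d)
  | .get A e, d => (.seq (e.compile d).1 (.load d A.code (e.compile d).2), d)

def Exp.time : Exp → ℕ
  | .var _ => 1
  | .lit _ => 1
  | .bin _ e e' => e.time + e'.time + 1
  | .get _ e => e.time + 1

/-- Adding register 5, which is zero, serves as a move. In a store the value is evaluated from
register 101 on, so that an index held in register 100 survives. The flag in register 98 is
recomputed after each round and may be overwritten by inner loops in between. -/
def Stmt.compile : Stmt → Prog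
  | .skip => .skip
  | .assign x e => .seq (e.compile 100).1 (.arith .add x.code (e.compile 100).2 5)
  | .store A i e => .seq (i.compile 100).1 (.seq (e.compile 101).1
      (.store A.code (i.compile 100).2 (e.compile 101).2))
  | .seq p q => .seq p.compile q.compile
  | .ite e p q => .seq (e.compile 100).1 (.cond (e.compile 100).2 p.compile q.compile)
  | .loop x r p => .seq (.seq (.const x.code 0) (.arith .lt 98 x.code r.code))
      (.loop 98 (.seq p.compile (.seq (.seq (.const 100 1) (.arith .add x.code x.code 100))
        (.arith .lt 98 x.code r.code))))

/-- A bound on the number of steps, where `ρ` bounds the loop bounds. -/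
def Stmt.time (ρ : Var → ℕ) : Stmt → ℕ
  | .skip => 1
  | .assign _ e => e.time + 1
  | .store _ i e => i.time + e.time + 1
  | .seq p q => p.time ρ + q.time ρ
  | .ite e p q => e.time + 1 + (p.time ρ + q.time ρ)
  | .loop _ r p => 3 + ρ r * (p.time ρ + 4)

/-- The machine state `s` represents `σ`; register `2` holds `k`. -/
structure Sim (W k : ℕ) (σ : HState) (s : State) : Prop where
  reg : ∀ x : Var, s.reg x.code = σ.v x
  arr : ∀ (A : Arr) (i : ℕ), s.arr A.code i = σ.a A i
  zero : s.reg 5 = 0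
  key : s.reg 2 = k
  v_le : ∀ x, σ.v x ≤ W
  a_le : ∀ A i, σ.a A i ≤ W

theorem Sim.temp {W k : ℕ} {σ : HState} {s : State} (h : Sim W k σ s) {d : ℕ} (hd : 98 ≤ d)
    (a : ℕ) : Sim W k σ (s.setReg d a) := by
  refine ⟨fun x => ?_, h.arr, ?_, ?_, h.v_le, h.a_le⟩
  · have := x.code_lt
    rw [← h.reg x]
    exact Function.update_of_ne (by omega) _ _
  · rw [← h.zero]
    exact Function.update_of_ne (by omega) _ _
  · rw [← h.key]
    exact Function.update_of_ne (by omega) _ _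

theorem Sim.set {W k : ℕ} {σ : HState} {s : State} (h : Sim W k σ s) (x : Var) {a : ℕ}
    (ha : a ≤ W) : Sim W k (σ.set x a) (s.setReg x.code a) := by
  refine ⟨fun y => ?_, h.arr, ?_, ?_, fun y => ?_, h.a_le⟩
  · by_cases hy : y = x
    · subst hy; simp [State.setReg]
    · have : y.code ≠ x.code := fun h' => hy (Var.code_injective h')
      simp [State.setReg, hy, this, h.reg y]
  · rw [← h.zero]
    exact Function.update_of_ne x.code_ne_five.symm _ _
  · rw [← h.key]
    exact Function.update_of_ne x.code_ne_two.symm _ _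
  · by_cases hy : y = x <;> simp [hy, ha, h.v_le y]

theorem Sim.put {W k : ℕ} {σ : HState} {s : State} (h : Sim W k σ s) (A : Arr) (i : ℕ) {a : ℕ}
    (ha : a ≤ W) : Sim W k (σ.put A i a) (s.setArr A.code i a) := by
  refine ⟨h.reg, fun B l => ?_, h.zero, h.key, h.v_le, fun B l => ?_⟩
  · by_cases hB : B = A
    · subst hB
      by_cases hl : l = i
      · subst hl; simp [State.setArr]
      · simp [State.setArr, hl, h.arr]
    · have : B.code ≠ A.code := fun h' => hB (Arr.code_injective h')
      simp [State.setArr, hB, this, h.arr]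
  · by_cases hB : B = A
    · subst hB
      by_cases hl : l = i
      · subst hl; simpa using ha
      · simpa [hl] using h.a_le B l
    · simpa [hB] using h.a_le B l

/-- A result lies either in the scratch register `d`, below the registers used by the next operand,
or in the register of a variable, which evaluation does not change. So the first operand survives
the second in both cases. -/
theorem Exp.compile_snd (e : Exp) (d : ℕ) :
    (e.compile d).2 = d ∨ ∃ x, e = .var x ∧ (e.compile d).2 = x.code := by
  cases e <;> simp [Exp.compile]

/-- The induction carries two further facts. Registers below `d` are preserved, and the value is at
most `W`; the latter is why only literals, sums and products have to be checked, as the other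
operations do not exceed their first operand or one. -/
theorem Exp.exec_compile {W k : ℕ} (hW : 1 ≤ W) (e : Exp) : ∀ {d : ℕ} {σ : HState} {s : State},
    100 ≤ d → e.ok W σ → Sim W k σ s →
    ∃ T s', Exec W (e.compile d).1 s T s' ∧ T ≤ e.time ∧ Sim W k σ s' ∧
      s'.reg (e.compile d).2 = e.eval σ ∧ e.eval σ ≤ W ∧
      ∀ d', d' < d → s'.reg d' = s.reg d' := by
  induction e with
  | var x =>
      intro d σ s _ _ hs
      exact ⟨1, s, .skip s, le_rfl, hs, hs.reg x, hs.v_le x, fun _ _ => rfl⟩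
  | lit a =>
      intro d σ s hd hok hs
      refine ⟨1, _, .const s d a hok, le_rfl, hs.temp (by omega) a, ?_, hok, fun d' hd' => ?_⟩
      · simp [Exp.compile, State.setReg]
      · exact Function.update_of_ne (by omega) _ _
  | bin o e e' he he' =>
      intro d σ s hd hok hs
      obtain ⟨h1, h2, h3⟩ := hok
      obtain ⟨T1, s1, E1, t1, S1, r1, b1, f1⟩ := he (d := d) hd h1 hs
      obtain ⟨T2, s2, E2, t2, S2, r2, b2, f2⟩ := he' (d := d + 1) (by omega) h2 S1
      have r1' : s2.reg (e.compile d).2 = e.eval σ := by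
        rcases e.compile_snd d with h | ⟨x, hx, h⟩
        · rw [f2 _ (by omega), r1]
        · rw [h, S2.reg, hx]; rfl
      have hb : o.eval (e.eval σ) (e'.eval σ) ≤ W := by
        cases o with
        | add => exact h3
        | mul => exact h3
        | sub => exact (Nat.sub_le _ _).trans b1
        | div => exact (Nat.div_le_self _ _).trans b1
        | mod => exact (Nat.mod_le _ _).trans b1
        | lt => simp only [Op.eval]; split <;> omega
        | eq => simp only [Op.eval]; split <;> omega
      refine ⟨T1 + (T2 + 1), s2.setReg d (o.eval (e.eval σ) (e'.eval σ)),
        .seq E1 (.seq E2 ?_), ?_, S2.temp (by omega) _, ?_, hb, fun d' hd' => ?_⟩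
      · have := Exec.arith (W := W) s2 o d (e.compile d).2 (e'.compile (d + 1)).2
          (by rw [r1', r2]; exact hb)
        rwa [r1', r2] at this
      · simp only [Exp.time]; omega
      · simp [Exp.compile, State.setReg, Exp.eval]
      · rw [← f1 d' hd', ← f2 d' (by omega)]
        exact Function.update_of_ne (by omega) _ _
  | get A e he =>
      intro d σ s hd hok hs
      obtain ⟨T1, s1, E1, t1, S1, r1, b1, f1⟩ := he (d := d) hd hok hs
      refine ⟨T1 + 1, s1.setReg d (σ.a A (e.eval σ)), .seq E1 ?_, ?_, S1.temp (by omega) _, ?_,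
        S1.a_le _ _, fun d' hd' => ?_⟩
      · have := Exec.load (W := W) s1 d A.code (e.compile d).2
        rwa [r1, S1.arr] at this
      · simp only [Exp.time]; omega
      · simp [Exp.compile, State.setReg, Exp.eval]
      · rw [← f1 d' hd']
        exact Function.update_of_ne (by omega) _ _

/-- A statement that meets its specification is compiled to a program that does so in the
predicted time. -/
theorem Stmt.exec_compile {W k : ℕ} (hW : 1 ≤ W) {R : List Var} {ρ : Var → ℕ} (p : Stmt) :
    ∀ {Q : HState → Prop} {σ : HState} {s : State}, p.wf R = true → (∀ r ∈ R, r ∉ p.writes) →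
      (∀ r ∈ R, σ.v r ≤ ρ r) → wp W p Q σ → Sim W k σ s →
      ∃ T s' σ', Exec W p.compile s T s' ∧ T ≤ p.time ρ ∧ Sim W k σ' s' ∧ Q σ' := by
  -- The frame is part of the induction: it shows that the counter and all loop bounds have kept
  -- their values when the body has been executed.
  suffices H : ∀ {Q : HState → Prop} {σ : HState} {s : State}, p.wf R = true →
      (∀ r ∈ R, r ∉ p.writes) →
      (∀ r ∈ R, σ.v r ≤ ρ r) → wp W p (fun τ => Q τ ∧ Frame p.writes p.stores σ τ) σ →
      Sim W k σ s → ∃ T s' σ', Exec W p.compile s T s' ∧ T ≤ p.time ρ ∧ Sim W k σ' s' ∧ Q σ' ∧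
        Frame p.writes p.stores σ σ' by
    intro Q σ s h1 h2 h3 h4 h5
    obtain ⟨T, s', σ', a, b, c, d, _⟩ := H h1 h2 h3 (wp_frame W p h4) h5
    exact ⟨T, s', σ', a, b, c, d⟩
  induction p with
  | skip => exact fun _ _ _ h hs => ⟨1, _, _, .skip _, le_rfl, hs, h⟩
  | assign x e =>
      intro Q σ s _ _ _ h hs
      obtain ⟨T1, s1, E1, t1, S1, r1, b1, f1⟩ := e.exec_compile hW (d := 100) le_rfl h.1 hs
      refine ⟨T1 + 1, _, _, .seq E1 (.arith s1 .add x.code _ 5 ?_), ?_, ?_, h.2⟩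
      · simp only [Op.eval, S1.zero, r1]; exact b1
      · simp only [Stmt.time]; omega
      · simp only [Op.eval, S1.zero, r1]; exact S1.set x b1
  | store A i e =>
      intro Q σ s _ _ _ h hs
      obtain ⟨T1, s1, E1, t1, S1, r1, b1, f1⟩ := i.exec_compile hW (d := 100) le_rfl h.1 hs
      obtain ⟨T2, s2, E2, t2, S2, r2, b2, f2⟩ := e.exec_compile hW (d := 101) (by omega) h.2.1 S1
      have r1' : s2.reg (i.compile 100).2 = i.eval σ := by
        rcases i.compile_snd 100 with h | ⟨x, hx, h⟩
        · rw [f2 _ (by omega), r1]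
        · rw [h, S2.reg, hx]; rfl
      refine ⟨T1 + (T2 + 1), _, _, .seq E1 (.seq E2 (.store s2 A.code _ _)), ?_, ?_, h.2.2⟩
      · simp only [Stmt.time]; omega
      · rw [r1', r2]; exact S2.put A _ b2
  | seq p q hp hq =>
      intro Q σ s hwf hR hρ h hs
      simp only [Stmt.wf, Bool.and_eq_true] at hwf
      have hRp : ∀ r ∈ R, r ∉ p.writes := fun r hr h' => hR r hr (by simp [Stmt.writes, h'])
      have hRq : ∀ r ∈ R, r ∉ q.writes := fun r hr h' => hR r hr (by simp [Stmt.writes, h'])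
      obtain ⟨T1, s1, σ1, E1, t1, S1, H1, F1⟩ := hp hwf.1 hRp hρ (wp_frame W p h) hs
      obtain ⟨T2, s2, σ2, E2, t2, S2, H2, F2⟩ := hq hwf.2 hRq
        (fun r hr => (F1.v r (hRp r hr)).symm ▸ hρ r hr) (wp_frame W q H1) S1
      exact ⟨_, s2, σ2, .seq E1 E2, by simp only [Stmt.time]; omega, S2, H2.1, H2.2⟩
  | ite e p q hp hq =>
      intro Q σ s hwf hR hρ h hs
      simp only [Stmt.wf, Bool.and_eq_true] at hwf
      have hRp : ∀ r ∈ R, r ∉ p.writes := fun r hr h' => hR r hr (by simp [Stmt.writes, h'])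
      have hRq : ∀ r ∈ R, r ∉ q.writes := fun r hr h' => hR r hr (by simp [Stmt.writes, h'])
      obtain ⟨T1, s1, E1, t1, S1, r1, b1, f1⟩ := e.exec_compile hW (d := 100) le_rfl h.1 hs
      by_cases hc : e.eval σ = 0
      · obtain ⟨T2, s2, σ2, E2, t2, S2, H2, F2⟩ := hq hwf.2 hRq hρ (wp_frame W q (h.2.2 hc)) S1
        exact ⟨_, s2, σ2, .seq E1 (.condFalse (r1.trans hc) E2),
          by simp only [Stmt.time]; omega, S2, H2.1, H2.2⟩
      · obtain ⟨T2, s2, σ2, E2, t2, S2, H2, F2⟩ := hp hwf.1 hRp hρ (wp_frame W p (h.2.1 hc)) S1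
        exact ⟨_, s2, σ2, .seq E1 (.condTrue (by rw [r1]; exact hc) E2),
          by simp only [Stmt.time]; omega, S2, H2.1, H2.2⟩
  | loop x r p hp =>
      intro Q σ s hwf hR hρ h hs
      simp only [Stmt.wf, Bool.and_eq_true, decide_eq_true_eq] at hwf
      obtain ⟨hwf, hr, hx⟩ := hwf
      have hRp : ∀ y ∈ R, y ∉ p.writes := fun y hy h' => hR y hy (by simp [Stmt.writes, h'])
      have hrx : r ≠ x := fun h' => hR r hr (by simp [Stmt.writes, h'])
      set Q' : HState → Prop := fun τ => Q τ ∧ Frame (x :: p.writes) p.stores σ τ with hQ'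
      have key : ∀ (m : ℕ) (τ : HState) (s1 : State), Sim W k τ s1 → τ.v x + m = σ.v r →
          τ.v r = σ.v r → (∀ y ∈ R, τ.v y ≤ ρ y) → rounds (wp W p) x m Q' τ →
          ∃ T s' σ', Exec W (.loop 98 (.seq p.compile
            (.seq (.seq (.const 100 1) (.arith .add x.code x.code 100))
              (.arith .lt 98 x.code r.code)))) (s1.setReg 98 (if τ.v x < σ.v r then 1 else 0)) T s' ∧
            T ≤ 1 + m * (p.time ρ + 4) ∧ Sim W k σ' s' ∧ Q' σ' := by
        intro m
        induction m with
        | zero =>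
            intro τ s1 S1 hm hτr hτR hτ
            refine ⟨1, _, τ, .loopFalse ?_, by simp, S1.temp (by omega) _, hτ⟩
            have : ¬ τ.v x < σ.v r := by omega
            simp [State.setReg, this]
        | succ m ih =>
            intro τ s1 S1 hm hτr hτR hτ
            have hlt : τ.v x < σ.v r := by omega
            obtain ⟨T2, s2, τ2, E2, t2, S2, H2, F2⟩ := hp hwf hRp hτR (wp_frame W p hτ)
              (S1.temp (d := 98) (by omega) (if τ.v x < σ.v r then 1 else 0))
            have hx2 : τ2.v x = τ.v x := F2.v x hx
            have hr2 : τ2.v r = τ.v r := F2.v r (hRp r hr)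
            -- The counter is below a bound that is itself a stored word, so its increment cannot
            -- exceed the capacity.
            have hrW : σ.v r ≤ W := hτr ▸ S1.v_le r
            have hle : τ2.v x + 1 ≤ W := by omega
            have S3 := (S2.temp (d := 100) (by omega) 1).set x hle
            have E3 : Exec W (.seq (.const 100 1) (.arith .add x.code x.code 100)) s2 (1 + 1)
                ((s2.setReg 100 1).setReg x.code (τ2.v x + 1)) := by
              refine .seq (.const s2 100 1 hW) ?_
              have e1 : (s2.setReg 100 1).reg x.code = τ2.v x :=
                (S2.temp (d := 100) (by omega) 1).reg x
              have e2 : (s2.setReg 100 1).reg 100 = 1 := by simp [State.setReg]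
              have := Exec.arith (W := W) (s2.setReg 100 1) .add x.code x.code 100
                (by simp only [Op.eval, e1, e2]; exact hle)
              simpa only [Op.eval, e1, e2] using this
            obtain ⟨T4, s4, σ4, E4, t4, S4, H4⟩ := ih _ _ S3 (by simp; omega)
              (by simp [hrx, hr2, hτr]) (fun y hy => by
                have hyx : y ≠ x := fun h' => hR y hy (by simp [Stmt.writes, h'])
                simpa [hyx, F2.v y (hRp y hy)] using hτR y hy) H2
            have E5 : Exec W (.arith .lt 98 x.code r.code)
                ((s2.setReg 100 1).setReg x.code (τ2.v x + 1)) 1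
                (((s2.setReg 100 1).setReg x.code (τ2.v x + 1)).setReg 98
                  (if (τ2.set x (τ2.v x + 1)).v x < σ.v r then 1 else 0)) := by
              have := Exec.arith (W := W) ((s2.setReg 100 1).setReg x.code (τ2.v x + 1))
                .lt 98 x.code r.code (by
                  simp only [Op.eval]; split <;> omega)
              have e1 := S3.reg x
              have e2 := S3.reg r
              simp only [HState.set_v, hrx, if_false, hr2, hτr] at e2
              simpa only [Op.eval, e1, e2] using this
            refine ⟨_, s4, σ4, .loopTrue ?_ (.seq E2 (.seq E3 E5)) E4, ?_, S4, H4⟩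
            · simp [State.setReg, hlt]
            · rw [Nat.succ_mul]; omega
      have S1 := hs.set x (a := 0) (Nat.zero_le _)
      obtain ⟨T, s', σ', E, t, S, H⟩ := key (σ.v r) (σ.set x 0) _ S1 (by simp) (by simp [hrx])
        (fun y hy => by
          have hyx : y ≠ x := fun h' => hR y hy (by simp [Stmt.writes, h'])
          simpa [hyx] using hρ y hy) h
      refine ⟨1 + 1 + T, s', σ', .seq (.seq (.const s x.code 0 (Nat.zero_le _)) ?_) E, ?_, S, H⟩
      · have := Exec.arith (W := W) (s.setReg x.code 0) .lt 98 x.code r.code (by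
          simp only [Op.eval]; split <;> omega)
        have e1 := S1.reg x
        have e2 := S1.reg r
        simp only [HState.set_v, hrx, if_false] at e2
        simpa only [Op.eval, e1, e2] using this
      · have := Nat.mul_le_mul_right (p.time ρ + 4) (hρ r hr)
        simp only [Stmt.time]; omega

/-! ## Consistency of nice tree decompositions -/

namespace NiceTree

variable {n : ℕ}

/-- The vertices that occur in the bags of the tree. -/
def verts : NiceTree n → Finset (Fin n)
  | leaf => ∅
  | introVertex v t => insert v t.verts
  | introEdge _ _ t => t.verts
  | forget _ t => t.verts
  | join a b => a.verts ∪ b.verts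

/-- A structural form of the condition that the nodes containing a vertex form a subtree. -/
def Consistent : NiceTree n → Prop
  | leaf => True
  | introVertex v t => v ∉ t.verts ∧ t.Consistent
  | introEdge _ _ t => t.Consistent
  | forget _ t => t.Consistent
  | join a b => (∀ x ∈ a.verts, x ∈ b.verts → x ∈ a.bag) ∧ a.Consistent ∧ b.Consistent

theorem bag_subset_verts (t : NiceTree n) : t.bag ⊆ t.verts := by
  induction t with
  | leaf => simp [bag, verts]
  | introVertex v t ih => exact Finset.insert_subset_insert _ ih
  | introEdge u v t ih => exact ih
  | forget v t ih => exact (Finset.erase_subset _ _).trans ih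
  | join a b iha ihb => exact iha.trans Finset.subset_union_left

theorem mem_verts_of_introducedEdges {t : NiceTree n} (h : t.LocallyNice) {x y : Fin n}
    (hxy : s(x, y) ∈ t.introducedEdges) : x ∈ t.verts ∧ y ∈ t.verts := by
  induction t with
  | leaf => simp [introducedEdges] at hxy
  | introVertex v t ih =>
      have := ih h.2 hxy
      simp [verts, this]
  | introEdge u v t ih =>
      simp only [introducedEdges, List.mem_cons] at hxy
      rcases hxy with hxy | hxy
      · have hu := t.bag_subset_verts h.1
        have hv := t.bag_subset_verts h.2.1
        rcases Sym2.eq_iff.1 hxy with ⟨rfl, rfl⟩ | ⟨rfl, rfl⟩ <;> simp [verts, hu, hv]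
      · exact ih h.2.2 hxy
  | forget v t ih => exact ih h.2 hxy
  | join a b iha ihb =>
      simp only [introducedEdges, List.mem_append] at hxy
      rcases hxy with hxy | hxy
      · have := iha h.2.1 hxy
        simp [verts, this]
      · have := ihb h.2.2 hxy
        simp [verts, this]

theorem exists_subtree_of_mem_verts (t : NiceTree n) {x : Fin n} (hx : x ∈ t.verts) :
    ∃ p t', t.subtree p = some t' ∧ x ∈ t'.bag := by
  induction t with
  | leaf => simp [verts] at hx
  | introVertex v t ih =>
      simp only [verts, Finset.mem_insert] at hx
      rcases hx with rfl | hx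
      · exact ⟨[], _, rfl, by simp [bag]⟩
      · obtain ⟨p, t', h, h'⟩ := ih hx
        exact ⟨false :: p, t', h, h'⟩
  | introEdge u v t ih =>
      obtain ⟨p, t', h, h'⟩ := ih hx
      exact ⟨false :: p, t', h, h'⟩
  | forget v t ih =>
      obtain ⟨p, t', h, h'⟩ := ih hx
      exact ⟨false :: p, t', h, h'⟩
  | join a b iha ihb =>
      simp only [verts, Finset.mem_union] at hx
      rcases hx with hx | hx
      · obtain ⟨p, t', h, h'⟩ := iha hx
        exact ⟨false :: p, t', h, h'⟩
      · obtain ⟨p, t', h, h'⟩ := ihb hx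
        exact ⟨true :: p, t', h, h'⟩

theorem mem_verts_of_subtree (t : NiceTree n) {x : Fin n} : ∀ {p : List Bool} {t' : NiceTree n},
    t.subtree p = some t' → x ∈ t'.bag → x ∈ t.verts := by
  induction t with
  | leaf =>
      intro p t' h hx
      cases p with
      | nil => cases h; exact bag_subset_verts _ hx
      | cons c p => simp [subtree] at h
  | introVertex v t ih =>
      intro p t' h hx
      rcases p with _ | ⟨_ | _, p⟩
      · cases h; exact bag_subset_verts _ hx
      · exact Finset.mem_insert_of_mem (ih h hx)
      · simp [subtree] at h
  | introEdge u v t ih =>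
      intro p t' h hx
      rcases p with _ | ⟨_ | _, p⟩
      · cases h; exact bag_subset_verts _ hx
      · exact ih h hx
      · simp [subtree] at h
  | forget v t ih =>
      intro p t' h hx
      rcases p with _ | ⟨_ | _, p⟩
      · cases h; exact bag_subset_verts _ hx
      · exact ih h hx
      · simp [subtree] at h
  | join a b iha ihb =>
      intro p t' h hx
      rcases p with _ | ⟨_ | _, p⟩
      · cases h; exact bag_subset_verts _ hx
      · exact Finset.mem_union_left _ (iha h hx)
      · exact Finset.mem_union_right _ (ihb h hx)

theorem subtree_append (t : NiceTree n) {p : List Bool} {t' : NiceTree n}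
    (h : t.subtree p = some t') (q : List Bool) : t.subtree (p ++ q) = t'.subtree q := by
  induction t generalizing p with
  | leaf =>
      cases p with
      | nil => cases h; rfl
      | cons c p => simp [subtree] at h
  | introVertex v t ih | introEdge u v t ih | forget v t ih =>
      rcases p with _ | ⟨_ | _, p⟩
      · cases h; rfl
      · exact ih h
      · simp [subtree] at h
  | join a b iha ihb =>
      rcases p with _ | ⟨_ | _, p⟩
      · cases h; rfl
      · exact iha h
      · exact ihb h

/-- The nodes containing `x` cannot leave a subtree except through its root. -/
theorem mem_bag_of_crossing (t : NiceTree n) {x : Fin n}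
    (hc : (t.treeGraph.induce {y | x ∈ t.bagAt y}).Connected) {p : List Bool} {c : Bool}
    {q q' : List Bool} {t₁ t₂ t₀ : NiceTree n} (h₀ : t.subtree p = some t₀)
    (h₁ : t.subtree (p ++ c :: q) = some t₁) (hx₁ : x ∈ t₁.bag)
    (h₂ : t.subtree q' = some t₂) (hx₂ : x ∈ t₂.bag) (hq' : ¬ (p ++ [c]) <+: q') :
    x ∈ t₀.bag := by
  by_contra hx₀
  have e₁ : ∀ h, x ∈ t.bagAt ⟨p ++ c :: q, h⟩ := fun h => by simp [bagAt, h₁, hx₁]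
  have e₂ : ∀ h, x ∈ t.bagAt ⟨q', h⟩ := fun h => by simp [bagAt, h₂, hx₂]
  let y₁ : {y | x ∈ t.bagAt y} := ⟨⟨p ++ c :: q, by simp [h₁]⟩, e₁ _⟩
  let y₂ : {y | x ∈ t.bagAt y} := ⟨⟨q', by simp [h₂]⟩, e₂ _⟩
  obtain ⟨w⟩ := hc.preconnected y₁ y₂
  -- A walk that starts below the edge from `p` to its child `c` can leave that part only by
  -- stepping to `p`, and `p` is not among the nodes whose bags contain `x`.
  have key : ∀ (a b : {y | x ∈ t.bagAt y}), (t.treeGraph.induce {y | x ∈ t.bagAt y}).Walk a b →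
      (p ++ [c]) <+: a.1.1 → (p ++ [c]) <+: b.1.1 := by
    intro a b w
    induction w with
    | nil => exact id
    | @cons a b d hab w ih =>
        intro ha
        refine ih ?_
        have hab : t.treeGraph.Adj a.1 b.1 := hab
        rcases hab with ⟨e, he⟩ | ⟨e, he⟩
        · rw [he]; exact ha.trans (List.prefix_append _ _)
        · rw [he] at ha
          rcases List.prefix_concat_iff.1 ha with h | h
          · exfalso
            have hb : b.1.1 = p := (List.append_inj_left' h rfl).symm
            have := b.2
            simp only [Set.mem_ofPred_eq, bagAt, hb, h₀, Option.get_some] at this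
            exact hx₀ this
          · exact h
  exact hq' (key _ _ w ⟨q, by simp [y₁]⟩)

/-- If an introduced vertex occurred below the child, its nodes would be connected across the child,
whose bag omits it. If a vertex occurs below both children of a join, its nodes are connected across
the join node. -/
theorem consistent_of_connected {t : NiceTree n} (h : t.LocallyNice)
    (hc : ∀ x, (t.treeGraph.induce {y | x ∈ t.bagAt y}).Connected) : t.Consistent := by
  have key : ∀ (t' : NiceTree n) (p : List Bool), t.subtree p = some t' → t'.LocallyNice →
      t'.Consistent := by
    intro t'
    induction t' with
    | leaf => exact fun _ _ _ => trivial
    | introVertex v t' ih =>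
        intro p hp hl
        have hp' : t.subtree (p ++ [false]) = some t' := by
          rw [subtree_append t hp]; cases t' <;> rfl
        refine ⟨fun hv => hl.1 ?_, ih _ hp' hl.2⟩
        obtain ⟨q, t₁, hq, hv⟩ := exists_subtree_of_mem_verts t' hv
        rcases q with _ | ⟨c, q⟩
        · cases t' <;> cases hq <;> exact hv
        · refine mem_bag_of_crossing t (hc v) hp' (c := c) (q := q) (q' := p)
            (by rw [subtree_append t hp']; exact hq) hv hp (by simp [bag]) fun h => ?_
          simpa using h.length_le
    | introEdge u v t' ih =>
        intro p hp hl
        exact ih (p ++ [false]) (by rw [subtree_append t hp]; cases t' <;> rfl) hl.2.2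
    | forget v t' ih =>
        intro p hp hl
        exact ih (p ++ [false]) (by rw [subtree_append t hp]; cases t' <;> rfl) hl.2
    | join a b iha ihb =>
        intro p hp hl
        refine ⟨fun x hxa hxb => ?_,
          iha (p ++ [false]) (by rw [subtree_append t hp]; cases a <;> rfl) hl.2.1,
          ihb (p ++ [true]) (by rw [subtree_append t hp]; cases b <;> rfl) hl.2.2⟩
        obtain ⟨q, t₁, hq, hv⟩ := exists_subtree_of_mem_verts a hxa
        obtain ⟨q', t₂, hq', hv'⟩ := exists_subtree_of_mem_verts b hxb
        change x ∈ (join a b).bag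
        refine mem_bag_of_crossing t (hc x) hp (c := false) (q := q) (q' := p ++ true :: q')
            (by rw [subtree_append t hp]; exact hq) hv
            (by rw [subtree_append t hp]; exact hq') hv' fun h => ?_
        rw [List.prefix_append_right_inj] at h
        simp at h
  exact key t [] (by cases t <;> rfl) h

theorem mem_verts_of_connected {t : NiceTree n} {x : Fin n}
    (hc : (t.treeGraph.induce {y | x ∈ t.bagAt y}).Connected) : x ∈ t.verts := by
  obtain ⟨⟨y, hy⟩⟩ := hc.nonempty
  exact mem_verts_of_subtree t (p := y.1) (t' := (t.subtree y.1).get y.2) (by simp) hy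

/-! ## Connectivity within the two sides of a cut -/

/-- Adjacency by an introduced edge that does not cross the cut. -/
def SideAdj (t : NiceTree n) (S : Finset (Fin n)) (x y : Fin n) : Prop :=
  s(x, y) ∈ t.introducedEdges ∧ (x ∈ S ↔ y ∈ S)

/-- Connectivity by introduced edges that do not cross the cut. -/
def Conn (t : NiceTree n) (S : Finset (Fin n)) : Fin n → Fin n → Prop :=
  Relation.EqvGen (t.SideAdj S)

/-- One forgotten vertex for each component that contains no vertex of the bag. -/
noncomputable def closers (S : Finset (Fin n)) : NiceTree n → Finset (Fin n)
  | leaf => ∅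
  | introVertex _ t => t.closers S
  | introEdge _ _ t => t.closers S
  | forget v t => open Classical in
      if ∃ w ∈ t.bag.erase v, t.Conn S v w then t.closers S else insert v (t.closers S)
  | join a b => a.closers S ∪ b.closers S

end NiceTree

/-! ### Generated equivalences across a separator -/

theorem eqvGen_invariant {α β : Type*} {E : α → α → Prop} {f : α → β}
    (hf : ∀ x y, E x y → f x = f y) {x y : α} (h : Relation.EqvGen E x y) : f x = f y := by
  induction h with
  | rel x y h => exact hf x y h
  | refl => rfl
  | symm x y _ ih => exact ih.symm
  | trans x y z _ _ h₁ h₂ => exact h₁.trans h₂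

theorem eqvGen_mem {α : Type*} {E : α → α → Prop} {A : Set α}
    (hE : ∀ x y, E x y → x ∈ A ∧ y ∈ A) {x y : α} (h : Relation.EqvGen E x y) :
    x = y ∨ (x ∈ A ∧ y ∈ A) := by
  induction h with
  | rel x y h => exact .inr (hE x y h)
  | refl => exact .inl rfl
  | symm x y _ ih => exact ih.imp Eq.symm And.symm
  | trans x y z _ _ h₁ h₂ =>
      rcases h₁ with rfl | h₁
      · exact h₂
      · rcases h₂ with rfl | h₂
        · exact .inr h₁
        · exact .inr ⟨h₁.1, h₂.2⟩

/-- A labelling of a separator `D` that respects connectivity on both sides respects connectivity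
in the union. -/
theorem label_eq_of_eqvGen_union {α : Type*} {E E₁ E₂ : α → α → Prop} {A₁ A₂ D : Set α}
    (hE : ∀ x y, E x y → E₁ x y ∨ E₂ x y) (h₁ : ∀ x y, E₁ x y → x ∈ A₁ ∧ y ∈ A₁)
    (h₂ : ∀ x y, E₂ x y → x ∈ A₂ ∧ y ∈ A₂) (hD : ∀ x ∈ A₁, x ∈ A₂ → x ∈ D) {f : α → ℕ}
    (hf₁ : ∀ x ∈ D, ∀ y ∈ D, Relation.EqvGen E₁ x y → f x = f y)
    (hf₂ : ∀ x ∈ D, ∀ y ∈ D, Relation.EqvGen E₂ x y → f x = f y) {x y : α} (hx : x ∈ D)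
    (hy : y ∈ D) (h : Relation.EqvGen E x y) : f x = f y := by
  -- `g x` collects the labels of the separator points that `x` reaches inside a single part. It is
  -- constant along each generator: a point of one part that is connected within the other part to a
  -- point of `D` lies in `D` itself. For a point of `D` the set contains its own label and no
  -- other.
  let g : α → Set ℕ := fun x =>
    {k | ∃ u ∈ D, (Relation.EqvGen E₁ x u ∨ Relation.EqvGen E₂ x u) ∧ f u = k}
  have sub₁ : ∀ x y, x ∈ A₁ → Relation.EqvGen E₁ x y → g x ⊆ g y := by
    rintro x y hxA hxy _ ⟨u, hu, hxu | hxu, rfl⟩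
    · exact ⟨u, hu, .inl (hxy.symm.trans _ _ _ hxu), rfl⟩
    · have hxD : x ∈ D := by
        rcases eqvGen_mem h₂ hxu with rfl | h
        · exact hu
        · exact hD x hxA h.1
      exact ⟨x, hxD, .inl hxy.symm, hf₂ x hxD u hu hxu⟩
  have sub₂ : ∀ x y, x ∈ A₂ → Relation.EqvGen E₂ x y → g x ⊆ g y := by
    rintro x y hxA hxy _ ⟨u, hu, hxu | hxu, rfl⟩
    · have hxD : x ∈ D := by
        rcases eqvGen_mem h₁ hxu with rfl | h
        · exact hu
        · exact hD x h.1 hxA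
      exact ⟨x, hxD, .inr hxy.symm, hf₁ x hxD u hu hxu⟩
    · exact ⟨u, hu, .inr (hxy.symm.trans _ _ _ hxu), rfl⟩
  have hg : g x = g y := by
    refine eqvGen_invariant (E := E) (fun x y hxy => ?_) h
    rcases hE x y hxy with e | e
    · have e' := Relation.EqvGen.rel _ _ e
      exact (sub₁ x y (h₁ x y e).1 e').antisymm (sub₁ y x (h₁ x y e).2 e'.symm)
    · have e' := Relation.EqvGen.rel _ _ e
      exact (sub₂ x y (h₂ x y e).1 e').antisymm (sub₂ y x (h₂ x y e).2 e'.symm)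
  have : f x ∈ g y := hg ▸ ⟨x, hx, .inl (.refl x), rfl⟩
  obtain ⟨u, hu, hyu, hfu⟩ := this
  rw [← hfu]
  rcases hyu with hyu | hyu
  · exact (hf₁ y hy u hu hyu).symm
  · exact (hf₂ y hy u hu hyu).symm

/-- A component that avoids the separator `D` does not grow in the union. -/
theorem eqvGen_of_eqvGen_union {α : Type*} {E E₁ E₂ : α → α → Prop} {A₁ A₂ D : Set α}
    (hE : ∀ x y, E x y → E₁ x y ∨ E₂ x y) (h₁ : ∀ x y, E₁ x y → x ∈ A₁ ∧ y ∈ A₁)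
    (h₂ : ∀ x y, E₂ x y → x ∈ A₂ ∧ y ∈ A₂) (hD : ∀ x ∈ A₁, x ∈ A₂ → x ∈ D) {c y : α}
    (hcA : c ∈ A₁) (hc : ∀ u ∈ D, ¬ Relation.EqvGen E₁ c u) (h : Relation.EqvGen E c y) :
    Relation.EqvGen E₁ c y := by
  -- Being `E₁`-equivalent to `c` is constant along all generators: an `E₂`-edge lies in `A₂`, and a
  -- point of `A₂` reached from `c` would belong to `D`.
  have key : (Relation.EqvGen E₁ c c) = (Relation.EqvGen E₁ c y) := by
    refine eqvGen_invariant (E := E) (f := fun z => Relation.EqvGen E₁ c z) (fun x y hxy => ?_) h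
    rcases hE x y hxy with e | e
    · exact propext ⟨fun h => h.trans _ _ _ (.rel _ _ e), fun h => h.trans _ _ _ (.symm _ _ (.rel _ _ e))⟩
    · have hn : ∀ z ∈ A₂, ¬ Relation.EqvGen E₁ c z := by
        intro z hz hcz
        refine hc z (hD z ?_ hz) hcz
        rcases eqvGen_mem h₁ hcz with rfl | h
        · exact hcA
        · exact h.2
      exact propext ⟨fun h => absurd h (hn x (h₂ x y e).1), fun h => absurd h (hn y (h₂ x y e).2)⟩
  exact key ▸ .refl c

namespace NiceTree

variable {n : ℕ} {S : Finset (Fin n)}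

theorem SideAdj.mem_verts {t : NiceTree n} (h : t.LocallyNice) :
    ∀ x y, t.SideAdj S x y → x ∈ (t.verts : Set (Fin n)) ∧ y ∈ (t.verts : Set (Fin n)) :=
  fun _ _ hxy => mem_verts_of_introducedEdges h hxy.1

theorem Conn.side {t : NiceTree n} {x y : Fin n} (h : t.Conn S x y) : x ∈ S ↔ y ∈ S :=
  iff_of_eq (eqvGen_invariant (f := fun z => z ∈ S) (fun _ _ h => propext h.2) h)

theorem sideAdj_join (a b : NiceTree n) (x y : Fin n) :
    (join a b).SideAdj S x y ↔ a.SideAdj S x y ∨ b.SideAdj S x y := by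
  simp only [SideAdj, introducedEdges, List.mem_append]; tauto

/-- The adjacency added by an introduced edge. -/
def NewAdj (S : Finset (Fin n)) (u v x y : Fin n) : Prop :=
  s(x, y) = s(u, v) ∧ (x ∈ S ↔ y ∈ S)

theorem sideAdj_introEdge (u v : Fin n) (t : NiceTree n) (x y : Fin n) :
    (introEdge u v t).SideAdj S x y ↔ t.SideAdj S x y ∨ NewAdj S u v x y := by
  simp only [SideAdj, NewAdj, introducedEdges, List.mem_cons]; tauto

theorem NewAdj.mem {u v : Fin n} {D : Finset (Fin n)} (hu : u ∈ D) (hv : v ∈ D) :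
    ∀ x y, NewAdj S u v x y → x ∈ (D : Set (Fin n)) ∧ y ∈ (D : Set (Fin n)) := by
  rintro x y ⟨h, _⟩
  rcases Sym2.eq_iff.1 h with ⟨rfl, rfl⟩ | ⟨rfl, rfl⟩ <;> simp [hu, hv]

theorem eqvGen_newAdj {u v : Fin n} {β : Type*} {f : Fin n → β}
    (hf : (u ∈ S ↔ v ∈ S) → f u = f v) {x y : Fin n}
    (h : Relation.EqvGen (NewAdj S u v) x y) : f x = f y := by
  refine eqvGen_invariant (fun x y hxy => ?_) h
  rcases Sym2.eq_iff.1 hxy.1 with ⟨rfl, rfl⟩ | ⟨rfl, rfl⟩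
  · exact hf hxy.2
  · exact (hf hxy.2.symm).symm

theorem conn_join_left {a b : NiceTree n} {x y : Fin n} (h : a.Conn S x y) :
    (join a b).Conn S x y :=
  Relation.EqvGen.mono (fun _ _ h => (sideAdj_join a b _ _).2 (.inl h)) _ _ h

theorem conn_join_right {a b : NiceTree n} {x y : Fin n} (h : b.Conn S x y) :
    (join a b).Conn S x y :=
  Relation.EqvGen.mono (fun _ _ h => (sideAdj_join a b _ _).2 (.inr h)) _ _ h

theorem conn_introEdge {u v : Fin n} {t : NiceTree n} {x y : Fin n} (h : t.Conn S x y) :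
    (introEdge u v t).Conn S x y :=
  Relation.EqvGen.mono (fun _ _ h => (sideAdj_introEdge u v t _ _).2 (.inl h)) _ _ h

/-- The closers represent the components without vertices in the bag. -/
structure ClosersSpec (t : NiceTree n) (S : Finset (Fin n)) : Prop where
  mem : ∀ c ∈ t.closers S, c ∈ t.verts
  notMem : ∀ c ∈ t.closers S, c ∉ t.bag
  bag : ∀ c ∈ t.closers S, ∀ u ∈ t.bag, ¬ t.Conn S c u
  eq : ∀ c ∈ t.closers S, ∀ c' ∈ t.closers S, t.Conn S c c' → c = c'
  cover : ∀ x ∈ t.verts, ∃ c, (c ∈ t.bag ∨ c ∈ t.closers S) ∧ t.Conn S x c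

/-- A component loses its last bag vertex at one moment only, when that vertex is forgotten without
a mate in the bag, and the vertex then represents it. Later edges lie in the bag or beyond the
separator, so represented components neither grow nor unite. -/
theorem closersSpec (S : Finset (Fin n)) {t : NiceTree n} (hl : t.LocallyNice)
    (hc : t.Consistent) : t.ClosersSpec S := by
  induction t with
  | leaf => constructor <;> simp [closers, verts]
  | introVertex v t ih =>
      have ih := ih hl.2 hc.2
      have hne : ∀ c ∈ t.closers S, c ≠ v := fun c h h' => hc.1 (h' ▸ ih.mem c h)
      refine ⟨fun c h => Finset.mem_insert_of_mem (ih.mem c h), fun c h => ?_, fun c h u hu => ?_,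
        ih.eq, fun x hx => ?_⟩
      · simp only [NiceTree.bag, Finset.mem_insert, not_or]
        exact ⟨hne c h, ih.notMem c h⟩
      · simp only [NiceTree.bag, Finset.mem_insert] at hu
        rcases hu with rfl | hu
        · intro hcu
          rcases eqvGen_mem (SideAdj.mem_verts hl.2) hcu with e | e
          · exact hne c h e
          · exact hc.1 e.2
        · exact ih.bag c h u hu
      · simp only [verts, Finset.mem_insert] at hx
        rcases hx with rfl | hx
        · exact ⟨x, .inl (by simp [NiceTree.bag]), .refl x⟩
        · obtain ⟨c, h, h'⟩ := ih.cover x hx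
          exact ⟨c, h.imp (fun h => Finset.mem_insert_of_mem h) id, h'⟩
  | introEdge u v t ih =>
      have ih := ih hl.2.2 hc
      -- Both ends of the new edge are in the bag, which serves as separator; a component that
      -- avoids the bag does not notice it.
      have grow : ∀ c ∈ t.closers S, ∀ y, (introEdge u v t).Conn S c y → t.Conn S c y := by
        intro c h y hy
        exact eqvGen_of_eqvGen_union (fun x y => (sideAdj_introEdge u v t x y).1)
          (SideAdj.mem_verts hl.2.2) (NewAdj.mem hl.1 hl.2.1) (fun x _ hx => hx) (ih.mem c h)
          (ih.bag c h) hy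
      refine ⟨ih.mem, ih.notMem, fun c h w hw hcw => ih.bag c h w hw (grow c h w hcw),
        fun c h c' h' hcc => ih.eq c h c' h' (grow c h c' hcc), fun x hx => ?_⟩
      obtain ⟨c, h, h'⟩ := ih.cover x hx
      exact ⟨c, h, conn_introEdge h'⟩
  | forget v t ih =>
      have ih := ih hl.2 hc
      by_cases hm : ∃ w ∈ t.bag.erase v, t.Conn S v w
      · have hcl : (forget v t).closers S = t.closers S := by simp only [closers, if_pos hm]
        refine ⟨by rw [hcl]; exact ih.mem, by
            rw [hcl]; exact fun c h h' => ih.notMem c h (Finset.mem_of_mem_erase h'), by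
            rw [hcl]; exact fun c h u hu => ih.bag c h u (Finset.mem_of_mem_erase hu), by
            rw [hcl]; exact ih.eq, fun x hx => ?_⟩
        obtain ⟨c, h, h'⟩ := ih.cover x hx
        rw [hcl]
        by_cases hcv : c = v
        · obtain ⟨w, hw, hvw⟩ := hm
          subst hcv
          exact ⟨w, .inl hw, h'.trans _ _ _ hvw⟩
        · exact ⟨c, h.imp (fun h => Finset.mem_erase.2 ⟨hcv, h⟩) id, h'⟩
      · have hcl : (forget v t).closers S = insert v (t.closers S) := by
          simp only [closers, if_neg hm]
        have hm' : ∀ w ∈ t.bag.erase v, ¬ t.Conn S v w := fun w hw h => hm ⟨w, hw, h⟩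
        constructor
        · rw [hcl]; intro c h
          rcases Finset.mem_insert.1 h with rfl | h
          · exact t.bag_subset_verts hl.1
          · exact ih.mem c h
        · rw [hcl]; intro c h
          rcases Finset.mem_insert.1 h with rfl | h
          · simp [NiceTree.bag]
          · exact fun h' => ih.notMem c h (Finset.mem_of_mem_erase h')
        · rw [hcl]; intro c h u hu
          rcases Finset.mem_insert.1 h with rfl | h
          · exact hm' u hu
          · exact ih.bag c h u (Finset.mem_of_mem_erase hu)
        · rw [hcl]; intro c h c' h' hcc
          rcases Finset.mem_insert.1 h with rfl | h
          · rcases Finset.mem_insert.1 h' with rfl | h'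
            · rfl
            · exact absurd hcc.symm (ih.bag c' h' _ hl.1)
          · rcases Finset.mem_insert.1 h' with rfl | h'
            · exact absurd hcc (ih.bag c ‹_› _ hl.1)
            · exact ih.eq c h c' h' hcc
        · rw [hcl]; intro x hx
          obtain ⟨c, h, h'⟩ := ih.cover x hx
          refine ⟨c, ?_, h'⟩
          by_cases hcv : c = v
          · exact .inr (by simp [hcv])
          · exact h.imp (fun h => Finset.mem_erase.2 ⟨hcv, h⟩) (Finset.mem_insert_of_mem)
  | join a b iha ihb =>
      have iha := iha hl.2.1 hc.2.1
      have ihb := ihb hl.2.2 hc.2.2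
      have hab := hl.1
      have growa : ∀ c ∈ a.closers S, ∀ y, (join a b).Conn S c y → a.Conn S c y := by
        intro c h y hy
        exact eqvGen_of_eqvGen_union (fun x y => (sideAdj_join a b x y).1)
          (SideAdj.mem_verts hl.2.1) (SideAdj.mem_verts hl.2.2) (D := (a.bag : Set (Fin n))) hc.1
          (iha.mem c h) (iha.bag c h) hy
      have growb : ∀ c ∈ b.closers S, ∀ y, (join a b).Conn S c y → b.Conn S c y := by
        intro c h y hy
        exact eqvGen_of_eqvGen_union (fun x y h => ((sideAdj_join a b x y).1 h).symm)
          (SideAdj.mem_verts hl.2.2) (SideAdj.mem_verts hl.2.1) (D := (b.bag : Set (Fin n)))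
          (fun x h h' => hab ▸ hc.1 x h' h) (ihb.mem c h) (ihb.bag c h) hy
      -- A connection between the two would place `c'` below both children, hence in the common bag,
      -- which contains no closers.
      have disj : ∀ c ∈ a.closers S, ∀ c' ∈ b.closers S, ¬ (join a b).Conn S c c' := by
        intro c h c' h' hcc
        have h1 : c' ∈ a.verts := by
          rcases eqvGen_mem (SideAdj.mem_verts hl.2.1) (growa c h c' hcc) with e | e
          · exact e ▸ iha.mem c h
          · exact e.2
        exact ihb.notMem c' h' (hab ▸ hc.1 c' h1 (ihb.mem c' h'))
      constructor
      · intro c h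
        rcases Finset.mem_union.1 h with h | h
        · exact Finset.mem_union_left _ (iha.mem c h)
        · exact Finset.mem_union_right _ (ihb.mem c h)
      · intro c h
        rcases Finset.mem_union.1 h with h | h
        · exact iha.notMem c h
        · change c ∉ a.bag
          rw [hab]; exact ihb.notMem c h
      · intro c h u hu hcu
        rcases Finset.mem_union.1 h with h | h
        · exact iha.bag c h u hu (growa c h u hcu)
        · exact ihb.bag c h u (hab ▸ hu) (growb c h u hcu)
      · intro c h c' h' hcc
        rcases Finset.mem_union.1 h with h | h
        · rcases Finset.mem_union.1 h' with h' | h'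
          · exact iha.eq c h c' h' (growa c h c' hcc)
          · exact absurd hcc (disj c h c' h')
        · rcases Finset.mem_union.1 h' with h' | h'
          · exact absurd hcc.symm (disj c' h' c h)
          · exact ihb.eq c h c' h' (growb c h c' hcc)
      · intro x hx
        rcases Finset.mem_union.1 hx with hx | hx
        · obtain ⟨c, h, h'⟩ := iha.cover x hx
          exact ⟨c, h.imp id (Finset.mem_union_left _), conn_join_left h'⟩
        · obtain ⟨c, h, h'⟩ := ihb.cover x hx
          exact ⟨c, h.imp (fun h => (hab ▸ h : c ∈ a.bag)) (Finset.mem_union_right _),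
            conn_join_right h'⟩

/-- A common element would occur below both children, hence in the bag. This is why the counters of
completed components add up at a join. -/
theorem disjoint_closers {a b : NiceTree n} (hl : (join a b).LocallyNice)
    (hc : (join a b).Consistent) : Disjoint (a.closers S) (b.closers S) := by
  have ha := closersSpec S hl.2.1 hc.2.1
  have hb := closersSpec S hl.2.2 hc.2.2
  rw [Finset.disjoint_left]
  intro c h h'
  exact ha.notMem c h (hc.1 c (ha.mem c h) (hb.mem c h'))

end NiceTree

/-! ## Signatures of partial solutions

The signature of a partial solution `S` at a node is a function `X`: a slot `j < b` that is occupied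
by a vertex of the bag holds a positive label, which is odd if the vertex belongs to `S`, and two
labels agree if the vertices are connected by the edges seen so far that do not cross the cut.
`X b` and `X (b + 1)` count the components of `S` and of its complement that are complete. -/

/-- `k` rounds of an iteration. -/
def iter {α : Type*} (f : ℕ → α → α) : ℕ → α → α
  | 0, x => x
  | k + 1, x => f k (iter f k x)

theorem iter_induction {α : Type*} {f : ℕ → α → α} {x : α} (P : ℕ → α → Prop) (h0 : P 0 x)
    (m : ℕ) (hs : ∀ k < m, ∀ y, P k y → P (k + 1) (f k y)) : P m (iter f m x) := by
  induction m with
  | zero => exact h0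
  | succ m ih => exact hs m (by omega) _ (ih fun k hk => hs k (by omega))

/-- Replace the label `a` by `e`. -/
def renumber (b : ℕ) (X : ℕ → ℕ) (a e : ℕ) : ℕ → ℕ :=
  fun j => if j < b ∧ X j = a then e else X j

/-- Unite two labels of `X` if they belong to slots with equal labels in `Y`. -/
def mergeStep (b : ℕ) (Y : ℕ → ℕ) (p q : ℕ) (X : ℕ → ℕ) : ℕ → ℕ :=
  if Y p = Y q then renumber b X (X p) (X q) else X

/-- The common coarsening of the partitions given by `X` and `Y`. -/
def merge (b : ℕ) (Y X : ℕ → ℕ) : ℕ → ℕ :=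
  iter (fun p => iter (mergeStep b Y p) b) b X

/-- The parameters of the algorithm: the number of slots, whether the complement must be connected,
whether `s` and `t` must be separated, and the slots of the vertices. -/
structure Ctx : Type where
  b : ℕ
  conn : ℕ
  st : ℕ
  s : ℕ
  t : ℕ
  slot : ℕ → ℕ

namespace Ctx

variable (C : Ctx)

open Classical in
/-- The signature after a vertex in slot `p` has been forgotten. -/
noncomputable def forgetOut (p : ℕ) (X : ℕ → ℕ) : ℕ → ℕ :=
  if ∃ j < C.b, Function.update X p 0 j = X p then Function.update X p 0
  -- Labels inside `S` are odd, so a completed component is counted in cell `b` if it is inside and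
  -- in cell `b + 1` if it is outside.
  else Function.update (Function.update X p 0) (C.b + 1 - X p % 2)
    (Function.update X p 0 (C.b + 1 - X p % 2) + 1)

def joinOut (X Y : ℕ → ℕ) : ℕ → ℕ :=
  Function.update (Function.update (merge C.b Y X) C.b (merge C.b Y X C.b + Y C.b)) (C.b + 1)
    (merge C.b Y X (C.b + 1) + Y (C.b + 1))

/-- The new signature, before the counters are checked. -/
noncomputable def preOut (ty u v : ℕ) (X Y : ℕ → ℕ) : ℕ → ℕ :=
  if ty = 0 then fun _ => 0
  -- At an introduce-vertex node the second code is a guess: its digit zero is the label of the new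
  -- vertex.
  else if ty = 1 then Function.update X (C.slot u) (Y 0)
  else if ty = 2 then
    if X (C.slot u) % 2 = X (C.slot v) % 2 then
      renumber C.b X (X (C.slot u)) (X (C.slot v)) else X
  else if ty = 3 then C.forgetOut (C.slot u) X
  else C.joinOut X Y

/-- Whether signatures can be combined, before the counters are checked. -/
def preOk (ty u : ℕ) (X Y : ℕ → ℕ) : Prop :=
  if ty = 0 then True
  else if ty = 1 then Y 0 ≠ 0 ∧ (∀ j < C.b, X j ≠ Y 0) ∧
    (C.st ≠ 0 → (u = C.s → Y 0 % 2 = 1) ∧ (u = C.t → Y 0 % 2 ≠ 1))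
  else if ty = 2 then True
  else if ty = 3 then True
  else ∀ j < C.b, X j % 2 = Y j % 2

/-- The number of new edges of the cut. -/
def stepGain (ty u v : ℕ) (X : ℕ → ℕ) : ℕ :=
  if ty = 2 then if X (C.slot u) % 2 = X (C.slot v) % 2 then 0 else 1 else 0

/-- The outer counter is capped at one. Unless the complement must be connected, it matters only
whether this counter is zero, and the cap keeps it a digit. The inner counter needs no cap, since
`stepOk` rejects values above one. -/
noncomputable def stepOut (ty u v : ℕ) (X Y : ℕ → ℕ) : ℕ → ℕ :=
  Function.update (C.preOut ty u v X Y) (C.b + 1) (min 1 (C.preOut ty u v X Y (C.b + 1)))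

def stepOk (ty u v : ℕ) (X Y : ℕ → ℕ) : Prop :=
  C.preOk ty u X Y ∧ C.preOut ty u v X Y C.b ≤ 1 ∧
    (C.conn ≠ 0 → C.preOut ty u v X Y (C.b + 1) ≤ 1)

/-- `X` consists of `b + 2` digits in base `2 * b + 1`. -/
def IsCode (X : ℕ → ℕ) : Prop := (∀ j, X j < 2 * C.b + 1) ∧ ∀ j, C.b + 2 ≤ j → X j = 0

/-- `X` is a signature, and `w` the number of edges in the cut, of the partial solution `S`. -/
def Deriv {n : ℕ} : NiceTree n → (ℕ → ℕ) → ℕ → Finset (Fin n) → Prop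
  | .leaf, X, w, _ => X = (fun _ => 0) ∧ w = 0
  | .introVertex v t, X, w, S => ∃ X₁ Y w₁, Deriv t X₁ w₁ S ∧ C.IsCode Y ∧ C.stepOk 1 v 0 X₁ Y ∧
      X = C.stepOut 1 v 0 X₁ Y ∧ w = w₁ + C.stepGain 1 v 0 X₁ ∧ (Y 0 % 2 = 1 ↔ v ∈ S)
  | .introEdge u v t, X, w, S => ∃ X₁ Y w₁, Deriv t X₁ w₁ S ∧ C.IsCode Y ∧ C.stepOk 2 u v X₁ Y ∧
      X = C.stepOut 2 u v X₁ Y ∧ w = w₁ + C.stepGain 2 u v X₁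
  | .forget v t, X, w, S => ∃ X₁ Y w₁, Deriv t X₁ w₁ S ∧ C.IsCode Y ∧ C.stepOk 3 v 0 X₁ Y ∧
      X = C.stepOut 3 v 0 X₁ Y ∧ w = w₁ + C.stepGain 3 v 0 X₁
  | .join a b, X, w, S => ∃ X₁ X₂ w₁ w₂, Deriv a X₁ w₁ S ∧ Deriv b X₂ w₂ S ∧
      C.stepOk 4 0 0 X₁ X₂ ∧ X = C.stepOut 4 0 0 X₁ X₂ ∧ w = w₁ + w₂ + C.stepGain 4 0 0 X₁

end Ctx

/-! ### Renumbering -/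

section Renumber

variable {b : ℕ} {X Y : ℕ → ℕ}

theorem renumber_of_le {j : ℕ} (hj : b ≤ j) (a e : ℕ) : renumber b X a e j = X j := by
  simp [renumber, show ¬ j < b by omega]

theorem renumber_congr {i j a e : ℕ} (hi : i < b) (hj : j < b) (h : X i = X j) :
    renumber b X a e i = renumber b X a e j := by
  simp [renumber, hi, hj, h]

theorem renumber_self {p q : ℕ} (hp : p < b) (hq : q < b) :
    renumber b X (X p) (X q) p = renumber b X (X p) (X q) q := by
  simp [renumber, hp, hq]

theorem renumber_invariant {β : Type*} {h : ℕ → β} {p q : ℕ} (hpq : h (X p) = h (X q)) (j : ℕ) :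
    h (renumber b X (X p) (X q) j) = h (X j) := by
  unfold renumber
  split
  · next hj => rw [hj.2, hpq]
  · rfl

/-- Identifying two labels unites two classes, so the new partition is the finest one that contains
the old one and the pair `p`, `q`. Every equivalence `R` with both still contains it. -/
theorem renumber_kernel {R : ℕ → ℕ → Prop} (hR : Equivalence R) {p q : ℕ} (hp : p < b) (hq : q < b)
    (hpq : R p q) (hX : ∀ i < b, ∀ j < b, X i = X j → R i j) :
    ∀ i < b, ∀ j < b, renumber b X (X p) (X q) i = renumber b X (X p) (X q) j → R i j := by
  intro i hi j hj h
  simp only [renumber, hi, hj, true_and] at h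
  split_ifs at h with h₁ h₂ h₂
  · exact hX i hi j hj (h₁.trans h₂.symm)
  · exact hR.trans (hR.trans (hX i hi p hp h₁) hpq) (hX q hq j hj h)
  · exact hR.trans (hX i hi q hq h) (hR.trans (hR.symm hpq) (hX p hp j hj h₂.symm))
  · exact hX i hi j hj h

theorem merge_induction {P : (ℕ → ℕ) → Prop} (h0 : P X)
    (hs : ∀ Z, ∀ p < b, ∀ q < b, Y p = Y q → P Z → P (renumber b Z (Z p) (Z q))) :
    P (merge b Y X) := by
  refine iter_induction (fun _ => P) h0 b fun p hp Z hZ => ?_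
  refine iter_induction (fun _ => P) hZ b fun q hq Z hZ => ?_
  unfold mergeStep
  split
  · next h => exact hs Z p hp q hq h hZ
  · exact hZ

theorem merge_of_le {j : ℕ} (hj : b ≤ j) : merge b Y X j = X j :=
  merge_induction (P := fun Z => Z j = X j) rfl fun Z p _ q _ _ h => by
    rw [renumber_of_le hj, h]

theorem merge_invariant {β : Type*} {h : ℕ → β}
    (hX : ∀ p < b, ∀ q < b, Y p = Y q → h (X p) = h (X q)) (j : ℕ) :
    h (merge b Y X j) = h (X j) := by
  refine merge_induction (P := fun Z => ∀ j, h (Z j) = h (X j)) (fun _ => rfl)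
    (fun Z p hp q hq hpq hZ j => ?_) j
  exact (renumber_invariant (h := h) (by rw [hZ, hZ, hX p hp q hq hpq]) j).trans (hZ j)

theorem merge_lt {m : ℕ} (hX : ∀ j, X j < m) (j : ℕ) : merge b Y X j < m := by
  refine merge_induction (P := fun Z => ∀ j, Z j < m) hX (fun Z p _ q _ _ hZ j => ?_) j
  unfold renumber
  split
  · exact hZ q
  · exact hZ j

/-- This is the minimality of the common coarsening: no two slots are united without a chain of
equalities in `X` and in `Y`. The two congruence lemmas that follow give the other inclusion. -/
theorem merge_kernel {R : ℕ → ℕ → Prop} (hR : Equivalence R)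
    (hX : ∀ i < b, ∀ j < b, X i = X j → R i j) (hY : ∀ i < b, ∀ j < b, Y i = Y j → R i j) :
    ∀ i < b, ∀ j < b, merge b Y X i = merge b Y X j → R i j :=
  merge_induction (P := fun Z => ∀ i < b, ∀ j < b, Z i = Z j → R i j) hX
    fun _ p hp q hq hpq hZ => renumber_kernel hR hp hq (hY p hp q hq hpq) hZ

theorem merge_congr_left {i j : ℕ} (hi : i < b) (hj : j < b) (h : X i = X j) :
    merge b Y X i = merge b Y X j :=
  merge_induction (P := fun Z => Z i = Z j) h fun _ _ _ _ _ _ hZ => renumber_congr hi hj hZ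

theorem mergeStep_congr {p q i j : ℕ} (hi : i < b) (hj : j < b) (h : X i = X j) :
    mergeStep b Y p q X i = mergeStep b Y p q X j := by
  unfold mergeStep
  split
  · exact renumber_congr hi hj h
  · exact h

/-- The double loop comes to the pair `i`, `j` at some time and makes the two labels equal. Later
renumberings treat equal labels alike and never separate them. -/
theorem merge_congr_right {i j : ℕ} (hi : i < b) (hj : j < b) (h : Y i = Y j) :
    merge b Y X i = merge b Y X j := by
  refine iter_induction (f := fun p => iter (mergeStep b Y p) b) (x := X)
    (fun k (Z : ℕ → ℕ) => i < k → Z i = Z j) (by simp) b (fun p hp Z hZ => ?_) hi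
  intro hip
  by_cases hip' : i < p
  · exact iter_induction (fun _ (Z : ℕ → ℕ) => Z i = Z j) (hZ hip') b
      fun _ _ _ h => mergeStep_congr hi hj h
  · have : p = i := by omega
    subst this
    refine iter_induction (fun k (Z : ℕ → ℕ) => j < k → Z p = Z j) (by simp) b (fun q hq Z hZ hjq => ?_) hj
    by_cases hjq' : j < q
    · exact mergeStep_congr hi hj (hZ hjq')
    · have : q = j := by omega
      subst this
      simp only [mergeStep, h, if_true]
      exact renumber_self hi hj

end Renumber

/-! ### Slots -/

/-- The vertices of `D` have different slots below `b`. -/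
def GoodOn {n : ℕ} (slot : ℕ → ℕ) (b : ℕ) (D : Finset (Fin n)) : Prop :=
  (∀ x ∈ D, slot x < b) ∧ ∀ x ∈ D, ∀ y ∈ D, slot x = slot y → x = y

/-- In every bag, the vertices have different slots. -/
def SlotGood {n : ℕ} (slot : ℕ → ℕ) (b : ℕ) : NiceTree n → Prop
  | .leaf => True
  | .introVertex v t => GoodOn slot b (insert v t.bag) ∧ SlotGood slot b t
  | .introEdge _ _ t => SlotGood slot b t
  | .forget _ t => SlotGood slot b t
  | .join a c => SlotGood slot b a ∧ SlotGood slot b c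

theorem GoodOn.mono {n : ℕ} {slot : ℕ → ℕ} {b : ℕ} {D D' : Finset (Fin n)}
    (h : GoodOn slot b D) (hD : D' ⊆ D) : GoodOn slot b D' :=
  ⟨fun x hx => h.1 x (hD hx), fun x hx y hy => h.2 x (hD hx) y (hD hy)⟩

theorem SlotGood.bag {n : ℕ} {slot : ℕ → ℕ} {b : ℕ} {t : NiceTree n} (h : SlotGood slot b t) :
    GoodOn slot b t.bag := by
  induction t with
  | leaf => simp [GoodOn, NiceTree.bag]
  | introVertex v t ih => exact h.1
  | introEdge u v t ih => exact ih h
  | forget v t ih => exact (ih h).mono (Finset.erase_subset _ _)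
  | join a c iha ihb => exact iha h.1

theorem GoodOn.congr {n : ℕ} {slot slot' : ℕ → ℕ} {b : ℕ} {D : Finset (Fin n)}
    (h : GoodOn slot b D) (hs : ∀ x ∈ D, slot' x = slot x) : GoodOn slot' b D :=
  ⟨fun x hx => hs x hx ▸ h.1 x hx, fun x hx y hy hxy => h.2 x hx y hy (by
    rw [← hs x hx, ← hs y hy, hxy])⟩

theorem SlotGood.congr {n : ℕ} {slot slot' : ℕ → ℕ} {b : ℕ} {t : NiceTree n}
    (h : SlotGood slot b t) (hs : ∀ x ∈ t.verts, slot' x = slot x) : SlotGood slot' b t := by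
  induction t with
  | leaf => trivial
  | introVertex v t ih =>
      refine ⟨h.1.congr fun x hx => hs x ?_, ih h.2 fun x hx => hs x (Finset.mem_insert_of_mem hx)⟩
      exact Finset.insert_subset_insert _ t.bag_subset_verts hx
  | introEdge u v t ih => exact ih h hs
  | forget v t ih => exact ih h hs
  | join a c iha ihb =>
      exact ⟨iha h.1 fun x hx => hs x (Finset.mem_union_left _ hx),
        ihb h.2 fun x hx => hs x (Finset.mem_union_right _ hx)⟩

/-! ### Signatures describe partial solutions -/

/-- The number of edges of the cut. -/
def NiceTree.cutCount {n : ℕ} (t : NiceTree n) (S : Finset (Fin n)) : ℕ :=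
  t.introducedEdges.countP fun e => decide (∃ u v, e = s(u, v) ∧ u ∈ S ∧ v ∉ S)

namespace Ctx

variable {n : ℕ} (C : Ctx)

/-- `X` describes the partial solution `S` at the root of `t`. -/
structure Describes (t : NiceTree n) (X : ℕ → ℕ) (w : ℕ) (S : Finset (Fin n)) : Prop where
  isCode : C.IsCode X
  empty : ∀ j < C.b, (∀ u ∈ t.bag, C.slot u ≠ j) → X j = 0
  pos : ∀ u ∈ t.bag, X (C.slot u) ≠ 0
  side : ∀ u ∈ t.bag, X (C.slot u) % 2 = 1 ↔ u ∈ S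
  label : ∀ u ∈ t.bag, ∀ v ∈ t.bag, X (C.slot u) = X (C.slot v) ↔ t.Conn S u v
  inner : X C.b = (t.closers S ∩ S).card
  inner_le : (t.closers S ∩ S).card ≤ 1
  outer : X (C.b + 1) = min 1 (t.closers S \ S).card
  outer_le : C.conn ≠ 0 → (t.closers S \ S).card ≤ 1
  value : w = t.cutCount S
  st : C.st ≠ 0 → ∀ v ∈ t.verts, ((v : ℕ) = C.s → v ∈ S) ∧ ((v : ℕ) = C.t → v ∉ S)

theorem forgetOut_lt {p : ℕ} {X : ℕ → ℕ} {m : ℕ} (hX : ∀ j, X j < m) {j : ℕ} (hj : j < C.b) :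
    C.forgetOut p X j < m := by
  have h0 : 0 < m := (Nat.zero_le _).trans_lt (hX 0)
  unfold forgetOut
  have : j ≠ C.b + 1 - X p % 2 := by omega
  split <;> simp only [Function.update_apply, this, if_false] <;> split <;> simp_all

/-- Labels are only copied from `X` and `Y`, so they stay below the base. Only the two counters can
grow; the first is bounded by the acceptance condition and the second by the cap. -/
theorem stepOut_isCode (hb : 1 ≤ C.b) {ty u v : ℕ} {X Y : ℕ → ℕ} (hX : C.IsCode X)
    (hY : C.IsCode Y) (hu : ty = 1 → C.slot u < C.b) (hok : C.stepOk ty u v X Y) :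
    C.IsCode (C.stepOut ty u v X Y) := by
  have main : (∀ j < C.b, C.preOut ty u v X Y j < 2 * C.b + 1) ∧
      ∀ j, C.b + 2 ≤ j → C.preOut ty u v X Y j = 0 := by
    unfold preOut
    split_ifs with h0 h1 h2 h3 h4
    · simp
    · refine ⟨fun j _ => ?_, fun j hj => ?_⟩
      · rw [Function.update_apply]; split
        · exact hY.1 0
        · exact hX.1 j
      · have := hu h1
        rw [Function.update_of_ne (by omega)]; exact hX.2 j hj
    · refine ⟨fun j _ => ?_, fun j hj => ?_⟩
      · unfold renumber; split
        · exact hX.1 _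
        · exact hX.1 j
      · rw [renumber_of_le (by omega)]; exact hX.2 j hj
    · exact ⟨fun j _ => hX.1 j, hX.2⟩
    · refine ⟨fun j hj => C.forgetOut_lt hX.1 hj, fun j hj => ?_⟩
      have : j ≠ C.b + 1 - X (C.slot u) % 2 := by omega
      unfold forgetOut
      split <;> simp [Function.update_apply, this, hX.2 j hj]
    · refine ⟨fun j hj => ?_, fun j hj => ?_⟩
      · simp only [joinOut, Function.update_apply, show j ≠ C.b + 1 by omega,
          show j ≠ C.b by omega, if_false]
        exact merge_lt hX.1 j
      · simp only [joinOut, Function.update_apply, show j ≠ C.b + 1 by omega,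
          show j ≠ C.b by omega, if_false]
        rw [merge_of_le (by omega)]; exact hX.2 j hj
  refine ⟨fun j => ?_, fun j hj => ?_⟩
  · unfold stepOut
    rw [Function.update_apply]
    split
    · omega
    · rcases lt_trichotomy j C.b with h | rfl | h
      · exact main.1 j h
      · have := hok.2.1; omega
      · rw [main.2 j (by omega)]; omega
  · unfold stepOut
    rw [Function.update_of_ne (by omega)]; exact main.2 j hj

end Ctx

namespace NiceTree

variable {n : ℕ} {S : Finset (Fin n)}

theorem cutCount_join (a b : NiceTree n) :
    (join a b).cutCount S = a.cutCount S + b.cutCount S := by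
  simp [cutCount, introducedEdges]

theorem cutCount_introEdge (u v : Fin n) (t : NiceTree n) :
    (introEdge u v t).cutCount S = t.cutCount S + if (u ∈ S ↔ v ∈ S) then 0 else 1 := by
  have : (∃ a b, s(u, v) = s(a, b) ∧ a ∈ S ∧ b ∉ S) ↔ ¬ (u ∈ S ↔ v ∈ S) := by
    constructor
    · rintro ⟨a, b, h, ha, hb⟩
      rcases Sym2.eq_iff.1 h with ⟨rfl, rfl⟩ | ⟨rfl, rfl⟩ <;> tauto
    · intro h
      by_cases hu : u ∈ S
      · exact ⟨u, v, rfl, hu, by tauto⟩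
      · exact ⟨v, u, Sym2.eq_swap, by tauto, hu⟩
  unfold cutCount
  rw [introducedEdges, List.countP_cons]
  congr 1
  simp only [decide_eq_true_eq, this]
  by_cases h : (u ∈ S ↔ v ∈ S) <;> simp only [h, not_true_eq_false, not_false_eq_true, if_true,
    if_false]

theorem card_closers_join_inter {a c : NiceTree n} (hl : (join a c).LocallyNice)
    (hc : (join a c).Consistent) : ((join a c).closers S ∩ S).card =
      (a.closers S ∩ S).card + (c.closers S ∩ S).card := by
  simp only [closers]
  rw [Finset.union_inter_distrib_right, Finset.card_union_of_disjoint]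
  exact (disjoint_closers hl hc).mono Finset.inter_subset_left Finset.inter_subset_left

theorem card_closers_join_sdiff {a c : NiceTree n} (hl : (join a c).LocallyNice)
    (hc : (join a c).Consistent) : ((join a c).closers S \ S).card =
      (a.closers S \ S).card + (c.closers S \ S).card := by
  simp only [closers]
  rw [Finset.union_sdiff_distrib, Finset.card_union_of_disjoint]
  exact (disjoint_closers hl hc).mono Finset.sdiff_subset Finset.sdiff_subset

end NiceTree

namespace Ctx

variable {n : ℕ} (C : Ctx) {S : Finset (Fin n)}

theorem stepOut_of_ne {ty u v : ℕ} {X Y : ℕ → ℕ} {j : ℕ} (hj : j ≠ C.b + 1) :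
    C.stepOut ty u v X Y j = C.preOut ty u v X Y j := Function.update_of_ne hj _ _

theorem stepOut_last {ty u v : ℕ} {X Y : ℕ → ℕ} :
    C.stepOut ty u v X Y (C.b + 1) = min 1 (C.preOut ty u v X Y (C.b + 1)) :=
  Function.update_self _ _ _

variable {C}

/-- The new vertex has not occurred below and no edge at it has been seen. It is therefore a
component of its own, and a label that differs from all others describes it. -/
theorem Describes.introVertex (hb : 1 ≤ C.b) {v : Fin n} {t : NiceTree n}
    (hl : (NiceTree.introVertex v t).LocallyNice) (hc : (NiceTree.introVertex v t).Consistent)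
    (hg : SlotGood C.slot C.b (.introVertex v t)) {X Y : ℕ → ℕ} {w : ℕ} (h : C.Describes t X w S)
    (hY : C.IsCode Y) (hok : C.stepOk 1 v 0 X Y) (hv : Y 0 % 2 = 1 ↔ v ∈ S) :
    C.Describes (.introVertex v t) (C.stepOut 1 v 0 X Y) (w + C.stepGain 1 v 0 X) S := by
  obtain ⟨hY0, hfresh, hst⟩ := hok.1
  have hvb : C.slot v < C.b := hg.1.1 v (by simp)
  have hpre : C.preOut 1 v 0 X Y = Function.update X (C.slot v) (Y 0) := by simp [preOut]
  have hne : ∀ u ∈ t.bag, C.slot u ≠ C.slot v := fun u hu h' => hl.1 (by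
    rw [← hg.1.2 u (by simp [hu]) v (by simp) h']; exact hu)
  have hub : ∀ u ∈ t.bag, C.slot u < C.b := fun u hu => hg.1.1 u (by simp [hu])
  have hXv : ∀ j < C.b, C.stepOut 1 v 0 X Y j = Function.update X (C.slot v) (Y 0) j :=
    fun j hj => by rw [C.stepOut_of_ne (by omega), hpre]
  have hXs : C.stepOut 1 v 0 X Y (C.slot v) = Y 0 := by rw [hXv _ hvb]; simp
  have hXu : ∀ u ∈ t.bag, C.stepOut 1 v 0 X Y (C.slot u) = X (C.slot u) := fun u hu => by
    rw [hXv _ (hub u hu), Function.update_of_ne (hne u hu)]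
  have hconn : ∀ x y, (NiceTree.introVertex v t).Conn S x y ↔ t.Conn S x y := fun _ _ => Iff.rfl
  have hvu : ∀ u ∈ t.bag, ¬ t.Conn S v u := by
    intro u hu hvu
    rcases eqvGen_mem (NiceTree.SideAdj.mem_verts hl.2) hvu with e | e
    · exact hl.1 (e ▸ hu)
    · exact hc.1 e.1
  refine ⟨C.stepOut_isCode hb h.isCode hY (fun _ => hvb) hok, ?_, ?_, ?_, ?_, ?_, h.inner_le, ?_,
    h.outer_le, ?_, ?_⟩
  · intro j hj hju
    simp only [NiceTree.bag, Finset.mem_insert, forall_eq_or_imp] at hju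
    rw [hXv j hj, Function.update_of_ne hju.1.symm]
    exact h.empty j hj hju.2
  · simp only [NiceTree.bag, Finset.mem_insert, forall_eq_or_imp, hXs]
    exact ⟨hY0, fun u hu => by rw [hXu u hu]; exact h.pos u hu⟩
  · simp only [NiceTree.bag, Finset.mem_insert, forall_eq_or_imp, hXs]
    exact ⟨hv, fun u hu => by rw [hXu u hu]; exact h.side u hu⟩
  · simp only [NiceTree.bag, Finset.mem_insert, forall_eq_or_imp, hXs, hconn, true_iff]
    refine ⟨⟨.refl v, fun u hu => ?_⟩, fun u hu => ⟨?_, fun u' hu' => ?_⟩⟩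
    · rw [hXu u hu]
      exact ⟨fun e => absurd e.symm (hfresh _ (hub u hu)), fun e => absurd e (hvu u hu)⟩
    · rw [hXu u hu]
      exact ⟨fun e => absurd e (hfresh _ (hub u hu)), fun e => absurd e.symm (hvu u hu)⟩
    · rw [hXu u hu, hXu u' hu']; exact h.label u hu u' hu'
  · rw [C.stepOut_of_ne (by omega), hpre, Function.update_of_ne (by omega)]; exact h.inner
  · rw [C.stepOut_last, hpre, Function.update_of_ne (by omega), h.outer]
    simp [NiceTree.closers]
  · simp only [stepGain]; exact h.value
  · intro hs u hu
    simp only [NiceTree.verts, Finset.mem_insert] at hu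
    rcases hu with rfl | hu
    · exact ⟨fun e => hv.1 ((hst hs).1 e), fun e h' => (hst hs).2 e (hv.2 h')⟩
    · exact h.st hs u hu

/-- An edge that crosses the cut raises the value and leaves connectivity alone. An edge inside a
side unites two label classes; that nothing else becomes connected within the bag is the separator
lemma, with the bag between the old edges and the new one. -/
theorem Describes.introEdge (hb : 1 ≤ C.b) {u v : Fin n} {t : NiceTree n}
    (hl : (NiceTree.introEdge u v t).LocallyNice)
    (hg : SlotGood C.slot C.b (.introEdge u v t)) {X Y : ℕ → ℕ} {w : ℕ} (h : C.Describes t X w S)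
    (hY : C.IsCode Y) (hok : C.stepOk 2 u v X Y) :
    C.Describes (.introEdge u v t) (C.stepOut 2 u v X Y) (w + C.stepGain 2 u v X) S := by
  obtain ⟨hu, hv, hl⟩ := hl
  have hg : SlotGood C.slot C.b t := hg
  have hub : ∀ x ∈ t.bag, C.slot x < C.b := hg.bag.1
  have hpar : X (C.slot u) % 2 = X (C.slot v) % 2 ↔ (u ∈ S ↔ v ∈ S) := by
    rw [← h.side u hu, ← h.side v hv]; omega
  set Z := C.preOut 2 u v X Y with hZ
  have hZdef : Z = if (u ∈ S ↔ v ∈ S) then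
      renumber C.b X (X (C.slot u)) (X (C.slot v)) else X := by
    simp [hZ, preOut, hpar]
  have hZle : ∀ j, C.b ≤ j → Z j = X j := by
    intro j hj
    rw [hZdef]; split
    · exact renumber_of_le hj _ _
    · rfl
  -- Whatever the two united labels have in common is the same for old and new labels in every slot.
  -- It is applied to vanishing and to parity.
  have hZinv : ∀ {β : Type} (f : ℕ → β), (X (C.slot u) % 2 = X (C.slot v) % 2 →
      f (X (C.slot u)) = f (X (C.slot v))) → ∀ j, f (Z j) = f (X j) := by
    intro β f hf j
    rw [hZdef]; split
    · next huv => exact renumber_invariant (hf (hpar.2 huv)) j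
    · rfl
  have hpos : ∀ j, (Z j = 0) = (X j = 0) := hZinv (fun k => k = 0) fun _ => by
    simp [h.pos u hu, h.pos v hv]
  have hside : ∀ j, Z j % 2 = X j % 2 := hZinv (fun k => k % 2) id
  have hs : ∀ j < C.b, C.stepOut 2 u v X Y j = Z j := fun j hj => C.stepOut_of_ne (by omega)
  have hnew : ∀ x ∈ t.bag, ∀ y ∈ t.bag, Z (C.slot x) = Z (C.slot y) →
      (NiceTree.introEdge u v t).Conn S x y := by
    intro x hx y hy hxy
    by_cases huv : (u ∈ S ↔ v ∈ S)
    · rw [hZdef, if_pos huv] at hxy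
      have huv' : (NiceTree.introEdge u v t).Conn S u v :=
        .rel _ _ ((NiceTree.sideAdj_introEdge u v t u v).2 (.inr ⟨rfl, huv⟩))
      have lab : ∀ x ∈ t.bag, ∀ y ∈ t.bag, X (C.slot x) = X (C.slot y) →
          (NiceTree.introEdge u v t).Conn S x y :=
        fun x hx y hy e => NiceTree.conn_introEdge ((h.label x hx y hy).1 e)
      simp only [renumber, hub x hx, hub y hy, true_and] at hxy
      split_ifs at hxy with h₁ h₂ h₂
      · exact lab x hx y hy (h₁.trans h₂.symm)
      · exact ((lab x hx u hu h₁).trans _ _ _ huv').trans _ _ _ (lab v hv y hy hxy)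
      · exact (lab x hx v hv hxy).trans _ _ _ (huv'.symm.trans _ _ _ (lab u hu y hy h₂.symm))
      · exact lab x hx y hy hxy
    · rw [hZdef, if_neg huv] at hxy
      exact NiceTree.conn_introEdge ((h.label x hx y hy).1 hxy)
  have hold : ∀ x ∈ t.bag, ∀ y ∈ t.bag, (NiceTree.introEdge u v t).Conn S x y →
      Z (C.slot x) = Z (C.slot y) := by
    intro x hx y hy hxy
    refine label_eq_of_eqvGen_union (f := fun x : Fin n => Z (C.slot x))
      (fun x y => (NiceTree.sideAdj_introEdge u v t x y).1)
      (NiceTree.SideAdj.mem_verts hl) (NiceTree.NewAdj.mem hu hv) (fun x _ hx => hx) ?_ ?_ hx hy hxy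
    · intro x hx y hy hxy
      have hX : X (C.slot x) = X (C.slot y) := (h.label x hx y hy).2 hxy
      change Z (C.slot x) = Z (C.slot y)
      rw [hZdef]; split
      · exact renumber_congr (hub x hx) (hub y hy) hX
      · exact hX
    · intro x hx y hy hxy
      refine NiceTree.eqvGen_newAdj (f := fun x : Fin n => Z (C.slot x)) (fun huv => ?_) hxy
      rw [hZdef, if_pos huv]
      exact renumber_self (hub u hu) (hub v hv)
  refine ⟨C.stepOut_isCode hb h.isCode hY (by simp) hok, ?_, ?_, ?_, ?_, ?_, h.inner_le, ?_,
    h.outer_le, ?_, h.st⟩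
  · intro j hj hju
    rw [hs j hj, hpos]; exact h.empty j hj hju
  · intro x hx
    rw [hs _ (hub x hx), Ne, hpos]; exact h.pos x hx
  · intro x hx
    rw [hs _ (hub x hx), hside]; exact h.side x hx
  · intro x hx y hy
    rw [hs _ (hub x hx), hs _ (hub y hy)]
    exact ⟨hnew x hx y hy, hold x hx y hy⟩
  · rw [C.stepOut_of_ne (by omega), ← hZ, hZle _ le_rfl]; exact h.inner
  · rw [C.stepOut_last, ← hZ, hZle _ (by omega), h.outer]
    simp [NiceTree.closers]
  · rw [NiceTree.cutCount_introEdge, h.value]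
    simp [stepGain, hpar]

/-- The forgotten vertex completes a component exactly when its label occurs in no other slot. The
test may run over all slots because empty ones hold zero and its label is positive. The counters are
found without assuming that the step is accepted, so that the lemma also serves to prove acceptance.
-/
theorem Describes.forget_counters {v : Fin n} {t : NiceTree n}
    (hl : (NiceTree.forget v t).LocallyNice) (hc : (NiceTree.forget v t).Consistent)
    (hg : SlotGood C.slot C.b (.forget v t)) {X Y : ℕ → ℕ} {w : ℕ} (h : C.Describes t X w S) :
  (C.preOut 3 v 0 X Y C.b = ((NiceTree.forget v t).closers S ∩ S).card) ∧
    C.preOut 3 v 0 X Y (C.b + 1) = min 1 (t.closers S \ S).card +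
    (((NiceTree.forget v t).closers S \ S).card - (t.closers S \ S).card) ∧
    (t.closers S \ S).card ≤ ((NiceTree.forget v t).closers S \ S).card := by
  obtain ⟨hv, hl⟩ := hl
  have hc : t.Consistent := hc
  have hg : SlotGood C.slot C.b t := hg
  have hub : ∀ x ∈ t.bag, C.slot x < C.b := hg.bag.1
  have hcl := NiceTree.closersSpec S hl hc
  have hpre : C.preOut 3 v 0 X Y = C.forgetOut (C.slot v) X := by simp [preOut]
  have hne : ∀ u ∈ t.bag.erase v, C.slot u ≠ C.slot v := fun u hu h' =>
    (Finset.mem_erase.1 hu).1 (hg.bag.2 u (Finset.mem_erase.1 hu).2 v hv h')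
  have hmate : (∃ j < C.b, Function.update X (C.slot v) 0 j = X (C.slot v)) ↔
      ∃ x ∈ t.bag.erase v, t.Conn S v x := by
    constructor
    · rintro ⟨j, hj, e⟩
      have hjv : j ≠ C.slot v := by
        rintro rfl
        rw [Function.update_self] at e
        exact h.pos v hv e.symm
      rw [Function.update_of_ne hjv] at e
      by_contra! hno
      refine h.pos v hv (e.symm.trans (h.empty j hj fun x hx hxj => ?_))
      by_cases hxv : x = v
      · exact hjv (hxv ▸ hxj.symm)
      · refine hno x (Finset.mem_erase.2 ⟨hxv, hx⟩) ((h.label v hv x hx).1 ?_)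
        rw [hxj, e]
    · rintro ⟨x, hx, hvx⟩
      have hxb := (Finset.mem_erase.1 hx).2
      refine ⟨C.slot x, hub x hxb, ?_⟩
      rw [Function.update_of_ne (hne x hx)]
      exact ((h.label v hv x hxb).2 hvx).symm
  have hvb := hub v hv
  have hvcl : v ∉ t.closers S := fun h' => hcl.notMem v h' hv
  rw [hpre]
  by_cases hm : ∃ x ∈ t.bag.erase v, t.Conn S v x
  · have : (NiceTree.forget v t).closers S = t.closers S := by
      simp only [NiceTree.closers, if_pos hm]
    rw [this]
    unfold forgetOut
    rw [if_pos (hmate.2 hm), Function.update_of_ne (by omega), Function.update_of_ne (by omega),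
      h.inner, h.outer]
    simp
  · have : (NiceTree.forget v t).closers S = insert v (t.closers S) := by
      simp only [NiceTree.closers, if_neg hm]
    rw [this]
    unfold forgetOut
    rw [if_neg fun h' => hm (hmate.1 h')]
    by_cases hvS : v ∈ S
    · have e : X (C.slot v) % 2 = 1 := (h.side v hv).2 hvS
      rw [e, Finset.insert_inter_of_mem hvS, Finset.insert_sdiff_of_mem _ hvS,
        Finset.card_insert_of_notMem (by simp [hvcl])]
      simp only [Nat.add_sub_cancel, Function.update_apply, if_true]
      simp [show C.b ≠ C.slot v by omega, show C.b + 1 ≠ C.slot v by omega, h.inner, h.outer]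
    · have e : X (C.slot v) % 2 = 0 := by
        have := (h.side v hv).not.2 hvS; omega
      rw [e, Finset.insert_inter_of_notMem hvS, Finset.insert_sdiff_of_notMem _ hvS,
        Finset.card_insert_of_notMem (by simp [hvcl])]
      simp only [Nat.sub_zero, Function.update_apply, if_true]
      simp [show C.b ≠ C.slot v by omega, show C.b + 1 ≠ C.slot v by omega, h.inner, h.outer]

theorem Describes.forget (hb : 1 ≤ C.b) {v : Fin n} {t : NiceTree n}
    (hl : (NiceTree.forget v t).LocallyNice) (hc : (NiceTree.forget v t).Consistent)
    (hg : SlotGood C.slot C.b (.forget v t)) {X Y : ℕ → ℕ} {w : ℕ} (h : C.Describes t X w S)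
    (hY : C.IsCode Y) (hok : C.stepOk 3 v 0 X Y) :
    C.Describes (.forget v t) (C.stepOut 3 v 0 X Y) (w + C.stepGain 3 v 0 X) S := by
  obtain ⟨hv, hl⟩ := hl
  have hc : t.Consistent := hc
  have hg : SlotGood C.slot C.b t := hg
  have hub : ∀ x ∈ t.bag, C.slot x < C.b := hg.bag.1
  have hpre : C.preOut 3 v 0 X Y = C.forgetOut (C.slot v) X := by simp [preOut]
  have hne : ∀ u ∈ t.bag.erase v, C.slot u ≠ C.slot v := fun u hu h' =>
    (Finset.mem_erase.1 hu).1 (hg.bag.2 u (Finset.mem_erase.1 hu).2 v hv h')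
  have hlow : ∀ j < C.b, C.stepOut 3 v 0 X Y j = Function.update X (C.slot v) 0 j := by
    intro j hj
    rw [C.stepOut_of_ne (by omega), hpre]
    unfold forgetOut
    split
    · rfl
    · rw [Function.update_of_ne (by omega)]
  have hlow' : ∀ x ∈ t.bag.erase v, C.stepOut 3 v 0 X Y (C.slot x) = X (C.slot x) := by
    intro x hx
    rw [hlow _ (hub x (Finset.mem_erase.1 hx).2), Function.update_of_ne (hne x hx)]
  obtain ⟨hf₁, hf₂, hf₃⟩ := h.forget_counters (Y := Y) ⟨hv, hl⟩ hc hg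
  have hle := hok.2.1
  refine ⟨C.stepOut_isCode hb h.isCode hY (by simp) hok, ?_, ?_, ?_, ?_, ?_, ?_, ?_,
    ?_, ?_, h.st⟩
  · intro j hj hju
    rw [hlow j hj, Function.update_apply]
    split
    · rfl
    · next hjv =>
        refine h.empty j hj fun x hx hxj => ?_
        by_cases hxv : x = v
        · exact hjv (hxv ▸ hxj.symm)
        · exact hju x (Finset.mem_erase.2 ⟨hxv, hx⟩) hxj
  · intro x hx
    rw [hlow' x hx]; exact h.pos x (Finset.mem_erase.1 hx).2
  · intro x hx
    rw [hlow' x hx]; exact h.side x (Finset.mem_erase.1 hx).2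
  · intro x hx y hy
    rw [hlow' x hx, hlow' y hy]
    exact h.label x (Finset.mem_erase.1 hx).2 y (Finset.mem_erase.1 hy).2
  · rw [C.stepOut_of_ne (by omega), hf₁]
  · rw [← hf₁]; exact hle
  -- Capping before and after adding the new component gives the same as capping once.
  · rw [C.stepOut_last, hf₂]; omega
  · intro hcn
    have h1 := hok.2.2 hcn
    have h2 := h.outer_le hcn
    omega
  · simp only [stepGain]; exact h.value

theorem Describes.join_counters {a c : NiceTree n} {X Y : ℕ → ℕ} {w w' : ℕ}
    (h : C.Describes a X w S) (h' : C.Describes c Y w' S) :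
    C.preOut 4 0 0 X Y C.b = (a.closers S ∩ S).card + (c.closers S ∩ S).card ∧
    C.preOut 4 0 0 X Y (C.b + 1) =
      min 1 (a.closers S \ S).card + min 1 (c.closers S \ S).card := by
  have hpre : C.preOut 4 0 0 X Y = C.joinOut X Y := by simp [preOut]
  rw [hpre, joinOut, Function.update_of_ne (by omega), Function.update_self,
    Function.update_self, merge_of_le le_rfl, merge_of_le (by omega), h.inner, h'.inner, h.outer,
    h'.outer]
  exact ⟨rfl, rfl⟩

/-- The bag separates the two subtrees. Connectivity in the union, restricted to the bag, is thus
generated by the two partitions of the bag, and `merge` computes the partition so generated. -/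
theorem Describes.join (hb : 1 ≤ C.b) {a c : NiceTree n}
    (hl : (NiceTree.join a c).LocallyNice) (hc : (NiceTree.join a c).Consistent)
    (hg : SlotGood C.slot C.b (.join a c)) {X Y : ℕ → ℕ} {w w' : ℕ} (h : C.Describes a X w S)
    (h' : C.Describes c Y w' S) (hok : C.stepOk 4 0 0 X Y) :
    C.Describes (.join a c) (C.stepOut 4 0 0 X Y) (w + w' + C.stepGain 4 0 0 X) S := by
  obtain ⟨hac, hla, hlc⟩ := hl
  have hub : ∀ x ∈ a.bag, C.slot x < C.b := hg.1.bag.1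
  have hinj := hg.1.bag.2
  have hpar : ∀ j < C.b, X j % 2 = Y j % 2 := hok.1
  have hpre : C.preOut 4 0 0 X Y = C.joinOut X Y := by simp [preOut]
  set Z := merge C.b Y X with hZ
  have hs : ∀ j < C.b, C.stepOut 4 0 0 X Y j = Z j := by
    intro j hj
    rw [C.stepOut_of_ne (by omega), hpre, joinOut, Function.update_of_ne (by omega),
      Function.update_of_ne (by omega)]
  have hzero : ∀ j < C.b, X j = 0 ↔ Y j = 0 := by
    intro j hj
    by_cases ho : ∃ x ∈ a.bag, C.slot x = j
    · obtain ⟨x, hx, rfl⟩ := ho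
      simp [h.pos x hx, h'.pos x (hac ▸ hx)]
    · push Not at ho
      simp [h.empty j hj ho, h'.empty j hj (hac ▸ ho)]
  have hpos : ∀ j, (Z j = 0) = (X j = 0) :=
    merge_invariant (h := fun k => k = 0) fun p hp q hq hpq => by
      simp [hzero p hp, hzero q hq, hpq]
  have hside : ∀ j, Z j % 2 = X j % 2 :=
    merge_invariant (h := fun k => k % 2) fun p hp q hq hpq => by
      simp [hpar p hp, hpar q hq, hpq]
  have hkernel : ∀ x ∈ a.bag, ∀ y ∈ a.bag, Z (C.slot x) = Z (C.slot y) →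
      (NiceTree.join a c).Conn S x y := by
    -- `R` transports connectivity of bag vertices to slots. The empty slots, which all carry label
    -- zero, are put into one class, so that `R` is an equivalence that contains the kernels of `X`
    -- and of `Y`.
    let R : ℕ → ℕ → Prop := fun i j =>
      (i = j) ∨ (X i = 0 ∧ X j = 0) ∨
      ∃ x ∈ a.bag, ∃ y ∈ a.bag, C.slot x = i ∧ C.slot y = j ∧ (NiceTree.join a c).Conn S x y
    have hR : Equivalence R := by
      refine ⟨fun i => .inl rfl, ?_, ?_⟩
      · rintro i j (e | e | ⟨x, hx, y, hy, e, e', hxy⟩)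
        · exact .inl e.symm
        · exact .inr (.inl e.symm)
        · exact .inr (.inr ⟨y, hy, x, hx, e', e, hxy.symm⟩)
      · rintro i j k (rfl | e | ⟨x, hx, y, hy, e, e', hxy⟩) H
        · exact H
        · rcases H with rfl | H | ⟨x, hx, y, hy, H, -, -⟩
          · exact .inr (.inl e)
          · exact .inr (.inl ⟨e.1, H.2⟩)
          · exact absurd (H ▸ e.2) (h.pos x hx)
        · rcases H with rfl | H | ⟨x', hx', y', hy', H, H', hxy'⟩
          · exact .inr (.inr ⟨x, hx, y, hy, e, e', hxy⟩)
          · exact absurd (e' ▸ H.1) (h.pos y hy)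
          · have : y = x' := hinj y hy x' hx' (e'.trans H.symm)
            subst this
            exact .inr (.inr ⟨x, hx, y', hy', e, H', hxy.trans _ _ _ hxy'⟩)
    have occ : ∀ j < C.b, X j ≠ 0 → ∃ x ∈ a.bag, C.slot x = j := by
      intro j hj hX
      by_contra! hno
      exact hX (h.empty j hj hno)
    have key : ∀ i < C.b, ∀ j < C.b, Z i = Z j → R i j := by
      refine merge_kernel hR (fun i hi j hj e => ?_) fun i hi j hj e => ?_
      · by_cases h0 : X i = 0
        · exact .inr (.inl ⟨h0, e ▸ h0⟩)
        · obtain ⟨x, hx, rfl⟩ := occ i hi h0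
          obtain ⟨y, hy, rfl⟩ := occ j hj (e ▸ h0)
          exact .inr (.inr ⟨x, hx, y, hy, rfl, rfl,
            NiceTree.conn_join_left ((h.label x hx y hy).1 e)⟩)
      · by_cases h0 : X i = 0
        · exact .inr (.inl ⟨h0, (hzero j hj).2 (e ▸ (hzero i hi).1 h0)⟩)
        · have h1 : X j ≠ 0 := fun h1 => h0 ((hzero i hi).2 (e ▸ (hzero j hj).1 h1))
          obtain ⟨x, hx, rfl⟩ := occ i hi h0
          obtain ⟨y, hy, rfl⟩ := occ j hj h1
          exact .inr (.inr ⟨x, hx, y, hy, rfl, rfl,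
            NiceTree.conn_join_right ((h'.label x (hac ▸ hx) y (hac ▸ hy)).1 e)⟩)
    intro x hx y hy e
    rcases key _ (hub x hx) _ (hub y hy) e with e | e | ⟨x', hx', y', hy', e, e', hxy⟩
    · rw [hinj x hx y hy e]; exact .refl y
    · exact absurd e.1 (h.pos x hx)
    · rwa [hinj x' hx' x hx e, hinj y' hy' y hy e'] at hxy
  have hold : ∀ x ∈ a.bag, ∀ y ∈ a.bag, (NiceTree.join a c).Conn S x y →
      Z (C.slot x) = Z (C.slot y) := by
    intro x hx y hy hxy
    refine label_eq_of_eqvGen_union (f := fun x : Fin n => Z (C.slot x))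
      (D := (a.bag : Set (Fin n))) (fun x y => (NiceTree.sideAdj_join a c x y).1)
      (NiceTree.SideAdj.mem_verts hla) (NiceTree.SideAdj.mem_verts hlc) hc.1 ?_ ?_ hx hy hxy
    · intro x hx y hy hxy
      exact merge_congr_left (hub x hx) (hub y hy) ((h.label x hx y hy).2 hxy)
    · intro x hx y hy hxy
      exact merge_congr_right (hub x hx) (hub y hy)
        ((h'.label x (hac ▸ hx) y (hac ▸ hy)).2 hxy)
  have hci := NiceTree.card_closers_join_inter (S := S) ⟨hac, hla, hlc⟩ hc
  have hco := NiceTree.card_closers_join_sdiff (S := S) ⟨hac, hla, hlc⟩ hc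
  obtain ⟨hf₁, hf₂⟩ := h.join_counters h'
  rw [← hci] at hf₁
  have hle := hok.2.1
  refine ⟨C.stepOut_isCode hb h.isCode h'.isCode (by simp) hok, ?_, ?_, ?_, ?_, ?_, ?_, ?_,
    ?_, ?_, ?_⟩
  · intro j hj hju
    rw [hs j hj, hpos]; exact h.empty j hj hju
  · intro x hx
    rw [hs _ (hub x hx), Ne, hpos]; exact h.pos x hx
  · intro x hx
    rw [hs _ (hub x hx), hside]; exact h.side x hx
  · intro x hx y hy
    rw [hs _ (hub x hx), hs _ (hub y hy)]
    exact ⟨hkernel x hx y hy, hold x hx y hy⟩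
  · rw [C.stepOut_of_ne (by omega), hf₁]
  · rw [← hf₁]; exact hle
  · rw [C.stepOut_last, hf₂, hco]; omega
  · intro hcn
    have h1 := hok.2.2 hcn
    have h2 := h.outer_le hcn
    have h3 := h'.outer_le hcn
    omega
  · rw [NiceTree.cutCount_join, h.value, h'.value]
    simp [stepGain]
  · intro hst x hx
    rcases Finset.mem_union.1 hx with hx | hx
    · exact h.st hst x hx
    · exact h'.st hst x hx

theorem Describes.leaf (w : ℕ) (hw : w = 0) : C.Describes (.leaf : NiceTree n) (fun _ => 0) w S := by
  subst hw
  constructor <;> simp [IsCode, NiceTree.bag, NiceTree.closers, NiceTree.verts, NiceTree.cutCount,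
    NiceTree.introducedEdges]

/-- This is the soundness of the states: what the digits claim about the components of `S` is true,
whatever choices of labels were made on the way. -/
theorem Deriv.describes (hb : 1 ≤ C.b) {t : NiceTree n} (hl : t.LocallyNice) (hc : t.Consistent)
    (hg : SlotGood C.slot C.b t) {X : ℕ → ℕ} {w : ℕ} (h : C.Deriv t X w S) :
    C.Describes t X w S := by
  induction t generalizing X w with
  | leaf => obtain ⟨rfl, hw⟩ := h; exact .leaf w hw
  | introVertex v t ih =>
      obtain ⟨X₁, Y, w₁, h₁, hY, hok, rfl, rfl, hv⟩ := h
      exact (ih hl.2 hc.2 hg.2 h₁).introVertex hb hl hc hg hY hok hv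
  | introEdge u v t ih =>
      obtain ⟨X₁, Y, w₁, h₁, hY, hok, rfl, rfl⟩ := h
      exact (ih hl.2.2 hc hg h₁).introEdge hb hl hg hY hok
  | forget v t ih =>
      obtain ⟨X₁, Y, w₁, h₁, hY, hok, rfl, rfl⟩ := h
      exact (ih hl.2 hc hg h₁).forget hb hl hc hg hY hok
  | join a c iha ihc =>
      obtain ⟨X₁, X₂, w₁, w₂, h₁, h₂, hok, rfl, rfl⟩ := h
      exact (iha hl.2.1 hc.2.1 hg.1 h₁).join hb hl hc hg (ihc hl.2.2 hc.2.2 hg.2 h₂) hok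

end Ctx

/-! ### Gluing partial solutions, and the existence of signatures -/

namespace NiceTree

variable {n : ℕ} {S : Finset (Fin n)}

/-- Completed components are never lost, so bounds on their number pass from a node down to its
child. -/
theorem closers_subset_forget (v : Fin n) (t : NiceTree n) :
    t.closers S ⊆ (forget v t).closers S := by
  simp only [closers]
  split
  · exact Finset.Subset.refl _
  · exact Finset.subset_insert _ _

end NiceTree

namespace Ctx

variable {n : ℕ} {C : Ctx} {S : Finset (Fin n)}

/-- A derivation asks for membership only at introduced vertices. Sets that agree below a node are
interchangeable there, which allows the solutions of two subtrees to be glued. -/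
theorem Deriv.congr {S' : Finset (Fin n)} {t : NiceTree n} {X : ℕ → ℕ} {w : ℕ}
    (h : C.Deriv t X w S) (hS : ∀ x ∈ t.verts, x ∈ S ↔ x ∈ S') : C.Deriv t X w S' := by
  induction t generalizing X w with
  | leaf => exact h
  | introVertex v t ih =>
      obtain ⟨X₁, Y, w₁, h₁, hY, hok, e, e', hv⟩ := h
      exact ⟨X₁, Y, w₁, ih h₁ fun x hx => hS x (Finset.mem_insert_of_mem hx), hY, hok, e, e',
        hv.trans (hS v (Finset.mem_insert_self _ _))⟩
  | introEdge u v t ih =>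
      obtain ⟨X₁, Y, w₁, h₁, h⟩ := h
      exact ⟨X₁, Y, w₁, ih h₁ hS, h⟩
  | forget v t ih =>
      obtain ⟨X₁, Y, w₁, h₁, h⟩ := h
      exact ⟨X₁, Y, w₁, ih h₁ hS, h⟩
  | join a c iha ihc =>
      obtain ⟨X₁, X₂, w₁, w₂, h₁, h₂, h⟩ := h
      exact ⟨X₁, X₂, w₁, w₂, iha h₁ fun x hx => hS x (Finset.mem_union_left _ hx),
        ihc h₂ fun x hx => hS x (Finset.mem_union_right _ hx), h⟩

/-- The union of partial solutions at a join node whose signatures can be combined. -/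
theorem Deriv.join (hb : 1 ≤ C.b) {a c : NiceTree n}
    (hl : (NiceTree.join a c).LocallyNice) (hc : (NiceTree.join a c).Consistent)
    (hg : SlotGood C.slot C.b (.join a c)) {X Y : ℕ → ℕ} {w w' : ℕ} {S₁ S₂ : Finset (Fin n)}
    (h₁ : C.Deriv a X w S₁) (h₂ : C.Deriv c Y w' S₂) (hok : C.stepOk 4 0 0 X Y) :
    C.Deriv (.join a c) (C.stepOut 4 0 0 X Y) (w + w' + C.stepGain 4 0 0 X)
      (Finset.univ.filter fun x => if x ∈ a.verts then x ∈ S₁ else x ∈ S₂) := by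
  refine ⟨X, Y, w, w', h₁.congr fun x hx => by simp [hx], h₂.congr fun x hx => ?_, hok, rfl, rfl⟩
  by_cases hxa : x ∈ a.verts
  · have hxb := hc.1 x hxa hx
    have d₁ := h₁.describes hb hl.2.1 hc.2.1 hg.1
    have d₂ := h₂.describes hb hl.2.2 hc.2.2 hg.2
    have hpar : ∀ j < C.b, X j % 2 = Y j % 2 := hok.1
    simp only [hxa, if_true, Finset.mem_filter, Finset.mem_univ, true_and]
    rw [← d₁.side x hxb, ← d₂.side x (hl.1 ▸ hxb), hpar _ (hg.1.bag.1 x hxb)]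
  · simp [hxa]

/-- Between 1 and `2 * b` there are `b` labels of each parity, and at most `b - 1` slots other than
the empty slot `p` can use them up. The base `2 * b + 1` is chosen for this pigeonhole argument. -/
theorem exists_fresh {X : ℕ → ℕ} {b p : ℕ} (hp : p < b) (hX : X p = 0) (ε : ℕ) (hε : ε < 2) :
    ∃ d, d ≠ 0 ∧ d < 2 * b + 1 ∧ d % 2 = ε ∧ ∀ j < b, X j ≠ d := by
  obtain ⟨d, hd, hd'⟩ := Finset.exists_mem_notMem_of_card_lt_card
    (s := ((Finset.range b).erase p).image X)
    (t := (Finset.range b).image fun k => 2 * k + (2 - ε)) (by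
      rw [Finset.card_image_of_injective (f := fun k => 2 * k + (2 - ε)) _ (fun k k' h => by
        simpa using h), Finset.card_range]
      refine Finset.card_image_le.trans_lt ?_
      rw [Finset.card_erase_of_mem (by simpa using hp), Finset.card_range]
      omega)
  simp only [Finset.mem_image, Finset.mem_range, Finset.mem_erase, not_exists, not_and] at hd hd'
  obtain ⟨k, hk, rfl⟩ := hd
  refine ⟨2 * k + (2 - ε), by omega, by omega, by omega, fun j hj h => ?_⟩
  by_cases hjp : j = p
  · subst hjp; omega
  · exact hd' j ⟨hjp, hj⟩ h

theorem isCode_zero : C.IsCode fun _ => 0 := ⟨fun _ => Nat.succ_pos _, fun _ _ => rfl⟩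

/-- Every solution with the right numbers of completed components has a signature. -/
theorem exists_deriv (hb : 1 ≤ C.b) {t : NiceTree n} (hl : t.LocallyNice) (hc : t.Consistent)
    (hg : SlotGood C.slot C.b t) (hin : (t.closers S ∩ S).card ≤ 1)
    (hout : C.conn ≠ 0 → (t.closers S \ S).card ≤ 1)
    (hst : C.st ≠ 0 → ∀ v ∈ t.verts, ((v : ℕ) = C.s → v ∈ S) ∧ ((v : ℕ) = C.t → v ∉ S)) :
    ∃ X w, C.Deriv t X w S := by
  induction t with
  | leaf => exact ⟨_, _, rfl, rfl⟩
  | introVertex v t ih =>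
      obtain ⟨X, w, h⟩ := ih hl.2 hc.2 hg.2 hin hout fun hs x hx =>
        hst hs x (Finset.mem_insert_of_mem hx)
      have d := h.describes hb hl.2 hc.2 hg.2
      have hvb : C.slot v < C.b := hg.1.1 v (by simp)
      have h0 : X (C.slot v) = 0 := d.empty _ hvb fun u hu e => hl.1 (by
        rw [← hg.1.2 u (by simp [hu]) v (by simp) e]; exact hu)
      obtain ⟨k, hk0, hkb, hk2, hk⟩ := exists_fresh hvb h0 (if v ∈ S then 1 else 0)
        (by split <;> omega)
      refine ⟨_, _, X, fun j => if j = 0 then k else 0, w, h, ⟨fun j => ?_, fun j hj => ?_⟩,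
        ⟨⟨by simpa using hk0, by simpa using hk, fun hs => ?_⟩, ?_, fun hcn => ?_⟩, rfl, rfl, ?_⟩
      · dsimp only; split <;> omega
      · exact if_neg (by omega)
      · have := hst hs v (Finset.mem_insert_self _ _)
        simp only [if_true, hk2]
        refine ⟨fun e => by simp [this.1 e], fun e => by simp [this.2 e]⟩
      · rw [show C.preOut 1 v 0 X (fun j => if j = 0 then k else 0) =
          Function.update X (C.slot v) k by simp [preOut], Function.update_of_ne (by omega), d.inner]
        exact hin
      · rw [show C.preOut 1 v 0 X (fun j => if j = 0 then k else 0) =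
          Function.update X (C.slot v) k by simp [preOut], Function.update_of_ne (by omega), d.outer]
        exact Nat.min_le_left _ _
      · simp only [if_true, hk2]
        by_cases hv : v ∈ S <;> simp [hv]
  | introEdge u v t ih =>
      obtain ⟨X, w, h⟩ := ih hl.2.2 hc hg hin hout hst
      have d := h.describes hb hl.2.2 hc hg
      have hhigh : ∀ j, C.b ≤ j → C.preOut 2 u v X (fun _ => 0) j = X j := by
        intro j hj
        simp only [preOut, if_true, if_neg (show (2 : ℕ) ≠ 0 by decide),
          if_neg (show (2 : ℕ) ≠ 1 by decide)]
        split
        · exact renumber_of_le hj _ _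
        · rfl
      refine ⟨_, _, X, fun _ => 0, w, h, isCode_zero, ⟨trivial, ?_, fun hcn => ?_⟩, rfl, rfl⟩
      · rw [hhigh _ le_rfl, d.inner]; exact hin
      · rw [hhigh _ (by omega), d.outer]; exact Nat.min_le_left _ _
  | forget v t ih =>
      have hsub := NiceTree.closers_subset_forget (S := S) v t
      have hin' := (Finset.card_le_card (Finset.inter_subset_inter_right (u := S) hsub)).trans hin
      have hout' := fun hcn => (Finset.card_le_card
        (Finset.sdiff_subset_sdiff hsub (Finset.Subset.refl S))).trans (hout hcn)
      obtain ⟨X, w, h⟩ := ih hl.2 hc hg hin' hout' hst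
      have d := h.describes hb hl.2 hc hg
      have hf := d.forget_counters hl hc hg (Y := fun _ => 0)
      refine ⟨_, _, X, fun _ => 0, w, h, isCode_zero, ⟨trivial, ?_, fun hcn => ?_⟩, rfl, rfl⟩
      · rw [hf.1]; exact hin
      · have := hout hcn
        rw [hf.2.1]; omega
  | join a c iha ihc =>
      have hdisj := NiceTree.disjoint_closers (S := S) hl hc
      have hci := NiceTree.card_closers_join_inter (S := S) hl hc
      have hco := NiceTree.card_closers_join_sdiff (S := S) hl hc
      obtain ⟨X, w, h⟩ := iha hl.2.1 hc.2.1 hg.1 (by omega)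
        (fun hcn => by have := hout hcn; omega) fun hs x hx => hst hs x (Finset.mem_union_left _ hx)
      obtain ⟨Y, w', h'⟩ := ihc hl.2.2 hc.2.2 hg.2 (by omega)
        (fun hcn => by have := hout hcn; omega) fun hs x hx => hst hs x (Finset.mem_union_right _ hx)
      have d := h.describes hb hl.2.1 hc.2.1 hg.1
      have d' := h'.describes hb hl.2.2 hc.2.2 hg.2
      have hf := d.join_counters d'
      refine ⟨_, _, X, Y, w, w', h, h', ⟨?_, ?_, fun hcn => ?_⟩, rfl, rfl⟩
      · change ∀ j < C.b, X j % 2 = Y j % 2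
        intro j hj
        -- In an occupied slot both parities tell the side of the same vertex; a free slot holds
        -- zero in both signatures.
        by_cases ho : ∃ x ∈ a.bag, C.slot x = j
        · obtain ⟨x, hx, rfl⟩ := ho
          have h1 := d.side x hx
          have h2 := d'.side x (hl.1 ▸ hx)
          have h3 := h1.trans h2.symm
          clear h1 h2
          omega
        · push Not at ho
          rw [d.empty j hj ho, d'.empty j hj (hl.1 ▸ ho)]
      · rw [hf.1]; omega
      · have := hout hcn
        rw [hf.2]; omega

/-- The signature of a solution at the root. -/
def final (C : Ctx) : ℕ → ℕ := fun j => if j = C.b ∨ j = C.b + 1 then 1 else 0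

/-- With an empty bag all slots are empty and only the counters remain, so a single entry of the
root row stands for all feasible sets. -/
theorem Describes.eq_final {t : NiceTree n} {X : ℕ → ℕ} {w : ℕ} (h : C.Describes t X w S)
    (ht : t.bag = ∅) (h1 : (t.closers S ∩ S).card = 1) (h2 : (t.closers S \ S).card ≠ 0) :
    X = C.final := by
  funext j
  unfold final
  rcases lt_trichotomy j C.b with hj | rfl | hj
  · rw [if_neg (by omega)]
    exact h.empty j hj (by simp [ht])
  · rw [if_pos (by omega), h.inner, h1]
  · by_cases hj' : j = C.b + 1
    · subst hj'
      rw [if_pos (by omega), h.outer]; omega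
    · rw [if_neg (by omega)]
      exact h.isCode.2 j (by omega)

theorem Describes.of_final {t : NiceTree n} {w : ℕ} (h : C.Describes t C.final w S) :
    (t.closers S ∩ S).card = 1 ∧ (t.closers S \ S).card ≠ 0 ∧
      (C.conn ≠ 0 → (t.closers S \ S).card = 1) := by
  have h1 := h.inner
  have h2 := h.outer
  have h3 := h.outer_le
  simp only [final, true_or, or_true, if_true] at h1 h2
  refine ⟨by omega, by omega, fun hc => ?_⟩
  have := h3 hc
  omega

end Ctx

/-! ### Membership in cut-sets -/

variable {n : ℕ} {G : SimpleGraph (Fin n)} {S : Finset (Fin n)}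

theorem mem_cutSet {e : Sym2 (Fin n)} :
    e ∈ cutSet G S ↔ ∃ u v, e = s(u, v) ∧ G.Adj u v ∧ u ∈ S ∧ v ∉ S := by
  classical
  simp [cutSet]

theorem mk_mem_cutSet {u v : Fin n} :
    s(u, v) ∈ cutSet G S ↔ G.Adj u v ∧ ¬ (u ∈ S ↔ v ∈ S) := by
  rw [mem_cutSet]
  constructor
  · rintro ⟨a, b, h, hab, ha, hb⟩
    rcases Sym2.eq_iff.1 h with ⟨rfl, rfl⟩ | ⟨rfl, rfl⟩
    · exact ⟨hab, by tauto⟩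
    · exact ⟨hab.symm, by tauto⟩
  · rintro ⟨h, h'⟩
    by_cases hu : u ∈ S
    · exact ⟨u, v, rfl, h, hu, by tauto⟩
    · exact ⟨v, u, Sym2.eq_swap, h.symm, by tauto, hu⟩

/-! ## Solutions and signatures at the root -/

namespace NiceTree

variable {t : NiceTree n}

/-- Each edge is introduced exactly once, so counting along the list of introduced edges is counting
a set. -/
theorem IsNiceDecomposition.cutCount_eq (h : t.IsNiceDecomposition G) (S : Finset (Fin n)) :
    t.cutCount S = (cutSet G S).card := by
  classical
  unfold cutCount
  rw [List.countP_eq_length_filter, ← List.toFinset_card_of_nodup (h.edges_nodup.filter _)]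
  congr 1
  ext e
  induction e with
  | _ u v =>
    rw [List.mem_toFinset, List.mem_filter, h.mem_edges, mem_cutSet, SimpleGraph.mem_edgeSet]
    simp only [decide_eq_true_eq]
    constructor
    · rintro ⟨hadj, a, b, he, ha, hb⟩
      refine ⟨a, b, he, ?_, ha, hb⟩
      rcases Sym2.eq_iff.1 he with ⟨rfl, rfl⟩ | ⟨rfl, rfl⟩
      · exact hadj
      · exact hadj.symm
    · rintro ⟨a, b, he, hadj, ha, hb⟩
      refine ⟨?_, a, b, he, ha, hb⟩
      rcases Sym2.eq_iff.1 he with ⟨rfl, rfl⟩ | ⟨rfl, rfl⟩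
      · exact hadj
      · exact hadj.symm

theorem IsNiceDecomposition.sideAdj_iff (h : t.IsNiceDecomposition G) {x y : Fin n} :
    t.SideAdj S x y ↔ G.Adj x y ∧ (x ∈ S ↔ y ∈ S) := by
  rw [SideAdj, h.mem_edges, SimpleGraph.mem_edgeSet]

/-- A side of a cut is connected if and only if it is nonempty and in one class of `Conn`. -/
theorem IsNiceDecomposition.connected_induce_iff (h : t.IsNiceDecomposition G) {A : Set (Fin n)}
    (hA : ∀ x ∈ A, ∀ y, y ∈ A ↔ (x ∈ S ↔ y ∈ S)) :
    (G.induce A).Connected ↔ A.Nonempty ∧ ∀ x ∈ A, ∀ y ∈ A, t.Conn S x y := by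
  constructor
  · intro hc
    refine ⟨Set.nonempty_coe_sort.1 hc.nonempty, fun x hx y hy => ?_⟩
    obtain ⟨w⟩ := hc.preconnected ⟨x, hx⟩ ⟨y, hy⟩
    have key : ∀ (a b : A), (G.induce A).Walk a b → t.Conn S a b := by
      intro a b w
      induction w with
      | nil => exact .refl _
      | @cons a b c hab _ ih =>
          exact .trans _ _ _ (.rel _ _ (h.sideAdj_iff.2 ⟨hab, (hA a a.2 b).1 b.2⟩)) ih
    exact key _ _ w
  · rintro ⟨⟨x, hx⟩, hc⟩
    have : Nonempty A := ⟨⟨x, hx⟩⟩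
    refine ⟨fun a b => ?_⟩
    have key : ∀ x y, t.Conn S x y → ∀ (hx : x ∈ A) (hy : y ∈ A),
        (G.induce A).Reachable ⟨x, hx⟩ ⟨y, hy⟩ := by
      intro x y hxy
      induction hxy with
      | rel x y hxy =>
          exact fun hx hy => SimpleGraph.Adj.reachable (h.sideAdj_iff.1 hxy).1
      | refl x => exact fun _ _ => .refl _
      | symm x y _ ih => exact fun hx hy => (ih hy hx).symm
      | trans x y z hxy _ ih₁ ih₂ =>
          intro hx hz
          have hy : y ∈ A := (hA x hx y).2 (Conn.side hxy)
          exact (ih₁ hx hy).trans (ih₂ hy hz)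
    exact key a b (hc a a.2 b b.2) a.2 b.2

theorem IsNiceDecomposition.consistent (h : t.IsNiceDecomposition G) : t.Consistent :=
  consistent_of_connected h.locallyNice h.connected

theorem IsNiceDecomposition.mem_verts (h : t.IsNiceDecomposition G) (x : Fin n) : x ∈ t.verts :=
  mem_verts_of_connected (h.connected x)

/-- At the root no component can be represented by a bag vertex, so the closers within a side are in
bijection with its components. -/
theorem IsNiceDecomposition.connected_induce_iff_card (h : t.IsNiceDecomposition G)
    {A : Finset (Fin n)} (hA : ∀ x ∈ A, ∀ y, y ∈ A ↔ (x ∈ S ↔ y ∈ S)) :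
    (G.induce {x | x ∈ A}).Connected ↔ (t.closers S ∩ A).card = 1 := by
  have hcl := closersSpec S h.locallyNice h.consistent
  have cover : ∀ x ∈ A, ∃ c ∈ t.closers S ∩ A, t.Conn S x c := by
    intro x hx
    obtain ⟨c, hc, hxc⟩ := hcl.cover x (h.mem_verts x)
    simp only [h.root_bag, Finset.notMem_empty, false_or] at hc
    exact ⟨c, Finset.mem_inter.2 ⟨hc, (hA x hx c).2 hxc.side⟩, hxc⟩
  rw [h.connected_induce_iff (S := S) (A := {x | x ∈ A}) hA, Finset.card_eq_one]
  constructor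
  · rintro ⟨⟨x, hx⟩, hc⟩
    obtain ⟨c, hcA, -⟩ := cover x hx
    refine ⟨c, Finset.eq_singleton_iff_unique_mem.2 ⟨hcA, fun d hd => ?_⟩⟩
    rw [Finset.mem_inter] at hcA hd
    exact hcl.eq d hd.1 c hcA.1 (hc d hd.2 c hcA.2)
  · rintro ⟨c, hc⟩
    have hcA : c ∈ t.closers S ∩ A := by simp [hc]
    refine ⟨⟨c, (Finset.mem_inter.1 hcA).2⟩, fun x hx y hy => ?_⟩
    obtain ⟨d, hd, hxd⟩ := cover x hx
    obtain ⟨e, he, hye⟩ := cover y hy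
    simp only [hc, Finset.mem_singleton] at hd he
    subst hd
    subst he
    exact hxd.trans _ _ _ hye.symm

end NiceTree

/-- The solutions that the algorithm with parameters `C` looks for. -/
def Ctx.Feasible (C : Ctx) (G : SimpleGraph (Fin n)) (S : Finset (Fin n)) : Prop :=
  (G.induce {v | v ∈ S}).Connected ∧ (∃ v, v ∉ S) ∧
    (C.conn ≠ 0 → (G.induce {v | v ∉ S}).Connected) ∧
    (C.st ≠ 0 → ∀ v : Fin n, ((v : ℕ) = C.s → v ∈ S) ∧ ((v : ℕ) = C.t → v ∉ S))

namespace Ctx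

variable {C : Ctx} {t : NiceTree n}

theorem connected_inner_iff (h : t.IsNiceDecomposition G) :
    (G.induce {v | v ∈ S}).Connected ↔ (t.closers S ∩ S).card = 1 :=
  h.connected_induce_iff_card fun x hx y => by simp [hx]

theorem connected_outer_iff (h : t.IsNiceDecomposition G) :
    (G.induce {v | v ∉ S}).Connected ↔ (t.closers S \ S).card = 1 := by
  have := h.connected_induce_iff_card (S := S) (A := Sᶜ) fun x hx y => by
    simp only [Finset.mem_compl] at hx
    simp [hx]
  rw [Finset.sdiff_eq_inter_compl, ← this]
  have e : {v | v ∉ S} = {v | v ∈ Sᶜ} := by ext; simp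
  rw [e]

theorem exists_outer_iff (h : t.IsNiceDecomposition G) :
    (∃ v, v ∉ S) ↔ (t.closers S \ S).card ≠ 0 := by
  have hcl := NiceTree.closersSpec S h.locallyNice h.consistent
  rw [Finset.card_ne_zero]
  constructor
  · rintro ⟨x, hx⟩
    obtain ⟨c, hc, hxc⟩ := hcl.cover x (h.mem_verts x)
    simp only [h.root_bag, Finset.notMem_empty, false_or] at hc
    exact ⟨c, Finset.mem_sdiff.2 ⟨hc, fun h' => hx (hxc.side.2 h')⟩⟩
  · rintro ⟨c, hc⟩
    exact ⟨c, (Finset.mem_sdiff.1 hc).2⟩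

theorem Deriv.feasible (hb : 1 ≤ C.b) (h : t.IsNiceDecomposition G)
    (hg : SlotGood C.slot C.b t) {w : ℕ} (hd : C.Deriv t C.final w S) :
    C.Feasible G S ∧ w = (cutSet G S).card := by
  have d := hd.describes hb h.locallyNice h.consistent hg
  obtain ⟨h1, h2, h3⟩ := d.of_final
  exact ⟨⟨(connected_inner_iff h).2 h1, (exists_outer_iff h).2 h2,
    fun hc => (connected_outer_iff h).2 (h3 hc), fun hs v => d.st hs v (h.mem_verts v)⟩,
    d.value.trans (h.cutCount_eq S)⟩

/-- Some signature exists by `exists_deriv`. The description then forces it to be `final` and its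
value to be the size of the cut-set. -/
theorem Feasible.deriv (hb : 1 ≤ C.b) (h : t.IsNiceDecomposition G)
    (hg : SlotGood C.slot C.b t) (hf : C.Feasible G S) :
    C.Deriv t C.final (cutSet G S).card S := by
  obtain ⟨h1, h2, h3, h4⟩ := hf
  have h1 := (connected_inner_iff h).1 h1
  have h2 := (exists_outer_iff h).1 h2
  obtain ⟨X, w, hd⟩ := exists_deriv hb h.locallyNice h.consistent hg h1.le
    (fun hc => ((connected_outer_iff h).1 (h3 hc)).le) fun hs v _ => h4 hs v
  have d := hd.describes hb h.locallyNice h.consistent hg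
  have hX := d.eq_final h.root_bag h1 h2
  have hw := d.value.trans (h.cutCount_eq S)
  rwa [hX, hw] at hd

end Ctx

/-! ## Bonds -/

theorem cutSet_subset_edgeSet : ∀ e ∈ cutSet G S, e ∈ G.edgeSet := by
  intro e he
  obtain ⟨u, v, rfl, h, -⟩ := mem_cutSet.1 he
  exact h

theorem isDisconnectingSet_cutSet (h1 : ∃ v, v ∈ S) (h2 : ∃ v, v ∉ S) :
    IsDisconnectingSet G (cutSet G S) := by
  refine ⟨cutSet_subset_edgeSet, fun hc => ?_⟩
  obtain ⟨x, hx⟩ := h1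
  obtain ⟨y, hy⟩ := h2
  obtain ⟨w⟩ := hc.preconnected x y
  have key : ∀ (a b : Fin n), (G.deleteEdges (cutSet G S : Set (Sym2 (Fin n)))).Walk a b →
      (a ∈ S ↔ b ∈ S) := by
    intro a b w
    induction w with
    | nil => exact Iff.rfl
    | @cons a b c hab _ ih =>
        rw [SimpleGraph.deleteEdges_adj] at hab
        have : a ∈ S ↔ b ∈ S := by
          by_contra h
          exact hab.2 (mk_mem_cutSet.2 ⟨hab.1, h⟩)
        exact this.trans ih
  exact hy ((key _ _ w).1 hx)

theorem reachable_of_induce {H : SimpleGraph (Fin n)} {A : Set (Fin n)}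
    (hH : ∀ x ∈ A, ∀ y ∈ A, G.Adj x y → H.Adj x y) (hc : (G.induce A).Connected) {x y : Fin n}
    (hx : x ∈ A) (hy : y ∈ A) : H.Reachable x y := by
  obtain ⟨w⟩ := hc.preconnected ⟨x, hx⟩ ⟨y, hy⟩
  have key : ∀ (a b : A), (G.induce A).Walk a b → H.Reachable a b := by
    intro a b w
    induction w with
    | nil => exact .refl _
    | @cons a b c hab _ ih => exact (hH a a.2 b b.2 hab).reachable.trans ih
  exact key _ _ w

/-- A single cut edge that is kept joins two connected sides, so no proper subset of the cut-set
disconnects the graph. -/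
theorem isBond_cutSet (h1 : (G.induce {v | v ∈ S}).Connected)
    (h2 : (G.induce {v | v ∉ S}).Connected) : IsBond G (cutSet G S) := by
  obtain ⟨⟨x₀, hx₀⟩⟩ := h1.nonempty
  obtain ⟨⟨y₀, hy₀⟩⟩ := h2.nonempty
  refine ⟨isDisconnectingSet_cutSet ⟨x₀, hx₀⟩ ⟨y₀, hy₀⟩, fun F hF hFS => ?_⟩
  by_contra hne
  obtain ⟨e, he, heF⟩ := Finset.not_subset.1 hne
  obtain ⟨u, v, rfl, huv, hu, hv⟩ := mem_cutSet.1 he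
  have side : ∀ A : Set (Fin n), (∀ x ∈ A, ∀ y ∈ A, x ∈ S ↔ y ∈ S) → ∀ x ∈ A, ∀ y ∈ A, G.Adj x y →
      (G.deleteEdges (F : Set (Sym2 (Fin n)))).Adj x y := by
    intro A hA x hx y hy hxy
    rw [SimpleGraph.deleteEdges_adj]
    exact ⟨hxy, fun h => (mk_mem_cutSet.1 (hFS h)).2 (hA x hx y hy)⟩
  have r1 : ∀ x ∈ S, (G.deleteEdges (F : Set (Sym2 (Fin n)))).Reachable x u := fun x hx =>
    reachable_of_induce (A := {v | v ∈ S}) (side _ fun x hx y hy => iff_of_true hx hy) h1 hx hu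
  have r2 : ∀ x, x ∉ S → (G.deleteEdges (F : Set (Sym2 (Fin n)))).Reachable x v := fun x hx =>
    reachable_of_induce (A := {v | v ∉ S}) (side _ fun x hx y hy => iff_of_false hx hy) h2 hx hv
  have r3 : (G.deleteEdges (F : Set (Sym2 (Fin n)))).Reachable v u := by
    refine SimpleGraph.Adj.reachable ?_
    rw [SimpleGraph.deleteEdges_adj, Sym2.eq_swap]
    exact ⟨huv.symm, heF⟩
  have r : ∀ x, (G.deleteEdges (F : Set (Sym2 (Fin n)))).Reachable x u := fun x => by
    by_cases hx : x ∈ S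
    · exact r1 x hx
    · exact (r2 x hx).trans r3
  have : Nonempty (Fin n) := ⟨x₀⟩
  exact hF.2 ⟨fun x y => (r x).trans (r y).symm⟩

/-- All edges that leave a component of `G` without `F` belong to `F`, and they already disconnect.
By minimality they are all of `F`. -/
theorem IsBond.component {F : Finset (Sym2 (Fin n))} (hF : IsBond G F) {a b : Fin n}
    (hab : ¬ (G.deleteEdges (F : Set (Sym2 (Fin n)))).Reachable a b)
    (hS : ∀ x, x ∈ S ↔ (G.deleteEdges (F : Set (Sym2 (Fin n)))).Reachable a x) :
    F = cutSet G S ∧ (G.induce {v | v ∈ S}).Connected := by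
  have hsub : cutSet G S ⊆ F := by
    intro e he
    obtain ⟨u, v, rfl, huv, hu, hv⟩ := mem_cutSet.1 he
    by_contra heF
    refine hv ((hS v).2 (((hS u).1 hu).trans (SimpleGraph.Adj.reachable ?_)))
    rw [SimpleGraph.deleteEdges_adj]
    exact ⟨huv, heF⟩
  have ha : a ∈ S := (hS a).2 (.refl a)
  refine ⟨(hF.2 (isDisconnectingSet_cutSet ⟨a, ha⟩ ⟨b, fun h => hab ((hS b).1 h)⟩) hsub).antisymm
    hsub, ?_⟩
  have : Nonempty {v | v ∈ S} := ⟨⟨a, ha⟩⟩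
  have key : ∀ (x y : Fin n), (G.deleteEdges (F : Set (Sym2 (Fin n)))).Walk x y →
      ∀ (hx : x ∈ S) (hy : y ∈ S), (G.induce {v | v ∈ S}).Reachable ⟨x, hx⟩ ⟨y, hy⟩ := by
    intro x y w
    induction w with
    | nil => exact fun _ _ => .refl _
    | @cons x y z hxy _ ih =>
        intro hx hz
        have hy : y ∈ S := (hS y).2 (((hS x).1 hx).trans hxy.reachable)
        refine .trans (SimpleGraph.Adj.reachable ?_) (ih hy hz)
        exact ((SimpleGraph.deleteEdges_adj ..).1 hxy).1
  refine ⟨fun x y => ?_⟩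
  obtain ⟨w⟩ := ((hS x.1).1 x.2).symm.trans ((hS y.1).1 y.2)
  exact key _ _ w x.2 y.2

/-- The bonds of a connected graph are the cut-sets with two connected sides. -/
theorem isBond_iff (hG : G.Connected) {F : Finset (Sym2 (Fin n))} :
    IsBond G F ↔ ∃ S, F = cutSet G S ∧ (G.induce {v | v ∈ S}).Connected ∧
      (G.induce {v | v ∉ S}).Connected := by
  classical
  constructor
  · intro hF
    set H := G.deleteEdges (F : Set (Sym2 (Fin n))) with hH
    have := hG.nonempty
    obtain ⟨a, b, hab⟩ : ∃ a b, ¬ H.Reachable a b := by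
      by_contra! h
      exact hF.1.2 ⟨h⟩
    set S := Finset.univ.filter fun x => H.Reachable a x with hS
    set S' := Finset.univ.filter fun x => H.Reachable b x with hS'
    obtain ⟨e1, c1⟩ := hF.component (S := S) hab (by simp [hS, hH])
    obtain ⟨e2, c2⟩ := hF.component (S := S') (fun h => hab (SimpleGraph.Reachable.symm h))
      (by simp [hS', hH])
    have hdisj : ∀ x, x ∈ S → x ∉ S' := by
      intro x hx hx'
      simp only [hS, hS', Finset.mem_filter, Finset.mem_univ, true_and] at hx hx'
      exact hab (hx.trans hx'.symm)
    -- `F` is the cut-set of both components, so an edge that leaves one of them crosses the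
    -- boundary of the other and must end there. Connectedness of `G` then leaves no third
    -- component.
    have hstep : ∀ x y, G.Adj x y → (x ∈ S ∨ x ∈ S') → (y ∈ S ∨ y ∈ S') := by
      intro x y hxy hx
      by_contra! hy
      rcases hx with hx | hx
      · have : s(x, y) ∈ cutSet G S := mk_mem_cutSet.2 ⟨hxy, by simp [hx, hy.1]⟩
        rw [← e1, e2] at this
        exact (mk_mem_cutSet.1 this).2 (by simp [hdisj x hx, hy.2])
      · have : s(x, y) ∈ cutSet G S' := mk_mem_cutSet.2 ⟨hxy, by simp [hx, hy.2]⟩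
        rw [← e2, e1] at this
        exact (mk_mem_cutSet.1 this).2 (iff_of_false (fun h => hdisj x h hx) hy.1)
    have hall : ∀ x, x ∈ S ∨ x ∈ S' := by
      intro x
      obtain ⟨w⟩ := hG.preconnected a x
      have key : ∀ (x y : Fin n), G.Walk x y → (x ∈ S ∨ x ∈ S') → (y ∈ S ∨ y ∈ S') := by
        intro x y w
        induction w with
        | nil => exact id
        | @cons x y z hxy _ ih => exact fun hx => ih (hstep x y hxy hx)
      exact key a x w (.inl (by simp [hS]))
    refine ⟨S, e1, c1, ?_⟩
    have : {v | v ∉ S} = {v | v ∈ S'} := by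
      ext x
      exact ⟨fun h => (hall x).resolve_left h, fun h h' => hdisj x h' h⟩
    rw [this]; exact c2
  · rintro ⟨S, rfl, h1, h2⟩
    exact isBond_cutSet h1 h2

/-! ## Digits -/

/-- The digit `j` of `c` in base `B`. -/
def dig (B c j : ℕ) : ℕ := c / B ^ j % B

theorem dig_eq_zero {B c L j : ℕ} (hB : 0 < B) (hc : c < B ^ L) (hj : L ≤ j) : dig B c j = 0 := by
  rw [dig, Nat.div_eq_of_lt (hc.trans_le (Nat.pow_le_pow_right hB hj)), Nat.zero_mod]

theorem sum_digits_lt {B : ℕ} {X : ℕ → ℕ} (L : ℕ) (hX : ∀ j < L, X j < B) :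
    ∑ k ∈ Finset.range L, X k * B ^ k < B ^ L := by
  induction L with
  | zero => simp
  | succ L ih =>
      rw [Finset.sum_range_succ, pow_succ]
      have h1 := ih fun j hj => hX j (by omega)
      have h2 := hX L (by omega)
      calc _ < B ^ L + X L * B ^ L := by omega
        _ = (X L + 1) * B ^ L := by ring
        _ ≤ B * B ^ L := Nat.mul_le_mul_right _ h2
        _ = _ := by ring

theorem dig_sum {B : ℕ} (L : ℕ) : ∀ {X : ℕ → ℕ} {j : ℕ}, (∀ j < L, X j < B) → j < L →
    dig B (∑ k ∈ Finset.range L, X k * B ^ k) j = X j := by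
  induction L with
  | zero => intro X j _ hj; omega
  | succ L ih =>
      intro X j hX hj
      have hB : 0 < B := (Nat.zero_le _).trans_lt (hX 0 (by omega))
      have e : ∑ k ∈ Finset.range (L + 1), X k * B ^ k =
          X 0 + B * ∑ k ∈ Finset.range L, X (k + 1) * B ^ k := by
        rw [Finset.sum_range_succ', Finset.mul_sum, add_comm]
        congr 1
        · simp
        · exact Finset.sum_congr rfl fun k _ => by ring
      cases j with
      | zero =>
          rw [dig, e, pow_zero, Nat.div_one, Nat.add_mul_mod_self_left]
          exact Nat.mod_eq_of_lt (hX 0 (by omega))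
      | succ j =>
          have := ih (X := fun k => X (k + 1)) (j := j) (fun k hk => hX (k + 1) (by omega)) (by omega)
          rw [← this, dig, dig, e, pow_succ', ← Nat.div_div_eq_div_mul, Nat.add_mul_div_left _ _ hB,
            Nat.div_eq_of_lt (hX 0 (by omega)), Nat.zero_add]

theorem sum_dig {B : ℕ} (L : ℕ) : ∀ {c : ℕ}, c < B ^ L →
    ∑ k ∈ Finset.range L, dig B c k * B ^ k = c := by
  induction L with
  | zero => intro c hc; simp at hc; simp [hc]
  | succ L ih =>
      intro c hc
      rw [Finset.sum_range_succ']
      have h1 : c / B < B ^ L := Nat.div_lt_of_lt_mul (by rwa [pow_succ, mul_comm] at hc)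
      have h2 := ih h1
      have e : ∑ k ∈ Finset.range L, dig B c (k + 1) * B ^ (k + 1) =
          B * ∑ k ∈ Finset.range L, dig B (c / B) k * B ^ k := by
        rw [Finset.mul_sum]
        refine Finset.sum_congr rfl fun k _ => ?_
        rw [dig, dig, pow_succ' B k, Nat.div_div_eq_div_mul]; ring
      rw [e, h2]
      simp only [dig, pow_zero, Nat.div_one, mul_one]
      exact Nat.div_add_mod c B

namespace Ctx

variable (C : Ctx)

/-- The base of the codes of signatures. -/
def base : ℕ := 2 * C.b + 1

/-- The number of codes of signatures. -/
def size : ℕ := C.base ^ (C.b + 2)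

theorem base_pos : 0 < C.base := Nat.succ_pos _

theorem isCode_dig {c : ℕ} (hc : c < C.size) : C.IsCode (dig C.base c) :=
  ⟨fun _ => Nat.mod_lt _ C.base_pos, fun _ hj => dig_eq_zero C.base_pos hc hj⟩

/-- The code of a signature. -/
def encode (X : ℕ → ℕ) : ℕ := ∑ k ∈ Finset.range (C.b + 2), X k * C.base ^ k

variable {C}

theorem IsCode.encode_lt {X : ℕ → ℕ} (h : C.IsCode X) : C.encode X < C.size :=
  sum_digits_lt _ fun j _ => h.1 j

theorem IsCode.dig_encode {X : ℕ → ℕ} (h : C.IsCode X) : dig C.base (C.encode X) = X := by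
  funext j
  by_cases hj : j < C.b + 2
  · exact dig_sum _ (fun j _ => h.1 j) hj
  · rw [dig_eq_zero C.base_pos h.encode_lt (by omega), h.2 j (by omega)]

theorem encode_dig {c : ℕ} (hc : c < C.size) : C.encode (dig C.base c) = c := sum_dig _ hc

theorem isCode_final (hb : 1 ≤ C.b) : C.IsCode C.final := by
  refine ⟨fun j => ?_, fun j hj => ?_⟩
  · unfold final; split <;> omega
  · exact if_neg (by omega)

/-- The program holds the number of codes and the base; two divisions give `base ^ b`, the weight of
the first counter, and no power has to be computed for the final code. -/
theorem encode_final (_hb : 1 ≤ C.b) :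
    C.encode C.final = C.size / C.base / C.base * (1 + C.base) := by
  have h1 : C.size / C.base / C.base = C.base ^ C.b := by
    rw [size, pow_succ, Nat.mul_div_cancel _ C.base_pos, pow_succ,
      Nat.mul_div_cancel _ C.base_pos]
  rw [h1, encode, Finset.sum_range_succ, Finset.sum_range_succ, Finset.sum_eq_zero]
  · simp only [final, true_or, or_true, if_true, pow_succ]; ring
  · intro k hk
    rw [Finset.mem_range] at hk
    rw [final, if_neg (by omega), Nat.zero_mul]

theorem base_le_size : C.base * C.base ≤ C.size := by
  rw [size, pow_add, pow_two]
  exact Nat.le_mul_of_pos_left _ (Nat.pow_pos C.base_pos)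

end Ctx

/-! ## The program -/

open Exp in
/-- Write the digits of the variable `x` into the array `A`. -/
def decodeStmt (A : Arr) (x : Var) : Stmt := block [
  .assign .r (var x),
  .loop .j .L (block [
    .store A (var .j) (var .r % var .B),
    .assign .r (var .r / var .B)])]

open Exp in
/-- Compute the number with the digits in `X`. -/
def encodeStmt : Stmt := block [
  .assign .c (lit 0),
  .assign .pw (lit 1),
  .loop .j .L (block [
    .assign .c (var .c + get .X (var .j) * var .pw),
    .assign .pw (var .pw * var .B)])]

open Exp in
def renumberStmt : Stmt :=
  .loop .j .b (.ite (same (get .X (var .j)) (var .aa)) (.store .X (var .j) (var .ee)) .skip)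

open Exp in
def leafStmt : Stmt := .loop .j .L (.store .X (var .j) (lit 0))

open Exp in
def introStmt : Stmt := block [
  .assign .d (get .Y (lit 0)),
  .ite (var .d) .skip (.assign .ok (lit 0)),
  .loop .j .b (.ite (same (get .X (var .j)) (var .d)) (.assign .ok (lit 0)) .skip),
  .ite (var .st) (block [
    .ite (same (var .u) (var .s))
      (.ite (same (var .d % (lit 2)) (lit 1)) .skip (.assign .ok (lit 0))) .skip,
    .ite (same (var .u) (var .t))
      (.ite (same (var .d % (lit 2)) (lit 1)) (.assign .ok (lit 0)) .skip) .skip]) .skip,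
  .store .X (var .p) (var .d)]

open Exp in
def edgeStmt : Stmt :=
  .ite (same (get .X (var .p) % (lit 2)) (get .X (var .q) % (lit 2)))
    (block [.assign .aa (get .X (var .p)), .assign .ee (get .X (var .q)), renumberStmt])
    (.assign .g (lit 1))

open Exp in
def forgetStmt : Stmt := block [
  .assign .aa (get .X (var .p)),
  -- The slot is cleared before the search so that a forgotten vertex with a positive label is not
  -- found as its own mate.
  .store .X (var .p) (lit 0),
  .assign .f (lit 0),
  .loop .j .b (.ite (same (get .X (var .j)) (var .aa)) (.assign .f (lit 1)) .skip),
  .ite (var .f) .skip (block [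
    .assign .r (var .b + (lit 1) - var .aa % (lit 2)),
    .store .X (var .r) (get .X (var .r) + (lit 1))])]

open Exp in
def joinStmt : Stmt := block [
  .loop .j .b (.ite (same (get .X (var .j) % (lit 2)) (get .Y (var .j) % (lit 2))) .skip (.assign .ok (lit 0))),
  .loop .j1 .b (.loop .j2 .b (
    .ite (same (get .Y (var .j1)) (get .Y (var .j2)))
      (block [.assign .aa (get .X (var .j1)), .assign .ee (get .X (var .j2)), renumberStmt])
      .skip)),
  .store .X (var .b) (get .X (var .b) + get .Y (var .b)),
  .store .X (var .b + (lit 1)) (get .X (var .b + (lit 1)) + get .Y (var .b + (lit 1)))]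

open Exp in
def clampStmt : Stmt := block [
  .ite (less (lit 1) (get .X (var .b))) (.assign .ok (lit 0)) .skip,
  .ite (less (lit 1) (get .X (var .b + (lit 1))))
    (.ite (var .conn) (.assign .ok (lit 0)) (.store .X (var .b + (lit 1)) (lit 1))) .skip]

open Exp in
/-- Combine the signatures in `X` and `Y` at a node of type `ty`. -/
def stepStmt : Stmt := block [
  .assign .ok (lit 1),
  .assign .g (lit 0),
  .ite (same (var .ty) (lit 0)) leafStmt
    (.ite (same (var .ty) (lit 1)) introStmt
      (.ite (same (var .ty) (lit 2)) edgeStmt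
        (.ite (same (var .ty) (lit 3)) forgetStmt joinStmt))),
  clampStmt]

/-! ### Specifications -/

/-- The rule of consequence: what follows a statement may use its postcondition `R` together with
all values that it cannot have changed. -/
theorem wp_use {W : ℕ} {p : Stmt} {R Q : HState → Prop} {σ : HState} (h : wp W p R σ)
    (k : ∀ τ, R τ → Frame p.writes p.stores σ τ → Q τ) : wp W p Q σ :=
  wp_mono W p (fun τ hτ => k τ hτ.1 hτ.2) (wp_frame W p h)

/-- The state holds the parameters of the algorithm. -/
structure Env (W N : ℕ) (C : Ctx) (σ : HState) : Prop where
  b : σ.v .b = C.b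
  L : σ.v .L = C.b + 2
  B : σ.v .B = C.base
  M : σ.v .M = C.size
  nodes : σ.v .N = N
  conn : σ.v .conn = C.conn
  st : σ.v .st = C.st
  s : σ.v .s = C.s
  t : σ.v .t = C.t
  slot : σ.a .slot = C.slot
  pos : 1 ≤ C.b
  word : 4 * (N + 1) * C.size ≤ W

def envVars : List Var := [.b, .L, .B, .M, .N, .conn, .st, .s, .t]

theorem Env.frame {W N : ℕ} {C : Ctx} {σ τ : HState} (h : Env W N C σ) {xs : List Var}
    {As : List Arr} (hf : Frame xs As σ τ) (hx : ∀ y ∈ envVars, y ∉ xs) (hA : Arr.slot ∉ As) :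
    Env W N C τ := by
  have e : ∀ y ∈ envVars, τ.v y = σ.v y := fun y hy => hf.v y (hx y hy)
  exact ⟨(e _ (by decide)).trans h.b, (e _ (by decide)).trans h.L, (e _ (by decide)).trans h.B,
    (e _ (by decide)).trans h.M, (e _ (by decide)).trans h.nodes, (e _ (by decide)).trans h.conn,
    (e _ (by decide)).trans h.st, (e _ (by decide)).trans h.s, (e _ (by decide)).trans h.t,
    (hf.a _ hA).trans h.slot, h.pos, h.word⟩

theorem Env.size_le {W N : ℕ} {C : Ctx} {σ : HState} (h : Env W N C σ) : 4 * C.size ≤ W := by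
  refine le_trans ?_ h.word
  exact Nat.mul_le_mul_right _ (by omega)

theorem Env.base_le {W N : ℕ} {C : Ctx} {σ : HState} (h : Env W N C σ) : 4 * C.base ≤ W := by
  have h1 := h.size_le
  have h2 := C.base_le_size
  have h3 := Nat.le_mul_of_pos_left C.base C.base_pos
  omega

theorem Env.b_le {W N : ℕ} {C : Ctx} {σ : HState} (h : Env W N C σ) : C.b + 2 ≤ W ∧ 12 ≤ W := by
  have h1 := h.base_le
  have h2 := h.pos
  unfold Ctx.base at h1
  omega

/-- Only the first `b + 2` cells are written. The array agrees with the digit function everywhere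
because its other cells were zero and so are the higher digits of a code. -/
theorem wp_decodeStmt {W N : ℕ} {C : Ctx} {σ : HState} (h : Env W N C σ) {A : Arr} {x : Var}
    (hx : σ.v x < C.size) (hA : ∀ k, C.b + 2 ≤ k → σ.a A k = 0) :
    wp W (decodeStmt A x) (fun τ => τ.a A = dig C.base (σ.v x)) σ := by
  simp only [decodeStmt, wp_block_cons, wp_assign, Exp.ok_var, true_and,
    Exp.eval_var]
  refine wp_loop (fun k τ => τ.v .r = σ.v x / C.base ^ k ∧
    τ.a A = fun j => if j < k then dig C.base (σ.v x) j else σ.a A j) (by simp [block, Stmt.writes]) ?_ ?_ ?_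
  · simp
  · intro k hk τ hf hj hI
    have hB : τ.v .B = C.base := by rw [← h.B, hf.v _ (by simp [block, Stmt.writes])]; simp
    simp only [wp_block_cons, wp_block_nil, wp_assign, wp_store, Exp.ok_var, Exp.ok_mod,
      Exp.ok_div, true_and, Exp.eval_var, Exp.eval_mod, Exp.eval_div, hB, hj, hI.1]
    refine ⟨by simp [hB, hI.1, Nat.div_div_eq_div_mul, pow_succ], ?_⟩
    funext j
    simp only [HState.set_a, HState.put_a, if_true, Function.update_apply, hI.2]
    by_cases h1 : j = k
    · simp [h1, dig]
    · simp [h1, show j < k + 1 ↔ j < k by omega]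
  · intro τ _ hI
    change τ.a A = _
    rw [hI.2]
    funext j
    simp only [HState.set_v, reduceCtorEq, if_false, h.L]
    split
    · rfl
    · rw [hA j (by omega), dig_eq_zero C.base_pos hx (by omega)]

theorem wp_encodeStmt {W N : ℕ} {C : Ctx} {σ : HState} (h : Env W N C σ)
    (hX : C.IsCode (σ.a .X)) :
    wp W encodeStmt (fun τ => τ.v .c = C.encode (σ.a .X)) σ := by
  have hW := h.size_le
  have hW' := h.b_le
  simp only [encodeStmt, wp_block_cons, wp_assign, Exp.ok_lit, Exp.eval_lit]
  refine ⟨by omega, by omega, ?_⟩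
  refine wp_loop (fun k τ => τ.v .c = ∑ i ∈ Finset.range k, σ.a .X i * C.base ^ i ∧
    τ.v .pw = C.base ^ k) (by decide) (by simp) ?_ ?_
  · intro k hk τ hf hj hI
    simp only [HState.set_v, reduceCtorEq, if_false, h.L] at hk
    have hB : τ.v .B = C.base := by rw [← h.B, hf.v _ (by decide)]; simp
    have hXτ : τ.a .X = σ.a .X := hf.a _ (by decide)
    have h1 : ∑ i ∈ Finset.range (k + 1), σ.a .X i * C.base ^ i < C.base ^ (k + 1) :=
      sum_digits_lt _ fun j _ => hX.1 j
    have h2 : C.base ^ (k + 1) ≤ C.size := Nat.pow_le_pow_right C.base_pos (by omega)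
    rw [Finset.sum_range_succ] at h1
    simp only [wp_block_cons, wp_block_nil, wp_assign, Exp.ok_var, Exp.ok_get, Exp.ok_add,
      Exp.ok_mul, true_and, Exp.eval_var, Exp.eval_add, Exp.eval_mul, Exp.eval_get, hB, hj,
      hI.1, hI.2, hXτ, HState.set_v, reduceCtorEq, if_false, if_true,
      Finset.sum_range_succ, ← pow_succ, and_true]
    omega
  · intro τ hf hI
    change τ.v .c = _
    rw [hI.1]
    simp [Ctx.encode, h.L]

/-- The labels are compared with copies in `aa` and `ee`, so overwriting cells does not disturb
later rounds. After `k` rounds the array is the renumbering with `k` in place of the number of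
slots. -/
theorem wp_renumberStmt {W : ℕ} {σ : HState} :
    wp W renumberStmt (fun τ => τ.a .X = renumber (σ.v .b) (σ.a .X) (σ.v .aa) (σ.v .ee)) σ := by
  refine wp_loop (fun k τ => τ.a .X = renumber k (σ.a .X) (σ.v .aa) (σ.v .ee)) (by decide) ?_ ?_ ?_
  · funext j; simp [renumber]
  · intro k hk τ hf hj hI
    have ha : τ.v .aa = σ.v .aa := hf.v _ (by decide)
    have he : τ.v .ee = σ.v .ee := hf.v _ (by decide)
    have hXk : τ.a .X k = σ.a .X k := by rw [hI, renumber_of_le le_rfl]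
    simp only [wp_ite, wp_store, wp_skip, Exp.ok_same, Exp.ok_get, Exp.ok_var, Exp.eval_same,
      Exp.eval_get, Exp.eval_var, hj, ha, he, hXk, true_and, HState.set_a, HState.put_a, if_true]
    constructor
    · intro h
      have h : σ.a .X k = σ.v .aa := by by_contra h'; simp [h'] at h
      funext j
      by_cases hjk : j = k
      · simp [hjk, renumber, h]
      · simp [hjk, hI, renumber, show j < k + 1 ↔ j < k by omega]
    · intro h
      have h : σ.a .X k ≠ σ.v .aa := by intro h'; simp [h'] at h
      rw [hI]
      funext j
      by_cases hjk : j = k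
      · simp [hjk, renumber, h]
      · simp [renumber, show j < k + 1 ↔ j < k by omega]
  · exact fun τ _ h => h

theorem wp_ite_same {W : ℕ} {e e' : Exp} {p q : Stmt} {Q : HState → Prop} {σ : HState} :
    wp W (.ite (.same e e') p q) Q σ ↔ e.ok W σ ∧ e'.ok W σ ∧
      (e.eval σ = e'.eval σ → wp W p Q σ) ∧ (e.eval σ ≠ e'.eval σ → wp W q Q σ) := by
  rw [wp_ite, Exp.ok_same, Exp.eval_same]
  by_cases h : e.eval σ = e'.eval σ <;> simp [h, and_assoc]

theorem wp_ite_less {W : ℕ} {e e' : Exp} {p q : Stmt} {Q : HState → Prop} {σ : HState} :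
    wp W (.ite (.less e e') p q) Q σ ↔ e.ok W σ ∧ e'.ok W σ ∧
      (e.eval σ < e'.eval σ → wp W p Q σ) ∧ (¬ e.eval σ < e'.eval σ → wp W q Q σ) := by
  rw [wp_ite, Exp.ok_less, Exp.eval_less]
  by_cases h : e.eval σ < e'.eval σ <;> simp [h, and_assoc]

theorem wp_leafStmt {W N : ℕ} {C : Ctx} {σ : HState} (h : Env W N C σ)
    (hX : ∀ k, C.b + 2 ≤ k → σ.a .X k = 0) :
    wp W leafStmt (fun τ => τ.a .X = fun _ => 0) σ := by
  refine wp_loop (fun k τ => τ.a .X = fun j => if j < k then 0 else σ.a .X j) (by decide)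
    (by simp) ?_ ?_
  · intro k hk τ hf hj hI
    simp only [wp_store, Exp.ok_var, Exp.ok_lit, Nat.zero_le, true_and, Exp.eval_var, Exp.eval_lit,
      hj, HState.set_a, HState.put_a, if_true, hI]
    funext j
    by_cases hjk : j = k
    · simp [hjk]
    · simp [hjk, show j < k + 1 ↔ j < k by omega]
  · intro τ _ hI
    rw [hI]
    funext j
    rw [h.L]
    split
    · rfl
    · exact hX j (by omega)

theorem wp_introStmt {W N : ℕ} {C : Ctx} {σ : HState} (h : Env W N C σ) (hok : σ.v .ok = 1) :
    wp W introStmt (fun τ => τ.a .X = Function.update (σ.a .X) (σ.v .p) (σ.a .Y 0) ∧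
      (τ.v .ok ≠ 0 ↔ C.preOk 1 (σ.v .u) (σ.a .X) (σ.a .Y))) σ := by
  have hW := h.b_le
  set d := σ.a .Y 0 with hd
  unfold introStmt
  rw [wp_block_cons, wp_assign, wp_block_cons]
  refine ⟨by simp, wp_use (R := fun τ => τ.v .ok ≠ 0 ↔ d ≠ 0) ?_ fun τ h₁ f₁ => ?_⟩
  · simp only [wp_ite, wp_assign, wp_skip, Exp.ok_var, Exp.ok_lit, Exp.eval_var, Exp.eval_get,
      Exp.eval_lit, HState.set_v, if_true, reduceCtorEq, if_false, Nat.zero_le, true_and, hok, ← hd]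
    tauto
  have d₁ : τ.v .d = d := by rw [f₁.v _ (by decide)]; simp [hd]
  have X₁ : τ.a .X = σ.a .X := by rw [f₁.a _ (by decide)]; rfl
  have b₁ : τ.v .b = C.b := by rw [f₁.v _ (by decide)]; simp [h.b]
  rw [wp_block_cons]
  refine wp_use (R := fun υ => υ.v .ok ≠ 0 ↔ (d ≠ 0 ∧ ∀ j < C.b, σ.a .X j ≠ d)) ?_
    fun υ h₂ f₂ => ?_
  · refine wp_loop (fun k υ => υ.v .ok ≠ 0 ↔ (d ≠ 0 ∧ ∀ j < k, σ.a .X j ≠ d)) (by decide)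
      (by simpa using h₁) ?_ ?_
    · intro k hk υ hf hj hI
      have d₂ : υ.v .d = d := (hf.v _ (by decide)).trans d₁
      have X₂ : υ.a .X = σ.a .X := (hf.a _ (by decide)).trans X₁
      have split : (∀ j < k + 1, σ.a .X j ≠ d) ↔ (∀ j < k, σ.a .X j ≠ d) ∧ σ.a .X k ≠ d :=
        ⟨fun H => ⟨fun j hj => H j (by omega), H k (by omega)⟩, fun H j hj => by
          rcases Nat.lt_succ_iff_lt_or_eq.1 hj with h | rfl
          · exact H.1 j h
          · exact H.2⟩
      simp only [wp_ite_same, wp_assign, wp_skip, Exp.ok_get, Exp.ok_var, Exp.ok_lit, Exp.eval_get,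
        Exp.eval_var, Exp.eval_lit, hj, X₂, d₂, split, HState.set_v, reduceCtorEq, if_false,
        if_true, Nat.zero_le, true_and]
      tauto
    · intro υ _ hI
      rw [hI, b₁]
  have e : ∀ y, y ∉ [Var.j, Var.ok, Var.d] → υ.v y = σ.v y := by
    intro y hy
    simp only [List.mem_cons, List.not_mem_nil, or_false, not_or] at hy
    rw [f₂.v y (by simp [Stmt.writes, hy]), f₁.v y (by simp [Stmt.writes, hy])]
    simp [hy]
  have d₂ : υ.v .d = d := (f₂.v _ (by decide)).trans d₁
  have X₂ : υ.a .X = σ.a .X := (f₂.a _ (by decide)).trans X₁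
  rw [wp_block_cons]
  refine wp_use (R := fun ω => ω.v .ok ≠ 0 ↔ C.preOk 1 (σ.v .u) (σ.a .X) (σ.a .Y)) ?_
    fun ω h₃ f₃ => ?_
  · have key : C.preOk 1 (σ.v .u) (σ.a .X) (σ.a .Y) ↔ (υ.v .ok ≠ 0 ∧
        (C.st ≠ 0 → (σ.v .u = C.s → d % 2 = 1) ∧ (σ.v .u = C.t → d % 2 ≠ 1))) := by
      simp only [Ctx.preOk, h₂, ← hd, if_true, if_neg (show (1 : ℕ) ≠ 0 by decide)]
      tauto
    rw [key]
    rw [wp_ite, wp_skip, Exp.eval_var, e .st (by decide), h.st]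
    refine ⟨trivial, fun h₀ => ?_, fun h₀ => by simp [h₀]⟩
    simp only [wp_ite_same, wp_block_cons, wp_block_nil, wp_assign, wp_skip, Exp.ok_var,
      Exp.ok_lit, Exp.ok_mod, Exp.eval_var, Exp.eval_lit, Exp.eval_mod, HState.set_v, reduceCtorEq,
      if_false, if_true, Nat.zero_le, true_and, d₂, e .u (by decide),
      e .s (by decide), e .t (by decide), h.s, h.t, ne_eq, show 1 ≤ W by omega,
      show 2 ≤ W by omega]
    generalize (σ.v .u = C.s) = Ps, (σ.v .u = C.t) = Pt
    by_cases hs : Ps <;> by_cases ht : Pt <;> by_cases hd2 : d % 2 = 1 <;> simp [h₀, hs, ht, hd2]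
  · have d₃ : ω.v .d = d := (f₃.v _ (by decide)).trans d₂
    have X₃ : ω.a .X = σ.a .X := (f₃.a _ (by decide)).trans X₂
    have p₃ : ω.v .p = σ.v .p := (f₃.v _ (by decide)).trans (e _ (by decide))
    simp only [wp_block_cons, wp_block_nil, wp_store, Exp.ok_var, Exp.eval_var, true_and,
      HState.put_a, if_true, HState.put_v, X₃, d₃, p₃]
    exact h₃

theorem wp_edgeStmt {W N : ℕ} {C : Ctx} {σ : HState} (h : Env W N C σ) (hg : σ.v .g = 0)
    {u w : ℕ} (hp : σ.v .p = C.slot u) (hq : σ.v .q = C.slot w) (Y : ℕ → ℕ) :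
    wp W edgeStmt (fun τ => τ.a .X = C.preOut 2 u w (σ.a .X) Y ∧
      τ.v .g = C.stepGain 2 u w (σ.a .X)) σ := by
  have hW := h.b_le
  unfold edgeStmt
  simp only [wp_ite_same, wp_block_cons, wp_assign, Exp.ok_var, Exp.ok_get, Exp.ok_mod,
    Exp.ok_lit, Exp.eval_mod, Exp.eval_get, Exp.eval_var, Exp.eval_lit, hp, hq, HState.set_v,
    HState.set_a, reduceCtorEq, if_false, true_and, show 1 ≤ W by omega, show 2 ≤ W by omega,
    if_true]
  refine ⟨fun H => ?_, fun H => ?_⟩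
  · refine wp_use wp_renumberStmt fun τ h₁ f₁ => ?_
    simp only [HState.set_v, HState.set_a, reduceCtorEq, if_false, if_true, h.b] at h₁
    rw [wp_block_nil, h₁, f₁.v .g (by decide)]
    simp [Ctx.preOut, Ctx.stepGain, H, hg]
  · simp [Ctx.preOut, Ctx.stepGain, H]

theorem wp_forgetStmt {W N : ℕ} {C : Ctx} {σ : HState} (h : Env W N C σ)
    (hX : ∀ j, σ.a .X j < C.base) :
    wp W forgetStmt (fun τ => τ.a .X = C.forgetOut (σ.v .p) (σ.a .X)) σ := by
  have hW := h.b_le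
  have hW' := h.base_le
  have hpos := C.base_pos
  set X := Function.update (σ.a .X) (σ.v .p) 0 with hXdef
  set a := σ.a .X (σ.v .p) with ha
  unfold forgetStmt
  simp only [wp_block_cons, wp_assign, wp_store, Exp.ok_var, Exp.ok_get, Exp.ok_lit, Exp.eval_get,
    Exp.eval_var, Exp.eval_lit, HState.set_v, HState.set_a, HState.put_v, reduceCtorEq, if_false,
    true_and, Nat.zero_le, ← ha]
  refine wp_use (R := fun τ => τ.v .f ≠ 0 ↔ ∃ j < C.b, X j = a) ?_ fun τ h₁ f₁ => ?_
  · refine wp_loop (fun k τ => τ.v .f ≠ 0 ↔ ∃ j < k, X j = a) (by decide) (by simp) ?_ ?_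
    · intro k hk τ hf hj hI
      have a₁ : τ.v .aa = a := by rw [hf.v _ (by decide)]; simp
      have X₁ : τ.a .X = X := by rw [hf.a _ (by decide)]; simp [hXdef]
      have split : (∃ j < k + 1, X j = a) ↔ (∃ j < k, X j = a) ∨ X k = a := by
        constructor
        · rintro ⟨j, hj, e⟩
          rcases Nat.lt_succ_iff_lt_or_eq.1 hj with h | rfl
          · exact .inl ⟨j, h, e⟩
          · exact .inr e
        · rintro (⟨j, hj, e⟩ | e)
          · exact ⟨j, by omega, e⟩
          · exact ⟨k, by omega, e⟩
      simp only [wp_ite_same, wp_assign, wp_skip, Exp.ok_get, Exp.ok_var, Exp.ok_lit, Exp.eval_get,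
        Exp.eval_var, Exp.eval_lit, hj, X₁, a₁, split, HState.set_v, reduceCtorEq, if_false,
        if_true, true_and, show 1 ≤ W by omega]
      refine ⟨fun e => ?_, fun e => ?_⟩
      · simp [e]
      · rw [hI]; simp [e]
    · intro τ _ hI
      rw [hI]; simp [h.b]
  · have a₁ : τ.v .aa = a := by rw [f₁.v _ (by decide)]; simp
    have X₁ : τ.a .X = X := by rw [f₁.a _ (by decide)]; simp [hXdef]
    have b₁ : τ.v .b = C.b := by rw [f₁.v _ (by decide)]; simp [h.b]
    have hX1 : ∀ j, X j < C.base := by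
      intro j
      rw [hXdef, Function.update_apply]
      split
      · exact hpos
      · exact hX j
    have hX' := hX1 (C.b + 1 - a % 2)
    simp only [wp_ite, wp_skip, wp_block_cons, wp_block_nil, wp_assign, wp_store, Exp.ok_var,
      Exp.ok_get, Exp.ok_lit, Exp.ok_add, Exp.ok_sub, Exp.ok_mod, Exp.eval_get, Exp.eval_var,
      Exp.eval_lit, Exp.eval_add, Exp.eval_sub, Exp.eval_mod, HState.set_v, HState.set_a,
      HState.put_a, reduceCtorEq, if_false, if_true, true_and, X₁, a₁, b₁, h₁]
    refine ⟨fun H => ?_, fun H => ⟨by omega, by omega, ?_⟩⟩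
    · rw [Ctx.forgetOut, if_pos H]
    · have H' : ¬ ∃ j < C.b, X j = a := fun h' => h₁.2 h' H
      rw [Ctx.forgetOut, if_neg H']

theorem wp_joinStmt {W N : ℕ} {C : Ctx} {σ : HState} (h : Env W N C σ) (hok : σ.v .ok = 1)
    (hX : ∀ j, σ.a .X j < C.base) (hY : ∀ j, σ.a .Y j < C.base) (u : ℕ) :
    wp W joinStmt (fun τ => τ.a .X = C.joinOut (σ.a .X) (σ.a .Y) ∧
      (τ.v .ok ≠ 0 ↔ C.preOk 4 u (σ.a .X) (σ.a .Y))) σ := by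
  have hW := h.b_le
  have hW' := h.base_le
  set X := σ.a .X with hXd
  set Y := σ.a .Y with hYd
  unfold joinStmt
  rw [wp_block_cons]
  refine wp_use (R := fun τ => τ.v .ok ≠ 0 ↔ ∀ j < C.b, X j % 2 = Y j % 2) ?_ fun τ h₁ f₁ => ?_
  · refine wp_loop (fun k τ => τ.v .ok ≠ 0 ↔ ∀ j < k, X j % 2 = Y j % 2) (by decide)
      (by simp [hok]) ?_ ?_
    · intro k hk τ hf hj hI
      have X₁ : τ.a .X = X := hf.a _ (by decide)
      have Y₁ : τ.a .Y = Y := hf.a _ (by decide)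
      have split : (∀ j < k + 1, X j % 2 = Y j % 2) ↔
          (∀ j < k, X j % 2 = Y j % 2) ∧ X k % 2 = Y k % 2 :=
        ⟨fun H => ⟨fun j hj => H j (by omega), H k (by omega)⟩, fun H j hj => by
          rcases Nat.lt_succ_iff_lt_or_eq.1 hj with h | rfl
          · exact H.1 j h
          · exact H.2⟩
      simp only [wp_ite_same, wp_assign, wp_skip, Exp.ok_get, Exp.ok_var, Exp.ok_lit, Exp.ok_mod,
        Exp.eval_get, Exp.eval_var, Exp.eval_lit, Exp.eval_mod, hj, X₁, Y₁, split, HState.set_v,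
        reduceCtorEq, if_false, if_true, true_and, Nat.zero_le, show 2 ≤ W by omega]
      tauto
    · intro τ _ hI
      rw [hI, h.b]
  have X₁ : τ.a .X = X := f₁.a _ (by decide)
  have Y₁ : τ.a .Y = Y := f₁.a _ (by decide)
  have b₁ : τ.v .b = C.b := (f₁.v _ (by decide)).trans h.b
  rw [wp_block_cons]
  refine wp_use (R := fun υ => υ.a .X = merge C.b Y X) ?_ fun υ h₂ f₂ => ?_
  · refine wp_loop (fun k υ => υ.a .X = iter (fun p => iter (mergeStep C.b Y p) C.b) k X)
      (by decide) (by simpa [iter] using X₁) ?_ ?_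
    · intro k hk υ hf hk' hI
      have Y₂ : υ.a .Y = Y := (hf.a _ (by decide)).trans Y₁
      have b₂ : υ.v .b = C.b := (hf.v _ (by decide)).trans b₁
      set Z := iter (fun p => iter (mergeStep C.b Y p) C.b) k X with hZ
      refine wp_loop (fun l ω => ω.a .X = iter (mergeStep C.b Y k) l Z)
        (by decide) (by simpa [iter] using hI) ?_ ?_
      · intro l hl ω hf' hl' hI'
        have Y₃ : ω.a .Y = Y := (hf'.a _ (by decide)).trans Y₂
        have b₃ : ω.v .b = C.b := (hf'.v _ (by decide)).trans b₂
        have k₃ : ω.v .j1 = k := (hf'.v _ (by decide)).trans hk'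
        simp only [wp_ite_same, wp_block_cons, wp_assign, wp_skip, Exp.ok_get, Exp.ok_var,
          Exp.eval_get, Exp.eval_var, Y₃, k₃, hl', HState.set_v, HState.set_a, reduceCtorEq,
          if_false, true_and]
        refine ⟨fun e => ?_, fun e => ?_⟩
        · refine wp_use wp_renumberStmt fun ξ h₄ f₄ => ?_
          simp only [HState.set_v, HState.set_a, reduceCtorEq, if_false, if_true, b₃] at h₄
          rw [wp_block_nil]
          rw [h₄, hI']
          simp [iter, mergeStep, e]
        · rw [hI']
          simp [iter, mergeStep, e]
      · intro ω _ hI'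
        change ω.a .X = _
        rw [hI', b₂]
        rfl
    · intro υ _ hI
      rw [hI, b₁]; rfl
  have Y₂ : υ.a .Y = Y := (f₂.a _ (by decide)).trans Y₁
  have b₂ : υ.v .b = C.b := (f₂.v _ (by decide)).trans b₁
  have ok₂ : υ.v .ok = τ.v .ok := f₂.v _ (by decide)
  have m₁ : merge C.b Y X C.b = X C.b := merge_of_le le_rfl
  have m₂ : merge C.b Y X (C.b + 1) = X (C.b + 1) := merge_of_le (by omega)
  have x₁ := hX C.b
  have x₂ := hX (C.b + 1)
  have y₁ := hY C.b
  have y₂ := hY (C.b + 1)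
  simp only [wp_block_cons, wp_block_nil, wp_store, Exp.ok_var, Exp.ok_get, Exp.ok_lit, Exp.ok_add,
    Exp.eval_get, Exp.eval_var, Exp.eval_lit, Exp.eval_add, HState.put_a, HState.put_v,
    reduceCtorEq, if_false, if_true, true_and, h₂, Y₂, b₂, ok₂, h₁,
    Function.update_of_ne (show C.b + 1 ≠ C.b by omega), m₁, m₂]
  refine ⟨by omega, ⟨by omega, by omega⟩, ⟨⟨by omega, by omega⟩, ⟨by omega, by omega⟩, by omega⟩,
    ?_, Iff.rfl⟩
  rw [Ctx.joinOut, m₁, m₂]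

/-- Rejected pairs are covered too: the next decoding into the same array relies on its high cells
being zero, whether or not this step was accepted. -/
theorem Ctx.preOut_eq_zero {C : Ctx} {ty u v : ℕ} {X Y : ℕ → ℕ} (hX : C.IsCode X)
    (hu : ty = 1 → C.slot u < C.b) {j : ℕ} (hj : C.b + 2 ≤ j) : C.preOut ty u v X Y j = 0 := by
  have hj' := hX.2 j hj
  unfold preOut
  split_ifs with h0 h1 h2 h3 h4
  · rfl
  · have := hu h1
    rw [Function.update_of_ne (by omega), hj']
  · rw [renumber_of_le (by omega), hj']
  · exact hj'
  · have : j ≠ C.b + 1 - X (C.slot u) % 2 := by omega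
    unfold forgetOut
    split <;> simp [Function.update_apply, this, hj']
  · simp only [joinOut, Function.update_apply, show j ≠ C.b + 1 by omega,
      show j ≠ C.b by omega, if_false]
    rw [merge_of_le (by omega), hj']

theorem wp_clampStmt {W N : ℕ} {C : Ctx} {σ : HState} (h : Env W N C σ) :
    wp W clampStmt (fun τ => (τ.v .ok ≠ 0 ↔ σ.v .ok ≠ 0 ∧ σ.a .X C.b ≤ 1 ∧
        (C.conn ≠ 0 → σ.a .X (C.b + 1) ≤ 1)) ∧
      (τ.v .ok ≠ 0 → τ.a .X = Function.update (σ.a .X) (C.b + 1) (min 1 (σ.a .X (C.b + 1)))) ∧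
      ∀ k, k ≠ C.b + 1 → τ.a .X k = σ.a .X k) σ := by
  have hW := h.b_le
  unfold clampStmt
  rw [wp_block_cons]
  refine wp_use (R := fun τ => τ.a .X = σ.a .X ∧ (τ.v .ok ≠ 0 ↔ σ.v .ok ≠ 0 ∧ σ.a .X C.b ≤ 1)) ?_
    fun τ h₁ f₁ => ?_
  · simp only [wp_ite_less, wp_assign, wp_skip, Exp.ok_get, Exp.ok_var, Exp.ok_lit, Exp.eval_get,
      Exp.eval_var, Exp.eval_lit, h.b, HState.set_v, HState.set_a, if_true, Nat.zero_le, true_and]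
    refine ⟨by omega, fun _ => ⟨?_, ?_⟩, fun _ => ?_⟩
    · simp
    · omega
    · simp; omega
  have b₁ : τ.v .b = C.b := (f₁.v _ (by decide)).trans h.b
  have c₁ : τ.v .conn = C.conn := (f₁.v _ (by decide)).trans h.conn
  rw [wp_block_cons, wp_ite_less]
  simp only [Exp.ok_get, Exp.ok_var, Exp.ok_lit, Exp.ok_add, Exp.eval_get,
      Exp.eval_var, Exp.eval_lit, Exp.eval_add, b₁, h₁.1, wp_skip, wp_block_nil]
  refine ⟨by omega, ⟨trivial, by omega, by omega⟩, fun H => ?_, fun H => ⟨?_, fun _ => ?_, ?_⟩⟩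
  · simp only [wp_ite, wp_assign, wp_store, Exp.ok_get, Exp.ok_var, Exp.ok_lit, Exp.ok_add,
      Exp.eval_get, Exp.eval_var, Exp.eval_lit, Exp.eval_add, b₁, c₁, h₁.1, h₁.2, HState.set_v,
      HState.set_a, HState.put_v, HState.put_a, if_true, Nat.zero_le, true_and]
    refine ⟨fun hc => ⟨?_, ?_, ?_⟩, fun hc => ⟨⟨by omega, by omega⟩, by omega, ⟨?_, ?_, ?_⟩⟩⟩
    · simp [hc]; omega
    · simp
    · simp [h₁.1]
    · simpa [hc] using h₁.2
    · rw [min_eq_left (by omega)]; simp [h₁.1]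
    · exact fun k hk => (Function.update_of_ne hk _ _).trans (congrFun h₁.1 k)
  · rw [h₁.2]
    have : σ.a .X (C.b + 1) ≤ 1 := by omega
    simp [this]
  · rw [min_eq_right (by omega), Function.update_eq_self]
  · simp

theorem wp_stepStmt {W N : ℕ} {C : Ctx} {σ : HState} (h : Env W N C σ)
    (hX : C.IsCode (σ.a .X)) (hY : C.IsCode (σ.a .Y)) {ty u w : ℕ} (hty : σ.v .ty = ty)
    (hty4 : ty ≤ 4) (hu : σ.v .u = u) (hp : σ.v .p = C.slot u) (hq : σ.v .q = C.slot w)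
    (hslot : ty = 1 → C.slot u < C.b) :
    wp W stepStmt (fun τ => (τ.v .ok ≠ 0 ↔ C.stepOk ty u w (σ.a .X) (σ.a .Y)) ∧
      (τ.v .ok ≠ 0 → τ.a .X = C.stepOut ty u w (σ.a .X) (σ.a .Y)) ∧
      τ.v .g = C.stepGain ty u w (σ.a .X) ∧ ∀ k, C.b + 2 ≤ k → τ.a .X k = 0) σ := by
  have hW := h.b_le
  set X := σ.a .X with hXd
  set Y := σ.a .Y with hYd
  unfold stepStmt
  simp only [wp_block_cons, wp_assign, Exp.ok_lit, Exp.eval_lit, Nat.zero_le, true_and]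
  refine ⟨by omega, ?_⟩
  set ρ := (σ.set .ok 1).set .g 0 with hρ
  have Eρ : Env W N C ρ := ⟨h.b, h.L, h.B, h.M, h.nodes, h.conn, h.st, h.s, h.t, h.slot, h.pos,
    h.word⟩
  have ok₀ : ρ.v .ok = 1 := by simp [hρ]
  have g₀ : ρ.v .g = 0 := by simp [hρ]
  have X₀ : ρ.a .X = X := rfl
  have Y₀ : ρ.a .Y = Y := rfl
  have p₀ : ρ.v .p = C.slot u := hp
  have q₀ : ρ.v .q = C.slot w := hq
  have u₀ : ρ.v .u = u := hu
  have ty₀ : ρ.v .ty = ty := hty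
  refine wp_use (R := fun τ => τ.a .X = C.preOut ty u w X Y ∧
    (τ.v .ok ≠ 0 ↔ C.preOk ty u X Y) ∧ τ.v .g = C.stepGain ty u w X) ?_ fun τ h₁ f₁ => ?_
  · simp only [wp_ite_same, Exp.ok_var, Exp.ok_lit, Exp.eval_var, Exp.eval_lit, ty₀, true_and,
      Nat.zero_le]
    refine ⟨?_, fun n0 => ⟨by omega, ?_, fun n1 => ⟨by omega, ?_, fun n2 => ⟨by omega, ?_, fun n3 => ?_⟩⟩⟩⟩
    · rintro rfl
      refine wp_use (wp_leafStmt Eρ hX.2) fun τ h₁ f₁ => ⟨?_, ?_, ?_⟩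
      · rw [h₁]; rfl
      · rw [f₁.v .ok (by decide), ok₀]; simp [Ctx.preOk]
      · rw [f₁.v .g (by decide), g₀]; simp [Ctx.stepGain]
    · rintro rfl
      refine wp_use (wp_introStmt Eρ ok₀) fun τ h₁ f₁ => ⟨?_, ?_, ?_⟩
      · rw [h₁.1, p₀, X₀, Y₀]; rfl
      · rw [h₁.2, u₀, X₀, Y₀]
      · rw [f₁.v .g (by decide), g₀]; simp [Ctx.stepGain]
    · rintro rfl
      refine wp_use (wp_edgeStmt Eρ g₀ p₀ q₀ Y) fun τ h₁ f₁ => ⟨?_, ?_, ?_⟩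
      · rw [h₁.1, X₀]
      · rw [f₁.v .ok (by decide), ok₀]; simp [Ctx.preOk]
      · rw [h₁.2, X₀]
    · rintro rfl
      refine wp_use (wp_forgetStmt Eρ hX.1) fun τ h₁ f₁ => ⟨?_, ?_, ?_⟩
      · rw [h₁, X₀, p₀]; rfl
      · rw [f₁.v .ok (by decide), ok₀]; simp [Ctx.preOk]
      · rw [f₁.v .g (by decide), g₀]; simp [Ctx.stepGain]
    · obtain rfl : ty = 4 := by omega
      refine wp_use (wp_joinStmt Eρ ok₀ hX.1 hY.1 u) fun τ h₁ f₁ => ⟨?_, ?_, ?_⟩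
      · rw [h₁.1, X₀, Y₀]; rfl
      · rw [h₁.2, X₀, Y₀]
      · rw [f₁.v .g (by decide), g₀]; simp [Ctx.stepGain]
  · have Eτ : Env W N C τ := Eρ.frame f₁ (by decide) (by decide)
    refine wp_use (wp_clampStmt Eτ) fun υ h₂ f₂ => ⟨?_, ?_, ?_, ?_⟩
    · rw [h₂.1, h₁.1, h₁.2.1]; rfl
    · intro hk
      rw [h₂.2.1 hk, h₁.1]; rfl
    · exact (f₂.v _ (by decide)).trans h₁.2.2
    · intro k hk
      rw [h₂.2.2 k (by omega), h₁.1]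
      exact C.preOut_eq_zero hX hslot hk

section

variable {n : ℕ}

/-! ## Trees in post-order -/

/-- `T` consists of a root with code `(ty, u, w)` and one child `t`. -/
inductive Unary : ℕ → ℕ → ℕ → NiceTree n → NiceTree n → Prop
  | vertex (v : Fin n) (t : NiceTree n) : Unary 1 v 0 t (.introVertex v t)
  | edge (u v : Fin n) (t : NiceTree n) : Unary 2 u v t (.introEdge u v t)
  | forget (v : Fin n) (t : NiceTree n) : Unary 3 v 0 t (.forget v t)

/-- The three kinds of nodes with one child are treated alike in most passes; this induction leaves
one case for them. -/
theorem NiceTree.unary_induction {P : NiceTree n → Prop} (leaf : P .leaf)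
    (unary : ∀ ty u w t T, Unary ty u w t T → P t → P T)
    (join : ∀ a b, P a → P b → P (.join a b)) (t : NiceTree n) : P t := by
  induction t with
  | leaf => exact leaf
  | introVertex v t ih => exact unary _ _ _ _ _ (.vertex v t) ih
  | introEdge u v t ih => exact unary _ _ _ _ _ (.edge u v t) ih
  | forget v t ih => exact unary _ _ _ _ _ (.forget v t) ih
  | join a b iha ihb => exact join a b iha ihb

/-- The codes of the nodes of `t` in post-order are found in `A` from position `o` on. -/
def Located (A : ℕ → ℕ × ℕ × ℕ) : NiceTree n → ℕ → Prop
  | .leaf, o => A o = (0, 0, 0)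
  | .introVertex v t, o => Located A t o ∧ A (o + t.numNodes) = (1, v.val, 0)
  | .introEdge u v t, o => Located A t o ∧ A (o + t.numNodes) = (2, u.val, v.val)
  | .forget v t, o => Located A t o ∧ A (o + t.numNodes) = (3, v.val, 0)
  | .join a b, o => Located A a o ∧ Located A b (o + a.numNodes) ∧
      A (o + a.numNodes + b.numNodes) = (4, 0, 0)

theorem NiceTree.length_postorder (t : NiceTree n) : t.postorder.length = t.numNodes := by
  induction t <;> simp_all [postorder, numNodes, add_assoc]

theorem NiceTree.numNodes_pos (t : NiceTree n) : 0 < t.numNodes := by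
  cases t <;> simp [numNodes]

theorem located_of_getD {A : ℕ → ℕ × ℕ × ℕ} {t : NiceTree n} : ∀ {o : ℕ},
    (∀ i < t.numNodes, A (o + i) = t.postorder.getD i (0, 0, 0)) → Located A t o := by
  have app : ∀ (l : List (ℕ × ℕ × ℕ)) (x : ℕ × ℕ × ℕ) (k : ℕ), l.length = k →
      (∀ i < k, (l ++ [x]).getD i (0, 0, 0) = l.getD i (0, 0, 0)) ∧
      (l ++ [x]).getD k (0, 0, 0) = x := by
    rintro l x _ rfl
    exact ⟨fun i hi => List.getD_append _ _ _ _ hi, by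
      rw [List.getD_append_right _ _ _ _ le_rfl]; simp⟩
  induction t with
  | leaf => intro o h; simpa [NiceTree.postorder, Located] using h 0 (by simp [NiceTree.numNodes])
  | introVertex v t ih | introEdge u v t ih | forget v t ih =>
      intro o h
      have e := fun x => app t.postorder x _ t.length_postorder
      simp only [NiceTree.postorder, NiceTree.numNodes] at h
      exact ⟨ih fun i hi => (h i (by omega)).trans ((e _).1 i hi),
        (h _ (by omega)).trans (e _).2⟩
  | join a b iha ihb =>
      intro o h
      simp only [NiceTree.postorder, NiceTree.numNodes] at h
      have e := app (a.postorder ++ b.postorder) (4, 0, 0) (a.numNodes + b.numNodes)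
        (by simp [NiceTree.length_postorder])
      refine ⟨iha fun i hi => ?_, ihb fun i hi => ?_, ?_⟩
      · rw [h i (by omega), e.1 i (by omega)]
        exact List.getD_append _ _ _ _ (by rwa [a.length_postorder])
      · rw [add_assoc, h _ (by omega), e.1 _ (by omega),
          List.getD_append_right _ _ _ _ (by rw [a.length_postorder]; omega), a.length_postorder,
          Nat.add_sub_cancel_left]
      · rw [add_assoc, h _ (by omega), e.2]

theorem Unary.numNodes {ty u w : ℕ} {t T : NiceTree n} (h : Unary ty u w t T) :
    T.numNodes = t.numNodes + 1 := by cases h <;> rfl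

theorem Unary.located {ty u w : ℕ} {t T : NiceTree n} (h : Unary ty u w t T)
    {A : ℕ → ℕ × ℕ × ℕ} {o : ℕ} :
    Located A T o ↔ Located A t o ∧ A (o + t.numNodes) = (ty, u, w) := by cases h <;> rfl

theorem Unary.type {ty u w : ℕ} {t T : NiceTree n} (h : Unary ty u w t T) :
    ty ≠ 0 ∧ ty < 4 := by cases h <;> decide

theorem NiceTree.card_bag_le (t : NiceTree n) : t.bag.card ≤ t.numNodes := by
  induction t with
  | leaf => simp [bag]
  | introVertex v t ih => exact (Finset.card_insert_le _ _).trans (by simpa [numNodes] using ih)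
  | introEdge u v t ih => exact ih.trans (by simp [numNodes])
  | forget v t ih => exact (Finset.card_erase_le).trans (ih.trans (by simp [numNodes]))
  | join a b iha ihb => exact iha.trans (by simp [numNodes]; omega)

theorem NiceTree.card_bag_le_maxBagCard (t : NiceTree n) : t.bag.card ≤ t.maxBagCard := by
  cases t <;> simp [bag, maxBagCard]

theorem Unary.maxBagCard {ty u w : ℕ} {t T : NiceTree n} (h : Unary ty u w t T) :
    T.maxBagCard = max T.bag.card t.maxBagCard := by cases h <;> rfl

theorem NiceTree.maxBagCard_le (t : NiceTree n) : t.maxBagCard ≤ t.numNodes := by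
  induction t using NiceTree.unary_induction with
  | leaf => simp [maxBagCard]
  | unary ty u w t T h ih =>
      rw [h.maxBagCard]
      exact max_le T.card_bag_le (ih.trans (by simp [h.numNodes]))
  | join a b iha ihb =>
      exact max_le (card_bag_le _) (max_le (iha.trans (by simp [numNodes]; omega))
        (ihb.trans (by simp [numNodes]; omega)))

/-- `left` gives the positions of the first children. -/
def LeftOK (left : ℕ → ℕ) : NiceTree n → ℕ → Prop
  | .leaf, _ => True
  | .introVertex _ t, o => LeftOK left t o ∧ left (o + t.numNodes) = o + t.numNodes - 1
  | .introEdge _ _ t, o => LeftOK left t o ∧ left (o + t.numNodes) = o + t.numNodes - 1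
  | .forget _ t, o => LeftOK left t o ∧ left (o + t.numNodes) = o + t.numNodes - 1
  | .join a b, o => LeftOK left a o ∧ LeftOK left b (o + a.numNodes) ∧
      left (o + a.numNodes + b.numNodes) = o + a.numNodes - 1

theorem Unary.leftOK {ty u w : ℕ} {t T : NiceTree n} (h : Unary ty u w t T) {left : ℕ → ℕ}
    {o : ℕ} : LeftOK left T o ↔ LeftOK left t o ∧ left (o + t.numNodes) = o + t.numNodes - 1 := by
  cases h <;> rfl

theorem LeftOK.congr {left left' : ℕ → ℕ} {t : NiceTree n} : ∀ {o : ℕ}, LeftOK left t o →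
    (∀ j, o ≤ j → j < o + t.numNodes → left' j = left j) → LeftOK left' t o := by
  induction t using NiceTree.unary_induction with
  | leaf => exact fun _ _ => trivial
  | unary ty u w t T h ih =>
      intro o hl he
      rw [h.leftOK] at hl ⊢
      rw [h.numNodes] at he
      exact ⟨ih hl.1 fun j h1 h2 => he j h1 (by omega), (he _ (by omega) (by omega)).trans hl.2⟩
  | join a b iha ihb =>
      intro o hl he
      simp only [NiceTree.numNodes] at he
      exact ⟨iha hl.1 fun j h1 h2 => he j h1 (by omega),
        ihb hl.2.1 fun j h1 h2 => he j (by omega) (by omega),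
        (he _ (by omega) (by omega)).trans hl.2.2⟩

theorem rounds_use {W : ℕ} {p : Stmt} {x : Var} {R Q : HState → Prop} {k : ℕ} {σ : HState}
    (h : rounds (wp W p) x k R σ)
    (hQ : ∀ τ, R τ → Frame (x :: p.writes) p.stores σ τ → Q τ) : rounds (wp W p) x k Q σ :=
  rounds_mono (F := wp W p) (fun _ _ h' _ => wp_mono W p h') x (fun τ hτ => hQ τ hτ.1 hτ.2) k σ
    (rounds_frame W p x k h)

/-- The arrays `ty`, `u`, `w` hold the data `A`. -/
structure Input (A : ℕ → ℕ × ℕ × ℕ) (σ : HState) : Prop where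
  ty : ∀ i, σ.a .ty i = (A i).1
  u : ∀ i, σ.a .u i = (A i).2.1
  w : ∀ i, σ.a .w i = (A i).2.2

theorem Input.frame {A : ℕ → ℕ × ℕ × ℕ} {σ τ : HState} (h : Input A σ) {xs : List Var}
    {As : List Arr} (hf : Frame xs As σ τ) (h1 : Arr.ty ∉ As) (h2 : Arr.u ∉ As)
    (h3 : Arr.w ∉ As) : Input A τ :=
  ⟨by rw [hf.a _ h1]; exact h.ty, by rw [hf.a _ h2]; exact h.u, by rw [hf.a _ h3]; exact h.w⟩

theorem Input.set {A : ℕ → ℕ × ℕ × ℕ} {σ : HState} (h : Input A σ) (x : Var) (k : ℕ) :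
    Input A (σ.set x k) := ⟨h.ty, h.u, h.w⟩

/-! ### Sizes of subtrees and bags -/

open Exp in
/-- Compute the size of the subtree, the first child and the size of the bag of node `i`. -/
def sizeStmt : Stmt := block [
  .assign .ty (get .ty (var .i)),
  .ite (same (var .ty) (lit 0)) (block [
    .store .sz (var .i) (lit 1),
    .assign .cur (lit 0)])
  (.ite (same (var .ty) (lit 4)) (block [
    .assign .l (var .i - lit 1 - get .sz (var .i - lit 1)),
    .store .left (var .i) (var .l),
    .store .sz (var .i) (get .sz (var .l) + get .sz (var .i - lit 1) + lit 1)])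
  (block [
    .store .left (var .i) (var .i - lit 1),
    .store .sz (var .i) (get .sz (var .i - lit 1) + lit 1),
    .ite (same (var .ty) (lit 1)) (.assign .cur (var .cur + lit 1))
      (.ite (same (var .ty) (lit 3)) (.assign .cur (var .cur - lit 1)) .skip)])),
  .ite (less (var .b) (var .cur)) (.assign .b (var .cur)) .skip]

/-- In post-order the last child of node `i` is at `i - 1`, and its subtree occupies the `sz (i -
1)` positions that end there. At a join the first child is therefore at `i - 1 - sz (i - 1)`. -/
theorem wp_sizeStmt {W i ty l : ℕ} {σ : HState} (hW : 5 ≤ W) (hi : σ.v .i = i)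
    (hty : σ.a .ty i = ty)
    (hl : l = if ty = 4 then i - 1 - σ.a .sz (i - 1) else i - 1)
    (h₄ : ty = 4 → σ.a .sz l + σ.a .sz (i - 1) + 1 ≤ W)
    (h₁ : ty ≠ 0 → σ.a .sz (i - 1) + 1 ≤ W) (hcur : ty ≠ 0 → σ.v .cur + 1 ≤ W) :
    wp W sizeStmt (fun τ => τ.a .sz = Function.update (σ.a .sz) i
        (if ty = 0 then 1 else if ty = 4 then σ.a .sz l + σ.a .sz (i - 1) + 1
          else σ.a .sz (i - 1) + 1) ∧
      (ty ≠ 0 → τ.a .left i = l) ∧ (∀ j, j ≠ i → τ.a .left j = σ.a .left j) ∧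
      τ.v .cur = (if ty = 0 then 0 else if ty = 1 then σ.v .cur + 1
        else if ty = 3 then σ.v .cur - 1 else σ.v .cur) ∧
      τ.v .b = max (σ.v .b) (τ.v .cur)) σ := by
  unfold sizeStmt
  rw [wp_block_cons, wp_assign, wp_block_cons]
  refine ⟨by simp, ?_⟩
  refine wp_use (R := fun τ => τ.a .sz = Function.update (σ.a .sz) i
        (if ty = 0 then 1 else if ty = 4 then σ.a .sz l + σ.a .sz (i - 1) + 1
          else σ.a .sz (i - 1) + 1) ∧
      (ty ≠ 0 → τ.a .left i = l) ∧ (∀ j, j ≠ i → τ.a .left j = σ.a .left j) ∧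
      τ.v .cur = (if ty = 0 then 0 else if ty = 1 then σ.v .cur + 1
        else if ty = 3 then σ.v .cur - 1 else σ.v .cur)) ?_ fun τ k₁ f₁ => ?_
  · rw [wp_ite_same]
    simp only [Exp.eval_get, Exp.eval_var, hi, hty, HState.set_v, reduceCtorEq, if_true, if_false,
      Exp.eval_lit, Exp.ok_var, Exp.ok_lit, Nat.zero_le, true_and]
    refine ⟨fun h0 => ?_, fun h0 => ?_⟩
    · simp [h0, hi, show 1 ≤ W by omega]
    · have h₁ := h₁ h0
      have hcur := hcur h0
      rw [wp_ite_same]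
      simp only [Exp.eval_get, Exp.eval_var, hi, hty, HState.set_v, reduceCtorEq, if_true,
        if_false, Exp.eval_lit, Exp.ok_var, Exp.ok_lit, true_and]
      refine ⟨by omega, fun h4 => ?_, fun h4 => ?_⟩
      · have := h₄ h4
        rw [if_pos h4] at hl
        simp only [wp_block_cons, wp_block_nil, wp_assign, wp_store, Exp.ok_var, Exp.ok_sub,
          Exp.ok_lit, Exp.ok_get, Exp.ok_add, Exp.eval_var, Exp.eval_sub, Exp.eval_lit,
          Exp.eval_get, Exp.eval_add, HState.set_v, HState.set_a, HState.put_v, HState.put_a,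
          reduceCtorEq, if_true, if_false, hi, h4, ← hl, true_and, Function.update_self]
        exact ⟨by omega, by omega, by simp, fun j hj => by simp [hj], by simp⟩
      · rw [if_neg h4] at hl
        simp only [wp_block_cons, wp_store, Exp.ok_var, Exp.ok_sub,
          Exp.ok_lit, Exp.ok_get, Exp.ok_add, Exp.eval_var, Exp.eval_sub, Exp.eval_lit,
          Exp.eval_get, Exp.eval_add, HState.set_v, HState.set_a, HState.put_v, HState.put_a,
          reduceCtorEq, if_true, if_false, hi, true_and]
        refine ⟨by omega, ⟨by omega, by omega, by omega⟩, ?_⟩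
        refine wp_use (R := fun τ => τ.v .cur = if ty = 1 then σ.v .cur + 1
          else if ty = 3 then σ.v .cur - 1 else σ.v .cur) ?_ fun τ k₂ f₂ => ?_
        · simp only [wp_ite_same, wp_assign, wp_skip, Exp.ok_var, Exp.ok_sub,
            Exp.ok_lit, Exp.ok_get, Exp.ok_add, Exp.eval_var, Exp.eval_sub, Exp.eval_lit,
            Exp.eval_get, Exp.eval_add, HState.set_v, HState.set_a, HState.put_v, HState.put_a,
            reduceCtorEq, if_true, if_false, hi, true_and]
          refine ⟨by omega, fun h => ⟨by omega, by simp [h]⟩, fun h => ⟨by omega, fun h' =>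
            ⟨by omega, by simp [h']⟩, fun h' => by simp [h, h']⟩⟩
        · rw [wp_block_nil, f₂.a .sz (by decide), f₂.a .left (by decide), k₂]
          simp only [HState.set_v, HState.set_a, HState.put_v, HState.put_a,
            reduceCtorEq, if_true, if_false, h0, h4, hl, Function.update_self]
          refine ⟨trivial, fun _ => trivial, fun j hj => by simp [hj], trivial⟩
  · have b₁ : τ.v .b = σ.v .b := f₁.v _ (by decide)
    simp only [wp_ite_less, wp_block_cons, wp_block_nil, wp_assign, wp_skip, Exp.ok_var,
      Exp.eval_var, HState.set_v, HState.set_a, reduceCtorEq, if_true, if_false, true_and]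
    refine ⟨fun h => ⟨k₁.1, k₁.2.1, k₁.2.2.1, k₁.2.2.2, ?_⟩, fun h => ⟨k₁.1, k₁.2.1, k₁.2.2.1,
      k₁.2.2.2, ?_⟩⟩
    · rw [max_eq_right (by omega)]
    · rw [max_eq_left (by omega), b₁]

theorem Unary.locallyNice {ty u w : ℕ} {t T : NiceTree n} (h : Unary ty u w t T)
    (hT : T.LocallyNice) : t.LocallyNice ∧ T.bag.card =
      if ty = 1 then t.bag.card + 1 else if ty = 3 then t.bag.card - 1 else t.bag.card := by
  cases h with
  | vertex v t => exact ⟨hT.2, by simp [NiceTree.bag, Finset.card_insert_of_notMem hT.1]⟩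
  | edge u v t => exact ⟨hT.2.2, by simp [NiceTree.bag]⟩
  | forget v t => exact ⟨hT.2, by simp [NiceTree.bag, Finset.card_erase_of_mem hT.1]⟩

/-- The results of the computation of the sizes for a subtree. -/
structure SizePost (t : NiceTree n) (o : ℕ) (σ τ : HState) : Prop where
  i : τ.v .i = o + t.numNodes
  cur : τ.v .cur = t.bag.card
  b : τ.v .b = max (σ.v .b) t.maxBagCard
  sz : τ.a .sz (o + t.numNodes - 1) = t.numNodes
  old_sz : ∀ j < o, τ.a .sz j = σ.a .sz j
  old_left : ∀ j < o, τ.a .left j = σ.a .left j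
  left : LeftOK (τ.a .left) t o

/-- After a subtree has been scanned, `cur` is the size of the bag of its root. Leaves reset it,
introduce and forget nodes change it by one, and at a join the value left by the second child is
right because the bags agree. The running maximum in `b` is the number of slots needed. -/
theorem rounds_sizeStmt {W N : ℕ} {A : ℕ → ℕ × ℕ × ℕ} (hW : 2 * N + 5 ≤ W) {t : NiceTree n} :
    ∀ {o : ℕ} {σ : HState}, t.LocallyNice → Located A t o → Input A σ → σ.v .i = o →
      o + t.numNodes ≤ N → rounds (wp W sizeStmt) .i t.numNodes (SizePost t o σ) σ := by
  have hi' : Var.i ∉ sizeStmt.writes := by decide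
  induction t using NiceTree.unary_induction with
  | leaf =>
      intro o σ _ hA hin hi hN
      refine wp_use (wp_sizeStmt (ty := 0) (by omega) hi (by rw [hin.ty, hA]) rfl (by simp)
        (by simp) (by simp)) fun τ h₁ f₁ => ?_
      have i₁ : τ.v .i = o := (f₁.v _ hi').trans hi
      obtain ⟨a₁, -, a₃, a₄, a₅⟩ := h₁
      refine ⟨by simp [i₁, NiceTree.numNodes], by simpa [NiceTree.bag] using a₄, ?_, ?_, ?_, ?_,
        trivial⟩
      · simpa [a₄, NiceTree.maxBagCard] using a₅
      · simp [a₁, NiceTree.numNodes]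
      · intro j hj; simp [a₁, show j ≠ o by omega]
      · intro j hj; exact a₃ j (by omega)
  | unary ty u w t T h ih =>
      intro o σ hT hA hin hi hN
      rw [h.numNodes] at hN ⊢
      rw [rounds_add]
      obtain ⟨hA₁, hA₂⟩ := h.located.1 hA
      have hpos := t.numNodes_pos
      have hcard := t.card_bag_le
      refine rounds_use (ih (h.locallyNice hT).1 hA₁ hin hi (by omega)) fun τ h₁ f₁ => ?_
      have hin₁ : Input A τ := hin.frame f₁ (by decide) (by decide) (by decide)
      refine wp_use (wp_sizeStmt (ty := ty) (by omega) h₁.i (by rw [hin₁.ty, hA₂]) rfl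
        (fun h4 => absurd h4 h.type.2.ne) (fun _ => by rw [h₁.sz]; omega)
        (fun _ => by rw [h₁.cur]; omega)) fun υ h₂ f₂ => ?_
      have i₂ : υ.v .i = o + t.numNodes := (f₂.v _ hi').trans h₁.i
      obtain ⟨a₁, a₂, a₃, a₄, a₅⟩ := h₂
      rw [if_neg h.type.1, if_neg h.type.2.ne, h₁.sz] at a₁
      rw [if_neg h.type.1, h₁.cur, ← (h.locallyNice hT).2] at a₄
      rw [if_neg h.type.2.ne] at a₂
      refine ⟨by simp [i₂, h.numNodes, add_assoc], a₄, ?_, ?_, ?_, ?_, h.leftOK.2 ⟨?_, a₂ h.type.1⟩⟩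
      · rw [h.maxBagCard, max_comm T.bag.card, ← max_assoc, ← h₁.b, ← a₄]; exact a₅
      · simp [a₁, h.numNodes, ← add_assoc]
      · intro j hj
        rw [← h₁.old_sz j hj]
        simp [a₁, show j ≠ o + t.numNodes by omega]
      · intro j hj
        rw [← h₁.old_left j hj]
        exact a₃ j (by omega)
      · exact h₁.left.congr fun j _ hj => a₃ j (by omega)
  | join a b iha ihb =>
      intro o σ hT hA hin hi hN
      simp only [NiceTree.numNodes] at hN ⊢
      rw [rounds_add, rounds_add]
      obtain ⟨hA₁, hA₂, hA₃⟩ := hA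
      have ha := a.numNodes_pos
      have hb := b.numNodes_pos
      have hcard := b.card_bag_le
      refine rounds_use (iha hT.2.1 hA₁ hin hi (by omega)) fun τ h₁ f₁ => ?_
      have hin₁ : Input A τ := hin.frame f₁ (by decide) (by decide) (by decide)
      refine rounds_use (ihb hT.2.2 hA₂ hin₁ h₁.i (by omega)) fun υ h₂ f₂ => ?_
      have hin₂ : Input A υ := hin₁.frame f₂ (by decide) (by decide) (by decide)
      have e : o + a.numNodes + b.numNodes - 1 - b.numNodes = o + a.numNodes - 1 := by omega
      have s₂ : υ.a .sz (o + a.numNodes - 1) = a.numNodes :=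
        (h₂.old_sz _ (by omega)).trans h₁.sz
      refine wp_use (wp_sizeStmt (ty := 4) (l := o + a.numNodes - 1) (by omega) h₂.i
        (by rw [hin₂.ty, hA₃]) (by rw [h₂.sz, e]; rfl)
        (fun _ => by rw [h₂.sz, s₂]; omega) (fun _ => by rw [h₂.sz]; omega)
        (fun _ => by rw [h₂.cur]; omega)) fun ω h₃ f₃ => ?_
      have i₃ : ω.v .i = o + a.numNodes + b.numNodes := (f₃.v _ hi').trans h₂.i
      obtain ⟨a₁, a₂, a₃, a₄, a₅⟩ := h₃
      rw [h₂.sz, s₂] at a₁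
      simp only [show (4 : ℕ) ≠ 0 by decide, show (4 : ℕ) ≠ 1 by decide,
        show (4 : ℕ) ≠ 3 by decide, if_false, h₂.cur, ← hT.1, if_true] at a₁ a₄
      refine ⟨by simp [i₃, NiceTree.numNodes, add_assoc], a₄, ?_, ?_, ?_, ?_, ?_, ?_, ?_⟩
      · change ω.v .b = max _ (max _ (max _ _))
        rw [max_comm (NiceTree.bag _).card, ← max_assoc, ← max_assoc, ← h₁.b, ← h₂.b, a₅, a₄]; rfl
      · simp [a₁, NiceTree.numNodes, ← add_assoc]
      · intro j hj
        rw [← h₁.old_sz j hj, ← h₂.old_sz j (by omega)]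
        simp [a₁, show j ≠ o + a.numNodes + b.numNodes by omega]
      · intro j hj
        rw [← h₁.old_left j hj, ← h₂.old_left j (by omega)]
        exact a₃ j (by omega)
      · exact h₁.left.congr fun j _ hj => (a₃ j (by omega)).trans (h₂.old_left j (by omega))
      · exact h₂.left.congr fun j _ hj => a₃ j (by omega)
      · exact a₂ (by decide)

end

section

variable {n : ℕ}

/-! ### Slots of vertices -/

open Exp in
/-- Copy row `i` of `occ` to the row given by `y`. -/
def copyStmt (y : Var) : Stmt :=
  .loop .j .b (.store .occ (var y * var .b + var .j) (get .occ (var .i * var .b + var .j)))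

open Exp in
/-- Determine the occupied slots at the children of node `i`, and choose a free slot for a
forgotten vertex. -/
def slotStmt : Stmt := block [
  .assign .i (var .N - lit 1 - var .x),
  .assign .ty (get .ty (var .i)),
  .assign .u (get .u (var .i)),
  .assign .l (get .left (var .i)),
  .ite (same (var .ty) (lit 0)) .skip (block [
    copyStmt .l,
    .ite (same (var .ty) (lit 4)) (block [
      .assign .r (var .i - lit 1),
      copyStmt .r])
    (.ite (same (var .ty) (lit 1))
      (.store .occ (var .l * var .b + get .slot (var .u)) (lit 0))
    (.ite (same (var .ty) (lit 3)) (block [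
      .assign .f (lit 0),
      .loop .j .b (.ite (get .occ (var .l * var .b + var .j)) .skip (.assign .f (var .j))),
      .store .slot (var .u) (var .f),
      .store .occ (var .l * var .b + var .f) (lit 1)]) .skip))])]

/-- The target row lies entirely before row `i`, so the copy does not destroy its source. -/
theorem wp_copyStmt {W i l b : ℕ} {y : Var} {σ : HState} (hy : y ≠ .j) (hi : σ.v .i = i)
    (hl : σ.v y = l) (hb : σ.v .b = b) (hli : l * b + b ≤ i * b) (hW : i * b + b ≤ W) :
    wp W (copyStmt y) (fun τ => (∀ j < b, τ.a .occ (l * b + j) = σ.a .occ (i * b + j)) ∧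
      ∀ k, (k < l * b ∨ l * b + b ≤ k) → τ.a .occ k = σ.a .occ k) σ := by
  refine wp_loop (fun m τ => (∀ j < m, τ.a .occ (l * b + j) = σ.a .occ (i * b + j)) ∧
      ∀ k, (k < l * b ∨ l * b + m ≤ k) → τ.a .occ k = σ.a .occ k) (by simp [Stmt.writes]) (by simp) ?_ ?_
  · intro m hm τ hf hj hI
    rw [hb] at hm
    have i₁ : τ.v .i = i := (hf.v _ (by simp [Stmt.writes])).trans hi
    have b₁ : τ.v .b = b := (hf.v _ (by simp [Stmt.writes])).trans hb
    have l₁ : τ.v y = l := (hf.v _ (by simp [Stmt.writes, hy])).trans hl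
    simp only [wp_store, Exp.ok_add, Exp.ok_mul, Exp.ok_var, Exp.ok_get, Exp.eval_add,
      Exp.eval_mul, Exp.eval_var, Exp.eval_get, i₁, b₁, l₁, hj, true_and, HState.set_a,
      HState.put_a, if_true]
    refine ⟨⟨by omega, by omega⟩, ⟨by omega, by omega⟩, fun j hj' => ?_, fun k hk => ?_⟩
    · rw [hI.2 (i * b + m) (by omega), Function.update_apply]
      split
      · congr 1; omega
      · exact hI.1 j (by omega)
    · rw [Function.update_of_ne (by omega)]
      exact hI.2 k (by omega)
  · intro τ _ hI
    rwa [hb] at hI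

/-- The effect of `slotStmt` at a node that is not a leaf. -/
structure SlotStep (b i ty u l : ℕ) (σ τ : HState) : Prop where
  slot : ty ≠ 3 → τ.a .slot = σ.a .slot
  slot_forget : ty = 3 → τ.a .slot u < b ∧ σ.a .occ (i * b + τ.a .slot u) = 0 ∧
    ∀ k, k ≠ u → τ.a .slot k = σ.a .slot k
  row : ∀ j < b, τ.a .occ (l * b + j) ≠ 0 ↔
    if ty = 1 then σ.a .occ (i * b + j) ≠ 0 ∧ j ≠ σ.a .slot u
    else if ty = 3 then σ.a .occ (i * b + j) ≠ 0 ∨ j = τ.a .slot u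
    else σ.a .occ (i * b + j) ≠ 0
  row_right : ty = 4 → ∀ j < b, τ.a .occ ((i - 1) * b + j) ≠ 0 ↔ σ.a .occ (i * b + j) ≠ 0
  old : ∀ k, (k < l * b ∨ l * b + b ≤ k) → (ty = 4 → k < (i - 1) * b ∨ (i - 1) * b + b ≤ k) →
    τ.a .occ k = σ.a .occ k

theorem wp_slotStmt {W N i b ty u l : ℕ} {σ : HState} (hW : 5 ≤ W) (hN : σ.v .N = N)
    (hb : σ.v .b = b) (hx : N - 1 - σ.v .x = i) (hty : σ.a .ty i = ty) (hu : σ.a .u i = u)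
    (hleft : σ.a .left i = l) (hWi : i * b + b ≤ W) (hl : ty ≠ 0 → l < i)
    (hl₄ : ty = 4 → l < i - 1) (h₁ : ty = 1 → σ.a .slot u < b)
    (h₃ : ty = 3 → ∃ j < b, σ.a .occ (i * b + j) = 0) :
    wp W slotStmt (fun τ => (ty = 0 → τ.a = σ.a) ∧ (ty ≠ 0 → SlotStep b i ty u l σ τ)) σ := by
  unfold slotStmt
  simp only [wp_block_cons, wp_assign, wp_ite_same, wp_skip, wp_block_nil, Exp.ok_sub, Exp.ok_var,
    Exp.ok_lit, Exp.ok_get, Exp.eval_sub, Exp.eval_var, Exp.eval_lit, Exp.eval_get, HState.set_v,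
    HState.set_a, reduceCtorEq, if_true, if_false, hN, hx, hty, hu, hleft, true_and, Nat.zero_le]
  refine ⟨⟨by omega, trivial⟩, fun h0 => ⟨fun _ => trivial, fun h => absurd h0 h⟩, fun h0 => ?_⟩
  have hli := hl h0
  have hrow : l * b + b ≤ i * b := by
    rw [← Nat.succ_mul]; exact Nat.mul_le_mul_right _ hli
  set ρ := (((σ.set .i i).set .ty ty).set .u u).set .l l with hρ
  refine wp_use (wp_copyStmt (i := i) (l := l) (b := b) (by decide) (by simp [hρ]) (by simp [hρ])
    (by simp [hρ, hb]) hrow hWi) fun τ k₁ f₁ => ?_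
  have i₁ : τ.v .i = i := by rw [f₁.v _ (by decide)]; simp [hρ]
  have l₁ : τ.v .l = l := by rw [f₁.v _ (by decide)]; simp [hρ]
  have b₁ : τ.v .b = b := by rw [f₁.v _ (by decide)]; simp [hρ, hb]
  have u₁ : τ.v .u = u := by rw [f₁.v _ (by decide)]; simp [hρ]
  have t₁ : τ.v .ty = ty := by rw [f₁.v _ (by decide)]; simp [hρ]
  have s₁ : τ.a .slot = σ.a .slot := by rw [f₁.a _ (by decide)]; simp [hρ]
  have o₁ : ρ.a .occ = σ.a .occ := rfl
  rw [o₁] at k₁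
  simp only [wp_block_cons, wp_block_nil, wp_ite_same, wp_skip, wp_assign, Exp.ok_sub, Exp.ok_var,
    Exp.ok_lit, Exp.eval_sub, Exp.eval_var, Exp.eval_lit, i₁, t₁, true_and]
  refine ⟨by omega, fun h4 => ⟨by omega, ?_⟩, fun h4 => ⟨by omega, fun hty1 => ?_, fun hty1 =>
    ⟨by omega, fun hty3 => ?_, fun hty3 => ?_⟩⟩⟩
  · have hl' := hl₄ h4
    have hrow' : l * b + b ≤ (i - 1) * b := by
      rw [← Nat.succ_mul]; exact Nat.mul_le_mul_right _ hl'
    have hrow'' : (i - 1) * b + b ≤ i * b := by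
      rw [← Nat.succ_mul]; exact Nat.mul_le_mul_right _ (by omega)
    refine wp_use (wp_copyStmt (i := i) (l := i - 1) (b := b) (by decide) (by simp [i₁]) (by simp)
      (by simp [b₁]) hrow'' hWi) fun υ k₂ f₂ => ⟨fun h => absurd h h0, fun _ => ?_⟩
    simp only [HState.set_a] at k₂
    refine ⟨fun _ => ?_, fun h => by omega, fun j hj => ?_, fun _ j hj => ?_, fun k hk hk' => ?_⟩
    · rw [f₂.a _ (by decide), HState.set_a, s₁]
    · rw [k₂.2 _ (by omega), k₁.1 j hj, if_neg (by omega), if_neg (by omega)]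
    · rw [k₂.1 j hj, k₁.2 _ (by omega)]
    · rw [k₂.2 k (hk' h4), k₁.2 k hk]
  · have hs := h₁ hty1
    simp only [wp_store, Exp.ok_add, Exp.ok_mul, Exp.ok_var, Exp.ok_get, Exp.ok_lit, Exp.eval_add,
      Exp.eval_mul, Exp.eval_var, Exp.eval_get, Exp.eval_lit, i₁, b₁, l₁, u₁, s₁, true_and,
      Nat.zero_le]
    refine ⟨⟨by omega, by omega⟩, fun h => absurd h h0, fun _ => ⟨fun _ => ?_, fun h => by omega,
      fun j hj => ?_, fun h => by omega, fun k hk hk' => ?_⟩⟩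
    · simp [s₁]
    · rw [if_pos hty1, HState.put_a, if_pos rfl, Function.update_apply, ← k₁.1 j hj]
      by_cases h : j = σ.a .slot u
      · simp [h]
      · simp [h]
    · rw [HState.put_a, if_pos rfl, Function.update_of_ne (by omega), k₁.2 k hk]
  · obtain ⟨j₀, hj₀, hfree⟩ := h₃ hty3
    simp only [wp_block_cons, wp_assign, Exp.ok_lit, Exp.eval_lit, Nat.zero_le, true_and]
    refine wp_use (R := fun υ => υ.v .f < b ∧ τ.a .occ (l * b + υ.v .f) = 0) ?_ fun υ k₂ f₂ => ?_
    · refine wp_loop (fun m υ => (∃ j < m, τ.a .occ (l * b + j) = 0) →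
        υ.v .f < m ∧ τ.a .occ (l * b + υ.v .f) = 0) (by decide) (by simp) ?_ ?_
      · intro m hm υ hf hj hI
        simp only [HState.set_v, reduceCtorEq, if_false, b₁] at hm
        have l₂ : υ.v .l = l := by rw [hf.v _ (by decide)]; simp [l₁]
        have b₂ : υ.v .b = b := by rw [hf.v _ (by decide)]; simp [b₁]
        have o₂ : υ.a .occ = τ.a .occ := by rw [hf.a _ (by decide)]; simp
        simp only [wp_ite, wp_assign, wp_skip, Exp.ok_add, Exp.ok_mul, Exp.ok_var, Exp.ok_get,
          Exp.eval_add, Exp.eval_mul, Exp.eval_var, Exp.eval_get, l₂, b₂, o₂, hj, true_and,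
          HState.set_v, reduceCtorEq, if_true, if_false]
        refine ⟨⟨by omega, by omega⟩, fun h => ?_, fun h _ => ⟨by omega, h⟩⟩
        rintro ⟨j, hj, hj'⟩
        have : j ≠ m := by rintro rfl; exact h hj'
        have := hI ⟨j, by omega, hj'⟩
        exact ⟨by omega, this.2⟩
      · intro υ _ hI
        simp only [HState.set_v, reduceCtorEq, if_false, b₁] at hI
        exact hI ⟨j₀, hj₀, by rw [k₁.1 _ hj₀, hfree]⟩
    · have l₂ : υ.v .l = l := by rw [f₂.v _ (by decide)]; simp [l₁]
      have b₂ : υ.v .b = b := by rw [f₂.v _ (by decide)]; simp [b₁]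
      have u₂ : υ.v .u = u := by rw [f₂.v _ (by decide)]; simp [u₁]
      have o₂ : υ.a .occ = τ.a .occ := by rw [f₂.a _ (by decide)]; simp
      have s₂ : υ.a .slot = σ.a .slot := by rw [f₂.a _ (by decide)]; simp [s₁]
      simp only [wp_block_cons, wp_block_nil, wp_store, Exp.ok_add, Exp.ok_mul, Exp.ok_var, Exp.ok_get,
        Exp.ok_lit, Exp.eval_add, Exp.eval_mul, Exp.eval_var, Exp.eval_get, Exp.eval_lit, l₂, b₂,
        u₂, HState.put_v, true_and]
      set f := υ.v .f with hf
      refine ⟨⟨by omega, by omega⟩, by omega, fun h => absurd h h0, fun _ => ⟨fun h =>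
        absurd hty3 h, fun _ => ?_, fun j hj => ?_, fun h => by omega, fun k hk hk' => ?_⟩⟩
      · simp only [HState.put_a, reduceCtorEq, if_true, if_false, Function.update_self, s₂]
        refine ⟨k₂.1, by rw [← k₁.1 _ k₂.1]; exact k₂.2, fun k hk => by simp [hk]⟩
      · rw [if_neg hty1, if_pos hty3]
        simp only [HState.put_a, reduceCtorEq, if_true, if_false, Function.update_self, o₂, s₂]
        rw [Function.update_apply, ← k₁.1 j hj]
        by_cases h : j = f
        · simp [h]
        · simp [h]
      · simp only [HState.put_a, reduceCtorEq, if_true, if_false, o₂]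
        rw [Function.update_of_ne (by omega), k₁.2 k hk]
  · refine ⟨fun h => absurd h h0, fun _ => ⟨fun _ => s₁, fun h => absurd h hty3, fun j hj => ?_,
      fun h => absurd h h4, fun k hk _ => k₁.2 k hk⟩⟩
    rw [if_neg hty1, if_neg hty3, k₁.1 j hj]

/-- The results of the assignment of slots in a subtree. -/
structure SlotPost (N b : ℕ) (t : NiceTree n) (o : ℕ) (σ τ : HState) : Prop where
  x : τ.v .x = N - o
  good : SlotGood (τ.a .slot) b t
  slot : ∀ k, (∀ v ∈ t.verts, v ∉ t.bag → (v : ℕ) ≠ k) → τ.a .slot k = σ.a .slot k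
  old : ∀ k, (k < o * b ∨ (o + t.numNodes) * b ≤ k) → τ.a .occ k = σ.a .occ k

/-- Row `r` of `occ` gives the slots of the vertices in `D`. -/
def RowOK (b r : ℕ) (D : Finset (Fin n)) (σ : HState) : Prop :=
  ∀ j < b, σ.a .occ (r * b + j) ≠ 0 ↔ ∃ v ∈ D, σ.a .slot v = j

/-- This pass runs from the root down, since `x` counts positions from the end of the list. A vertex
takes a free slot of the bag at its forget node and gives it up below an introduce node of it.
Consistency of the decomposition ensures that each vertex keeps one slot throughout, so `slot` is a
function of the vertex alone. -/
theorem rounds_slotStmt {W N b : ℕ} {A : ℕ → ℕ × ℕ × ℕ} (hW : N * b + 5 ≤ W) {t : NiceTree n} :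
    ∀ {o : ℕ} {σ : HState}, t.LocallyNice → t.Consistent → t.maxBagCard ≤ b → Located A t o →
      Input A σ → LeftOK (σ.a .left) t o → σ.v .N = N → σ.v .b = b → o + t.numNodes ≤ N →
      σ.v .x = N - (o + t.numNodes) → RowOK b (o + t.numNodes - 1) t.bag σ →
      GoodOn (σ.a .slot) b t.bag →
      rounds (wp W slotStmt) .x t.numNodes (SlotPost N b t o σ) σ := by
  have hx' : Var.x ∉ slotStmt.writes := by decide
  have words : ∀ i < N, i * b + b ≤ W := fun i hi => by
    have := Nat.mul_le_mul_right b (Nat.succ_le_of_lt hi)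
    rw [Nat.succ_mul] at this; omega
  induction t with
  | leaf =>
      intro o σ _ _ _ hA hin hl hN hb ho hx hrow hg
      simp only [NiceTree.numNodes] at ho hx
      refine wp_use (wp_slotStmt (W := W) (i := o) (ty := 0) (by omega) hN hb (by omega)
        (by rw [hin.ty, hA]) rfl rfl (words o (by omega)) (by simp) (by simp) (by simp) (by simp))
        fun τ h₁ f₁ => ?_
      have x₁ : τ.v .x = N - (o + 1) := (f₁.v _ hx').trans hx
      refine ⟨by simp [x₁]; omega, trivial, fun k _ => ?_, fun k _ => ?_⟩
      · simp [h₁.1 rfl]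
      · simp [h₁.1 rfl]
  | introVertex v t ih =>
      intro o σ hT hc hm hA hin hl hN hb ho hx hrow hg
      obtain ⟨hA₁, hA₂⟩ := hA
      have hpos := t.numNodes_pos
      simp only [NiceTree.numNodes] at ho hx hrow ⊢
      rw [show o + (t.numNodes + 1) - 1 = o + t.numNodes by omega] at hrow
      have hv : σ.a .slot v < b := hg.1 v (Finset.mem_insert_self _ _)
      refine wp_use (wp_slotStmt (W := W) (i := o + t.numNodes) (ty := 1) (u := v)
        (l := o + t.numNodes - 1) (by omega) hN hb (by omega)
        (by rw [hin.ty, hA₂]) (by rw [hin.u, hA₂]) hl.2 (words _ (by omega)) (by omega) (by simp)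
        (fun _ => hv) (by simp)) fun τ h₁ f₁ => ?_
      have h₁ := h₁.2 (by decide)
      have slot₁ := h₁.slot (by decide)
      have x₁ : τ.v .x = N - (o + (t.numNodes + 1)) := (f₁.v _ hx').trans hx
      refine rounds_use (ih (o := o) hT.2 hc.2 ((le_max_right _ _).trans hm) hA₁
        ((hin.frame f₁ (by decide) (by decide) (by decide)).set _ _) (by
          rw [HState.set_a, f₁.a _ (by decide)]; exact hl.1)
        ((f₁.v .N (by decide)).trans hN) ((f₁.v .b (by decide)).trans hb) (by omega)
        (by simp [x₁]; omega) (fun j hj => ?_) ?_) fun υ h₂ _ => ?_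
      · rw [HState.set_a, h₁.row j hj, if_pos rfl, hrow j hj, slot₁]
        constructor
        · rintro ⟨⟨y, hy, rfl⟩, hne⟩
          rcases Finset.mem_insert.1 hy with rfl | hy
          · exact absurd rfl hne
          · exact ⟨y, hy, rfl⟩
        · rintro ⟨y, hy, rfl⟩
          refine ⟨⟨y, Finset.mem_insert_of_mem hy, rfl⟩, fun h => ?_⟩
          have := hg.2 y (Finset.mem_insert_of_mem hy) v (Finset.mem_insert_self _ _) h
          exact hT.1 (this ▸ hy)
      · rw [HState.set_a, slot₁]; exact hg.mono (Finset.subset_insert _ _)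
      · have slot₂ : ∀ k, (∀ y ∈ t.verts, y ∉ t.bag → (y : ℕ) ≠ k) →
            υ.a .slot k = σ.a .slot k := fun k hk => by
          rw [h₂.slot k hk, HState.set_a, slot₁]
        refine ⟨h₂.x, ⟨hg.congr fun y hy => slot₂ y fun z hz hz' h => ?_, h₂.good⟩, fun k hk =>
          slot₂ k fun y hy hy' => hk y (Finset.mem_insert_of_mem hy) fun h => ?_, fun k hk => ?_⟩
        · obtain rfl := Fin.ext h
          rcases Finset.mem_insert.1 hy with rfl | hy
          · exact hc.1 hz
          · exact hz' hy
        · rcases Finset.mem_insert.1 h with rfl | h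
          · exact hc.1 hy
          · exact hy' h
        · have e₁ : o * b + b ≤ (o + t.numNodes) * b := by
            rw [← Nat.succ_mul]; exact Nat.mul_le_mul_right _ (by omega)
          have e₂ : (o + t.numNodes - 1) * b + b = (o + t.numNodes) * b := by
            rw [← Nat.succ_mul]; congr 1; omega
          have e₃ : o * b ≤ (o + t.numNodes - 1) * b := Nat.mul_le_mul_right _ (by omega)
          have e₄ : (o + (NiceTree.introVertex v t).numNodes) * b = (o + t.numNodes) * b + b := by
            rw [← Nat.succ_mul]; rfl
          rw [h₂.old k (by omega)]
          exact h₁.old k (by omega) (by simp)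
  | introEdge u v t ih =>
      intro o σ hT hc hm hA hin hl hN hb ho hx hrow hg
      obtain ⟨hA₁, hA₂⟩ := hA
      have hpos := t.numNodes_pos
      simp only [NiceTree.numNodes] at ho hx hrow ⊢
      rw [show o + (t.numNodes + 1) - 1 = o + t.numNodes by omega] at hrow
      refine wp_use (wp_slotStmt (W := W) (i := o + t.numNodes) (ty := 2) (u := u)
        (l := o + t.numNodes - 1) (by omega) hN hb (by omega)
        (by rw [hin.ty, hA₂]) (by rw [hin.u, hA₂]) hl.2 (words _ (by omega)) (by omega) (by simp)
        (by simp) (by simp)) fun τ h₁ f₁ => ?_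
      have h₁ := h₁.2 (by decide)
      have slot₁ := h₁.slot (by decide)
      have x₁ : τ.v .x = N - (o + (t.numNodes + 1)) := (f₁.v _ hx').trans hx
      refine rounds_use (ih (o := o) hT.2.2 hc ((le_max_right _ _).trans hm) hA₁
        ((hin.frame f₁ (by decide) (by decide) (by decide)).set _ _) (by
          rw [HState.set_a, f₁.a _ (by decide)]; exact hl.1)
        ((f₁.v .N (by decide)).trans hN) ((f₁.v .b (by decide)).trans hb) (by omega)
        (by simp [x₁]; omega) (fun j hj => ?_) ?_) fun υ h₂ _ => ?_
      · rw [HState.set_a, h₁.row j hj, if_neg (by decide), if_neg (by decide), hrow j hj, slot₁]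
        rfl
      · rw [HState.set_a, slot₁]; exact hg
      · refine ⟨h₂.x, h₂.good, fun k hk => ?_, fun k hk => ?_⟩
        · rw [h₂.slot k hk, HState.set_a, slot₁]
        · have e₁ : o * b + b ≤ (o + t.numNodes) * b := by
            rw [← Nat.succ_mul]; exact Nat.mul_le_mul_right _ (by omega)
          have e₂ : (o + t.numNodes - 1) * b + b = (o + t.numNodes) * b := by
            rw [← Nat.succ_mul]; congr 1; omega
          have e₃ : o * b ≤ (o + t.numNodes - 1) * b := Nat.mul_le_mul_right _ (by omega)
          have e₄ : (o + (NiceTree.introEdge u v t).numNodes) * b = (o + t.numNodes) * b + b := by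
            rw [← Nat.succ_mul]; rfl
          rw [h₂.old k (by omega)]
          exact h₁.old k (by omega) (by simp)
  | forget v t ih =>
      intro o σ hT hc hm hA hin hl hN hb ho hx hrow hg
      obtain ⟨hA₁, hA₂⟩ := hA
      have hpos := t.numNodes_pos
      simp only [NiceTree.numNodes] at ho hx hrow ⊢
      rw [show o + (t.numNodes + 1) - 1 = o + t.numNodes by omega] at hrow
      -- The child bag has at most `b` elements and contains `v`, so the vertices of the current bag
      -- fill at most `b - 1` slots.
      have free : ∃ j < b, σ.a .occ ((o + t.numNodes) * b + j) = 0 := by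
        by_contra! H
        have h1 : Finset.range b ⊆ (t.bag.erase v).image fun y : Fin n => σ.a .slot y := by
          intro j hj
          rw [Finset.mem_range] at hj
          obtain ⟨y, hy, e⟩ := (hrow j hj).1 (H j hj)
          exact Finset.mem_image.2 ⟨y, hy, e⟩
        have h2 := (Finset.card_le_card h1).trans Finset.card_image_le
        rw [Finset.card_range, Finset.card_erase_of_mem hT.1] at h2
        have h3 := Finset.card_pos.2 ⟨v, hT.1⟩
        have h4 := t.card_bag_le_maxBagCard
        have h5 := (le_max_right (NiceTree.forget v t).bag.card t.maxBagCard).trans hm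
        omega
      refine wp_use (wp_slotStmt (W := W) (i := o + t.numNodes) (ty := 3) (u := v)
        (l := o + t.numNodes - 1) (by omega) hN hb (by omega)
        (by rw [hin.ty, hA₂]) (by rw [hin.u, hA₂]) hl.2 (words _ (by omega)) (by omega) (by simp)
        (by simp) (fun _ => free)) fun τ h₁ f₁ => ?_
      have h₁ := h₁.2 (by decide)
      obtain ⟨fb, f0, fs⟩ := h₁.slot_forget rfl
      have fs' : ∀ y ∈ t.bag.erase v, τ.a .slot y = σ.a .slot y := fun y hy =>
        fs y fun h => Finset.ne_of_mem_erase hy (Fin.ext h)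
      have ffree : ∀ y ∈ t.bag.erase v, σ.a .slot y ≠ τ.a .slot v := fun y hy h =>
        (hrow _ fb).2 ⟨y, hy, h⟩ f0
      have x₁ : τ.v .x = N - (o + (t.numNodes + 1)) := (f₁.v _ hx').trans hx
      refine rounds_use (ih (o := o) hT.2 hc ((le_max_right _ _).trans hm) hA₁
        ((hin.frame f₁ (by decide) (by decide) (by decide)).set _ _) (by
          rw [HState.set_a, f₁.a _ (by decide)]; exact hl.1)
        ((f₁.v .N (by decide)).trans hN) ((f₁.v .b (by decide)).trans hb) (by omega)
        (by simp [x₁]; omega) (fun j hj => ?_) ?_) fun υ h₂ _ => ?_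
      · rw [HState.set_a, h₁.row j hj, if_neg (by decide), if_pos rfl, hrow j hj]
        constructor
        · rintro (⟨y, hy, rfl⟩ | rfl)
          · exact ⟨y, Finset.mem_of_mem_erase hy, fs' y hy⟩
          · exact ⟨v, hT.1, rfl⟩
        · rintro ⟨y, hy, rfl⟩
          by_cases hyv : y = v
          · exact .inr (by rw [hyv])
          · exact .inl ⟨y, Finset.mem_erase.2 ⟨hyv, hy⟩, (fs' y (Finset.mem_erase.2 ⟨hyv, hy⟩)).symm⟩
      · rw [HState.set_a]
        constructor
        · intro y hy
          by_cases hyv : y = v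
          · rwa [hyv]
          · have hy' := Finset.mem_erase.2 ⟨hyv, hy⟩
            rw [fs' y hy']; exact hg.1 y hy'
        · intro y hy z hz h
          by_cases hyv : y = v <;> by_cases hzv : z = v
          · rw [hyv, hzv]
          · have hz' := Finset.mem_erase.2 ⟨hzv, hz⟩
            rw [hyv, fs' z hz'] at h
            exact absurd h.symm (ffree z hz')
          · have hy' := Finset.mem_erase.2 ⟨hyv, hy⟩
            rw [hzv, fs' y hy'] at h
            exact absurd h (ffree y hy')
          · have hy' := Finset.mem_erase.2 ⟨hyv, hy⟩
            have hz' := Finset.mem_erase.2 ⟨hzv, hz⟩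
            rw [fs' y hy', fs' z hz'] at h
            exact hg.2 y hy' z hz' h
      · refine ⟨h₂.x, h₂.good, fun k hk => ?_, fun k hk => ?_⟩
        · rw [h₂.slot k fun y hy hy' => hk y hy fun h => hy' (Finset.mem_of_mem_erase h),
            HState.set_a]
          exact fs k (hk v (t.bag_subset_verts hT.1) (Finset.notMem_erase _ _)).symm
        · have e₁ : o * b + b ≤ (o + t.numNodes) * b := by
            rw [← Nat.succ_mul]; exact Nat.mul_le_mul_right _ (by omega)
          have e₂ : (o + t.numNodes - 1) * b + b = (o + t.numNodes) * b := by
            rw [← Nat.succ_mul]; congr 1; omega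
          have e₃ : o * b ≤ (o + t.numNodes - 1) * b := Nat.mul_le_mul_right _ (by omega)
          have e₄ : (o + (NiceTree.forget v t).numNodes) * b = (o + t.numNodes) * b + b := by
            rw [← Nat.succ_mul]; rfl
          rw [h₂.old k (by omega)]
          exact h₁.old k (by omega) (by simp)
  | join a c iha ihc =>
      intro o σ hT hc hm hA hin hl hN hb ho hx hrow hg
      obtain ⟨hA₁, hA₂, hA₃⟩ := hA
      have hpa := a.numNodes_pos
      have hpc := c.numNodes_pos
      have hm' := max_le_iff.1 ((le_max_right _ _).trans hm)
      simp only [NiceTree.numNodes] at ho hx hrow ⊢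
      rw [show o + (a.numNodes + c.numNodes + 1) - 1 = o + a.numNodes + c.numNodes by omega] at hrow
      have e₀ : (o + a.numNodes - 1) * b + b = (o + a.numNodes) * b := by
        rw [← Nat.succ_mul]; congr 1; omega
      have e₁ : (o + a.numNodes + c.numNodes - 1) * b + b = (o + a.numNodes + c.numNodes) * b := by
        rw [← Nat.succ_mul]; congr 1; omega
      have e₂ : (o + a.numNodes) * b ≤ (o + a.numNodes + c.numNodes - 1) * b :=
        Nat.mul_le_mul_right _ (by omega)
      have e₃ : o * b ≤ (o + a.numNodes - 1) * b := Nat.mul_le_mul_right _ (by omega)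
      have e₄ : (o + (NiceTree.join a c).numNodes) * b = (o + a.numNodes + c.numNodes) * b + b := by
        rw [← Nat.succ_mul]; congr 1; simp only [NiceTree.numNodes]; omega
      refine wp_use (wp_slotStmt (W := W) (i := o + a.numNodes + c.numNodes) (ty := 4) (u := 0)
        (l := o + a.numNodes - 1) (by omega) hN hb (by omega)
        (by rw [hin.ty, hA₃]) (by rw [hin.u, hA₃]) hl.2.2 (words _ (by omega)) (by omega) (by omega)
        (by simp) (by simp)) fun τ h₁ f₁ => ?_
      have h₁ := h₁.2 (by decide)
      have slot₁ := h₁.slot (by decide)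
      have left₁ : τ.a .left = σ.a .left := f₁.a _ (by decide)
      have in₁ : Input A τ := hin.frame f₁ (by decide) (by decide) (by decide)
      have N₁ : τ.v .N = N := (f₁.v _ (by decide)).trans hN
      have b₁ : τ.v .b = b := (f₁.v _ (by decide)).trans hb
      have x₁ : τ.v .x = N - (o + (a.numNodes + c.numNodes + 1)) := (f₁.v _ hx').trans hx
      have rowa : RowOK b (o + a.numNodes - 1) a.bag τ := fun j hj => by
        rw [h₁.row j hj, if_neg (by decide), if_neg (by decide), hrow j hj, slot₁]; rfl
      have rowc : RowOK b (o + a.numNodes + c.numNodes - 1) c.bag τ := fun j hj => by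
        rw [h₁.row_right rfl j hj, hrow j hj, slot₁, ← hT.1]; rfl
      -- Read backwards, post-order visits the second subtree before the first.
      rw [add_comm a.numNodes, rounds_add]
      refine rounds_use (ihc (o := o + a.numNodes) hT.2.2 hc.2.2 hm'.2 hA₂ (in₁.set _ _)
        (by rw [HState.set_a, left₁]; exact hl.2.1) N₁ b₁ (by omega) (by simp [x₁]; omega) rowc
        (by rw [HState.set_a, slot₁, ← hT.1]; exact hg)) fun υ h₂ f₂ => ?_
      -- The pass through the second subtree assigns slots only to vertices outside its root bag,
      -- and that bag is also the bag of the first child.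
      have keep : ∀ y ∈ a.bag, υ.a .slot y = τ.a .slot y := fun y hy =>
        h₂.slot y fun z _ hz' h => hz' (by rw [Fin.ext h, ← hT.1]; exact hy)
      refine rounds_use (iha (o := o) hT.2.1 hc.2.1 hm'.1 hA₁
        ((in₁.set _ _).frame f₂ (by decide) (by decide) (by decide))
        (by rw [f₂.a _ (by decide), HState.set_a, left₁]; exact hl.1)
        ((f₂.v _ (by decide)).trans N₁) ((f₂.v _ (by decide)).trans b₁) (by omega) h₂.x
        (fun j hj => ?_) ?_) fun ω h₃ f₃ => ?_
      · rw [h₂.old _ (by omega), HState.set_a, rowa j hj]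
        refine exists_congr fun y => and_congr_right fun hy => ?_
        rw [keep y hy]
      · refine GoodOn.congr (D := a.bag) (slot := σ.a .slot) hg fun y hy => ?_
        rw [keep y hy, slot₁]
      · refine ⟨h₃.x, ⟨h₃.good, h₂.good.congr fun y hy => h₃.slot y fun z hz hz' h => ?_⟩,
          fun k hk => ?_, fun k hk => ?_⟩
        · obtain rfl := Fin.ext h
          exact hz' (hc.1 _ hz hy)
        · rw [h₃.slot k fun y hy hy' => hk y (Finset.mem_union_left _ hy) hy',
            h₂.slot k fun y hy hy' => hk y (Finset.mem_union_right _ hy) fun h => hy' (hT.1 ▸ h),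
            HState.set_a, slot₁]
        · rw [h₃.old k (by omega), h₂.old k (by omega), HState.set_a]
          exact h₁.old k (by omega) (by omega)

end

section

variable {n : ℕ}

/-! ### The table of the dynamic programming -/

/-- Row `i` of a table. -/
def Ctx.row (C : Ctx) (f : ℕ → ℕ) (i : ℕ) : ℕ → ℕ := fun c => f (i * C.size + c)

theorem Ctx.row_update (C : Ctx) (f : ℕ → ℕ) (i c v : ℕ) :
    C.row (Function.update f (i * C.size + c) v) i = Function.update (C.row f i) c v := by
  funext k
  by_cases h : k = c
  · simp [row, h]
  · simp [row, h, Function.update_of_ne]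

theorem Ctx.row_congr {C : Ctx} {f f' : ℕ → ℕ} {i : ℕ}
    (h : ∀ k, i * C.size ≤ k → k < i * C.size + C.size → f' k = f k) {c : ℕ} (hc : c < C.size) :
    C.row f' i c = C.row f i c := h _ (by omega) (by omega)

/-- A row of the table, with values `V` and back pointers `P` and `Q`, that results from the pairs in
`D` of codes from rows with values `V₁` and `V₂`. The values are shifted by one; a code that does not
occur has value zero. -/
structure NodeOK (C : Ctx) (ty u w : ℕ) (V₁ V₂ : ℕ → ℕ) (D : ℕ → ℕ → Prop) (V P Q : ℕ → ℕ) :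
    Prop where
  complete : ∀ c₁ < C.size, ∀ c₂ < C.size, D c₁ c₂ → V₁ c₁ ≠ 0 → V₂ c₂ ≠ 0 →
    C.stepOk ty u w (dig C.base c₁) (dig C.base c₂) →
    V₁ c₁ + V₂ c₂ - 1 + C.stepGain ty u w (dig C.base c₁) ≤
      V (C.encode (C.stepOut ty u w (dig C.base c₁) (dig C.base c₂)))
  sound : ∀ c < C.size, V c ≠ 0 → P c < C.size ∧ Q c < C.size ∧ V₁ (P c) ≠ 0 ∧ V₂ (Q c) ≠ 0 ∧
    C.stepOk ty u w (dig C.base (P c)) (dig C.base (Q c)) ∧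
    C.encode (C.stepOut ty u w (dig C.base (P c)) (dig C.base (Q c))) = c ∧
    V c = V₁ (P c) + V₂ (Q c) - 1 + C.stepGain ty u w (dig C.base (P c))

section NodeOK

variable {C : Ctx} {ty u w c₁ c₂ : ℕ} {V₁ V₂ V P Q : ℕ → ℕ} {D D' : ℕ → ℕ → Prop}

theorem NodeOK.skip (h : NodeOK C ty u w V₁ V₂ D V P Q)
    (hD : ∀ a b, D' a b → D a b ∨ (a = c₁ ∧ b = c₂))
    (hs : V₁ c₁ ≠ 0 → V₂ c₂ ≠ 0 → C.stepOk ty u w (dig C.base c₁) (dig C.base c₂) →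
      V₁ c₁ + V₂ c₂ - 1 + C.stepGain ty u w (dig C.base c₁) ≤
        V (C.encode (C.stepOut ty u w (dig C.base c₁) (dig C.base c₂)))) :
    NodeOK C ty u w V₁ V₂ D' V P Q := by
  refine ⟨fun a ha b hb hab => ?_, h.sound⟩
  rcases hD a b hab with h' | ⟨rfl, rfl⟩
  · exact h.complete a ha b hb h'
  · exact hs

/-- An entry is overwritten only by a larger value, so bounds established for earlier pairs persist,
and the new pointers explain the new value. -/
theorem NodeOK.insert (h : NodeOK C ty u w V₁ V₂ D V P Q)
    (hD : ∀ a b, D' a b → D a b ∨ (a = c₁ ∧ b = c₂)) (hc₁ : c₁ < C.size) (hc₂ : c₂ < C.size)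
    (h₁ : V₁ c₁ ≠ 0) (h₂ : V₂ c₂ ≠ 0) (hok : C.stepOk ty u w (dig C.base c₁) (dig C.base c₂))
    {e v : ℕ} (he : e = C.encode (C.stepOut ty u w (dig C.base c₁) (dig C.base c₂)))
    (hv : v = V₁ c₁ + V₂ c₂ - 1 + C.stepGain ty u w (dig C.base c₁)) (hlt : V e < v) :
    NodeOK C ty u w V₁ V₂ D' (Function.update V e v) (Function.update P e c₁)
      (Function.update Q e c₂) := by
  refine ⟨fun a ha b hb hab h₁' h₂' hok' => ?_, fun c hc hne => ?_⟩
  · rcases hD a b hab with h' | ⟨rfl, rfl⟩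
    · have := h.complete a ha b hb h' h₁' h₂' hok'
      rw [Function.update_apply]
      split
      · next h'' => rw [h''] at this; omega
      · exact this
    · rw [← he, Function.update_self, hv]
  · by_cases hce : c = e
    · subst hce
      simp only [Function.update_self]
      exact ⟨hc₁, hc₂, h₁, h₂, hok, he.symm, hv⟩
    · simp only [Function.update_of_ne hce] at hne ⊢
      exact h.sound c hc hne

theorem NodeOK.congr {V₁' V₂' V' P' Q' : ℕ → ℕ} (hb : 1 ≤ C.b) (hu : ty = 1 → C.slot u < C.b)
    (h : NodeOK C ty u w V₁ V₂ D V P Q)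
    (h₁ : ∀ c < C.size, V₁' c = V₁ c) (h₂ : ∀ c < C.size, V₂' c = V₂ c)
    (h₃ : ∀ c < C.size, V' c = V c) (h₄ : ∀ c < C.size, P' c = P c)
    (h₅ : ∀ c < C.size, Q' c = Q c) : NodeOK C ty u w V₁' V₂' D V' P' Q' := by
  refine ⟨fun a ha b hb' hab h₁' h₂' hok => ?_, fun c hc hne => ?_⟩
  · rw [h₁ a ha] at h₁' ⊢
    rw [h₂ b hb'] at h₂' ⊢
    rw [h₃ _ (C.stepOut_isCode hb (C.isCode_dig ha) (C.isCode_dig hb') hu hok).encode_lt]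
    exact h.complete a ha b hb' hab h₁' h₂' hok
  · rw [h₃ c hc] at hne ⊢
    rw [h₄ c hc, h₅ c hc]
    obtain ⟨a₁, a₂, a₃, a₄, a₅, a₆, a₇⟩ := h.sound c hc hne
    rw [h₁ _ a₁, h₂ _ a₂]
    exact ⟨a₁, a₂, a₃, a₄, a₅, a₆, a₇⟩

end NodeOK

/-- The rows of the table for the nodes of `t`, from row `o` on, are correct. -/
def TableOK (C : Ctx) (V P Q : ℕ → ℕ) : NiceTree n → ℕ → Prop
  -- An absent child is replaced by a row of ones, which is value zero for every code because of the
  -- shift. The rule `V₁ + V₂ - 1` is then the same for all types of nodes.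
  | .leaf, o => NodeOK C 0 0 0 (fun _ => 1) (fun _ => 1) (fun _ _ => True) (C.row V o) (C.row P o)
      (C.row Q o)
  | .introVertex v t, o => TableOK C V P Q t o ∧
      NodeOK C 1 v 0 (C.row V (o + t.numNodes - 1)) (fun _ => 1) (fun _ _ => True)
        (C.row V (o + t.numNodes)) (C.row P (o + t.numNodes)) (C.row Q (o + t.numNodes))
  | .introEdge u v t, o => TableOK C V P Q t o ∧
      NodeOK C 2 u v (C.row V (o + t.numNodes - 1)) (fun _ => 1) (fun _ _ => True)
        (C.row V (o + t.numNodes)) (C.row P (o + t.numNodes)) (C.row Q (o + t.numNodes))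
  | .forget v t, o => TableOK C V P Q t o ∧
      NodeOK C 3 v 0 (C.row V (o + t.numNodes - 1)) (fun _ => 1) (fun _ _ => True)
        (C.row V (o + t.numNodes)) (C.row P (o + t.numNodes)) (C.row Q (o + t.numNodes))
  | .join a b, o => TableOK C V P Q a o ∧ TableOK C V P Q b (o + a.numNodes) ∧
      NodeOK C 4 0 0 (C.row V (o + a.numNodes - 1)) (C.row V (o + a.numNodes + b.numNodes - 1))
        (fun _ _ => True) (C.row V (o + a.numNodes + b.numNodes))
        (C.row P (o + a.numNodes + b.numNodes)) (C.row Q (o + a.numNodes + b.numNodes))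

theorem Unary.tableOK {ty u w : ℕ} {t T : NiceTree n} (h : Unary ty u w t T) {C : Ctx}
    {V P Q : ℕ → ℕ} {o : ℕ} : TableOK C V P Q T o ↔ TableOK C V P Q t o ∧
      NodeOK C ty u w (C.row V (o + t.numNodes - 1)) (fun _ => 1) (fun _ _ => True)
        (C.row V (o + t.numNodes)) (C.row P (o + t.numNodes)) (C.row Q (o + t.numNodes)) := by
  cases h <;> rfl

theorem Unary.slotGood {ty u w : ℕ} {t T : NiceTree n} (h : Unary ty u w t T) {slot : ℕ → ℕ}
    {b : ℕ} (hT : SlotGood slot b T) : SlotGood slot b t ∧ (ty = 1 → slot u < b) := by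
  cases h with
  | vertex v t => exact ⟨hT.2, fun _ => hT.1.1 v (Finset.mem_insert_self _ _)⟩
  | edge u v t => exact ⟨hT, by simp⟩
  | forget v t => exact ⟨hT, by simp⟩

theorem TableOK.congr {C : Ctx} (hb : 1 ≤ C.b) {V P Q V' P' Q' : ℕ → ℕ} {t : NiceTree n} :
    ∀ {o : ℕ}, SlotGood C.slot C.b t → TableOK C V P Q t o →
    (∀ k, o * C.size ≤ k → k < (o + t.numNodes) * C.size → V' k = V k ∧ P' k = P k ∧ Q' k = Q k) →
    TableOK C V' P' Q' t o := by
  have row : ∀ {o m i : ℕ} (f f' : ℕ → ℕ),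
      (∀ k, o * C.size ≤ k → k < (o + m) * C.size → f' k = f k) → o ≤ i → i < o + m →
      ∀ c < C.size, C.row f' i c = C.row f i c := by
    intro o m i f f' h h1 h2 c hc
    refine C.row_congr (fun k hk hk' => h k ?_ ?_) hc
    · exact (Nat.mul_le_mul_right _ h1).trans hk
    · refine hk'.trans_le ?_
      rw [← Nat.succ_mul]; exact Nat.mul_le_mul_right _ h2
  induction t using NiceTree.unary_induction with
  | leaf =>
      intro o hs h he
      exact NodeOK.congr hb (by simp) h (fun _ _ => rfl) (fun _ _ => rfl)
        (row V V' (fun k h1 h2 => (he k h1 h2).1) le_rfl (by simp [NiceTree.numNodes]))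
        (row P P' (fun k h1 h2 => (he k h1 h2).2.1) le_rfl (by simp [NiceTree.numNodes]))
        (row Q Q' (fun k h1 h2 => (he k h1 h2).2.2) le_rfl (by simp [NiceTree.numNodes]))
  | unary ty u w t T hU ih =>
      intro o hs h he
      have hpos := t.numNodes_pos
      rw [hU.tableOK] at h ⊢
      rw [hU.numNodes] at he
      refine ⟨ih (hU.slotGood hs).1 h.1 fun k h1 h2 => he k h1
        (h2.trans_le (Nat.mul_le_mul_right _ (by omega))), ?_⟩
      have hV := fun i => row (i := i) V V' fun k h1 h2 => (he k h1 h2).1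
      exact h.2.congr hb (hU.slotGood hs).2 (hV _ (by omega) (by omega)) (fun _ _ => rfl)
        (hV _ (by omega) (by omega))
        (row P P' (fun k h1 h2 => (he k h1 h2).2.1) (by omega) (by omega))
        (row Q Q' (fun k h1 h2 => (he k h1 h2).2.2) (by omega) (by omega))
  | join a b iha ihb =>
      intro o hs h he
      have hpa := a.numNodes_pos
      have hpb := b.numNodes_pos
      simp only [NiceTree.numNodes] at he
      have hV := fun i => row (i := i) V V' fun k h1 h2 => (he k h1 h2).1
      refine ⟨iha hs.1 h.1 fun k h1 h2 => he k h1
          (h2.trans_le (Nat.mul_le_mul_right _ (by omega))),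
        ihb hs.2 h.2.1 fun k h1 h2 => he k ((Nat.mul_le_mul_right _ (by omega)).trans h1)
          (h2.trans_le (Nat.mul_le_mul_right _ (by omega))), ?_⟩
      exact h.2.2.congr hb (by simp) (hV _ (by omega) (by omega)) (hV _ (by omega) (by omega))
        (hV _ (by omega) (by omega))
        (row P P' (fun k h1 h2 => (he k h1 h2).2.1) (by omega) (by omega))
        (row Q Q' (fun k h1 h2 => (he k h1 h2).2.2) (by omega) (by omega))

theorem Ctx.stepGain_le (C : Ctx) (ty u w : ℕ) (X : ℕ → ℕ) : C.stepGain ty u w X ≤ 1 := by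
  unfold stepGain
  split_ifs <;> omega

/-- Leaves contribute one, a node with one child at most one more, and a join adds the values of its
children minus one. This bound keeps all values within the word capacity. -/
theorem TableOK.le_numNodes {C : Ctx} {V P Q : ℕ → ℕ} {t : NiceTree n} : ∀ {o : ℕ},
    TableOK C V P Q t o → ∀ c < C.size, C.row V (o + t.numNodes - 1) c ≤ t.numNodes := by
  induction t using NiceTree.unary_induction with
  | leaf =>
      intro o h c hc
      by_cases h0 : C.row V o c = 0
      · simp [NiceTree.numNodes, h0]
      · have := (h.sound c hc h0).2.2.2.2.2.2
        simp [NiceTree.numNodes, this, Ctx.stepGain]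
  | unary ty u w t T hU ih =>
      intro o h c hc
      rw [hU.tableOK] at h
      rw [hU.numNodes, ← add_assoc, Nat.add_sub_cancel]
      by_cases h0 : C.row V (o + t.numNodes) c = 0
      · omega
      · obtain ⟨a₁, -, -, -, -, -, a₇⟩ := h.2.sound c hc h0
        have := ih h.1 _ a₁
        have := C.stepGain_le ty u w (dig C.base (C.row P (o + t.numNodes) c))
        omega
  | join a b iha ihb =>
      intro o h c hc
      have e : o + (NiceTree.join a b).numNodes - 1 = o + a.numNodes + b.numNodes := by
        simp only [NiceTree.numNodes]; omega
      rw [e, NiceTree.numNodes]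
      by_cases h0 : C.row V (o + a.numNodes + b.numNodes) c = 0
      · omega
      · obtain ⟨a₁, a₂, -, -, -, -, a₇⟩ := h.2.2.sound c hc h0
        have := iha h.1 _ a₁
        have := ihb h.2.1 _ a₂
        rw [show ∀ X, C.stepGain 4 0 0 X = 0 from fun X => by simp [Ctx.stepGain]] at a₇
        omega

/-- Following a derivation through the tree, each of its steps is among the pairs that the row has
treated. The entry thus dominates the value of every derivation with that code. -/
theorem TableOK.complete {C : Ctx} (hb : 1 ≤ C.b) {V P Q : ℕ → ℕ} {t : NiceTree n} :
    ∀ {o : ℕ} {X : ℕ → ℕ} {w : ℕ} {S : Finset (Fin n)}, SlotGood C.slot C.b t →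
      TableOK C V P Q t o → C.Deriv t X w S →
      C.IsCode X ∧ w + 1 ≤ C.row V (o + t.numNodes - 1) (C.encode X) := by
  have hsz : 0 < C.size := Nat.pow_pos C.base_pos
  have key : ∀ {o : ℕ} {X : ℕ → ℕ} {w : ℕ} {S : Finset (Fin n)} {ty u v : ℕ} {t T : NiceTree n},
      Unary ty u v t T → SlotGood C.slot C.b T → TableOK C V P Q T o →
      (∃ X₁ Y w₁, (C.IsCode X₁ ∧ w₁ + 1 ≤ C.row V (o + t.numNodes - 1) (C.encode X₁)) ∧
        C.IsCode Y ∧ C.stepOk ty u v X₁ Y ∧ X = C.stepOut ty u v X₁ Y ∧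
        w = w₁ + C.stepGain ty u v X₁) →
      C.IsCode X ∧ w + 1 ≤ C.row V (o + T.numNodes - 1) (C.encode X) := by
    rintro o _ _ S ty u v t T hU hs h ⟨X₁, Y, w₁, ⟨hX₁, hle⟩, hY, hok, rfl, rfl⟩
    refine ⟨C.stepOut_isCode hb hX₁ hY (hU.slotGood hs).2 hok, ?_⟩
    have := (hU.tableOK.1 h).2.complete _ hX₁.encode_lt _ hY.encode_lt trivial (by omega)
      one_ne_zero (by rwa [hX₁.dig_encode, hY.dig_encode])
    rw [hX₁.dig_encode, hY.dig_encode] at this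
    rw [hU.numNodes, ← add_assoc, Nat.add_sub_cancel]
    omega
  induction t with
  | leaf =>
      rintro o X w S - h ⟨rfl, rfl⟩
      refine ⟨C.isCode_zero, ?_⟩
      have h0 : C.stepOut 0 0 0 (dig C.base 0) (dig C.base 0) = fun _ => 0 := by
        funext j; simp [Ctx.stepOut, Ctx.preOut, Function.update_apply]
      have := NodeOK.complete h 0 hsz 0 hsz trivial one_ne_zero one_ne_zero
        (by simp [Ctx.stepOk, Ctx.preOk, Ctx.preOut])
      rw [h0] at this
      exact (Nat.le_add_right _ _).trans this
  | introVertex v t ih =>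
      rintro o X w S hs h ⟨X₁, Y, w₁, hd, hY, hok, hX, hw, -⟩
      exact key (S := S) (.vertex v t) hs h ⟨X₁, Y, w₁, ih hs.2 h.1 hd, hY, hok, hX, hw⟩
  | introEdge u v t ih =>
      rintro o X w S hs h ⟨X₁, Y, w₁, hd, hY, hok, hX, hw⟩
      exact key (S := S) (.edge u v t) hs h ⟨X₁, Y, w₁, ih hs h.1 hd, hY, hok, hX, hw⟩
  | forget v t ih =>
      rintro o X w S hs h ⟨X₁, Y, w₁, hd, hY, hok, hX, hw⟩
      exact key (S := S) (.forget v t) hs h ⟨X₁, Y, w₁, ih hs h.1 hd, hY, hok, hX, hw⟩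
  | join a b iha ihb =>
      rintro o _ _ S hs h ⟨X₁, X₂, w₁, w₂, h₁, h₂, hok, rfl, rfl⟩
      obtain ⟨hX₁, le₁⟩ := iha hs.1 h.1 h₁
      obtain ⟨hX₂, le₂⟩ := ihb hs.2 h.2.1 h₂
      refine ⟨C.stepOut_isCode hb hX₁ hX₂ (by simp) hok, ?_⟩
      have := h.2.2.complete _ hX₁.encode_lt _ hX₂.encode_lt trivial (by omega) (by omega)
        (by rwa [hX₁.dig_encode, hX₂.dig_encode])
      rw [hX₁.dig_encode, hX₂.dig_encode] at this
      have e : o + (NiceTree.join a b).numNodes - 1 = o + a.numNodes + b.numNodes := by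
        simp only [NiceTree.numNodes]; omega
      rw [e]
      omega

end

section

variable {n : ℕ}

/-! ### Filling the table -/

open Exp in
/-- Combine the codes `c1` and `c2` at node `i`. -/
def pairStmt : Stmt := block [
  .ite (same (var .ty) (lit 4)) (.assign .v2 (get .val ((var .i - lit 1) * var .M + var .c2)))
    (.assign .v2 (lit 1)),
  .ite (var .v2) (block [
    decodeStmt .X .c1,
    decodeStmt .Y .c2,
    stepStmt,
    .ite (var .ok) (block [
      encodeStmt,
      .assign .nv (var .v1 + var .v2 - lit 1 + var .g),
      .assign .idx (var .i * var .M + var .c),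
      .ite (less (get .val (var .idx)) (var .nv)) (block [
        .store .val (var .idx) (var .nv),
        .store .bp1 (var .idx) (var .c1),
        .store .bp2 (var .idx) (var .c2)]) .skip]) .skip]) .skip]

open Exp in
/-- Fill row `i` of the table. -/
def nodeStmt : Stmt := block [
  .assign .ty (get .ty (var .i)),
  .assign .u (get .u (var .i)),
  .assign .p (get .slot (get .u (var .i))),
  .assign .q (get .slot (get .w (var .i))),
  .assign .l (get .left (var .i)),
  .loop .c1 .M (block [
    .ite (same (var .ty) (lit 0)) (.assign .v1 (lit 1))
      (.assign .v1 (get .val (var .l * var .M + var .c1))),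
    .ite (var .v1) (.loop .c2 .M pairStmt) .skip])]

/-- While row `i` is being filled, the pairs in `D` have been treated. -/
structure TableInv (C : Ctx) (i ty u w : ℕ) (V₁ V₂ : ℕ → ℕ) (D : ℕ → ℕ → Prop)
    (σ τ : HState) : Prop where
  X : ∀ k, C.b + 2 ≤ k → τ.a .X k = 0
  Y : ∀ k, C.b + 2 ≤ k → τ.a .Y k = 0
  node : NodeOK C ty u w V₁ V₂ D (C.row (τ.a .val) i) (C.row (τ.a .bp1) i) (C.row (τ.a .bp2) i)
  old : ∀ k < i * C.size, τ.a .val k = σ.a .val k ∧ τ.a .bp1 k = σ.a .bp1 k ∧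
    τ.a .bp2 k = σ.a .bp2 k
  zero : ∀ k, i * C.size + C.size ≤ k → τ.a .val k = 0

theorem wp_pairStmt {W N i ty u w c₁ c₂ : ℕ} {C : Ctx} {V₁ V₂ : ℕ → ℕ} {D D' : ℕ → ℕ → Prop}
    {σ₀ σ : HState} (h : Env W N C σ) (hi : σ.v .i = i) (hiN : i < N) (hty : σ.v .ty = ty)
    (hty4 : ty ≤ 4) (hu : σ.v .u = u) (hp : σ.v .p = C.slot u) (hq : σ.v .q = C.slot w)
    (hslot : ty = 1 → C.slot u < C.b) (hc₁ : σ.v .c1 = c₁) (hc₂ : σ.v .c2 = c₂)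
    (hl₁ : c₁ < C.size) (hl₂ : c₂ < C.size) (hv₁ : σ.v .v1 = V₁ c₁) (h₁ : V₁ c₁ ≠ 0)
    (hV₁ : V₁ c₁ ≤ N) (hV₂ : V₂ c₂ ≤ N) (hN : 1 ≤ N)
    (h₂ : V₂ c₂ = if ty = 4 then σ₀.a .val ((i - 1) * C.size + c₂) else 1) (hi₄ : ty = 4 → 1 ≤ i)
    (hI : TableInv C i ty u w V₁ V₂ D σ₀ σ)
    (hD : ∀ a b, D' a b → D a b ∨ (a = c₁ ∧ b = c₂)) :
    wp W pairStmt (TableInv C i ty u w V₁ V₂ D' σ₀) σ := by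
  have hW := h.word
  have hsz : 0 < C.size := Nat.pow_pos C.base_pos
  have hNs : 4 * (N + 1) ≤ 4 * (N + 1) * C.size := Nat.le_mul_of_pos_right _ hsz
  have his : i * C.size + C.size ≤ N * C.size := by
    rw [← Nat.succ_mul]; exact Nat.mul_le_mul_right _ hiN
  have hNs' : N * C.size ≤ W := (Nat.mul_le_mul_right _ (by omega)).trans hW
  unfold pairStmt
  rw [wp_block_cons]
  refine wp_use (R := fun τ => τ.v .v2 = V₂ c₂) ?_ fun τ k₁ f₁ => ?_
  · simp only [wp_ite_same, wp_assign, Exp.ok_var, Exp.ok_lit, Exp.ok_get, Exp.ok_add, Exp.ok_mul,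
      Exp.ok_sub, Exp.eval_var, Exp.eval_lit, Exp.eval_get, Exp.eval_add, Exp.eval_mul,
      Exp.eval_sub, hty, hi, hc₂, h.M, HState.set_v, if_true, true_and]
    refine ⟨by omega, fun h4 => ?_, fun h4 => ⟨by omega, by rw [h₂, if_neg h4]⟩⟩
    have := hi₄ h4
    have e : (i - 1) * C.size + C.size = i * C.size := by
      rw [← Nat.succ_mul]; congr 1; omega
    refine ⟨by omega, ?_⟩
    rw [h₂, if_pos h4]
    exact (hI.old _ (by omega)).1
  have E₁ : Env W N C τ := h.frame f₁ (by decide) (by decide)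
  have a₁ : τ.a = σ.a := funext fun A => f₁.a A (by cases A <;> decide)
  have v₁ : ∀ y, y ≠ .v2 → τ.v y = σ.v y := fun y hy => f₁.v y (by simpa [Stmt.writes] using hy)
  -- The table stays as it is in three cases: the second code does not occur, the pair is rejected,
  -- or the entry is already large enough.
  have skip : ∀ υ : HState, (∀ k, C.b + 2 ≤ k → υ.a .X k = 0) →
      (∀ k, C.b + 2 ≤ k → υ.a .Y k = 0) → υ.a .val = σ.a .val → υ.a .bp1 = σ.a .bp1 →
      υ.a .bp2 = σ.a .bp2 → (V₂ c₂ ≠ 0 → C.stepOk ty u w (dig C.base c₁) (dig C.base c₂) →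
      V₁ c₁ + V₂ c₂ - 1 + C.stepGain ty u w (dig C.base c₁) ≤
        C.row (σ.a .val) i (C.encode (C.stepOut ty u w (dig C.base c₁) (dig C.base c₂)))) →
      TableInv C i ty u w V₁ V₂ D' σ₀ υ := by
    intro υ hX hY e₁ e₂ e₃ hs
    refine ⟨hX, hY, ?_, ?_, ?_⟩
    · rw [e₁, e₂, e₃]; exact hI.node.skip hD fun _ => hs
    · rw [e₁, e₂, e₃]; exact hI.old
    · rw [e₁]; exact hI.zero
  rw [wp_block_cons, wp_ite, Exp.eval_var, k₁, wp_skip]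
  refine ⟨trivial, fun h0 => ?_, fun h0 => skip τ (a₁ ▸ hI.X) (a₁ ▸ hI.Y) (by rw [a₁]) (by rw [a₁])
    (by rw [a₁]) fun h => absurd h0 h⟩
  rw [wp_block_cons]
  refine wp_use (wp_decodeStmt E₁ (by rw [v₁ _ (by decide), hc₁]; exact hl₁) (a₁ ▸ hI.X))
    fun υ k₂ f₂ => ?_
  rw [v₁ _ (by decide), hc₁] at k₂
  have E₂ : Env W N C υ := E₁.frame f₂ (by decide) (by decide)
  have Y₂ : υ.a .Y = σ.a .Y := by rw [f₂.a _ (by decide), a₁]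
  have v₂ : ∀ y, y ∉ [Var.v2, .r, .j] → υ.v y = σ.v y := fun y hy => by
    simp only [List.mem_cons, List.not_mem_nil, or_false, not_or] at hy
    rw [f₂.v y (by simp [decodeStmt, block, Stmt.writes, hy]), v₁ y hy.1]
  rw [wp_block_cons]
  refine wp_use (wp_decodeStmt E₂ (by rw [v₂ _ (by decide), hc₂]; exact hl₂)
    (by rw [Y₂]; exact hI.Y)) fun φ k₃ f₃ => ?_
  rw [v₂ _ (by decide), hc₂] at k₃
  have E₃ : Env W N C φ := E₂.frame f₃ (by decide) (by decide)
  have X₃ : φ.a .X = dig C.base c₁ := by rw [f₃.a _ (by decide), k₂]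
  have v₃ : ∀ y, y ∉ [Var.v2, .r, .j] → φ.v y = σ.v y := fun y hy => by
    rw [← v₂ y hy]
    simp only [List.mem_cons, List.not_mem_nil, or_false, not_or] at hy
    rw [f₃.v y (by simp [decodeStmt, block, Stmt.writes, hy])]
  have code₁ := C.isCode_dig hl₁
  have code₂ := C.isCode_dig hl₂
  rw [wp_block_cons]
  refine wp_use (wp_stepStmt E₃ (by rw [X₃]; exact code₁) (by rw [k₃]; exact code₂)
    (by rw [v₃ _ (by decide), hty]) hty4 (by rw [v₃ _ (by decide), hu])
    (by rw [v₃ _ (by decide), hp]) (by rw [v₃ _ (by decide), hq]) hslot) fun ψ k₄ f₄ => ?_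
  rw [X₃, k₃] at k₄
  obtain ⟨ok₄, X₄, g₄, Z₄⟩ := k₄
  have E₄ : Env W N C ψ := E₃.frame f₄ (by decide) (by decide)
  have Y₄ : ψ.a .Y = dig C.base c₂ := by rw [f₄.a _ (by decide), k₃]
  have arr₄ : ∀ A, A ∉ [Arr.X, .Y] → ψ.a A = σ.a A := fun A hA => by
    have hA' : A ∉ stepStmt.stores := by revert hA; cases A <;> decide
    simp only [List.mem_cons, List.not_mem_nil, or_false, not_or] at hA
    rw [f₄.a A hA', f₃.a A (by simp [decodeStmt, block, Stmt.stores, hA]),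
      f₂.a A (by simp [decodeStmt, block, Stmt.stores, hA]), a₁]
  have val₄ := arr₄ .val (by decide)
  have bp₄ := arr₄ .bp1 (by decide)
  have bq₄ := arr₄ .bp2 (by decide)
  rw [wp_block_cons, wp_ite, Exp.eval_var, wp_skip]
  refine ⟨trivial, fun hok => ?_, fun hok => skip ψ Z₄ (by rw [Y₄]; exact code₂.2) val₄ bp₄ bq₄
    fun _ hs => absurd hok (ok₄.2 hs)⟩
  have hs := ok₄.1 hok
  have X₄ := X₄ hok
  have codeX := C.stepOut_isCode h.pos code₁ code₂ hslot hs
  rw [wp_block_cons]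
  refine wp_use (wp_encodeStmt E₄ (by rw [X₄]; exact codeX)) fun χ k₅ f₅ => ?_
  rw [X₄] at k₅
  set e := C.encode (C.stepOut ty u w (dig C.base c₁) (dig C.base c₂)) with he
  have he' : e < C.size := codeX.encode_lt
  have arr₅ : ∀ A, χ.a A = ψ.a A := fun A => f₅.a A (by cases A <;> decide)
  have i₅ : χ.v .i = i := by
    rw [f₅.v _ (by decide), f₄.v _ (by decide), v₃ _ (by decide), hi]
  have c₁₅ : χ.v .c1 = c₁ := by
    rw [f₅.v _ (by decide), f₄.v _ (by decide), v₃ _ (by decide), hc₁]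
  have c₂₅ : χ.v .c2 = c₂ := by
    rw [f₅.v _ (by decide), f₄.v _ (by decide), v₃ _ (by decide), hc₂]
  have v₁₅ : χ.v .v1 = V₁ c₁ := by
    rw [f₅.v _ (by decide), f₄.v _ (by decide), v₃ _ (by decide), hv₁]
  have v₂₅ : χ.v .v2 = V₂ c₂ := by
    rw [f₅.v _ (by decide), f₄.v _ (by decide), f₃.v _ (by decide), f₂.v _ (by decide), k₁]
  have M₅ : χ.v .M = C.size := by rw [f₅.v _ (by decide), E₄.M]
  have g₅ : χ.v .g = C.stepGain ty u w (dig C.base c₁) := by rw [f₅.v _ (by decide), g₄]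
  have hg := C.stepGain_le ty u w (dig C.base c₁)
  simp only [wp_block_cons, wp_block_nil, wp_assign, wp_ite_less, wp_store, wp_skip, Exp.ok_var,
    Exp.ok_lit, Exp.ok_get, Exp.ok_add, Exp.ok_mul, Exp.ok_sub, Exp.eval_var, Exp.eval_lit,
    Exp.eval_get, Exp.eval_add, Exp.eval_mul, Exp.eval_sub, HState.set_v, HState.set_a,
    HState.put_v, reduceCtorEq, if_true, if_false, true_and, i₅, c₁₅, c₂₅, v₁₅, v₂₅, M₅, g₅, k₅]
  refine ⟨⟨⟨by omega, by omega⟩, by omega⟩, ⟨by omega, by omega⟩, fun hlt => ?_, fun hlt => ?_⟩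
  · rw [arr₅, val₄] at hlt
    refine ⟨?_, ?_, ?_, ?_, ?_⟩
    · simpa [arr₅] using Z₄
    · simpa [arr₅, Y₄] using code₂.2
    · simp only [HState.put_a, HState.set_a, reduceCtorEq, if_true, if_false, C.row_update, arr₅,
        val₄, bp₄, bq₄]
      exact hI.node.insert hD hl₁ hl₂ h₁ h0 hs he rfl hlt
    · intro k hk
      simp only [HState.put_a, HState.set_a, reduceCtorEq, if_true, if_false, arr₅,
        val₄, bp₄, bq₄, Function.update_of_ne (show k ≠ i * C.size + e by omega)]
      exact hI.old k hk
    · intro k hk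
      simp only [HState.put_a, HState.set_a, reduceCtorEq, if_true, if_false, arr₅,
        val₄, bp₄, bq₄, Function.update_of_ne (show k ≠ i * C.size + e by omega)]
      exact hI.zero k hk
  · rw [arr₅, val₄] at hlt
    refine skip _ ?_ ?_ ?_ ?_ ?_ fun _ _ => not_lt.1 hlt
    · simpa [arr₅] using Z₄
    · simpa [arr₅, Y₄] using code₂.2
    · simp [arr₅, val₄]
    · simp [arr₅, bp₄]
    · simp [arr₅, bq₄]

theorem TableInv.set {C : Ctx} {i ty u w : ℕ} {V₁ V₂ : ℕ → ℕ} {D : ℕ → ℕ → Prop} {σ τ : HState}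
    (h : TableInv C i ty u w V₁ V₂ D σ τ) (x : Var) (k : ℕ) :
    TableInv C i ty u w V₁ V₂ D σ (τ.set x k) := ⟨h.X, h.Y, h.node, h.old, h.zero⟩

theorem TableInv.of_eq {C : Ctx} {i ty u w : ℕ} {V₁ V₂ : ℕ → ℕ} {D D' : ℕ → ℕ → Prop}
    {σ τ υ : HState} (h : TableInv C i ty u w V₁ V₂ D σ τ) (ha : υ.a = τ.a)
    (hD : ∀ a < C.size, ∀ b < C.size, D' a b → V₁ a ≠ 0 → D a b) :
    TableInv C i ty u w V₁ V₂ D' σ υ := by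
  refine ⟨ha ▸ h.X, ha ▸ h.Y, ?_, ha ▸ h.old, ha ▸ h.zero⟩
  rw [ha]
  exact ⟨fun a ha b hb hab h₁ => h.node.complete a ha b hb (hD a ha b hb hab h₁) h₁,
    h.node.sound⟩

/-- The second code runs over all codes at every type of node. At a join it is a signature of the
second child, at an introduce-vertex node it is the guess for the new label, and at the other nodes
it has no effect on the result. -/
theorem wp_nodeStmt {W N i l ty u w : ℕ} {C : Ctx} {V₁ V₂ : ℕ → ℕ} {σ : HState}
    (h : Env W N C σ) (hi : σ.v .i = i) (hiN : i < N) (hty : σ.a .ty i = ty) (hty4 : ty ≤ 4)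
    (hu : σ.a .u i = u) (hw : σ.a .w i = w) (hl : σ.a .left i = l) (hli : ty ≠ 0 → l < i)
    (hi₄ : ty = 4 → 1 ≤ i) (hslot : ty = 1 → C.slot u < C.b)
    (h₁ : ∀ c < C.size, V₁ c = if ty = 0 then 1 else σ.a .val (l * C.size + c))
    (h₂ : ∀ c < C.size, V₂ c = if ty = 4 then σ.a .val ((i - 1) * C.size + c) else 1)
    (hV₁ : ∀ c < C.size, V₁ c ≤ N) (hV₂ : ∀ c < C.size, V₂ c ≤ N)
    (hX : ∀ k, C.b + 2 ≤ k → σ.a .X k = 0) (hY : ∀ k, C.b + 2 ≤ k → σ.a .Y k = 0)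
    (hval : ∀ k, i * C.size ≤ k → σ.a .val k = 0) :
    wp W nodeStmt (TableInv C i ty u w V₁ V₂ (fun _ _ => True) σ) σ := by
  have hW := h.word
  have hsz : 0 < C.size := Nat.pow_pos C.base_pos
  have hNs : 4 * (N + 1) ≤ 4 * (N + 1) * C.size := Nat.le_mul_of_pos_right _ hsz
  have hNs' : N * C.size ≤ W := (Nat.mul_le_mul_right _ (by omega)).trans hW
  have his : i * C.size + C.size ≤ N * C.size := by
    rw [← Nat.succ_mul]; exact Nat.mul_le_mul_right _ hiN
  unfold nodeStmt
  simp only [wp_block_cons, wp_assign, Exp.ok_var, Exp.ok_get, Exp.eval_var, Exp.eval_get,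
    HState.set_v, HState.set_a, reduceCtorEq, if_true, if_false, true_and, hi, hty, hu, hw, hl,
    h.slot]
  set ρ := ((((σ.set .ty ty).set .u u).set .p (C.slot u)).set .q (C.slot w)).set .l l with hρ
  have Eρ : Env W N C ρ := ⟨h.b, h.L, h.B, h.M, h.nodes, h.conn, h.st, h.s, h.t, h.slot, h.pos,
    h.word⟩
  have vρ : ρ.v .i = i ∧ ρ.v .ty = ty ∧ ρ.v .u = u ∧ ρ.v .p = C.slot u ∧ ρ.v .q = C.slot w ∧
    ρ.v .l = l := by simp [hρ, hi]
  refine wp_loop (fun m τ => TableInv C i ty u w V₁ V₂ (fun a _ => a < m) σ τ) (by decide) ?_ ?_ ?_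
  · refine ⟨hX, hY, ⟨by simp, fun c hc hne => absurd (hval _ (by omega)) hne⟩,
      fun k _ => ⟨rfl, rfl, rfl⟩, fun k hk => hval k (by omega)⟩
  · intro m hm τ hf hm' hI
    rw [Eρ.M] at hm
    have Eτ : Env W N C τ := Eρ.frame hf (by decide) (by decide)
    have i₁ : τ.v .i = i := (hf.v _ (by decide)).trans vρ.1
    have t₁ : τ.v .ty = ty := (hf.v _ (by decide)).trans vρ.2.1
    have l₁ : τ.v .l = l := (hf.v _ (by decide)).trans vρ.2.2.2.2.2
    rw [wp_block_cons]
    refine wp_use (R := fun υ => υ.v .v1 = V₁ m) ?_ fun υ k₁ f₁ => ?_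
    · simp only [wp_ite_same, wp_assign, Exp.ok_var, Exp.ok_lit, Exp.ok_get, Exp.ok_add,
        Exp.ok_mul, Exp.eval_var, Exp.eval_lit, Exp.eval_get, Exp.eval_add, Exp.eval_mul,
        t₁, l₁, hm', Eτ.M, HState.set_v, if_true, true_and, h₁ m hm]
      refine ⟨by omega, fun h0 => ⟨by omega, by rw [if_pos h0]⟩, fun h0 => ?_⟩
      have hl' := hli h0
      have hls : l * C.size + C.size ≤ i * C.size := by
        rw [← Nat.succ_mul]; exact Nat.mul_le_mul_right _ hl'
      rw [if_neg h0]
      exact ⟨⟨by omega, by omega⟩, (hI.old _ (by omega)).1⟩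
    have a₁ : υ.a = τ.a := funext fun A => f₁.a A (by cases A <;> decide)
    have Eυ : Env W N C υ := Eτ.frame f₁ (by decide) (by decide)
    have v₁ : ∀ y, y ∉ [Var.c1, .v1, .c2] → y ∉ pairStmt.writes → υ.v y = ρ.v y := by
      intro y hy hy'
      simp only [List.mem_cons, List.not_mem_nil, or_false, not_or] at hy
      rw [f₁.v y (by simp [Stmt.writes, hy]), hf.v y (by simp [Stmt.writes, block, hy, hy'])]
    have m₁ : υ.v .c1 = m := (f₁.v _ (by decide)).trans hm'
    simp only [wp_block_cons, wp_block_nil, wp_ite, wp_skip, Exp.ok_var, Exp.eval_var, k₁,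
      true_and]
    refine ⟨fun h0 => ?_, fun h0 => ?_⟩
    -- The pairs treated so far form an initial segment in lexicographic order.
    · refine wp_loop (fun r φ => TableInv C i ty u w V₁ V₂ (fun a b => a < m ∨ (a = m ∧ b < r)) σ φ)
        (by decide) ?_ ?_ ?_
      · exact (hI.of_eq a₁ fun a _ b _ h _ => by omega).set _ _
      · intro r hr φ hφ hr' hJ
        rw [Eυ.M] at hr
        have Eφ : Env W N C φ := Eυ.frame hφ (by decide) (by decide)
        have v₂ : ∀ y, y ∉ [Var.c1, .v1, .c2] → y ∉ pairStmt.writes → φ.v y = ρ.v y := by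
          intro y hy hy'
          rw [← v₁ y hy hy']
          simp only [List.mem_cons, List.not_mem_nil, or_false, not_or] at hy
          exact hφ.v y (by simp [hy, hy'])
        refine wp_mono W _ (fun ψ hψ => hψ.set _ _) (wp_pairStmt (c₁ := m) (c₂ := r) Eφ
          ((v₂ _ (by decide) (by decide)).trans vρ.1) hiN
          ((v₂ _ (by decide) (by decide)).trans vρ.2.1) hty4
          ((v₂ _ (by decide) (by decide)).trans vρ.2.2.1)
          ((v₂ _ (by decide) (by decide)).trans vρ.2.2.2.1)
          ((v₂ _ (by decide) (by decide)).trans vρ.2.2.2.2.1) hslot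
          ((hφ.v _ (by decide)).trans m₁) hr' hm hr
          ((hφ.v _ (by decide)).trans k₁) h0 (hV₁ m hm) (hV₂ r hr) (by omega) (h₂ r hr) hi₄ hJ
          (by omega))
      · intro φ _ hJ
        rw [Eυ.M] at hJ
        exact (hJ.of_eq rfl fun a _ b _ h _ => by omega).set _ _
    · refine (hI.of_eq a₁ fun a ha b hb h h' => ?_).set _ _
      rcases Nat.lt_succ_iff_lt_or_eq.1 h with h | rfl
      · exact h
      · exact absurd h0 h'
  · intro τ _ hI
    rw [Eρ.M] at hI
    exact hI.of_eq rfl fun a ha _ _ _ _ => ha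

end

section

variable {n : ℕ}

/-- The results of filling the rows of a subtree. -/
structure TablePost (C : Ctx) (t : NiceTree n) (o : ℕ) (σ τ : HState) : Prop where
  i : τ.v .i = o + t.numNodes
  X : ∀ k, C.b + 2 ≤ k → τ.a .X k = 0
  Y : ∀ k, C.b + 2 ≤ k → τ.a .Y k = 0
  table : TableOK C (τ.a .val) (τ.a .bp1) (τ.a .bp2) t o
  old : ∀ k < o * C.size, τ.a .val k = σ.a .val k ∧ τ.a .bp1 k = σ.a .bp1 k ∧
    τ.a .bp2 k = σ.a .bp2 k
  zero : ∀ k, (o + t.numNodes) * C.size ≤ k → τ.a .val k = 0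

theorem Ctx.row_old {C : Ctx} {f f' : ℕ → ℕ} {i m : ℕ} (h : ∀ k < m * C.size, f' k = f k)
    (hi : i < m) : ∀ c < C.size, C.row f' i c = C.row f i c := by
  intro c hc
  have : i * C.size + C.size ≤ m * C.size := by
    rw [← Nat.succ_mul]; exact Nat.mul_le_mul_right _ hi
  exact h _ (by omega)

/-- Children precede their parents, so their rows are finished when they are needed and are not
touched afterwards. The rows still to come are zero, which is the entry for a code that does not
occur. -/
theorem rounds_nodeStmt {W N : ℕ} {C : Ctx} {A : ℕ → ℕ × ℕ × ℕ} {t : NiceTree n} :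
    ∀ {o : ℕ} {σ : HState}, SlotGood C.slot C.b t → Located A t o → Input A σ →
      LeftOK (σ.a .left) t o → Env W N C σ → σ.v .i = o → o + t.numNodes ≤ N →
      (∀ k, C.b + 2 ≤ k → σ.a .X k = 0) → (∀ k, C.b + 2 ≤ k → σ.a .Y k = 0) →
      (∀ k, o * C.size ≤ k → σ.a .val k = 0) →
      rounds (wp W nodeStmt) .i t.numNodes (TablePost C t o σ) σ := by
  have hi' : Var.i ∉ nodeStmt.writes := by decide
  induction t using NiceTree.unary_induction with
  | leaf =>
      intro o σ hs hA hin hl hE hi ho hX hY hv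
      simp only [NiceTree.numNodes] at ho
      refine wp_use (wp_nodeStmt (ty := 0) (u := 0) (w := 0) (V₁ := fun _ => 1) (V₂ := fun _ => 1)
        hE hi (by omega) (by rw [hin.ty, hA]) (by omega) (by rw [hin.u, hA]) (by rw [hin.w, hA])
        rfl (by simp) (by simp) (by simp) (by simp) (by simp) (fun _ _ => by omega)
        (fun _ _ => by omega) hX hY hv) fun τ h₁ f₁ => ?_
      have i₁ : τ.v .i = o := (f₁.v _ hi').trans hi
      refine ⟨by simp [i₁, NiceTree.numNodes], h₁.X, h₁.Y, h₁.node, h₁.old, fun k hk => h₁.zero k ?_⟩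
      rw [← Nat.succ_mul]; exact hk
  | unary ty u w t T hU ih =>
      intro o σ hs hA hin hl hE hi ho hX hY hv
      rw [hU.numNodes] at ho ⊢
      rw [rounds_add]
      obtain ⟨hA₁, hA₂⟩ := hU.located.1 hA
      obtain ⟨hs₁, hs₂⟩ := hU.slotGood hs
      obtain ⟨hl₁, hl₂⟩ := hU.leftOK.1 hl
      have hpos := t.numNodes_pos
      refine rounds_use (ih hs₁ hA₁ hin hl₁ hE hi (by omega) hX hY hv) fun τ h₁ f₁ => ?_
      have in₁ : Input A τ := hin.frame f₁ (by decide) (by decide) (by decide)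
      have E₁ : Env W N C τ := hE.frame f₁ (by decide) (by decide)
      have left₁ : τ.a .left = σ.a .left := f₁.a _ (by decide)
      have le₁ := h₁.table.le_numNodes
      refine wp_use (wp_nodeStmt (ty := ty) (u := u) (w := w) (l := o + t.numNodes - 1)
        (V₁ := C.row (τ.a .val) (o + t.numNodes - 1)) (V₂ := fun _ => 1) E₁ h₁.i (by omega)
        (by rw [in₁.ty, hA₂]) hU.type.2.le (by rw [in₁.u, hA₂]) (by rw [in₁.w, hA₂])
        (by rw [left₁, hl₂]) (fun _ => by omega) (fun h => absurd h hU.type.2.ne) hs₂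
        (fun c _ => by rw [if_neg hU.type.1]; rfl) (fun c _ => by rw [if_neg hU.type.2.ne])
        (fun c hc => (le₁ c hc).trans (by omega)) (fun _ _ => by omega) h₁.X h₁.Y h₁.zero)
        fun υ h₂ f₂ => ?_
      have i₂ : υ.v .i = o + t.numNodes := (f₂.v _ hi').trans h₁.i
      have e₁ : o * C.size ≤ (o + t.numNodes) * C.size := Nat.mul_le_mul_right _ (by omega)
      refine ⟨by simp [i₂, hU.numNodes, add_assoc], h₂.X, h₂.Y, hU.tableOK.2 ⟨?_, ?_⟩,
        fun k hk => ?_, fun k hk => h₂.zero k ?_⟩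
      · exact h₁.table.congr hE.pos hs₁ fun k _ hk => h₂.old k hk
      · exact h₂.node.congr hE.pos hs₂ (C.row_old (fun k hk => (h₂.old k hk).1) (by omega))
          (fun _ _ => rfl) (fun _ _ => rfl) (fun _ _ => rfl) (fun _ _ => rfl)
      · obtain ⟨a₁, a₂, a₃⟩ := h₂.old k (by omega)
        obtain ⟨b₁, b₂, b₃⟩ := h₁.old k hk
        exact ⟨a₁.trans b₁, a₂.trans b₂, a₃.trans b₃⟩
      · rw [hU.numNodes, ← add_assoc, Nat.succ_mul] at hk
        exact hk
  | join a b iha ihb =>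
      intro o σ hs hA hin hl hE hi ho hX hY hv
      simp only [NiceTree.numNodes] at ho ⊢
      rw [rounds_add, rounds_add]
      obtain ⟨hA₁, hA₂, hA₃⟩ := hA
      obtain ⟨hl₁, hl₂, hl₃⟩ := hl
      have hpa := a.numNodes_pos
      have hpb := b.numNodes_pos
      refine rounds_use (iha hs.1 hA₁ hin hl₁ hE hi (by omega) hX hY hv) fun τ h₁ f₁ => ?_
      have in₁ : Input A τ := hin.frame f₁ (by decide) (by decide) (by decide)
      have E₁ : Env W N C τ := hE.frame f₁ (by decide) (by decide)
      have left₁ : τ.a .left = σ.a .left := f₁.a _ (by decide)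
      refine rounds_use (ihb hs.2 hA₂ in₁ (by rw [left₁]; exact hl₂) E₁ h₁.i (by omega) h₁.X h₁.Y
        h₁.zero) fun υ h₂ f₂ => ?_
      have in₂ : Input A υ := in₁.frame f₂ (by decide) (by decide) (by decide)
      have E₂ : Env W N C υ := E₁.frame f₂ (by decide) (by decide)
      have left₂ : υ.a .left = σ.a .left := (f₂.a _ (by decide)).trans left₁
      have table₁ : TableOK C (υ.a .val) (υ.a .bp1) (υ.a .bp2) a o :=
        h₁.table.congr hE.pos hs.1 fun k _ hk => h₂.old k hk
      have le₁ := table₁.le_numNodes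
      have le₂ := h₂.table.le_numNodes
      refine wp_use (wp_nodeStmt (ty := 4) (u := 0) (w := 0) (l := o + a.numNodes - 1)
        (V₁ := C.row (υ.a .val) (o + a.numNodes - 1))
        (V₂ := C.row (υ.a .val) (o + a.numNodes + b.numNodes - 1)) E₂ h₂.i (by omega)
        (by rw [in₂.ty, hA₃]) (by omega) (by rw [in₂.u, hA₃]) (by rw [in₂.w, hA₃])
        (by rw [left₂, hl₃]) (fun _ => by omega) (fun _ => by omega) (by simp)
        (fun c _ => by rw [if_neg (by decide)]; rfl) (fun c _ => by rw [if_pos rfl]; rfl)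
        (fun c hc => (le₁ c hc).trans (by omega)) (fun c hc => (le₂ c hc).trans (by omega))
        h₂.X h₂.Y h₂.zero) fun ω h₃ f₃ => ?_
      have i₃ : ω.v .i = o + a.numNodes + b.numNodes := (f₃.v _ hi').trans h₂.i
      have e₁ : o * C.size ≤ (o + a.numNodes) * C.size := Nat.mul_le_mul_right _ (by omega)
      have e₂ : (o + a.numNodes) * C.size ≤ (o + a.numNodes + b.numNodes) * C.size :=
        Nat.mul_le_mul_right _ (by omega)
      refine ⟨by simp [i₃, NiceTree.numNodes, add_assoc], h₃.X, h₃.Y, ⟨?_, ?_, ?_⟩,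
        fun k hk => ?_, fun k hk => h₃.zero k ?_⟩
      · exact table₁.congr hE.pos hs.1 fun k _ hk => h₃.old k (by omega)
      · exact h₂.table.congr hE.pos hs.2 fun k _ hk => h₃.old k hk
      · exact h₃.node.congr hE.pos (by simp) (C.row_old (fun k hk => (h₃.old k hk).1) (by omega))
          (C.row_old (fun k hk => (h₃.old k hk).1) (by omega)) (fun _ _ => rfl) (fun _ _ => rfl)
          (fun _ _ => rfl)
      · obtain ⟨a₁, a₂, a₃⟩ := h₃.old k (by omega)
        obtain ⟨b₁, b₂, b₃⟩ := h₂.old k (by omega)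
        obtain ⟨c₁, c₂, c₃⟩ := h₁.old k hk
        exact ⟨a₁.trans (b₁.trans c₁), a₂.trans (b₂.trans c₂), a₃.trans (b₃.trans c₃)⟩
      · rw [← Nat.succ_mul]
        simpa only [NiceTree.numNodes, ← add_assoc] using hk

/-! ### Reading off a solution -/

open Exp in
/-- Pass the codes of an optimal solution on to the children of node `i`. -/
def backStmt : Stmt := block [
  .assign .i (var .N - lit 1 - var .x),
  .assign .ty (get .ty (var .i)),
  .assign .u (get .u (var .i)),
  .assign .l (get .left (var .i)),
  .assign .idx (var .i * var .M + get .nd (var .i)),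
  .assign .c1 (get .bp1 (var .idx)),
  .assign .c2 (get .bp2 (var .idx)),
  .ite (same (var .ty) (lit 0)) .skip (block [
    .store .nd (var .l) (var .c1),
    .ite (same (var .ty) (lit 4)) (.store .nd (var .i - lit 1) (var .c2))
      (.ite (same (var .ty) (lit 1)) (.store .out (var .u) (var .c2 % var .B % lit 2)) .skip)])]

/-- The effect of `backStmt` at a node that is not a leaf. -/
structure BackStep (C : Ctx) (i ty u l : ℕ) (σ τ : HState) : Prop where
  -- At a join there is a second store at `i - 1`, which must not hit the cell of the first child.
  left : (ty = 4 → l ≠ i - 1) →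
    τ.a .nd l = C.row (σ.a .bp1) i (σ.a .nd i)
  right : ty = 4 → τ.a .nd (i - 1) = C.row (σ.a .bp2) i (σ.a .nd i)
  old : ∀ k, k ≠ l → k ≠ i - 1 → τ.a .nd k = σ.a .nd k
  out : τ.a .out = if ty = 1 then
    Function.update (σ.a .out) u (dig C.base (C.row (σ.a .bp2) i (σ.a .nd i)) 0 % 2) else σ.a .out

theorem wp_backStmt {W N i ty u l : ℕ} {C : Ctx} {σ : HState} (h : Env W N C σ)
    (hx : N - 1 - σ.v .x = i) (hiN : i < N) (hty : σ.a .ty i = ty) (hu : σ.a .u i = u)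
    (hl : σ.a .left i = l) (hnd : σ.a .nd i < C.size) :
    wp W backStmt (fun τ => (ty = 0 → τ.a = σ.a) ∧ (ty ≠ 0 → BackStep C i ty u l σ τ)) σ := by
  have hW := h.word
  have hW' := h.b_le
  have his : i * C.size + C.size ≤ N * C.size := by
    rw [← Nat.succ_mul]; exact Nat.mul_le_mul_right _ hiN
  have hNs' : N * C.size ≤ W := (Nat.mul_le_mul_right _ (by omega)).trans hW
  unfold backStmt
  simp only [wp_block_cons, wp_assign, wp_ite_same, wp_skip, wp_block_nil, wp_store, Exp.ok_sub,
    Exp.ok_var, Exp.ok_lit, Exp.ok_get, Exp.ok_add, Exp.ok_mul, Exp.ok_mod, Exp.eval_sub,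
    Exp.eval_var, Exp.eval_lit, Exp.eval_get, Exp.eval_add, Exp.eval_mul, Exp.eval_mod,
    HState.set_v, HState.set_a, HState.put_v, reduceCtorEq, if_true, if_false, h.nodes, hx, hty, hu,
    hl, h.M, h.B, true_and, Nat.zero_le]
  refine ⟨⟨by omega, trivial⟩, by omega, fun h0 => ⟨fun _ => trivial, fun h => absurd h0 h⟩, fun h0 =>
    ⟨by omega, fun h4 => ⟨by omega, fun h => absurd h h0, fun _ => ⟨fun hne => ?_, fun _ => ?_,
      fun k hk hk' => ?_, ?_⟩⟩, fun h4 => ⟨by omega, fun h1 => ⟨by omega, fun h => absurd h h0,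
      fun _ => ⟨fun _ => ?_, fun h => absurd h h4, fun k hk hk' => ?_, ?_⟩⟩, fun h1 =>
      ⟨fun h => absurd h h0, fun _ => ⟨fun _ => ?_, fun h => absurd h h4, fun k hk hk' => ?_,
        ?_⟩⟩⟩⟩⟩
  · simp [hne h4, Ctx.row]
  · simp [Ctx.row]
  · simp [hk, hk']
  · simp [h4]
  · simp [Ctx.row]
  · simp [hk, hk']
  · simp [h1, Ctx.row, dig]
  · simp [Ctx.row]
  · simp [hk, hk']
  · simp [h1]

theorem Unary.mem_verts {ty u w : ℕ} {t T : NiceTree n} (h : Unary ty u w t T) (x : Fin n) :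
    x ∈ T.verts ↔ x ∈ t.verts ∨ (ty = 1 ∧ (x : ℕ) = u) := by
  cases h with
  | vertex v t => simp [NiceTree.verts, Fin.ext_iff, or_comm]
  | edge u v t => simp [NiceTree.verts]
  | forget v t => simp [NiceTree.verts]

theorem Unary.nice {ty u w : ℕ} {t T : NiceTree n} (h : Unary ty u w t T) (hT : T.LocallyNice)
    (hc : T.Consistent) : t.LocallyNice ∧ t.Consistent ∧ (ty = 1 → ∀ x ∈ t.verts, (x : ℕ) ≠ u) := by
  cases h with
  | vertex v t =>
      refine ⟨hT.2, hc.2, fun _ x hx hxv => hc.1 (?_ : v ∈ t.verts)⟩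
      rwa [← Fin.ext hxv]
  | edge u v t => exact ⟨hT.2.2, hc, by simp⟩
  | forget v t => exact ⟨hT.2, hc, by simp⟩

/-- An introduced vertex is new, so the set may be changed at this vertex to fit the parity of the
guessed label without affecting the derivation below. -/
theorem Unary.exists_deriv {ty u w : ℕ} {t T : NiceTree n} (h : Unary ty u w t T)
    (hc : T.Consistent) {C : Ctx} {X Y : ℕ → ℕ} {m : ℕ} {S : Finset (Fin n)}
    (hd : C.Deriv t X m S) (hY : C.IsCode Y) (hok : C.stepOk ty u w X Y) :
    ∃ S', C.Deriv T (C.stepOut ty u w X Y) (m + C.stepGain ty u w X) S' ∧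
      (∀ x ∈ t.verts, x ∈ S' ↔ x ∈ S) ∧
      (ty = 1 → ∀ x : Fin n, (x : ℕ) = u → (x ∈ S' ↔ Y 0 % 2 = 1)) := by
  cases h with
  | vertex v t =>
      have key : ∀ S', (∀ x ∈ t.verts, x ∈ S' ↔ x ∈ S) → (v ∈ S' ↔ Y 0 % 2 = 1) →
          ∃ S', C.Deriv (.introVertex v t) (C.stepOut 1 v 0 X Y) (m + C.stepGain 1 v 0 X) S' ∧
            (∀ x ∈ t.verts, x ∈ S' ↔ x ∈ S) ∧
            ((1 : ℕ) = 1 → ∀ x : Fin n, (x : ℕ) = v → (x ∈ S' ↔ Y 0 % 2 = 1)) :=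
        fun S' h₁ h₂ => ⟨S', ⟨X, Y, m, hd.congr fun x hx => (h₁ x hx).symm, hY, hok, rfl, rfl,
          h₂.symm⟩, h₁, fun _ x hx => by rwa [Fin.ext hx]⟩
      have hne : ∀ x ∈ t.verts, x ≠ v := fun x hx h => hc.1 (h ▸ hx)
      by_cases h0 : Y 0 % 2 = 1
      · exact key (insert v S) (fun x hx => by simp [hne x hx]) (by simp [h0])
      · exact key (S.erase v) (fun x hx => by simp [hne x hx]) (by simp [h0])
  | edge u v t => exact ⟨S, ⟨X, Y, m, hd, hY, hok, rfl, rfl⟩, fun _ _ => Iff.rfl, by simp⟩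
  | forget v t => exact ⟨S, ⟨X, Y, m, hd, hY, hok, rfl, rfl⟩, fun _ _ => Iff.rfl, by simp⟩

/-- The results of reading off a solution in a subtree. -/
structure BackPost (N : ℕ) (C : Ctx) (t : NiceTree n) (o : ℕ) (σ τ : HState) : Prop where
  x : τ.v .x = N - o
  solution : ∃ S, C.Deriv t (dig C.base (σ.a .nd (o + t.numNodes - 1)))
      (C.row (σ.a .val) (o + t.numNodes - 1) (σ.a .nd (o + t.numNodes - 1)) - 1) S ∧
    ∀ v ∈ t.verts, τ.a .out v = if v ∈ S then 1 else 0
  out : ∀ k, (∀ v ∈ t.verts, (v : ℕ) ≠ k) → τ.a .out k = σ.a .out k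
  old : ∀ k, (k < o ∨ o + t.numNodes ≤ k) → τ.a .nd k = σ.a .nd k

/-- A nonzero entry points to nonzero entries of the children, so the descent never fails. On the
way back up, the derivations of the children combine into one with exactly the recorded value;
membership of a vertex is read off where it is introduced. -/
theorem rounds_backStmt {W N : ℕ} {C : Ctx} {A : ℕ → ℕ × ℕ × ℕ} {t : NiceTree n} :
    ∀ {o : ℕ} {σ : HState}, t.LocallyNice → t.Consistent → SlotGood C.slot C.b t →
      Located A t o → Input A σ → LeftOK (σ.a .left) t o →
      TableOK C (σ.a .val) (σ.a .bp1) (σ.a .bp2) t o → Env W N C σ →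
      σ.v .x = N - (o + t.numNodes) → o + t.numNodes ≤ N →
      σ.a .nd (o + t.numNodes - 1) < C.size →
      C.row (σ.a .val) (o + t.numNodes - 1) (σ.a .nd (o + t.numNodes - 1)) ≠ 0 →
      rounds (wp W backStmt) .x t.numNodes (BackPost N C t o σ) σ := by
  have hx' : Var.x ∉ backStmt.writes := by decide
  induction t using NiceTree.unary_induction with
  | leaf =>
      intro o σ hT hc hs hA hin hl hV hE hx ho hnd h0
      simp only [NiceTree.numNodes, Nat.add_sub_cancel] at hx ho hnd h0
      refine wp_use (wp_backStmt (i := o) (ty := 0) hE (by omega) (by omega)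
        (by rw [hin.ty, hA]) rfl rfl hnd) fun τ h₁ f₁ => ?_
      have h₁ := h₁.1 rfl
      have x₁ : τ.v .x = N - (o + 1) := (f₁.v _ hx').trans hx
      refine ⟨by simp [x₁]; omega, ⟨∅, ⟨?_, ?_⟩, by simp [NiceTree.verts]⟩, fun k _ => by simp [h₁],
        fun k _ => by simp [h₁]⟩
      · obtain ⟨a₁, a₂, -, -, a₅, a₆, a₇⟩ := NodeOK.sound hV _ hnd h0
        have e := C.encode_dig hnd
        simp only [NiceTree.numNodes, Nat.add_sub_cancel]
        have z : C.stepOut 0 0 0 (dig C.base (C.row (σ.a .bp1) o (σ.a .nd o)))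
            (dig C.base (C.row (σ.a .bp2) o (σ.a .nd o))) = fun _ => 0 := by
          funext j; simp [Ctx.stepOut, Ctx.preOut, Function.update_apply]
        rw [z] at a₆
        rw [← a₆, C.isCode_zero.dig_encode]
      · have := (NodeOK.sound hV _ hnd h0).2.2.2.2.2.2
        simp only [NiceTree.numNodes, Nat.add_sub_cancel]
        rw [this]
        simp [Ctx.stepGain]
  | unary ty u w t T hU ih =>
      intro o σ hT hc hs hA hin hl hV hE hx ho hnd h0
      obtain ⟨hA₁, hA₂⟩ := hU.located.1 hA
      obtain ⟨hs₁, hs₂⟩ := hU.slotGood hs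
      obtain ⟨hl₁, hl₂⟩ := hU.leftOK.1 hl
      obtain ⟨hV₁, hV₂⟩ := hU.tableOK.1 hV
      obtain ⟨hT₁, hc₁, hfresh⟩ := hU.nice hT hc
      have hpos := t.numNodes_pos
      have er : o + T.numNodes - 1 = o + t.numNodes := by rw [hU.numNodes]; omega
      rw [er] at hnd h0
      rw [hU.numNodes] at hx ho ⊢
      obtain ⟨a₁, a₂, a₃, -, a₅, a₆, a₇⟩ := hV₂.sound _ hnd h0
      refine wp_use (wp_backStmt (i := o + t.numNodes) (ty := ty) (u := u)
        (l := o + t.numNodes - 1) hE (by omega) (by omega) (by rw [hin.ty, hA₂])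
        (by rw [hin.u, hA₂]) hl₂ hnd) fun τ h₁ f₁ => ?_
      have h₁ := h₁.2 hU.type.1
      have x₁ : τ.v .x = N - (o + (t.numNodes + 1)) := (f₁.v _ hx').trans hx
      have nd₁ := h₁.left fun h => absurd h hU.type.2.ne
      have val₁ : τ.a .val = σ.a .val := f₁.a _ (by decide)
      have bp₁ : τ.a .bp1 = σ.a .bp1 := f₁.a _ (by decide)
      have bq₁ : τ.a .bp2 = σ.a .bp2 := f₁.a _ (by decide)
      have left₁ : τ.a .left = σ.a .left := f₁.a _ (by decide)
      have E₁ : Env W N C (τ.set .x (τ.v .x + 1)) :=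
        hE.frame (Frame.set (f₁.mono (List.subset_cons_self .x _) (List.Subset.refl _)) (by simp) _)
          (by decide) (by decide)
      refine rounds_use (ih (o := o) hT₁ hc₁ hs₁ hA₁
        ((hin.frame f₁ (by decide) (by decide) (by decide)).set _ _)
        (by rw [HState.set_a, left₁]; exact hl₁)
        (by rw [HState.set_a, val₁, bp₁, bq₁]; exact hV₁) E₁ (by simp [x₁]; omega) (by omega)
        (by rw [HState.set_a, nd₁]; exact a₁) (by rw [HState.set_a, nd₁, val₁]; exact a₃))
        fun υ h₂ _ => ?_
      obtain ⟨S, hd, hS⟩ := h₂.solution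
      rw [HState.set_a, nd₁, val₁] at hd
      obtain ⟨S', hd', hS₁, hS₂⟩ := hU.exists_deriv hc hd (C.isCode_dig a₂) a₅
      refine ⟨h₂.x, ⟨S', ?_, fun v hv => ?_⟩, fun k hk => ?_, fun k hk => ?_⟩
      · rw [er]
        have e := congrArg (dig C.base) a₆
        rw [(C.stepOut_isCode hE.pos (C.isCode_dig a₁) (C.isCode_dig a₂) hs₂ a₅).dig_encode] at e
        rw [← e, a₇]
        convert hd' using 1
        omega
      · by_cases hvt : v ∈ t.verts
        · rw [hS v hvt]; simp only [hS₁ v hvt]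
        · obtain ⟨h1, hvu⟩ := ((hU.mem_verts v).1 hv).resolve_left hvt
          rw [h₂.out v fun y hy h => hvt (Fin.ext h ▸ hy), HState.set_a, h₁.out, if_pos h1, hvu,
            Function.update_self]
          simp only [hS₂ h1 v hvu]
          split <;> omega
      · rw [h₂.out k fun y hy => hk y ((hU.mem_verts y).2 (.inl hy)), HState.set_a, h₁.out]
        split
        · next h1 =>
          refine Function.update_of_ne (fun h => ?_) _ _
          subst h
          cases hU with
          | vertex v t => exact hk v (by simp [NiceTree.verts]) rfl
          | edge => simp at h1
          | forget => simp at h1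
        · rfl
      · rw [hU.numNodes] at hk
        rw [h₂.old k (by omega), HState.set_a, h₁.old k (by omega) (by omega)]
  | join a b iha ihb =>
      intro o σ hT hc hs hA hin hl hV hE hx ho hnd h0
      obtain ⟨hA₁, hA₂, hA₃⟩ := hA
      obtain ⟨hl₁, hl₂, hl₃⟩ := hl
      obtain ⟨hV₁, hV₂, hV₃⟩ := hV
      have hpa := a.numNodes_pos
      have hpb := b.numNodes_pos
      have er : o + (NiceTree.join a b).numNodes - 1 = o + a.numNodes + b.numNodes := by
        simp only [NiceTree.numNodes]; omega
      rw [er] at hnd h0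
      simp only [NiceTree.numNodes] at hx ho ⊢
      obtain ⟨a₁, a₂, a₃, a₄, a₅, a₆, a₇⟩ := hV₃.sound _ hnd h0
      refine wp_use (wp_backStmt (i := o + a.numNodes + b.numNodes) (ty := 4) (u := 0)
        (l := o + a.numNodes - 1) hE (by omega) (by omega) (by rw [hin.ty, hA₃])
        (by rw [hin.u, hA₃]) hl₃ hnd) fun τ h₁ f₁ => ?_
      have h₁ := h₁.2 (by decide)
      have x₁ : τ.v .x = N - (o + (a.numNodes + b.numNodes + 1)) := (f₁.v _ hx').trans hx
      have nda := h₁.left fun _ => by omega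
      have ndb := h₁.right rfl
      have out₁ : τ.a .out = σ.a .out := h₁.out.trans (if_neg (by decide))
      have val₁ : τ.a .val = σ.a .val := f₁.a _ (by decide)
      have bp₁ : τ.a .bp1 = σ.a .bp1 := f₁.a _ (by decide)
      have bq₁ : τ.a .bp2 = σ.a .bp2 := f₁.a _ (by decide)
      have left₁ : τ.a .left = σ.a .left := f₁.a _ (by decide)
      have in₁ : Input A (τ.set .x (τ.v .x + 1)) :=
        (hin.frame f₁ (by decide) (by decide) (by decide)).set _ _
      have E₁ : Env W N C (τ.set .x (τ.v .x + 1)) :=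
        hE.frame (Frame.set (f₁.mono (List.subset_cons_self .x _) (List.Subset.refl _)) (by simp) _)
          (by decide) (by decide)
      rw [add_comm a.numNodes, rounds_add]
      refine rounds_use (ihb (o := o + a.numNodes) hT.2.2 hc.2.2 hs.2 hA₂ in₁
        (by rw [HState.set_a, left₁]; exact hl₂)
        (by rw [HState.set_a, val₁, bp₁, bq₁]; exact hV₂) E₁ (by simp [x₁]; omega) (by omega)
        (by rw [HState.set_a, ndb]; exact a₂) (by rw [HState.set_a, ndb, val₁]; exact a₄))
        fun υ h₂ f₂ => ?_
      have nda₂ : υ.a .nd (o + a.numNodes - 1) =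
          C.row (σ.a .bp1) (o + a.numNodes + b.numNodes) (σ.a .nd (o + a.numNodes + b.numNodes)) := by
        rw [h₂.old _ (by omega), HState.set_a, nda]
      have val₂ : υ.a .val = σ.a .val := (f₂.a _ (by decide)).trans val₁
      have bp₂ : υ.a .bp1 = σ.a .bp1 := (f₂.a _ (by decide)).trans bp₁
      have bq₂ : υ.a .bp2 = σ.a .bp2 := (f₂.a _ (by decide)).trans bq₁
      have left₂ : υ.a .left = σ.a .left := (f₂.a _ (by decide)).trans left₁
      refine rounds_use (iha (o := o) hT.2.1 hc.2.1 hs.1 hA₁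
        (in₁.frame f₂ (by decide) (by decide) (by decide)) (by rw [left₂]; exact hl₁)
        (by rw [val₂, bp₂, bq₂]; exact hV₁) (E₁.frame f₂ (by decide) (by decide)) h₂.x (by omega)
        (by rw [nda₂]; exact a₁) (by rw [nda₂, val₂]; exact a₃)) fun ω h₃ _ => ?_
      obtain ⟨S₂, hd₂, hS₂⟩ := h₂.solution
      obtain ⟨S₁, hd₁, hS₁⟩ := h₃.solution
      rw [HState.set_a, ndb, val₁] at hd₂
      rw [nda₂, val₂] at hd₁
      have hd := hd₁.join hE.pos hT hc hs hd₂ a₅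
      -- The first subtree is read last, so its output prevails for shared vertices. This is the
      -- choice made by the set that `Deriv.join` glues together.
      refine ⟨h₃.x, ⟨Finset.univ.filter fun x => if x ∈ a.verts then x ∈ S₁ else x ∈ S₂, ?_,
        fun v hv => ?_⟩, fun k hk => ?_, fun k hk => ?_⟩
      · rw [er]
        have e := congrArg (dig C.base) a₆
        rw [(C.stepOut_isCode hE.pos (C.isCode_dig a₁) (C.isCode_dig a₂) (by simp) a₅).dig_encode]
          at e
        rw [← e, a₇]
        convert hd using 1
        omega
      · by_cases hva : v ∈ a.verts
        · rw [hS₁ v hva]; simp [hva]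
        · have hvb := (Finset.mem_union.1 hv).resolve_left hva
          rw [h₃.out v fun y hy h => hva (Fin.ext h ▸ hy), hS₂ v hvb]
          simp [hva]
      · rw [h₃.out k fun y hy => hk y (Finset.mem_union_left _ hy),
          h₂.out k fun y hy => hk y (Finset.mem_union_right _ hy), HState.set_a, out₁]
      · simp only [NiceTree.numNodes] at hk
        rw [h₃.old k (by omega), h₂.old k (by omega), HState.set_a,
          h₁.old k (by omega) (by omega)]

end

section

variable {n : ℕ}

/-! ### The phases of the algorithm -/

open Exp in
/-- Compute the sizes of the subtrees and the parameters of the table. -/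
def sizePhase (conn st : ℕ) : Stmt := block [
  .assign .conn (lit conn),
  .assign .st (lit st),
  .loop .i .N sizeStmt,
  .assign .L (var .b + lit 2),
  .assign .B (lit 2 * var .b + lit 1),
  .assign .M (lit 1)]

open Exp in
/-- Compute the number of codes and the slots of the vertices. -/
def slotPhase : Stmt := block [
  .loop .j .L (.assign .M (var .M * var .B)),
  .loop .x .N slotStmt]

open Exp in
/-- Fill the table and read off an optimal solution. -/
def tablePhase : Stmt := block [
  .loop .i .N nodeStmt,
  .assign .c (var .M / var .B / var .B * (lit 1 + var .B)),
  .assign .v1 (get .val ((var .N - lit 1) * var .M + var .c)),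
  .ite (var .v1) (block [
    .store .nd (var .N - lit 1) (var .c),
    .loop .x .N backStmt]) .skip]

open Exp in
/-- Output the value of the solution. -/
def outputPhase : Stmt :=
  .ite (var .v1) (block [.assign .n (lit 1), .assign .N (var .v1 - lit 1)]) (.assign .n (lit 0))

/-- The algorithm; the last instruction compares the value with the number in register `2`. -/
def program (conn st : ℕ) : Prog :=
  -- The phases are compiled one by one because a loop bound must be constant throughout a compiled
  -- statement: `b` and `L` result from the first phase, `M` from the second, and the last one
  -- overwrites `N`.
  .seq (sizePhase conn st).compile (.seq slotPhase.compile (.seq tablePhase.compile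
    -- `v1` is the optimal value plus one, or zero if nothing is feasible, so `k < v1` answers the
    -- question for a cut with at least `k` edges.
    (.seq outputPhase.compile (.arith .lt 2 2 Var.v1.code))))

theorem wp_sizePhase {W conn st : ℕ} {A : ℕ → ℕ × ℕ × ℕ} {t : NiceTree n} {σ : HState}
    (hT : t.LocallyNice) (hA : Located A t 0) (hin : Input A σ) (hN : σ.v .N = t.numNodes)
    (hb : σ.v .b = 0) (hW : 2 * t.numNodes + 5 ≤ W) (hconn : conn ≤ W) (hst : st ≤ W) :
    wp W (sizePhase conn st) (fun τ => LeftOK (τ.a .left) t 0 ∧ τ.v .b = t.maxBagCard ∧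
      τ.v .L = t.maxBagCard + 2 ∧ τ.v .B = 2 * t.maxBagCard + 1 ∧ τ.v .M = 1 ∧
      τ.v .conn = conn ∧ τ.v .st = st) σ := by
  have hm := t.maxBagCard_le
  have hpos := t.numNodes_pos
  unfold sizePhase
  simp only [wp_block_cons, wp_assign, Exp.ok_lit, Exp.eval_lit]
  refine ⟨hconn, hst, ?_⟩
  refine wp_use (R := fun τ => LeftOK (τ.a .left) t 0 ∧ τ.v .b = t.maxBagCard) ?_ fun τ h₁ f₁ => ?_
  · change rounds (wp W sizeStmt) .i _ _ _
    rw [show ((σ.set .conn conn).set .st st).v .N = t.numNodes by simpa using hN]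
    refine rounds_use (rounds_sizeStmt (o := 0) hW hT hA (((hin.set _ _).set _ _).set _ _)
      (by simp) (by omega)) fun τ h₁ _ => ⟨h₁.left, ?_⟩
    rw [h₁.b]
    simp [hb]
  · have c₁ : τ.v .conn = conn := by rw [f₁.v _ (by decide)]; simp
    have s₁ : τ.v .st = st := by rw [f₁.v _ (by decide)]; simp
    simp only [wp_block_cons, wp_block_nil, wp_assign, Exp.ok_var, Exp.ok_lit, Exp.ok_add,
      Exp.ok_mul, Exp.eval_var, Exp.eval_lit, Exp.eval_add, Exp.eval_mul, HState.set_v,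
      HState.set_a, reduceCtorEq, if_true, if_false, h₁.2, c₁, s₁, true_and, and_true, h₁.1]
    omega

theorem wp_slotPhase {W b : ℕ} {A : ℕ → ℕ × ℕ × ℕ} {t : NiceTree n} {σ : HState}
    (hT : t.LocallyNice) (hc : t.Consistent) (hbag : t.bag = ∅) (hA : Located A t 0)
    (hin : Input A σ) (hN : σ.v .N = t.numNodes) (hb : σ.v .b = b) (hL : σ.v .L = b + 2)
    (hB : σ.v .B = 2 * b + 1) (hM : σ.v .M = 1) (hm : t.maxBagCard ≤ b)
    (hl : LeftOK (σ.a .left) t 0) (hocc : ∀ k, σ.a .occ k = 0)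
    (hW : 4 * (t.numNodes + 1) * (2 * b + 1) ^ (b + 2) ≤ W) :
    wp W slotPhase (fun τ => τ.v .M = (2 * b + 1) ^ (b + 2) ∧ SlotGood (τ.a .slot) b t) σ := by
  have hpos := t.numNodes_pos
  unfold slotPhase
  rw [wp_block_cons]
  have hpow : ∀ k < b + 2, (2 * b + 1) ^ (k + 1) ≤ W := fun k hk =>
    (Nat.pow_le_pow_right (by omega) (by omega)).trans
      ((Nat.le_mul_of_pos_left _ (by omega)).trans hW)
  have hb2 : 2 * b + 1 ≤ (2 * b + 1) ^ (b + 2) := Nat.le_self_pow (by omega) _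
  have hW' : t.numNodes * b + 5 ≤ W := by
    have h₁ := Nat.mul_le_mul_left (4 * (t.numNodes + 1)) hb2
    have h₂ : t.numNodes * b + 5 ≤ 4 * (t.numNodes + 1) * (2 * b + 1) := by
      nlinarith [Nat.zero_le (t.numNodes * b)]
    omega
  refine wp_use (R := fun τ => τ.v .M = (2 * b + 1) ^ (b + 2)) ?_ fun τ h₁ f₁ => ?_
  · refine wp_loop (fun k τ => τ.v .M = (2 * b + 1) ^ k) (by decide) (by simp [hM]) ?_ ?_
    · intro k hk τ hf _ hI
      have B₁ : τ.v .B = 2 * b + 1 := (hf.v _ (by decide)).trans hB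
      have := hpow k (by omega)
      simp only [wp_assign, Exp.ok_mul, Exp.ok_var, Exp.eval_mul, Exp.eval_var, hI, B₁,
        HState.set_v, reduceCtorEq, if_true, if_false, ← pow_succ, true_and, and_true]
      exact this
    · intro τ _ hI
      rwa [hL] at hI
  · simp only [wp_block_cons, wp_block_nil]
    refine wp_use (R := fun υ => SlotGood (υ.a .slot) b t) ?_ fun υ h₂ f₂ =>
      ⟨(f₂.v _ (by decide)).trans h₁, h₂⟩
    change rounds (wp W slotStmt) .x _ _ _
    rw [show τ.v .N = t.numNodes from (f₁.v _ (by decide)).trans hN]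
    refine rounds_use (rounds_slotStmt (o := 0) (N := t.numNodes) hW' hT hc hm hA
      ((hin.frame f₁ (by decide) (by decide) (by decide)).set _ _)
      (by rw [HState.set_a, f₁.a _ (by decide)]; exact hl) ((f₁.v _ (by decide)).trans hN)
      ((f₁.v _ (by decide)).trans hb) (by omega) (by simp) ?_ ?_) fun υ h₂ _ => h₂.good
    · intro j _
      rw [HState.set_a, f₁.a _ (by decide), hocc, hbag]
      simp
    · simp [hbag, GoodOn]

/-- The entry of `final` in the last row decides everything: it exceeds the value of every
derivation with this signature, and if it is nonzero the descent from it delivers a set for which it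
is exact. -/
theorem wp_tablePhase {W : ℕ} {C : Ctx} {A : ℕ → ℕ × ℕ × ℕ} {t : NiceTree n} {σ : HState}
    (hT : t.LocallyNice) (hc : t.Consistent) (hs : SlotGood C.slot C.b t) (hA : Located A t 0)
    (hin : Input A σ) (hE : Env W t.numNodes C σ) (hl : LeftOK (σ.a .left) t 0)
    (hX : ∀ k, σ.a .X k = 0) (hY : ∀ k, σ.a .Y k = 0) (hval : ∀ k, σ.a .val k = 0) :
    wp W tablePhase (fun τ =>
      (τ.v .v1 ≠ 0 → ∃ S, C.Deriv t C.final (τ.v .v1 - 1) S ∧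
        ∀ v ∈ t.verts, τ.a .out v = if v ∈ S then 1 else 0) ∧
      (∀ w S, C.Deriv t C.final w S → w + 1 ≤ τ.v .v1)) σ := by
  have hpos := t.numNodes_pos
  have hW := hE.word
  have hW' := hE.b_le
  have hfin := (C.isCode_final hE.pos).encode_lt
  have hfe := C.encode_final hE.pos
  have e : 0 + t.numNodes - 1 = t.numNodes - 1 := by omega
  unfold tablePhase
  rw [wp_block_cons]
  refine wp_use (R := fun τ => TableOK C (τ.a .val) (τ.a .bp1) (τ.a .bp2) t 0) ?_ fun τ h₁ f₁ => ?_
  · change rounds (wp W nodeStmt) .i _ _ _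
    rw [hE.nodes]
    refine rounds_use (rounds_nodeStmt (o := 0) (N := t.numNodes) hs hA (hin.set _ _) hl
      ⟨hE.b, hE.L, hE.B, hE.M, hE.nodes, hE.conn, hE.st, hE.s, hE.t, hE.slot, hE.pos, hE.word⟩
      (by simp) (by omega) (fun k _ => hX k) (fun k _ => hY k) (fun k _ => hval k))
      fun τ h _ => h.table
  have E₁ : Env W t.numNodes C τ := hE.frame f₁ (by decide) (by decide)
  have hbase := hE.base_le
  have hrow : (t.numNodes - 1) * C.size + C.size ≤ W := by
    rw [← Nat.succ_mul]
    exact (Nat.mul_le_mul_right _ (by omega)).trans hW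
  have hsize := hE.size_le
  simp only [wp_block_cons, wp_block_nil, wp_assign, wp_ite, wp_store, wp_skip, Exp.ok_var,
    Exp.ok_lit, Exp.ok_get, Exp.ok_add, Exp.ok_mul, Exp.ok_sub, Exp.ok_div, Exp.eval_var,
    Exp.eval_lit, Exp.eval_get, Exp.eval_add, Exp.eval_mul, Exp.eval_sub, Exp.eval_div,
    HState.set_v, HState.set_a, reduceCtorEq, if_true, if_false, true_and, E₁.M, E₁.B, E₁.nodes,
    ← hfe]
  set v := τ.a .val ((t.numNodes - 1) * C.size + C.encode C.final) with hv
  have complete : ∀ w S, C.Deriv t C.final w S → w + 1 ≤ v := fun w S hd => by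
    have := (h₁.complete hE.pos hs hd).2
    rwa [e] at this
  refine ⟨by omega, by omega, fun h0 => ⟨by omega, ?_⟩, fun h0 => ⟨fun h => absurd h0 h, ?_⟩⟩
  · refine wp_use (R := fun υ => ∃ S, C.Deriv t C.final (v - 1) S ∧
      ∀ y ∈ t.verts, υ.a .out y = if y ∈ S then 1 else 0) ?_ fun υ h₂ f₂ => ?_
    · change rounds (wp W backStmt) .x _ _ _
      set ρ := (((τ.set .c (C.encode C.final)).set .v1 v).put .nd (t.numNodes - 1)
        (C.encode C.final)) with hρ
      rw [show ρ.v .N = t.numNodes from E₁.nodes]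
      have nd₁ : ρ.a .nd (0 + t.numNodes - 1) = C.encode C.final := by simp [hρ]
      have val₁ : ρ.a .val = τ.a .val := by simp [hρ]
      have in₁ := hin.frame f₁ (by decide) (by decide) (by decide)
      refine rounds_use (rounds_backStmt (o := 0) (N := t.numNodes) (A := A) (C := C) hT hc hs hA
        ⟨fun i => by simpa [hρ] using in₁.ty i, fun i => by simpa [hρ] using in₁.u i,
          fun i => by simpa [hρ] using in₁.w i⟩ ?_ ?_
        ⟨E₁.b, E₁.L, E₁.B, E₁.M, E₁.nodes, E₁.conn, E₁.st, E₁.s, E₁.t, ?_, E₁.pos, E₁.word⟩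
        (by simp) (by omega) ?_ ?_) fun υ h₂ _ => ?_
      · have : (ρ.set .x 0).a .left = σ.a .left := by
          rw [← f₁.a .left (by decide)]; simp [hρ]
        rw [this]; exact hl
      · simpa [hρ] using h₁
      · simpa [hρ] using E₁.slot
      · rw [HState.set_a, nd₁]; exact hfin
      · rw [HState.set_a, nd₁, val₁, e]; exact h0
      · obtain ⟨S, hd, hS⟩ := h₂.solution
        rw [HState.set_a, nd₁, val₁, e, (C.isCode_final hE.pos).dig_encode] at hd
        exact ⟨S, hd, hS⟩
    · have v₂ : υ.v .v1 = v := by rw [f₂.v _ (by decide)]; simp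
      rw [wp_block_nil, wp_block_nil, v₂]
      exact ⟨fun _ => h₂, complete⟩
  · exact complete

/-! ### Running time -/

/-- The number of instructions, up to a constant factor. -/
def Stmt.cost : Stmt → ℕ
  | .skip => 1
  | .assign _ e => e.time + 1
  | .store _ i e => i.time + e.time + 1
  | .seq p q => p.cost + q.cost
  | .ite e p q => e.time + 1 + (p.cost + q.cost)
  | .loop _ _ p => 3 + (p.cost + 4)

/-- The nesting depth of loops. -/
def Stmt.depth : Stmt → ℕ
  | .skip => 0
  | .assign _ _ => 0
  | .store _ _ _ => 0
  | .seq p q => max p.depth q.depth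
  | .ite _ p q => max p.depth q.depth
  | .loop _ _ p => p.depth + 1

/-- If all loop bounds are at most `m`, each level of nesting costs a factor `m`, and the rest is a
constant of the statement. -/
theorem Stmt.time_le {R : List Var} {ρ : Var → ℕ} {m : ℕ} (hm : 1 ≤ m) (hρ : ∀ r ∈ R, ρ r ≤ m)
    (p : Stmt) (hp : p.wf R = true) : p.time ρ ≤ p.cost * m ^ p.depth := by
  have one : ∀ d, 1 ≤ m ^ d := fun d => Nat.one_le_pow _ _ hm
  have up : ∀ {x c d d' : ℕ}, x ≤ c * m ^ d → d ≤ d' → x ≤ c * m ^ d' := fun h hd =>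
    h.trans (Nat.mul_le_mul_left _ (Nat.pow_le_pow_right hm hd))
  induction p with
  | skip => simp [time, cost, depth]
  | assign x e => simp [time, cost, depth]
  | store A i e => simp [time, cost, depth]
  | seq p q ihp ihq =>
      simp only [wf, Bool.and_eq_true] at hp
      simp only [time, cost, depth, Nat.add_mul]
      exact Nat.add_le_add (up (ihp hp.1) (le_max_left _ _)) (up (ihq hp.2) (le_max_right _ _))
  | ite e p q ihp ihq =>
      simp only [wf, Bool.and_eq_true] at hp
      simp only [time, cost, depth, Nat.add_mul _ (p.cost + q.cost), Nat.add_mul p.cost]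
      exact Nat.add_le_add (Nat.le_mul_of_pos_right _ (one _))
        (Nat.add_le_add (up (ihp hp.1) (le_max_left _ _)) (up (ihq hp.2) (le_max_right _ _)))
  | loop x r p ih =>
      simp only [wf, Bool.and_eq_true, decide_eq_true_eq] at hp
      simp only [time, cost, depth, Nat.add_mul 3]
      refine Nat.add_le_add (Nat.le_mul_of_pos_right _ (one _)) ?_
      rw [pow_succ']
      calc ρ r * (p.time ρ + 4) ≤ m * ((p.cost + 4) * m ^ p.depth) := by
            refine Nat.mul_le_mul (hρ r hp.2.1) ?_
            rw [Nat.add_mul]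
            exact Nat.add_le_add (ih hp.1) (Nat.le_mul_of_pos_right _ (one _))
        _ = _ := by ring

end

section

variable {n : ℕ}

/-! ### Correctness and running time -/

/-- The initial state. -/
def start (n N s t : ℕ) (A : ℕ → ℕ × ℕ × ℕ) : HState where
  v
    | .n => n
    | .N => N
    | .s => s
    | .t => t
    | _ => 0
  a
    | .ty => fun i => (A i).1
    | .u => fun i => (A i).2.1
    | .w => fun i => (A i).2.2
    | _ => fun _ => 0

theorem NiceTree.mem_postorder (t : NiceTree n) :
    ∀ e ∈ t.postorder, e.1 ≤ 4 ∧ e.2.1 ≤ n ∧ e.2.2 ≤ n := by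
  induction t with
  | leaf => simp [postorder]
  | introVertex v t ih | introEdge u v t ih | forget v t ih =>
      intro e he
      rcases List.mem_append.1 he with he | he
      · exact ih e he
      · rw [List.mem_singleton.1 he]
        simp only [Fin.is_le', Nat.zero_le, and_true, and_self]
        omega
  | join a b iha ihb =>
      intro e he
      rcases List.mem_append.1 he with he | he
      · rcases List.mem_append.1 he with he | he
        · exact iha e he
        · exact ihb e he
      · rw [List.mem_singleton.1 he]
        simp

theorem NiceTree.card_verts_le (t : NiceTree n) : t.verts.card ≤ t.numNodes := by
  induction t with
  | leaf => simp [verts]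
  | introVertex v t ih => exact (Finset.card_insert_le _ _).trans (by simpa [numNodes] using ih)
  | introEdge u v t ih => exact ih.trans (by simp [numNodes])
  | forget v t ih => exact ih.trans (by simp [numNodes])
  | join a b iha ihb => exact (Finset.card_union_le _ _).trans (by simp [numNodes]; omega)

/-- The number `k` has no bound in terms of `W`: it waits in register 2, outside the simulated
variables, and only takes part in the final comparison, whose result is at most one. -/
theorem sim_start {W : ℕ} {t : NiceTree n} {params : List ℕ} (hp : params.length ≤ 3)
    (hn : n ≤ W) (hN : t.numNodes ≤ W) (hW : 4 ≤ W) (hs : params.getD 1 0 ≤ W)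
    (ht : params.getD 2 0 ≤ W) :
    Sim W (params.getD 0 0) (start n t.numNodes (params.getD 1 0) (params.getD 2 0)
      fun i => t.postorder.getD i (0, 0, 0)) (t.input params) := by
  have hz : ∀ r, 5 ≤ r → (n :: t.numNodes :: params).getD r 0 = 0 := fun r hr =>
    List.getD_eq_default _ _ (by simp; omega)
  have hd : ∀ i, (t.postorder.getD i (0, 0, 0)).1 ≤ 4 ∧ (t.postorder.getD i (0, 0, 0)).2.1 ≤ n ∧
      (t.postorder.getD i (0, 0, 0)).2.2 ≤ n := by
    intro i
    by_cases hi : i < t.postorder.length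
    · rw [List.getD_eq_getElem _ _ hi]
      exact t.mem_postorder _ (List.getElem_mem hi)
    · rw [List.getD_eq_default _ _ (by omega)]
      simp
  refine ⟨fun x => ?_, fun A i => ?_, hz 5 le_rfl, rfl, fun x => ?_, fun A i => ?_⟩
  · cases x
    case n | N | s | t => rfl
    all_goals exact hz _ (by decide)
  · cases A <;> rfl
  · cases x
    case n => exact hn
    case N => exact hN
    case s => exact hs
    case t => exact ht
    all_goals exact Nat.zero_le _
  · cases A
    case ty => exact (hd i).1.trans hW
    case u => exact (hd i).2.1.trans hn
    case w => exact (hd i).2.2.trans hn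
    all_goals exact Nat.zero_le _

theorem NiceTree.maxBagCard_pos {t : NiceTree n} {x : Fin n} (hx : x ∈ t.verts) :
    1 ≤ t.maxBagCard := by
  induction t with
  | leaf => simp [verts] at hx
  | introVertex v t ih => exact le_max_of_le_left (Finset.card_pos.2 (Finset.insert_nonempty _ _))
  | introEdge u v t ih => exact le_max_of_le_right (ih hx)
  | forget v t ih => exact le_max_of_le_right (ih hx)
  | join a b iha ihb =>
      rcases Finset.mem_union.1 hx with hx | hx
      · exact le_max_of_le_right (le_max_of_le_left (iha hx))
      · exact le_max_of_le_right (le_max_of_le_right (ihb hx))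

theorem sizePhase_writes (conn st : ℕ) : (sizePhase conn st).writes = (sizePhase 0 0).writes := rfl

theorem sizePhase_stores (conn st : ℕ) : (sizePhase conn st).stores = (sizePhase 0 0).stores := rfl

theorem sizePhase_wf (conn st : ℕ) : (sizePhase conn st).wf [.N] = true := rfl

/-- A bound for the running time, up to a factor. -/
def timeConst : ℕ := sizeStmt.cost + slotStmt.cost + nodeStmt.cost + backStmt.cost + 200

/-- The exponent 5 is the loop depth of `nodeStmt`: two loops over codes, and inside them the two
loops of the merge with the renumbering loop. The number of nodes enters only linearly, as `N`
bounds only the outermost passes. -/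
theorem time_phases_le {conn st N M : ℕ} (hN : 1 ≤ N) (hM : 1 ≤ M) {ρ : Var → ℕ}
    (hρN : ρ .N = N) (hρ : ∀ r ∈ [Var.b, .L, .M], ρ r ≤ M) :
    (sizePhase conn st).time ρ + (slotPhase.time ρ + (tablePhase.time ρ + (outputPhase.time ρ + 1)))
      ≤ timeConst * N * M ^ 5 := by
  have e₁ : (sizePhase conn st).time ρ = (3 + ρ .N * (sizeStmt.time ρ + 4)) + 17 := by
    change 2 + (2 + ((3 + ρ .N * (sizeStmt.time ρ + 4)) + (4 + (6 + (2 + 1))))) = _; omega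
  have e₂ : slotPhase.time ρ = (3 + ρ .L * 8) + (3 + ρ .N * (slotStmt.time ρ + 4)) + 1 := rfl
  have e₃ : tablePhase.time ρ = (3 + ρ .N * (nodeStmt.time ρ + 4)) +
      (3 + ρ .N * (backStmt.time ρ + 4)) + 29 := by
    change (3 + ρ .N * (nodeStmt.time ρ + 4)) + (10 + (9 + ((2 + ((5 +
      ((3 + ρ .N * (backStmt.time ρ + 4)) + 1)) + 1)) + 1))) = _
    omega
  have e₄ : outputPhase.time ρ = 11 := rfl
  have t₁ := sizeStmt.time_le hM hρ (by decide)
  have t₂ := slotStmt.time_le hM hρ (by decide)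
  have t₃ := nodeStmt.time_le hM hρ (by decide)
  have t₄ := backStmt.time_le hM hρ (by decide)
  have up : ∀ {c d : ℕ} (p : Stmt), p.time ρ ≤ c * M ^ d → d ≤ 5 →
      N * (p.time ρ + 4) ≤ c * (N * M ^ 5) + 4 * (N * M ^ 5) := by
    intro c d p hp hd
    have h1 : M ^ d ≤ M ^ 5 := Nat.pow_le_pow_right hM hd
    have h2 : 1 ≤ M ^ 5 := Nat.one_le_pow _ _ hM
    calc N * (p.time ρ + 4) ≤ N * (c * M ^ 5 + 4 * M ^ 5) := by
          refine Nat.mul_le_mul_left _ (Nat.add_le_add (hp.trans (Nat.mul_le_mul_left _ h1)) ?_)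
          omega
      _ = _ := by ring
  have u₁ := up _ t₁ (by decide)
  have u₂ := up _ t₂ (by decide)
  have u₃ := up _ t₃ (by decide)
  have u₄ := up _ t₄ (by decide)
  have hL := hρ .L (by decide)
  have hX : M ≤ N * M ^ 5 := (Nat.le_self_pow (by decide) M).trans (Nat.le_mul_of_pos_left _ hN)
  rw [e₁, e₂, e₃, e₄, hρN, mul_assoc, timeConst]
  simp only [Nat.add_mul]
  omega

/-- The final state gives a feasible set with the largest cut and answers the question whether there
is one with at least `k` edges. -/
def Solved (G : SimpleGraph (Fin n)) (feasible : Finset (Fin n) → Prop) (k : ℕ) (σ : State) : Prop :=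
  (∃ S, σ.Outputs G S ∧ feasible S ∧ (∀ S', feasible S' → (cutSet G S').card ≤ (cutSet G S).card) ∧
    σ.reg 2 = if k ≤ (cutSet G S).card then 1 else 0) ∨
  (σ.reg 0 = 0 ∧ σ.reg 2 = 0 ∧ ∀ S, ¬ feasible S)

/-- The constraints on the sides of a cut. -/
def IsFeasible (G : SimpleGraph (Fin n)) (conn st s t : ℕ) (S : Finset (Fin n)) : Prop :=
  (Ctx.mk 0 conn st s t fun _ => 0).Feasible G S

theorem exec_program {conn st : ℕ} {G : SimpleGraph (Fin n)} {t : NiceTree n} {params : List ℕ}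
    (h : t.IsNiceDecomposition G) (hn : 0 < n) (hp : params.length ≤ 3) (hconn : conn ≤ 1)
    (hst : st ≤ 1) (hs : params.getD 1 0 ≤ n) (ht : params.getD 2 0 ≤ n) {M : ℕ}
    (hM : M = (2 * t.maxBagCard + 1) ^ (t.maxBagCard + 2)) :
    ∃ T W σ, Exec W (program conn st) (t.input params) T σ ∧
      Solved G (IsFeasible G conn st (params.getD 1 0) (params.getD 2 0)) (params.getD 0 0) σ ∧
      T ≤ timeConst * t.numNodes * M ^ 5 ∧ W ≤ timeConst * t.numNodes * M ^ 5 := by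
  set b := t.maxBagCard with hb
  set N := t.numNodes with hN
  set A : ℕ → ℕ × ℕ × ℕ := fun i => t.postorder.getD i (0, 0, 0) with hA
  have hb1 : 1 ≤ b := NiceTree.maxBagCard_pos (h.mem_verts ⟨0, hn⟩)
  -- Every vertex occurs in the tree, and a subtree with `N` nodes contains at most `N` vertices.
  have hnN : n ≤ N := by
    have := t.card_verts_le
    rw [Finset.eq_univ_iff_forall.2 h.mem_verts] at this
    simpa using this
  have hM1 : 2 * b + 1 ≤ M := hM ▸ Nat.le_self_pow (by omega) _
  have hbN : b ≤ N := t.maxBagCard_le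
  -- This covers table addresses below `N * M`, codes below `M` and values of order `N`, with room
  -- for intermediate sums.
  set W := 4 * (N + 1) * M with hW
  have hW1 : 4 * (N + 1) ≤ W := Nat.le_mul_of_pos_right _ (by omega)
  have hloc : Located A t 0 := located_of_getD fun i _ => by simp [hA]
  set σ₀ := start n N (params.getD 1 0) (params.getD 2 0) A with hσ₀
  have sim₀ : Sim W (params.getD 0 0) σ₀ (t.input params) :=
    sim_start hp (by omega) (by omega) (by omega) (by omega) (by omega)
  have in₀ : Input A σ₀ := ⟨fun _ => rfl, fun _ => rfl, fun _ => rfl⟩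
  set ρ : Var → ℕ := fun r => if r = .N then N else M with hρ
  obtain ⟨T₁, s₁, σ₁, x₁, time₁, sim₁, ⟨left₁, b₁, L₁, B₁, M₁, conn₁, st₁⟩, f₁⟩ :=
    (sizePhase conn st).exec_compile (W := W) (by omega) (R := [.N]) (ρ := ρ)
      (sizePhase_wf conn st) (by rw [sizePhase_writes]; decide)
      (by simp only [List.mem_singleton, forall_eq]; exact le_rfl)
      (wp_frame W _ (wp_sizePhase h.locallyNice hloc in₀ rfl rfl (by omega) (by omega) (by omega)))
      sim₀
  rw [sizePhase_writes, sizePhase_stores] at f₁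
  have in₁ : Input A σ₁ := in₀.frame f₁ (by decide) (by decide) (by decide)
  have N₁ : σ₁.v .N = N := (f₁.v _ (by decide)).trans rfl
  obtain ⟨T₂, s₂, σ₂, x₂, time₂, sim₂, ⟨M₂, slot₂⟩, f₂⟩ :=
    slotPhase.exec_compile (W := W) (by omega) (R := [.N, .b, .L]) (ρ := ρ) (by decide) (by decide)
      (by simp [hρ, N₁, b₁, L₁]; omega)
      (wp_frame W _ (wp_slotPhase h.locallyNice h.consistent h.root_bag hloc in₁ N₁ b₁ L₁ B₁ M₁
        le_rfl left₁ (fun k => by rw [f₁.a _ (by decide)]; rfl) (by rw [← hb, ← hM]))) sim₁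
  set C : Ctx := ⟨b, conn, st, params.getD 1 0, params.getD 2 0, σ₂.a .slot⟩ with hC
  have N₂ : σ₂.v .N = N := (f₂.v _ (by decide)).trans N₁
  have b₂ : σ₂.v .b = b := (f₂.v _ (by decide)).trans b₁
  have L₂ : σ₂.v .L = b + 2 := (f₂.v _ (by decide)).trans L₁
  have E₂ : Env W N C σ₂ := ⟨b₂, L₂, (f₂.v _ (by decide)).trans B₁, M₂, N₂,
    (f₂.v _ (by decide)).trans conn₁, (f₂.v _ (by decide)).trans st₁,
    (f₂.v _ (by decide)).trans (f₁.v _ (by decide)),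
    (f₂.v _ (by decide)).trans (f₁.v _ (by decide)), rfl, hb1, by rw [hW, hM]; exact le_rfl⟩
  obtain ⟨T₃, s₃, σ₃, x₃, time₃, sim₃, found, best⟩ :=
    tablePhase.exec_compile (W := W) (by omega) (R := [.N, .b, .L, .M]) (ρ := ρ) (by decide)
      (by decide) (by simp [hρ, N₂, b₂, L₂, M₂.trans hM.symm]; omega)
      (wp_tablePhase (C := C) h.locallyNice h.consistent slot₂ hloc
        (in₁.frame f₂ (by decide) (by decide) (by decide)) E₂
        (by rw [f₂.a _ (by decide)]; exact left₁)
        (fun k => by rw [f₂.a _ (by decide), f₁.a _ (by decide)]; rfl)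
        (fun k => by rw [f₂.a _ (by decide), f₁.a _ (by decide)]; rfl)
        (fun k => by rw [f₂.a _ (by decide), f₁.a _ (by decide)]; rfl)) sim₂
  obtain ⟨T₄, s₄, σ₄, x₄, time₄, sim₄, ⟨some₄, none₄⟩, f₄⟩ :=
    outputPhase.exec_compile (W := W) (σ := σ₃) (by omega) (R := []) (ρ := ρ) (by decide)
      (by decide) (by simp)
      (wp_frame W outputPhase (Q := fun τ => (σ₃.v .v1 ≠ 0 → τ.v .n = 1 ∧ τ.v .N = σ₃.v .v1 - 1) ∧
        (σ₃.v .v1 = 0 → τ.v .n = 0)) (by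
          simp only [outputPhase, wp_ite, wp_block_cons, wp_block_nil, wp_assign, Exp.ok_var,
            Exp.ok_lit, Exp.ok_sub, Exp.eval_var, Exp.eval_lit, Exp.eval_sub, HState.set_v,
            reduceCtorEq, if_true, if_false, true_and, Nat.zero_le]
          exact ⟨fun h0 => ⟨by omega, by omega, fun _ => trivial, fun h => absurd h h0⟩,
            fun h0 => ⟨fun h => absurd h0 h, fun _ => trivial⟩⟩)) sim₃
  have v₄ : σ₄.v .v1 = σ₃.v .v1 := f₄.v _ (by decide)
  have out₄ : σ₄.a .out = σ₃.a .out := f₄.a _ (by decide)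
  have key₄ := sim₄.key
  have reg₄ : s₄.reg Var.v1.code = σ₃.v .v1 := (sim₄.reg _).trans v₄
  have x₅ := Exec.arith (W := W) s₄ .lt 2 2 Var.v1.code (by simp only [Op.eval]; split <;> omega)
  refine ⟨_, W, _, x₁.seq (x₂.seq (x₃.seq (x₄.seq x₅))), ?_, ?_, ?_⟩
  · set s₅ := s₄.setReg 2 (Op.eval .lt (s₄.reg 2) (s₄.reg Var.v1.code)) with hs₅
    have r0 : s₅.reg 0 = σ₄.v .n := sim₄.reg .n
    have r1 : s₅.reg 1 = σ₄.v .N := sim₄.reg .N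
    have r2 : s₅.reg 2 = if params.getD 0 0 < σ₃.v .v1 then 1 else 0 := by
      simp [hs₅, State.setReg, key₄, reg₄, Op.eval]
    by_cases h0 : σ₃.v .v1 = 0
    · refine .inr ⟨r0.trans (none₄ h0), by simp [r2, h0], fun S hS => ?_⟩
      have := best _ S (Ctx.Feasible.deriv (C := C) hb1 h slot₂ hS)
      omega
    · obtain ⟨S, hd, hS⟩ := found h0
      obtain ⟨hF, hcard⟩ := hd.feasible hb1 h slot₂
      refine .inl ⟨S, ⟨r0.trans (some₄ h0).1, ?_, fun v => ?_⟩, hF, fun S' hS' => ?_, ?_⟩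
      · rw [r1, (some₄ h0).2, hcard]
      · rw [← hS v (h.mem_verts v), ← out₄]
        exact sim₄.arr .out v
      · have := best _ S' (Ctx.Feasible.deriv (C := C) hb1 h slot₂ hS')
        omega
      · rw [r2]
        congr 1
        rw [eq_iff_iff]
        omega
  · have := time_phases_le (conn := conn) (st := st) (N := N) (M := M) (ρ := ρ) (by omega)
      (by omega) (by simp [hρ]) (by simp [hρ])
    omega
  · have hX : M ≤ M ^ 5 := Nat.le_self_pow (by decide) M
    have h1 : 4 * (N + 1) ≤ timeConst * N := by
      have : 8 * N ≤ timeConst * N := Nat.mul_le_mul_right _ (by unfold timeConst; omega)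
      omega
    exact Nat.mul_le_mul h1 hX

end

section

variable {n : ℕ}

/-- For `w` at least 2 the base is at most `w ^ 3` and the exponent at most `13 * w`, whence 39. The
exponent on the left comes from the fifth power of `(2 * w + 3) ^ (w + 3)` and one more factor for
the number of nodes. -/
theorem pow_le_pow_self {w : ℕ} (hw : 2 ≤ w) : (2 * w + 3) ^ (5 * w + 16) ≤ w ^ (39 * w) := by
  have h₁ : 2 * w + 3 ≤ w ^ 3 := by
    have : 2 * 2 * w ≤ w ^ 3 := by
      rw [pow_succ, pow_two]; exact Nat.mul_le_mul_right _ (Nat.mul_le_mul hw hw)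
    omega
  have h₂ : 5 * w + 16 ≤ 13 * w := by omega
  have h₃ : 3 * (13 * w) = 39 * w := by ring
  calc (2 * w + 3) ^ (5 * w + 16) ≤ (w ^ 3) ^ (5 * w + 16) := Nat.pow_le_pow_left h₁ _
    _ ≤ (w ^ 3) ^ (13 * w) := Nat.pow_le_pow_right (Nat.pow_pos (by omega)) h₂
    _ = w ^ (39 * w) := by rw [← pow_mul, h₃]

/-- The factor in the running time is `2 ^ O(w * log w)`. -/
theorem exists_exponent (κ : ℕ) : ∃ c : ℝ, ∀ w : ℕ,
    ((κ * (w + 1) * ((2 * (w + 1) + 1) ^ (w + 3)) ^ 5 : ℕ) : ℝ) ≤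
      (2 : ℝ) ^ (c * (w * Real.logb 2 w + 1)) := by
  -- `5 ^ 21` is the value of `(2 * w + 3) ^ (5 * w + 16)` at `w = 1`. It settles the widths below
  -- two, where the logarithmic term vanishes and only the summand 1 in the exponent is left.
  obtain ⟨q, hq, hq1⟩ : ∃ q : ℕ, 5 ^ 21 ≤ q ∧ 1 ≤ q := ⟨5 ^ 21, le_rfl, by norm_num⟩
  obtain ⟨a, ha⟩ : ∃ a : ℕ, κ * q ≤ 2 ^ a := ⟨_, Nat.lt_two_pow_self.le⟩
  have ha' : ((κ * q : ℕ) : ℝ) ≤ (2 : ℝ) ^ (a : ℝ) := by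
    rw [Real.rpow_natCast]; exact_mod_cast ha
  refine ⟨a + 39, fun w => ?_⟩
  have small : κ * (w + 1) * ((2 * (w + 1) + 1) ^ (w + 3)) ^ 5 ≤
      κ * (2 * w + 3) ^ (5 * w + 16) := by
    rw [mul_assoc, ← pow_mul]
    refine Nat.mul_le_mul_left _ ?_
    calc (w + 1) * (2 * (w + 1) + 1) ^ ((w + 3) * 5) ≤ (2 * w + 3) * (2 * w + 3) ^ (5 * w + 15) := by
          refine Nat.mul_le_mul (by omega) (le_of_eq ?_)
          congr 1; ring
      _ = _ := by ring
  rcases Nat.lt_or_ge w 2 with hw | hw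
  · have h0 : (w : ℝ) * Real.logb 2 w = 0 := by
      interval_cases w <;> simp
    rw [h0, zero_add, mul_one]
    have h1 : κ * (2 * w + 3) ^ (5 * w + 16) ≤ κ * q :=
      Nat.mul_le_mul_left _ ((Nat.pow_le_pow_left (by omega) _).trans
        ((Nat.pow_le_pow_right (by omega) (by omega)).trans hq))
    calc _ ≤ ((κ * q : ℕ) : ℝ) := by exact_mod_cast small.trans h1
      _ ≤ (2 : ℝ) ^ (a : ℝ) := ha'
      _ ≤ _ := Real.rpow_le_rpow_of_exponent_le (by norm_num) (by linarith)
  · have hlog : 0 ≤ (w : ℝ) * Real.logb 2 w :=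
      mul_nonneg (Nat.cast_nonneg _) (Real.logb_nonneg (by norm_num) (by exact_mod_cast (by omega)))
    have h2 : κ * (2 * w + 3) ^ (5 * w + 16) ≤ κ * q * w ^ (39 * w) := by
      rw [mul_assoc]
      exact Nat.mul_le_mul_left _ ((pow_le_pow_self hw).trans (Nat.le_mul_of_pos_left _ hq1))
    have h3 : ((w : ℝ)) ^ (39 * w) = (2 : ℝ) ^ (39 * ((w : ℝ) * Real.logb 2 w)) := by
      have hw0 : (0 : ℝ) < w := by exact_mod_cast (by omega)
      conv_lhs => rw [← Real.rpow_logb (b := 2) (by norm_num) (by norm_num) hw0]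
      rw [← Real.rpow_natCast, ← Real.rpow_mul (by norm_num)]
      congr 1
      push_cast; ring
    calc _ ≤ ((κ * q * w ^ (39 * w) : ℕ) : ℝ) := Nat.cast_le.2 (small.trans h2)
      _ = ((κ * q : ℕ) : ℝ) * (w : ℝ) ^ (39 * w) := by rw [Nat.cast_mul, Nat.cast_pow]
      _ ≤ (2 : ℝ) ^ (a : ℝ) * (2 : ℝ) ^ (39 * ((w : ℝ) * Real.logb 2 w)) := by
          rw [h3]; exact mul_le_mul_of_nonneg_right ha' (by positivity)
      _ = (2 : ℝ) ^ ((a : ℝ) + 39 * ((w : ℝ) * Real.logb 2 w)) :=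
          (Real.rpow_add (by norm_num) _ _).symm
      _ ≤ _ := Real.rpow_le_rpow_of_exponent_le (by norm_num) (by
          have : (0 : ℝ) ≤ a * ((w : ℝ) * Real.logb 2 w) := mul_nonneg (Nat.cast_nonneg _) hlog
          linear_combination this)

/-- The algorithm solves the problem in time `2 ^ O(tw * log tw) * n`. -/
theorem exists_runsInTime {conn st : ℕ} (hconn : conn ≤ 1) (hst : st ≤ 1) (K : ℕ) :
    ∃ c : ℝ, ∀ (n : ℕ) (G : SimpleGraph (Fin n)) (t : NiceTree n) (params : List ℕ),
      params.length ≤ 3 → params.getD 1 0 ≤ n → params.getD 2 0 ≤ n →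
      t.IsNiceDecomposition G → t.numNodes ≤ K * (t.width + 1) * n →
      t.RunsInTime (program conn st) c params
        (Solved G (IsFeasible G conn st (params.getD 1 0) (params.getD 2 0)) (params.getD 0 0)) := by
  obtain ⟨c, hc⟩ := exists_exponent (timeConst * K)
  refine ⟨c, fun n G t params hp hs ht h hK => ?_⟩
  have hpos := t.numNodes_pos
  -- With no vertices the bound on the number of nodes would be zero, but a tree has at least one
  -- node.
  have hn : 0 < n := Nat.pos_of_ne_zero fun h0 => by
    subst h0
    simp at hK
    omega
  obtain ⟨T, W, σ, hx, hpost, hT, hW⟩ := exec_program h hn hp hconn hst hs ht rfl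
  have hb : t.maxBagCard = t.width + 1 := by
    have := NiceTree.maxBagCard_pos (h.mem_verts ⟨0, hn⟩)
    simp only [NiceTree.width]; omega
  have key : ∀ X, X ≤ timeConst * t.numNodes *
      ((2 * t.maxBagCard + 1) ^ (t.maxBagCard + 2)) ^ 5 →
      (X : ℝ) ≤ (2 : ℝ) ^ (c * (t.width * Real.logb 2 t.width + 1)) * n := by
    intro X hX
    rw [hb] at hX
    have h1 : X ≤ timeConst * K * (t.width + 1) *
        ((2 * (t.width + 1) + 1) ^ (t.width + 3)) ^ 5 * n := by
      refine hX.trans ?_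
      calc _ ≤ timeConst * (K * (t.width + 1) * n) *
            ((2 * (t.width + 1) + 1) ^ (t.width + 1 + 2)) ^ 5 :=
            Nat.mul_le_mul_right _ (Nat.mul_le_mul_left _ hK)
        _ = _ := by ring
    calc (X : ℝ) ≤ ((timeConst * K * (t.width + 1) *
          ((2 * (t.width + 1) + 1) ^ (t.width + 3)) ^ 5 * n : ℕ) : ℝ) := by exact_mod_cast h1
      _ ≤ _ := by
          rw [Nat.cast_mul]
          exact mul_le_mul_of_nonneg_right (hc t.width) (Nat.cast_nonneg _)
  exact ⟨T, W, σ, hx, hpost, key T hT, key W hW⟩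

theorem Solved.solvedCutProblem {G : SimpleGraph (Fin n)} {P P' : Finset (Fin n) → Prop} {k : ℕ}
    {σ : State} (h : Solved G P k σ) (hP : ∀ S, P S ↔ P' S) : SolvedCutProblem G P' k σ := by
  obtain rfl : P = P' := funext fun S => propext (hP S)
  rcases h with ⟨S, hout, hS, hmax, hk⟩ | ⟨h0, h2, hno⟩
  · refine ⟨.inl ⟨S, hout, hS, hmax⟩, ?_⟩
    by_cases hle : k ≤ (cutSet G S).card
    · exact .inl ⟨by rw [hk, if_pos hle], S, hS, hle⟩
    · exact .inr ⟨by rw [hk, if_neg hle], fun ⟨S', hS', hle'⟩ => hle (hle'.trans (hmax S' hS'))⟩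
  · exact ⟨.inr ⟨h0, fun ⟨S, hS⟩ => hno S hS⟩, .inr ⟨h2, fun ⟨S, hS, _⟩ => hno S hS⟩⟩

/-- A connected complement is nonempty, so feasibility with the connectivity switch on and the `st`
switch off is the two-sided description of bonds in `isBond_iff`. Maximality over sets then is
maximality over bonds. -/
theorem Solved.foundMaximumBond {G : SimpleGraph (Fin n)} (hG : G.Connected) {k s t : ℕ} {σ : State}
    (h : Solved G (IsFeasible G 1 0 s t) k σ) : FoundMaximumBond G σ := by
  have key : ∀ F, IsBond G F ↔ ∃ S, F = cutSet G S ∧ IsFeasible G 1 0 s t S := by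
    intro F
    rw [isBond_iff hG]
    refine exists_congr fun S => and_congr_right fun _ => ⟨fun ⟨h₁, h₂⟩ => ?_, fun h => ?_⟩
    · obtain ⟨v, hv⟩ := h₂.nonempty
      exact ⟨h₁, ⟨v, hv⟩, fun _ => h₂, fun h => absurd rfl h⟩
    · exact ⟨h.1, h.2.2.1 one_ne_zero⟩
  rcases h with ⟨S, hout, hS, hmax, -⟩ | ⟨h0, -, hno⟩
  · refine .inl ⟨S, hout, (key _).2 ⟨S, rfl, hS⟩, fun F hF => ?_⟩
    obtain ⟨S', rfl, hS'⟩ := (key F).1 hF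
    exact hmax S' hS'
  · refine .inr ⟨h0, fun ⟨F, hF⟩ => ?_⟩
    obtain ⟨S', -, hS'⟩ := (key F).1 hF
    exact hno S' hS'

theorem ssubset_univ_iff_exists {S : Finset (Fin n)} : S ⊂ Finset.univ ↔ ∃ v, v ∉ S := by
  rw [Finset.ssubset_univ_iff, Ne, Finset.eq_univ_iff_forall, not_forall]

theorem isFeasible_connectedCut {G : SimpleGraph (Fin n)} {s t : ℕ} (S : Finset (Fin n)) :
    IsFeasible G 0 0 s t S ↔ IsConnectedCut G S := by
  rw [IsConnectedCut, ssubset_univ_iff_exists]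
  exact ⟨fun h => ⟨h.2.1, h.1⟩, fun h => ⟨h.2, h.1, fun h => absurd rfl h, fun h => absurd rfl h⟩⟩

theorem isFeasible_connectedStCut {G : SimpleGraph (Fin n)} {x y : Fin n} (S : Finset (Fin n)) :
    IsFeasible G 0 1 x y S ↔ IsConnectedStCut G x y S := by
  rw [IsConnectedStCut, IsConnectedCut, ssubset_univ_iff_exists]
  constructor
  · intro h
    have h4 := h.2.2.2 one_ne_zero
    exact ⟨⟨h.2.1, h.1⟩, (h4 x).1 rfl, (h4 y).2 rfl⟩
  · rintro ⟨⟨h₁, h₂⟩, hx, hy⟩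
    exact ⟨h₂, h₁, fun h => absurd rfl h, fun _ v => ⟨fun h => by rwa [Fin.ext h],
      fun h => by rwa [Fin.ext h]⟩⟩

theorem isFeasible_stBondCut {G : SimpleGraph (Fin n)} {x y : Fin n} (S : Finset (Fin n)) :
    IsFeasible G 1 1 x y S ↔ IsStBondCut G x y S := by
  rw [IsStBondCut, ← isFeasible_connectedStCut]
  exact ⟨fun h => ⟨⟨h.1, h.2.1, fun h => absurd rfl h, h.2.2.2⟩, h.2.2.1 one_ne_zero⟩,
    fun h => ⟨h.1.1, h.1.2.1, fun _ => h.2, h.1.2.2.2⟩⟩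

theorem NiceTree.RunsInTime.mono {t : NiceTree n} {P : Prog} {c : ℝ}
    {params : List ℕ} {p q : State → Prop} (h : t.RunsInTime P c params p)
    (hpq : ∀ σ, p σ → q σ) : t.RunsInTime P c params q := by
  obtain ⟨T, W, σ, hx, hp, h⟩ := h
  exact ⟨T, W, σ, hx, hpq σ hp, h⟩

end

end BondCut

theorem mainTheorem7 :
    -- finding a bond of maximum size
    (∃ P : BondCut.Prog, ∀ K : ℕ, ∃ c : ℝ,
      ∀ (n : ℕ) (G : SimpleGraph (Fin n)) (t : BondCut.NiceTree n),
        G.Connected → t.IsNiceDecomposition G → t.numNodes ≤ K * (t.width + 1) * n →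
        t.RunsInTime P c [] (BondCut.FoundMaximumBond G)) ∧
    -- Largest st-Bond
    (∃ P : BondCut.Prog, ∀ K : ℕ, ∃ c : ℝ,
      ∀ (n : ℕ) (G : SimpleGraph (Fin n)) (t : BondCut.NiceTree n) (x y : Fin n) (k : ℕ),
        t.IsNiceDecomposition G → t.numNodes ≤ K * (t.width + 1) * n →
        t.RunsInTime P c [k, x, y]
          (BondCut.SolvedCutProblem G (BondCut.IsStBondCut G x y) k)) ∧
    -- Maximum Connected Cut
    (∃ P : BondCut.Prog, ∀ K : ℕ, ∃ c : ℝ,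
      ∀ (n : ℕ) (G : SimpleGraph (Fin n)) (t : BondCut.NiceTree n) (k : ℕ),
        t.IsNiceDecomposition G → t.numNodes ≤ K * (t.width + 1) * n →
        t.RunsInTime P c [k]
          (BondCut.SolvedCutProblem G (BondCut.IsConnectedCut G) k)) ∧
    -- Maximum Connected st-Cut
    (∃ P : BondCut.Prog, ∀ K : ℕ, ∃ c : ℝ,
      ∀ (n : ℕ) (G : SimpleGraph (Fin n)) (t : BondCut.NiceTree n) (x y : Fin n) (k : ℕ),
        t.IsNiceDecomposition G → t.numNodes ≤ K * (t.width + 1) * n →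
        t.RunsInTime P c [k, x, y]
          (BondCut.SolvedCutProblem G (BondCut.IsConnectedStCut G x y) k)) := by
  refine ⟨⟨BondCut.program 1 0, fun K => ?_⟩, ⟨BondCut.program 1 1, fun K => ?_⟩,
    ⟨BondCut.program 0 0, fun K => ?_⟩, ⟨BondCut.program 0 1, fun K => ?_⟩⟩
  · obtain ⟨c, hc⟩ := BondCut.exists_runsInTime (conn := 1) (st := 0) le_rfl zero_le_one K
    exact ⟨c, fun n G t hG ht hK => (hc n G t [] (by simp) (Nat.zero_le _) (Nat.zero_le _) ht hK).mono
      fun _ h => h.foundMaximumBond hG⟩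
  · obtain ⟨c, hc⟩ := BondCut.exists_runsInTime (conn := 1) (st := 1) le_rfl le_rfl K
    exact ⟨c, fun n G t x y k ht hK => (hc n G t [k, x, y] (by simp) x.2.le y.2.le ht hK).mono
      fun _ h => h.solvedCutProblem BondCut.isFeasible_stBondCut⟩
  · obtain ⟨c, hc⟩ := BondCut.exists_runsInTime (conn := 0) (st := 0) zero_le_one zero_le_one K
    exact ⟨c, fun n G t k ht hK => (hc n G t [k] (by simp) (Nat.zero_le _) (Nat.zero_le _) ht hK).mono
      fun _ h => h.solvedCutProblem BondCut.isFeasible_connectedCut⟩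
  · obtain ⟨c, hc⟩ := BondCut.exists_runsInTime (conn := 0) (st := 1) zero_le_one le_rfl K
    exact ⟨c, fun n G t x y k ht hK => (hc n G t [k, x, y] (by simp) x.2.le y.2.le ht hK).mono
      fun _ h => h.solvedCutProblem BondCut.isFeasible_connectedStCut⟩
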